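/- **Market.** Let $J_1,J_2\ge 1$, $J=J_1+J_2$, $p_0\in\mathbb R$, $\sigma_v,\sigma_1,\sigma_{1_+},\sigma_2>0$, $\sigma_\varepsilon\ge 0$, $\sigma_z\ge 0$. Let $v\sim N(p_0,\sigma_v^2)$, $z\sim N(0,\sigma_z^2)$, $u_1\sim N(0,\sigma_1^2)$, $u_{1_+}\sim N(0,\sigma_{1_+}^2)$, $u_2\sim N(0,\sigma_2^2)$, $\varepsilon_1,\dots,\varepsilon_J\sim N(0,\sigma_\varepsilon^2)$ be independent (a normal law with variance $0$ is a point mass). An informed trader (IT) trades $i_1$ at time $1$ and $i_2$ at time $2$; after time $1$, the $j$-th high-frequency trader (HFT) observes the signal $\tilde i_{1j}=i_1+\varepsilon_j$ and trades $x_{1j}$ at time $1_+$ and $x_{2j}$ at time $2$; the order flows are $$y_1=i_1+u_1,\qquad y_{1_+}=\sum_{j=1}^J x_{1j}+u_{1_+},\qquad y_2=i_2+\sum_{j=1}^J x_{2j}+u_2 .$$ Dealers set prices $p_1=p_1(y_1)$, $p_{1_+}=p_{1_+}(y_1,y_{1_+})$, $p_2=p_2(y_1,y_{1_+},y_2)$.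 The profits are $\pi^{IT}_1=i_1(v-p_1)$, $\pi^{IT}_2=i_2(v-p_2)$, $\pi^{j}_1=x_{1j}(v-p_{1_+})$, $\pi^{j}_2=x_{2j}(v-p_2)$. HFT $j$ bears the inventory penalty $\gamma_j(x_{1j}+x_{2j})^2$, where $\gamma_j=0$ for $j\le J_1$ (*Small-ITs*) and $\gamma_j=\infty$ for $j>J_1$ (*Round-Trippers*; with $\infty\cdot 0=0$, so that a Round-Tripper has to end with $x_{1j}+x_{2j}=0$). **Equilibrium.** All strategies are measurable functions of the stated information with square-integrable orders, "$\arg\max$" means the almost surely unique maximizer, and in the second-stage problems (b) and (d) the given strategy must be optimal after every own first-stage strategy, the other participants' strategies being fixed. An equilibrium requires: (a) $p_1=\mathbb E(v\mid y_1)$, $p_{1_+}=\mathbb E(v\mid y_1,y_{1_+})$, $p_2=\mathbb E(v\mid y_1,y_{1_+},y_2)$; (b) $i_2=\arg\max\mathbb E(\pi_2^{IT}\mid v,i_1,y_1)$ over $i_2=i_2(v,i_1,y_1)$; (c) in a *mixed-strategy* equilibrium: $\sigma_z>0$, and $\mathbb E(\pi_1^{IT}+\pi_2^{IT}\mid v)$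 is the same for all pure strategies $i_1=i_1(v)$; in a *pure-strategy* equilibrium: $\sigma_z=0$, and $i_1=\arg\max\mathbb E(\pi_1^{IT}+\pi_2^{IT}\mid v)$ over $i_1=i_1(v)$; (d) for each $j$, $x_{2j}=\arg\max\mathbb E(\pi_2^j-\gamma_j(x_{1j}+x_{2j})^2\mid\tilde i_{1j},y_1,y_{1_+})$ over $x_{2j}=x_{2j}(\tilde i_{1j},y_1,y_{1_+})$ (and, as always, her own order $x_{1j}$); (e) for each $j$, $x_{1j}=\arg\max\mathbb E(\pi_1^j+\pi_2^j-\gamma_j(x_{1j}+x_{2j})^2\mid\tilde i_{1j},y_1)$ over $x_{1j}=x_{1j}(\tilde i_{1j},y_1)$. **Linear strategies.** For real coefficients $\lambda_1,\lambda_{1_+},\lambda_{21},\lambda_{22},\alpha_1,\alpha_{21},\alpha_{22},\beta_{11},\beta_{21},\beta_{22},\beta_{23},\beta_{12}$ consider $$p_1=p_0+\lambda_1y_1,\quad p_{1_+}=p_0+\lambda_1y_1+\lambda_{1_+}y_{1_+},\quad p_2=p_0+\lambda_1y_1+\lambda_{21}y_{1_+}+\lambda_{22}y_2,$$ $$i_1=\alpha_1(v-p_0)+z,\qquad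 i_2=\alpha_{21}\,(v-\mathbb E(v\mid y_1))+\alpha_{22}\,(i_1-\mathbb E(i_1\mid y_1)),$$ $$x_{1j}=\beta_{11}(\tilde i_{1j}-\mathbb E(\tilde i_{1j}\mid y_1)),\quad x_{2j}=\beta_{21}(\tilde i_{1j}-\mathbb E(\tilde i_{1j}\mid y_1))+\beta_{22}\Big(\sum_{k\ne j}x_{1k}+u_{1_+}\Big)+\beta_{23}x_{1j}\qquad(j\le J_1),$$ $$x_{1j}=\beta_{12}(\tilde i_{1j}-\mathbb E(\tilde i_{1j}\mid y_1)),\quad x_{2j}=-x_{1j}\qquad(j>J_1).$$ Here $\mathbb E(\cdot\mid y_1)$ are the conditional expectations when $i_1=\alpha_1(v-p_0)+z$, that is (as is part of the claim) $$\mathbb E(v\mid y_1)=p_0+\frac{\alpha_1\sigma_v^2}{\alpha_1^2\sigma_v^2+\sigma_z^2+\sigma_1^2}\,y_1,\qquad \mathbb E(i_1\mid y_1)=\mathbb E(\tilde i_{1j}\mid y_1)=\frac{\alpha_1^2\sigma_v^2+\sigma_z^2}{\alpha_1^2\sigma_v^2+\sigma_z^2+\sigma_1^2}\,y_1 ;$$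 after a deviation the same functions of $y_1$ are used, and the sum $\sum_{k\ne j}x_{1k}+u_{1_+}$ is $y_{1_+}-x_{1j}$. Put $$\Lambda_1=\frac{\lambda_1}{\sigma_v/\sigma_1},\ \Lambda_{1_+}=\frac{\lambda_{1_+}}{\sigma_v/\sigma_1},\ \Lambda_{21}=\frac{\lambda_{21}}{\sigma_v/\sigma_1},\ \Lambda_{22}=\frac{\lambda_{22}}{\sigma_v/\sigma_1},\ A_1=\frac{\alpha_1}{\sigma_1/\sigma_v},\ A_{21}=\frac{\alpha_{21}}{\sigma_1/\sigma_v},$$ $$\theta_z=\frac{\sigma_z^2}{\sigma_1^2},\quad\theta_{1_+}=\frac{\sigma_{1_+}^2}{\sigma_1^2},\quad\theta_2=\frac{\sigma_2^2}{\sigma_1^2},\quad\theta_\varepsilon=\frac{\sigma_\varepsilon^2}{\sigma_1^2},\qquad (x)^+=\max(x,0).$$ **Theorem.** (In the displays below a line that begins with $+$, $-$, $/$ or a factor continues the previous one; $a/b$ at the start of a line has the whole preceding parenthesis as its numerator.) **(I)** The linear strategies are a mixed-strategy equilibrium if and only if $(A_1,\theta_z,\beta_{21},\beta_{11},\beta_{22},\beta_{23},\beta_{12})$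 satisfies $$ \begin{aligned} 0=&(A_{1} (A_{1}^2-\beta_{11} \beta_{22} J_{1}^2-\beta_{21} J_{1}+\beta_{11} \beta_{22} J_{1}-\beta_{11} \beta_{23} J_{1}+\beta_{12} J_{2}-\beta_{12} \beta_{22} J_{1} J_{2}+\theta_z+1))/((\beta_{11} J_{1}+\beta_{12} J_{2}) (A_{1}^2+\theta_z+1))\\ -&(A_{1} (-2 (\beta_{23}+\beta_{22} (J_{1}-1)) J_{1} (J_{1} \theta_z (A_{1}^2+\theta_z+1)+\theta_{\varepsilon} (-A_{1}^4+2 \beta_{12} (\beta_{22}-\beta_{23}-1) J_{2} A_{1}^2+(\theta_z+1)^2)) \beta_{11}^2\\ +&J_{1} (\theta_z A_{1}^4+2 (2 (\beta_{22}-\beta_{23}-1) \theta_{\varepsilon} (\beta_{22} J_{1}-1) J_{2} \beta_{12}^2+(-2 J_{1} \beta_{22}+\beta_{22}-\beta_{23}+1) J_{2} \theta_z \beta_{12}+\theta_z^2+2 \beta_{22}^2 J_{1} \theta_{1_+}\\ -&2 \beta_{22} \beta_{23} J_{1} \theta_{1_+}+2 \theta_2+\theta_z) A_{1}^2-(2 \beta_{12}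 (\beta_{23}+\beta_{22} (2 J_{1}-1)-1) J_{2}-\theta_z-1) \theta_z (\theta_z+1)+2 \beta_{21} (\theta_{\varepsilon} (A_{1}^4\\ +&2 \beta_{12} (2 \beta_{23}+\beta_{22} (J_{1}-2)+1) J_{2} A_{1}^2-(\theta_z+1)^2)-J_{1} \theta_z (A_{1}^2+\theta_z+1))) \beta_{11}-2 \beta_{22} J_{1} \theta_{1_+} (-A_{1}^4+2 \beta_{21} J_{1} A_{1}^2+(\theta_z+1)^2)\\ +&\beta_{12} J_{2} (\theta_z A_{1}^4+2 (2 \theta_{\varepsilon} J_{1} \beta_{21}^2-J_{1} \theta_z \beta_{21}+\theta_z^2+2 \beta_{22} J_{1} \theta_{1_+}+2 \theta_2+\theta_z) A_{1}^2-(2 \beta_{21} J_{1}-\theta_z-1) \theta_z (\theta_z+1))-2 \beta_{12}^2 (\beta_{22} J_{1}-1) J_{2} \\ &(J_{2} \theta_z (A_{1}^2+\theta_z+1)+\theta_{\varepsilon} (-A_{1}^4+2 \beta_{21} J_{1} A_{1}^2+(\theta_z+1)^2))))/(4 \beta_{12} J_{2} \theta_{1_+} (A_{1}^4+(2 \theta_z-2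 \beta_{21} J_{1}) A_{1}^2+\theta_z^2-2 \beta_{21} J_{1} \theta_z-1) A_{1}^2\\ +&\theta_{1_+} (A_{1}^8+(3 \theta_z-4 \beta_{21} J_{1}) A_{1}^6+(4 J_{1} (\theta_{\varepsilon}+J_{1}) \beta_{21}^2-8 J_{1} \theta_z \beta_{21}+3 \theta_z^2+4 \theta_2+\theta_z-2) A_{1}^4+(4 J_{1} (\theta_z \theta_{\varepsilon}+\theta_{\varepsilon}+J_{1} \theta_z) \beta_{21}^2\\ -&4 J_{1} (\theta_z^2-1) \beta_{21}+(\theta_z+1) (\theta_z^2+\theta_z+4 \theta_2)) A_{1}^2+(\theta_z+1)^3)+\beta_{12}^2 J_{2} (4 A_{1}^2 \beta_{21}^2 J_{1} (A_{1}^2+\theta_z+1) \theta_{\varepsilon}^2+(A_{1}^8+(3 \theta_z-4 \beta_{21} J_{1}) A_{1}^6\\ +&(4 J_{1} (J_{1}+J_{2}) \beta_{21}^2-8 J_{1} \theta_z \beta_{21}+3 \theta_z^2+4 \theta_{1_+}+4 \theta_2+\theta_z-2) A_{1}^4 +(4 J_{1} (J_{1}+J_{2}) \theta_z \beta_{21}^2-4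 J_{1} (\theta_z^2-1) \beta_{21}+(\theta_z+1) (\theta_z^2+\theta_z\\ +&4 \theta_{1_+} +4 \theta_2)) A_{1}^2+(\theta_z+1)^3) \theta_{\varepsilon}+J_{2} ((4 \theta_{1_+}+4 \theta_2+\theta_z) A_{1}^4+2 \theta_z (2 \theta_{1_+}+2 \theta_2+\theta_z+1) A_{1}^2+\theta_z (\theta_z+1)^2))+\beta_{11}^2 J_{1} (4 A_{1}^2 \beta_{12}^2 \\ &(-\beta_{22}+\beta_{23}+1)^2 J_{2} (A_{1}^2+\theta_z+1) \theta_{\varepsilon}^2+(A_{1}^8+(4 \beta_{12} (-\beta_{22}+\beta_{23}+1) J_{2}+3 \theta_z) A_{1}^6+(4 \theta_{1_+} \beta_{22}^2-8 \beta_{23} \theta_{1_+} \beta_{22}+3 \theta_z^2\\ +&4 \beta_{12}^2 (-\beta_{22}+\beta_{23}+1)^2 J_{2} (J_{1}+J_{2}) +4 \beta_{23}^2 \theta_{1_+}+4 \theta_2+8 \beta_{12} (-\beta_{22}+\beta_{23}+1) J_{2} \theta_z+\theta_z-2) A_{1}^4+(4 \beta_{12}^2 J_{2} (J_{1}+J_{2})\theta_z\\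 & (-\beta_{22}+\beta_{23}+1)^2-4 \beta_{12} (\beta_{22}-\beta_{23}-1) J_{2} (\theta_z^2-1) +(\theta_z+1) (4 \theta_{1_+} \beta_{22}^2-8 \beta_{23} \theta_{1_+} \beta_{22}+\theta_z^2+4 \beta_{23}^2 \theta_{1_+}+4 \theta_2+\theta_z)) A_{1}^2\\ +&(\theta_z+1)^3) \theta_{\varepsilon}+J_{1} ((4 \theta_{1_+} \beta_{22}^2-8 \beta_{23} \theta_{1_+} \beta_{22}+4 \beta_{23}^2 \theta_{1_+}+4 \theta_2+\theta_z) A_{1}^4 +2 \theta_z (2 \theta_{1_+} \beta_{22}^2-4 \beta_{23} \theta_{1_+} \beta_{22}+2 \beta_{23}^2 \theta_{1_+}+2 \theta_2+\theta_z+1) A_{1}^2\\ +&\theta_z (\theta_z+1)^2)) +2 \beta_{11} J_{1} (2 ((\beta_{22}-\beta_{23}-1) \theta_{\varepsilon} J_{2} \beta_{12}^2+\beta_{21} \theta_{\varepsilon} J_{2} \beta_{12} +(\beta_{22}-\beta_{23}) \theta_{1_+}) A_{1}^6+(-4 (\beta_{22}-\beta_{23}-1) \theta_{\varepsilon} \\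 &J_{2} (\beta_{21} (\theta_{\varepsilon}+J_{1}+J_{2})-\theta_z) \beta_{12}^2 +J_{2} (4 \beta_{22} \theta_{1_+}-4 \beta_{23} \theta_{1_+}+4 \theta_2+4 \beta_{21} \theta_{\varepsilon} \theta_z+\theta_z) \beta_{12} -4 (\beta_{22}-\beta_{23}) \theta_{1_+} (\beta_{21} (\theta_{\varepsilon}+J_{1})-\theta_z)) A_{1}^4\\ +&2 (-(\beta_{22}-\beta_{23}-1) \theta_{\varepsilon} J_{2} (-\theta_z^2 +2 \beta_{21} ((J_{1}+J_{2}) \theta_z+\theta_{\varepsilon} (\theta_z+1))+1) \beta_{12}^2+J_{2} (\theta_z (2 \beta_{22} \theta_{1_+}-2 \beta_{23} \theta_{1_+}+2 \theta_2+\theta_z+1)\\ +&\beta_{21} \theta_{\varepsilon} (\theta_z^2-1)) \beta_{12} -(\beta_{22}-\beta_{23}) \theta_{1_+} (-\theta_z^2+2 \beta_{21} (\theta_z \theta_{\varepsilon}+\theta_{\varepsilon}+J_{1} \theta_z)+1)) A_{1}^2+\beta_{12} J_{2} \theta_z (\theta_z+1)^2)),\\ 0=&4 \beta_{12} J_{2}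 \theta_{1_+} (A_{1}^2+\theta_z) (A_{1}^2-2 \beta_{21} J_{1}+\theta_z+1) A_{1}^2+\theta_{1_+} (A_{1}^8+(-4 \beta_{21} J_{1}+3 \theta_z+2) A_{1}^6+(4 J_{1} (\theta_{\varepsilon}+J_{1}) \beta_{21}^2-4 (2 \theta_z J_{1}+J_{1}) \beta_{21}\\ +&4 \theta_2+3 \theta_z (\theta_z+1)) A_{1}^4+(4 J_{1} (\theta_z \theta_{\varepsilon}+\theta_{\varepsilon}+J_{1} \theta_z) \beta_{21}^2-4 J_{1} \theta_z (\theta_z+1) \beta_{21}+(\theta_z+1) (\theta_z^2-\theta_z+4 \theta_2-2)) A_{1}^2-(\theta_z+1)^3)\\ +&\beta_{12}^2 J_{2} (4 A_{1}^2 \beta_{21}^2 J_{1} (A_{1}^2+\theta_z+1) \theta_{\varepsilon}^2+(A_{1}^8+(-4 \beta_{21} J_{1}+3 \theta_z+2) A_{1}^6+(4 J_{1} (J_{1}+J_{2}) \beta_{21}^2-4 (2 \theta_z J_{1}+J_{1}) \beta_{21}+3 \theta_z^2+4 \theta_{1_+}\\ +&4 \theta_2+3 \theta_z) A_{1}^4+(\theta_z^3+4\beta_{21}J_1\theta_z(\beta_{21}J_1-1-\theta_z)+4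 \beta_{21}^2 J_{1} J_{2} \theta_z-3 \theta_z+4 \theta_{1_+} (\theta_z+1)+4 \theta_2 (\theta_z+1)-2) A_{1}^2-(\theta_z+1)^3) \theta_{\varepsilon}\\ +&J_{2} ((4 \theta_{1_+}+4 \theta_2-\theta_z) A_{1}^4-2 \theta_z (-2 \theta_{1_+}-2 \theta_2+\theta_z+1) A_{1}^2-\theta_z (\theta_z+1)^2))+2 \beta_{11} J_{1} (2 ((\beta_{22}-\beta_{23}-1) \theta_{\varepsilon} J_{2} \beta_{12}^2+\beta_{21} \theta_{\varepsilon} J_{2} \beta_{12}\\ +&(\beta_{22}-\beta_{23}) \theta_{1_+}) A_{1}^6+(-2 (\beta_{22}-\beta_{23}-1) \theta_{\varepsilon} J_{2} (2 \beta_{21} (\theta_{\varepsilon}+J_{1}+J_{2})-2 \theta_z-1) \beta_{12}^2+J_{2} (4 \beta_{22} \theta_{1_+}-4 \beta_{23} \theta_{1_+}+4 \theta_2-\theta_z+2 \beta_{21} \\ &(2 \theta_z \theta_{\varepsilon}+\theta_{\varepsilon})) \beta_{12}-2 (\beta_{22}-\beta_{23}) \theta_{1_+} (2 \beta_{21} (\theta_{\varepsilon}+J_{1})-2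 \theta_z-1)) A_{1}^4-2 ((\beta_{22}-\beta_{23}-1) \theta_{\varepsilon} J_{2} (2 \beta_{21} ((J_{1}+J_{2}) \theta_z+\theta_{\varepsilon} (\theta_z+1))\\ -&\theta_z (\theta_z+1)) \beta_{12}^2+J_{2} \theta_z (-2 \beta_{22} \theta_{1_+}+2 \beta_{23} \theta_{1_+}-2 \theta_2+\theta_z-\beta_{21} \theta_{\varepsilon} (\theta_z+1)+1) \beta_{12}+(\beta_{22}-\beta_{23}) \theta_{1_+} (2 \beta_{21} ((\theta_z+1) \theta_{\varepsilon}\\ +&J_{1} \theta_z)-\theta_z (\theta_z+1))) A_{1}^2-\beta_{12} J_{2} \theta_z (\theta_z+1)^2)+\beta_{11}^2 J_{1} (4 A_{1}^2 \beta_{12}^2 (-\beta_{22}+\beta_{23}+1)^2 J_{2} (A_{1}^2+\theta_z+1) \theta_{\varepsilon}^2+(A_{1}^8\\ +&(4 \beta_{12} (-\beta_{22}+\beta_{23}+1) J_{2}+3 \theta_z+2) A_{1}^6+(4 \theta_{1_+} \beta_{22}^2-8 \beta_{23} \theta_{1_+} \beta_{22}+3 \theta_z^2+4 \beta_{12}^2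 (-\beta_{22}+\beta_{23}+1)^2 J_{2} (J_{1}+J_{2})+4 \beta_{23}^2 \theta_{1_+}+4 \theta_2\\ +&3 \theta_z-4 \beta_{12} (\beta_{22}-\beta_{23}-1) J_{2} (2 \theta_z+1)) A_{1}^4+(\theta_z^3+4 \beta_{12} J_{2} \theta_z^2+4 \beta_{12}^2 J_{2}^2 \theta_z+4 \beta_{12} J_{2} \theta_z+4 \beta_{12}^2 J_{1} J_{2} \theta_z+4 \theta_2 \theta_z\\ +&4 \beta_{12} \beta_{23} J_{2} (2 \beta_{12} (J_{1}+J_{2})+\theta_z+1) \theta_z-3 \theta_z+4 \theta_2+4 \beta_{22}^2 (J_{2} (J_{1}+J_{2}) \theta_z \beta_{12}^2+\theta_{1_+} (\theta_z+1))+4 \beta_{23}^2 (J_{2} (J_{1}+J_{2}) \theta_z \beta_{12}^2\\ +&\theta_{1_+} (\theta_z+1))-4 \beta_{22} (\beta_{12} J_{2} \theta_z (2 \beta_{12} (J_{1}+J_{2})+\theta_z+1)+2 \beta_{23} (J_{2} (J_{1}+J_{2}) \theta_z \beta_{12}^2+\theta_{1_+} (\theta_z+1)))-2) A_{1}^2-(\theta_z+1)^3)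 \theta_{\varepsilon}\\ +&J_{1} ((4 \theta_{1_+} \beta_{22}^2-8 \beta_{23} \theta_{1_+} \beta_{22}+4 \beta_{23}^2 \theta_{1_+}+4 \theta_2-\theta_z) A_{1}^4-2 \theta_z (-2 \theta_{1_+} \beta_{22}^2+4 \beta_{23} \theta_{1_+} \beta_{22}-2 \beta_{23}^2 \theta_{1_+}-2 \theta_2+\theta_z+1) A_{1}^2-\theta_z (\theta_z+1)^2)),\\ 0=&\beta_{11}-(-((A_{1}^2+\theta_z) (\beta_{11} (J_{1}-1)+\beta_{12} J_{2}) (\beta_{11} J_{1}+\beta_{12} J_{2}))/(\beta_{11}^2 J_{1} (\theta_{\varepsilon} (A_{1}^2+\theta_z+1)+J_{1} (A_{1}^2+\theta_z))\\ +&2 \beta_{11} \beta_{12} J_{1} J_{2} (A_{1}^2+\theta_z)+\beta_{12}^2 J_{2} (\theta_{\varepsilon} (A_{1}^2+\theta_z+1)+J_{2} (A_{1}^2+\theta_z))+\theta_{1_+} (A_{1}^2+\theta_z+1))\\ +&\frac{2 \beta_{23} (A_{1}^2 (\beta_{11} \beta_{22} (J_{1}-1)+\beta_{12} \beta_{22}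 J_{2}+\beta_{21} (\theta_{\varepsilon}+1))+\beta_{22} \theta_z (\beta_{11} (J_{1}-1)+\beta_{12} J_{2})+\beta_{21} (\theta_{\varepsilon} \theta_z+\theta_{\varepsilon}+\theta_z))}{A_{1}^2+\theta_z+1}+1)\\ /&(2 (A_{1}^2 (\theta_{\varepsilon}+1)+\theta_{\varepsilon} \theta_z+\theta_{\varepsilon}+\theta_z) ((\beta_{11} J_{1}+\beta_{12} J_{2})/(\beta_{11}^2 J_{1} (\theta_{\varepsilon} (A_{1}^2+\theta_z+1)+J_{1} (A_{1}^2+\theta_z))+2 \beta_{11} \beta_{12} J_{1} J_{2} (A_{1}^2+\theta_z)\\ +&\beta_{12}^2 J_{2} (\theta_{\varepsilon} (A_{1}^2+\theta_z+1)+J_{2} (A_{1}^2+\theta_z))+\theta_{1_+} (A_{1}^2+\theta_z+1))-(\beta_{23}^2)/(A_{1}^2+\theta_z+1))), \end{aligned} $$ $$ \begin{aligned} 0=&2 \beta_{11} \beta_{22} (J_{1}-1) (A_{1}^2+\theta_z) (J_1-2)^+ (\beta_{11} \beta_{12} \theta_{\varepsilon} J_{2}+\beta_{12}^2 (-\theta_{\varepsilon})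 J_{2}-\theta_{1_+})+A_{1}^4 \beta_{12}^2 \theta_{\varepsilon} J_{2}+A_{1}^4 \theta_{1_+}+2 \beta_{11} (J_{1}-1) (A_{1}^2+\theta_z)\\ &(-\beta_{12}^2\theta_{\varepsilon} J_{2} (\beta_{22} (-J_{1})+\beta_{22}+\beta_{23}+1)-3 \beta_{12} \beta_{21} \theta_{\varepsilon} J_{2}-\theta_{1_+} (\beta_{22} (-J_{1})+\beta_{22}+\beta_{23}))-4 A_{1}^2 \beta_{12}^2 \beta_{21} \theta_{\varepsilon}^2 J_{2}-2 A_{1}^2 \beta_{12}^2 \beta_{21} \theta_{\varepsilon} J_{1} J_{2}\\ -&4 A_{1}^2 \beta_{12}^2 \beta_{21} \theta_{\varepsilon} J_{2}^2-2 A_{1}^2 \beta_{12}^2 \beta_{21} \theta_{\varepsilon} J_{2}+2 A_{1}^2 \beta_{12}^2 \theta_{\varepsilon} J_{2} \theta_z+2 A_{1}^2 \beta_{12}^2 \theta_{\varepsilon} J_{2}+2 A_{1}^2 \beta_{12} J_{2} \theta_{1_+}-4 A_{1}^2 \beta_{21} \theta_{\varepsilon} \theta_{1_+}-2 A_{1}^2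 \beta_{21} J_{1} \theta_{1_+}-2 A_{1}^2 \beta_{21} \theta_{1_+}\\ +&2 A_{1}^2 \theta_{1_+} \theta_z +2 A_{1}^2 \theta_{1_+}+\beta_{11}^2 \theta_{\varepsilon} (J_{1}-1) (A_{1}^4+2 A_{1}^2 (\beta_{12} J_{2} (\beta_{22} (-J_{1})+\beta_{22}+\beta_{23}+1)-2 \beta_{21} (\theta_{\varepsilon}+J_{1})+\theta_z+1)-2 \beta_{12} \beta_{22} J_{1} J_{2} \theta_z\\ +&2 \beta_{12} \beta_{22} J_{2} \theta_z+2 \beta_{12} \beta_{23} J_{2} \theta_z+2 \beta_{12} J_{2} \theta_z-4 \beta_{21} \theta_{\varepsilon} \theta_z-4 \beta_{21} \theta_{\varepsilon}-4 \beta_{21} J_{1} \theta_z+\theta_z^2+2 \theta_z+1)-4 \beta_{12}^2 \beta_{21} \theta_{\varepsilon}^2 J_{2} \theta_z-4 \beta_{12}^2 \beta_{21} \theta_{\varepsilon}^2 J_{2}\\ -&2 \beta_{12}^2 \beta_{21} \theta_{\varepsilon} J_{1} J_{2} \theta_z-4 \beta_{12}^2 \beta_{21} \theta_{\varepsilon}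 J_{2}^2 \theta_z-2 \beta_{12}^2 \beta_{21} \theta_{\varepsilon} J_{2} \theta_z+\beta_{12}^2 \theta_{\varepsilon} J_{2} \theta_z^2+2 \beta_{12}^2 \theta_{\varepsilon} J_{2} \theta_z+\beta_{12}^2 \theta_{\varepsilon} J_{2}+2 \beta_{12} J_{2} \theta_{1_+} \theta_z\\ -&4 \beta_{21} \theta_{\varepsilon} \theta_{1_+} \theta_z-4 \beta_{21} \theta_{\varepsilon} \theta_{1_+}-2 \beta_{21} J_{1} \theta_{1_+} \theta_z-2 \beta_{21} \theta_{1_+} \theta_z+\theta_{1_+} \theta_z^2+2 \theta_{1_+} \theta_z+\theta_{1_+},\\ 0=&\beta_{12}^2 \theta_{\varepsilon} J_{2}^2 A_{1}^4+2 \beta_{12}^2 \theta_{\varepsilon}^2 J_{2} A_{1}^4+2 \beta_{12}^2 \theta_{\varepsilon} J_{2} A_{1}^4+2 \theta_{\varepsilon} \theta_{1_+} A_{1}^4+2 \theta_{1_+} A_{1}^4+2 \beta_{12}^3 \beta_{22} \theta_{\varepsilon} J_{2}^3 A_{1}^2+2 \beta_{12}^3 \beta_{22} \theta_{\varepsilon}^2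 J_{2}^2 A_{1}^2-2 \beta_{12}^2 \beta_{21} \theta_{\varepsilon} J_{2}^2 A_{1}^2\\ +&2 \beta_{12}^3 \beta_{22} \theta_{\varepsilon} J_{2}^2 A_{1}^2 +4 \beta_{12}^2 \theta_{\varepsilon}^2 J_{2} A_{1}^2+2 \beta_{12}^2 \theta_{\varepsilon} J_{2} A_{1}^2-2 \beta_{12}^2 \beta_{21} \theta_{\varepsilon}^2 J_{1} J_{2} A_{1}^2-2 \beta_{12}^2 \beta_{21} \theta_{\varepsilon} J_{1} J_{2} A_{1}^2+4 \theta_{\varepsilon} \theta_{1_+} A_{1}^2-2 \beta_{21} J_{1} \theta_{1_+} A_{1}^2\\ -&2 \beta_{21} \theta_{\varepsilon} J_{1} \theta_{1_+} A_{1}^2+2 \beta_{12} J_{2} \theta_{1_+} A_{1}^2+2 \beta_{12} \beta_{22} J_{2} \theta_{1_+} A_{1}^2+2 \beta_{12} \theta_{\varepsilon} J_{2} \theta_{1_+} A_{1}^2+2 \beta_{12} \beta_{22} \theta_{\varepsilon} J_{2} \theta_{1_+} A_{1}^2+2 \theta_{1_+} A_{1}^2+2 \beta_{12}^2 \theta_{\varepsilon}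 J_{2}^2 \theta_z A_{1}^2+4 \beta_{12}^2 \theta_{\varepsilon}^2 J_{2} \theta_z A_{1}^2\\ +&4 \beta_{12}^2 \theta_{\varepsilon} J_{2} \theta_z A_{1}^2+4 \theta_{\varepsilon} \theta_{1_+} \theta_z A_{1}^2+4 \theta_{1_+} \theta_z A_{1}^2+2 \beta_{12}^3 \beta_{22} \theta_{\varepsilon}^2 J_{2}^2-\beta_{12}^2 \theta_{\varepsilon} J_{2}^2+\beta_{12}^2 \theta_{\varepsilon} J_{2}^2 \theta_z^2+2 \beta_{12}^2 \theta_{\varepsilon}^2 J_{2} \theta_z^2+2 \beta_{12}^2 \theta_{\varepsilon} J_{2} \theta_z^2\\ +&2 \theta_{\varepsilon} \theta_{1_+} \theta_z^2+2 \theta_{1_+} \theta_z^2+2 \beta_{12}^2 \theta_{\varepsilon}^2 J_{2}-2 \beta_{12}^2 \beta_{21} \theta_{\varepsilon}^2 J_{1} J_{2}+2 \theta_{\varepsilon} \theta_{1_+}-2 \beta_{21} \theta_{\varepsilon} J_{1} \theta_{1_+}+2 \beta_{12} \theta_{\varepsilon} J_{2} \theta_{1_+}+2 \beta_{12} \beta_{22}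 \theta_{\varepsilon} J_{2} \theta_{1_+}+2 \beta_{12}^3 \beta_{22} \theta_{\varepsilon} J_{2}^3 \theta_z\\ +&2 \beta_{12}^3 \beta_{22} \theta_{\varepsilon}^2 J_{2}^2 \theta_z-2 \beta_{12}^2 \beta_{21} \theta_{\varepsilon} J_{2}^2 \theta_z+2 \beta_{12}^3 \beta_{22} \theta_{\varepsilon} J_{2}^2 \theta_z+4 \beta_{12}^2 \theta_{\varepsilon}^2 J_{2} \theta_z+2 \beta_{12}^2 \theta_{\varepsilon} J_{2} \theta_z-2 \beta_{12}^2 \beta_{21} \theta_{\varepsilon}^2 J_{1} J_{2} \theta_z-2 \beta_{12}^2 \beta_{21} \theta_{\varepsilon} J_{1} J_{2} \theta_z\\ +&4 \theta_{\varepsilon} \theta_{1_+} \theta_z-2 \beta_{21} J_{1} \theta_{1_+} \theta_z-2 \beta_{21} \theta_{\varepsilon} J_{1} \theta_{1_+} \theta_z+2 \beta_{12} J_{2} \theta_{1_+} \theta_z+2 \beta_{12} \beta_{22} J_{2} \theta_{1_+} \theta_z+2 \beta_{12} \theta_{\varepsilon} J_{2} \theta_{1_+} \theta_z+2 \beta_{12}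 \beta_{22} \theta_{\varepsilon} J_{2} \theta_{1_+} \theta_z+2 \theta_{1_+} \theta_z\\ -&2 \beta_{11}^3 \beta_{22} \theta_{\varepsilon} J_{1} (J_{1}^2-4 J_{1}+3) (J_{1} (A_{1}^2+\theta_z)+\theta_{\varepsilon} (A_{1}^2+\theta_z+1))+\beta_{11} (2 \theta_{\varepsilon} J_{2} (-A_{1}^2 (\beta_{22} J_{2} J_{1}^2+(\beta_{23}+1) (\theta_{\varepsilon}+1) J_{1}\\ -&2 \beta_{22} (\theta_{\varepsilon}+3 J_{2}+1) J_{1}+(3 \beta_{22}+\beta_{23}+1) J_{2})-(\beta_{22} J_{2} J_{1}^2+(-6 J_{2} \beta_{22}-2 \beta_{22}+\beta_{23}+1) J_{1}+(3 \beta_{22}+\beta_{23}+1) J_{2}) \theta_z\\ +&(2 \beta_{22}-\beta_{23}-1) \theta_{\varepsilon} J_{1} (\theta_z+1)) \beta_{12}^2+\theta_{\varepsilon} J_{2} (A_{1}^2+\theta_z+1) ((2 J_{1}-3) A_{1}^2+2 \beta_{21} \theta_{\varepsilon} (J_{1}-1)-2 J_{1}+2 J_{1} \theta_z-3 \theta_z+1)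 \beta_{12}\\ +&2 (2 \beta_{22}-\beta_{23}) J_{1} \theta_{1_+} ((\theta_{\varepsilon}+1) A_{1}^2+\theta_{\varepsilon}+\theta_{\varepsilon} \theta_z+\theta_z))+\beta_{11}^2 \theta_{\varepsilon} (J_{1}-1) (2 \theta_{\varepsilon} (A_{1}^2+\theta_z+1) (A_{1}^2+\beta_{12} (-J_{1} \beta_{22}+2 \beta_{22}+\beta_{23}+1) J_{2}\\ +&\theta_z+1)+J_{1} (A_{1}^4+2 (\beta_{12} \beta_{22} (7-2 J_{1}) J_{2}+\theta_z) A_{1}^2+\theta_z^2+2 \beta_{12} \beta_{22} (7-2 J_{1}) J_{2} \theta_z-1))+2 \beta_{11} \beta_{22} \theta_{\varepsilon} (J_{1}-1)\\ &(\beta_{11} J_{1}+\beta_{12} J_{2}) (\beta_{11} J_{1} (A_{1}^2+\theta_z)+\beta_{12} J_{2} (A_{1}^2+\theta_z)+\beta_{11} \theta_{\varepsilon} (A_{1}^2+\theta_z+1)) (J_1-2)^+,\\ 0=&\frac{A_{1}^2+\beta_{11} \beta_{23} J_{1}-\beta_{12} \beta_{22} J_{2}+2 \beta_{12} \beta_{23}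 J_{2}+\beta_{12} J_{2}-\beta_{21} J_{1}+\theta_z+1}{2 \beta_{11} J_{1}+2 \beta_{12} J_{2}},\\ 0=&\beta_{12}-(A_{1} (((A_{1}^2+\theta_z) (-(2 (\beta_{11} J_{1}+\beta_{12} (J_{2}-1)) ((A_{1}^2+\theta_z+1)^2 (\beta_{11} J_{1}+\beta_{12} J_{2})^2-(\theta_{\varepsilon} (A_{1}^2+\theta_z+1)^2 (\beta_{11}^2 J_{1}+\beta_{12}^2 J_{2})\\ +&(A_{1}^2+\theta_z)^2 (\beta_{11} J_{1}+\beta_{12} J_{2})^2+(A_{1}^2+\theta_z) (\beta_{11} J_{1}+\beta_{12} J_{2})^2+\theta_{1_+} (A_{1}^2+\theta_z+1)^2) (A_{1}^2-\beta_{11} \beta_{22} J_{1}^2+\beta_{11} \beta_{22} J_{1}-\beta_{11} \beta_{23} J_{1}\\ -&\beta_{12} \beta_{22} J_{1} J_{2}+\beta_{12} J_{2}-\beta_{21} J_{1}+\theta_z+1)))/(\theta_{\varepsilon} (A_{1}^2+\theta_z+1)^2 (\beta_{11}^2 J_{1}+\beta_{12}^2 J_{2})+(A_{1}^2+\theta_z)^2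 (\beta_{11} J_{1}+\beta_{12} J_{2})^2\\ +&(A_{1}^2+\theta_z) (\beta_{11} J_{1}+\beta_{12} J_{2})^2+\theta_{1_+} (A_{1}^2+\theta_z+1)^2)-\beta_{12} J_{2} (A_{1}^2+\beta_{11} J_{1} (\beta_{22}-\beta_{23}-1)-\beta_{21} J_{1}+\theta_z+1)\\ -&\beta_{11} J_{1} (A_{1}^2-\beta_{12} \beta_{22} J_{2}+\beta_{12} \beta_{23} J_{2}+\beta_{12} J_{2}-\beta_{21} J_{1}+\theta_z+1)+2 J_{1} (\beta_{11} J_{1}+\beta_{12} J_{2}) (\beta_{11} (\beta_{22} (J_{1}-1)+\beta_{23})\\ +&\beta_{12} \beta_{22} (J_{2}-1)+\beta_{21})-\beta_{21} J_{1} (\beta_{11} J_{1}+\beta_{12} J_{2})-2 \beta_{12} (J_{2}-1) (\beta_{11} J_{1}+\beta_{12} J_{2})))\\ /&((A_{1}^2+\theta_z+1) (\beta_{11} J_{1}+\beta_{12} J_{2}))+1))/(4 (A_{1}^2 (\theta_{\varepsilon}+1)+\theta_{\varepsilon} \theta_z+\theta_{\varepsilon}+\theta_z) \\ &(\frac{A_{1}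 (\beta_{11} J_{1}+\beta_{12} J_{2})}{\beta_{11}^2 J_{1} (\theta_{\varepsilon} (A_{1}^2+\theta_z+1)+J_{1} (A_{1}^2+\theta_z))+2 \beta_{11} \beta_{12} J_{1} J_{2} (A_{1}^2+\theta_z)+\beta_{12}^2 J_{2} (\theta_{\varepsilon} (A_{1}^2+\theta_z+1)+J_{2} (A_{1}^2+\theta_z))+\theta_{1_+} (A_{1}^2+\theta_z+1)}\\ -&\frac{A_{1} (A_{1}^2-\beta_{11} \beta_{22} J_{1}^2+\beta_{11} \beta_{22} J_{1}-\beta_{11} \beta_{23} J_{1}-\beta_{12} \beta_{22} J_{1} J_{2}+\beta_{12} J_{2}-\beta_{21} J_{1}+\theta_z+1)}{(A_{1}^2+\theta_z+1) (\beta_{11} J_{1}+\beta_{12} J_{2})}+\frac{A_{1}-A_{1} \beta_{22} J_{1}}{A_{1}^2+\theta_z+1})),\\ 0<&(\beta_{11} J_{1}+\beta_{12} J_{2})/(\beta_{11}^2 J_{1} (\theta_{\varepsilon} (A_{1}^2+\theta_z+1)+J_{1} (A_{1}^2+\theta_z))+2 \beta_{11} \beta_{12} J_{1} J_{2} (A_{1}^2+\theta_z)+\beta_{12}^2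 J_{2} (\theta_{\varepsilon} (A_{1}^2+\theta_z+1)+J_{2} (A_{1}^2+\theta_z))\\ +&\theta_{1_+} (A_{1}^2+\theta_z+1))-\frac{\beta_{23}^2}{A_{1}^2+\theta_z+1},\\ 0<&\frac{A_{1} (\beta_{11} J_{1}+\beta_{12} J_{2})}{\beta_{11}^2 J_{1} (\theta_{\varepsilon} (A_{1}^2+\theta_z+1)+J_{1} (A_{1}^2+\theta_z))+2 \beta_{11} \beta_{12} J_{1} J_{2} (A_{1}^2+\theta_z)+\beta_{12}^2 J_{2} (\theta_{\varepsilon} (A_{1}^2+\theta_z+1)+J_{2} (A_{1}^2+\theta_z))+\theta_{1_+} (A_{1}^2+\theta_z+1)}\\ -&\frac{A_{1} (A_{1}^2-\beta_{11} \beta_{22} J_{1}^2+\beta_{11} \beta_{22} J_{1}-\beta_{11} \beta_{23} J_{1}-\beta_{12} \beta_{22} J_{1} J_{2}+\beta_{12} J_{2}-\beta_{21} J_{1}+\theta_z+1)}{(A_{1}^2+\theta_z+1) (\beta_{11} J_{1}+\beta_{12} J_{2})}+\frac{A_{1}-A_{1} \beta_{22} J_{1}}{A_{1}^2+\theta_z+1},\\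 0<&A_1,\\ 0<&\theta_z. \end{aligned} $$ and the other coefficients are given by $$ \begin{aligned} \Lambda_1=&\frac{A_1 }{A_1^2 +\theta_z+1},\\ \Lambda_{1_+}=&A_{1} (\beta_{11} J_{1}+\beta_{12} J_{2})/\{\beta_{11}^2 J_{1} [\theta_{\varepsilon} (A_{1}^2+\theta_z+1)+J_{1} (A_{1}^2+\theta_z)]\\ +&2 \beta_{11} \beta_{12} J_{1} J_{2} (A_{1}^2+\theta_z)+\beta_{12}^2 J_{2} [\theta_{\varepsilon} (A_{1}^2+\theta_z+1)+J_{2} (A_{1}^2+\theta_z)]+\theta_{1_+} (A_{1}^2+\theta_z+1)\},\\ \Lambda_{21}=&\frac{A_{1} (A_{1}^2-\beta_{11} \beta_{22} J_{1}^2+\beta_{11} \beta_{22} J_{1}-\beta_{11} \beta_{23} J_{1}-\beta_{12} \beta_{22} J_{1} J_{2}+\beta_{12} J_{2}-\beta_{21} J_{1}+\theta_z+1)}{(A_{1}^2+\theta_z+1) (\beta_{11} J_{1}+\beta_{12} J_{2})},\\ \Lambda_{22}=&\Lambda_1,\\ A_{21}=&\frac{1}{2\Lambda_{22}},\\ \alpha_{22}=&-\frac{A_1^2+\theta_z+1}{2}.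 \end{aligned} $$ **(II)** The linear strategies are a pure-strategy equilibrium if and only if $\sigma_z=0$, $(\Lambda_{21},\Lambda_{22},A_1,\beta_{11},\beta_{21},\beta_{22},\beta_{12})$ satisfies $$ \begin{aligned} 0=&4 A_{1}^2 \theta_{\varepsilon} J_{2}^3 \Lambda_{21} (\Lambda_{21}+(\beta_{22} J_{1}-1) \Lambda_{22})^2 \beta_{12}^4+4 A_{1} \theta_{\varepsilon} J_{2}^2 (\Lambda_{21}+(\beta_{22} J_{1}-1) \Lambda_{22}) (\Lambda_{21} (3 A_{1} \beta_{11} J_{1} \Lambda_{21}-2)\\ +&(-2 \beta_{22} J_{1}+A_{1} (\beta_{11} (3 J_{1} \beta_{22}+\beta_{22}-4)-2 \beta_{21}) \Lambda_{21} J_{1}+2) \Lambda_{22}) \beta_{12}^3+J_{2} (4 J_{2} \Lambda_{21} (4 \theta_2 \Lambda_{22}^2\\ +&(\Lambda_{21}+\beta_{22} J_{1} \Lambda_{22}+\Lambda_{22})^2 \theta_{1_+}) A_{1}^2 +4 (A_{1}^2+1) J_{1} \Lambda_{21} (\beta_{11} \theta_{\varepsilon} (\Lambda_{21}+(J_{1}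 \beta_{22}+\beta_{22}-2) \Lambda_{22})-2 \beta_{21} \theta_{\varepsilon} \Lambda_{22})^2\\ +&\theta_{\varepsilon} (9 A_{1}^2 \beta_{11}^2 J_{1}^2 \Lambda_{21}^3 +6 A_{1} \beta_{11} J_{1} (A_{1} J_{1} (\beta_{11} (3 J_{1} \beta_{22}+\beta_{22}-4)-2 \beta_{21}) \Lambda_{22}-2) \Lambda_{21}^2 +(\Lambda_{22} (\Lambda_{22} (J_{1} (4 J_{2} (\beta_{11}(1-\beta_{22})+2 \beta_{21})^2\\ +&J_{1} (\beta_{11} (3 J_{1} \beta_{22}+\beta_{22}-4)-2 \beta_{21})^2)+16 (\theta_{1_+}+\theta_2)) A_{1}^2-4 J_{1} (\beta_{11} (6 J_{1} \beta_{22}+\beta_{22}-7)-2 \beta_{21}) A_{1}\\ +&16 \Lambda_{22} (\theta_{1_+}+\theta_2))+4) \Lambda_{21}+4 (\beta_{22} J_{1}-1) \Lambda_{22} (A_{1} J_{1} (2 \beta_{21}-\beta_{11} (3 J_{1} \beta_{22}+\beta_{22}-4)) \Lambda_{22}+2))) \beta_{12}^2\\ -&4 A_{1} J_{2} (A_{1}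 (\beta_{22}-1) \theta_{\varepsilon} J_{1}^2 \Lambda_{21} \Lambda_{22} (\Lambda_{21}+\beta_{22} (J_{1}-1) \Lambda_{22}) \beta_{11}^3+\theta_{\varepsilon} J_{1} \Lambda_{22} (-\Lambda_{21} (\beta_{22}+2 A_{1} \beta_{21} J_{1} \Lambda_{21}-1)\\ -&(\beta_{22}-1) \beta_{22} (J_{1}-1) \Lambda_{22}-2 A_{1} \beta_{21} (\beta_{22} (J_{1}-2)+1) J_{1} \Lambda_{21} \Lambda_{22}) \beta_{11}^2 -J_{1} (4 A_{1} \beta_{21}^2 \theta_{\varepsilon} J_{1} \Lambda_{21} \Lambda_{22}^2\\ -&2 \beta_{21} \theta_{\varepsilon} (\Lambda_{21}+\beta_{22} (J_{1}-2) \Lambda_{22}+\Lambda_{22}) \Lambda_{22} +A_{1} \Lambda_{21} (8 \theta_2 \Lambda_{22}^2+(\Lambda_{21}+\beta_{22} J_{1} \Lambda_{22}+\Lambda_{22}) (3 \Lambda_{21}+\beta_{22} \Lambda_{22}+3 \beta_{22} J_{1} \Lambda_{22}) \theta_{1_+})) \beta_{11}\\ +&2 (2 \beta_{21}^2 \theta_{\varepsilon}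 J_{1} \Lambda_{22}^2+2 \theta_2 \Lambda_{22}^2+A_{1} \beta_{21} J_{1} \Lambda_{21} (\Lambda_{21}+\beta_{22} J_{1} \Lambda_{22}+\Lambda_{22}) \theta_{1_+} \Lambda_{22}+(\Lambda_{21}+\beta_{22} J_{1} \Lambda_{22}) (\Lambda_{21}+\beta_{22} J_{1} \Lambda_{22}+\Lambda_{22}) \theta_{1_+})) \beta_{12}\\ -&2 A_{1} J_{1} (\theta_{\varepsilon} J_{1} (\Lambda_{21}+\beta_{22} (J_{1}-1) \Lambda_{22})^2 \beta_{11}^3+4 \beta_{21} \theta_{\varepsilon} J_{1} \Lambda_{22} (\Lambda_{21}+\beta_{22} (J_{1}-1) \Lambda_{22}) \beta_{11}^2+2 (2 \beta_{21}^2 \theta_{\varepsilon} J_{1} \Lambda_{22}^2+4 \theta_2 \Lambda_{22}^2\\ +&(\Lambda_{21}+\beta_{22} J_{1} \Lambda_{22}) (3 \Lambda_{21}+\beta_{22} \Lambda_{22}+3 \beta_{22} J_{1} \Lambda_{22}) \theta_{1_+}) \beta_{11}-4 \beta_{21} \Lambda_{22} (\Lambda_{21}+\beta_{22} J_{1} \Lambda_{22})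 \theta_{1_+})\\ +&A_{1}^2 \Lambda_{21} (\theta_{\varepsilon} J_{1}^3 (\Lambda_{21}+\beta_{22} (J_{1}-1) \Lambda_{22})^2 \beta_{11}^4+4 \beta_{21} \theta_{\varepsilon} J_{1}^3 \Lambda_{22} (\Lambda_{21}+\beta_{22} (J_{1}-1) \Lambda_{22}) \beta_{11}^3+J_{1} (4 \beta_{21}^2 \theta_{\varepsilon} J_{1}^2 \Lambda_{22}^2+16 (\theta_{\varepsilon}+J_{1}) \theta_2 \Lambda_{22}^2\\ +&(J_{1} (3 \Lambda_{21}+\beta_{22} \Lambda_{22}+3 \beta_{22} J_{1} \Lambda_{22})^2+4 \theta_{\varepsilon} (\Lambda_{21}+\beta_{22} (J_{1}+1) \Lambda_{22})^2) \theta_{1_+}) \beta_{11}^2-4 \beta_{21} J_{1} \Lambda_{22} (J_{1} (3 \Lambda_{21}+\beta_{22} \Lambda_{22}+3 \beta_{22} J_{1} \Lambda_{22})\\ +&4 \theta_{\varepsilon} (\Lambda_{21}+\beta_{22} (J_{1}+1) \Lambda_{22})) \theta_{1_+} \beta_{11}+4 \Lambda_{22}^2 \theta_{1_+} (J_{1}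 (4 \theta_{\varepsilon}+J_{1}) \beta_{21}^2+4 \theta_2))+4 (\theta_{\varepsilon} J_{1} (\theta_{1_+} \Lambda_{21}^3\\ +&\Lambda_{22} (\beta_{22} (J_{1}+(J_{1}+1) \Lambda_{21} (2 \Lambda_{21}+\beta_{22} (J_{1}+1) \Lambda_{22}) \theta_{1_+}-1)+4 \Lambda_{21} \Lambda_{22} \theta_2)) \beta_{11}^2\\ +&2 \beta_{21} \theta_{\varepsilon} J_{1} \Lambda_{22} (1-2 \Lambda_{21} (\Lambda_{21}+\beta_{22} (J_{1}+1) \Lambda_{22}) \theta_{1_+}) \beta_{11}+\theta_{1_+} (4 \Lambda_{21} (\theta_{\varepsilon} J_{1} \beta_{21}^2+\theta_2) \Lambda_{22}^2+2 \beta_{22} J_{1} \Lambda_{22}+\Lambda_{21})),\\ 0=&A_{1}^2 \beta_{11}^4 \theta_{\varepsilon} J_{1}^3 (\beta_{22} (J_{1}-1) \Lambda_{22}+\Lambda_{21})^2+4 A_{1}^2 \beta_{11}^3 \theta_{\varepsilon} J_{1}^2 \Lambda_{22} (\beta_{22} (J_{1}-1) \Lambda_{22}+\Lambda_{21}) (\beta_{21}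 J_{1}-\beta_{12} (\beta_{22}-1) J_{2})\\ +&\beta_{11}^2 J_{1} (\theta_{\varepsilon} (A_{1}^2 (\beta_{12}^2 J_{2} (\Lambda_{22}^2 (J_{1} (3 \beta_{22} J_{1}+\beta_{22}-4)^2+4 (\beta_{22}-1)^2 J_{2})+6 J_{1} \Lambda_{21} \Lambda_{22} (3 \beta_{22} J_{1}+\beta_{22}-4)+9 J_{1} \Lambda_{21}^2)\\ +&8 \beta_{12} \beta_{21} J_{1} J_{2} \Lambda_{22} (\beta_{22} (J_{1}-2) \Lambda_{22}+\Lambda_{21}+\Lambda_{22})+4 (\beta_{21}^2 J_{1}^2 \Lambda_{22}^2+\theta_{1_+} (\beta_{22} (J_{1}+1) \Lambda_{22}+\Lambda_{21})^2+4 \Lambda_{22}^2 \theta_2))\\ +&4 \theta_{1_+} (\beta_{22} (J_{1}+1) \Lambda_{22}+\Lambda_{21})^2+16 \Lambda_{22}^2 \theta_2-4)+4 (A_{1}^2+1) \beta_{12}^2 \theta_{\varepsilon}^2 J_{2} (\Lambda_{22} (\beta_{22} J_{1}+\beta_{22}-2)+\Lambda_{21})^2\\ +&A_{1}^2 J_{1}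 (\theta_{1_+} (\beta_{22} (3 J_{1}+1) \Lambda_{22}+3 \Lambda_{21})^2+16 \Lambda_{22}^2 \theta_2))+4 \beta_{11} J_{1} (A_{1}^2 (\beta_{12}^3 \theta_{\varepsilon} J_{2}^2 (\Lambda_{22} (\beta_{22} J_{1}-1)+\Lambda_{21})\\ &(\Lambda_{22} (3 \beta_{22} J_{1}+\beta_{22}-4)+3 \Lambda_{21})-\beta_{12}^2 \beta_{21} \theta_{\varepsilon} J_{2} \Lambda_{22} (4 \theta_{\varepsilon} (\Lambda_{22} (\beta_{22} J_{1}+\beta_{22}-2)+\Lambda_{21})+J_{1} \Lambda_{22} (3 \beta_{22} J_{1}+\beta_{22}-4)\\ +&4 (\beta_{22}-1) J_{2} \Lambda_{22}+3 J_{1} \Lambda_{21})+\beta_{12} J_{2} (4 \beta_{21}^2 \theta_{\varepsilon} J_{1} \Lambda_{22}^2+\theta_{1_+} (\beta_{22} J_{1} \Lambda_{22}+\Lambda_{21}+\Lambda_{22}) (3 \beta_{22} J_{1} \Lambda_{22}+\beta_{22} \Lambda_{22}+3 \Lambda_{21})+8 \Lambda_{22}^2 \theta_2)\\ -&\beta_{21}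 \Lambda_{22} \theta_{1_+} (4 \theta_{\varepsilon} (\beta_{22} (J_{1}+1) \Lambda_{22}+\Lambda_{21})+J_{1} (3 \beta_{22} J_{1} \Lambda_{22}+\beta_{22} \Lambda_{22}+3 \Lambda_{21})))\\ +&4 \beta_{21} \theta_{\varepsilon} \Lambda_{22} (-\beta_{12}^2 \theta_{\varepsilon} J_{2} (\Lambda_{22} (\beta_{22} J_{1}+\beta_{22}-2)+\Lambda_{21}) -\theta_{1_+} (\beta_{22} (J_{1}+1) \Lambda_{22}+\Lambda_{21})))+4 (A_{1}^2 \beta_{12}^4 \theta_{\varepsilon} J_{2}^3 (\Lambda_{22} (\beta_{22} J_{1}-1)+\Lambda_{21})^2\\ -&2 A_{1}^2 \beta_{12}^3 \beta_{21} \theta_{\varepsilon} J_{1} J_{2}^2 \Lambda_{22} (\Lambda_{22} (\beta_{22} J_{1}-1)+\Lambda_{21})+\beta_{12}^2 J_{2} (4 (A_{1}^2+1) \beta_{21}^2 \theta_{\varepsilon}^2 J_{1} \Lambda_{22}^2\\ +&\theta_{\varepsilon} (\Lambda_{22}^2 (A_{1}^2 (\beta_{21}^2 J_{1} (J_{1}+4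 J_{2})+4 (\theta_{1_+}+\theta_2))+4 (\theta_{1_+}+\theta_2))-1)+A_{1}^2 J_{2} (\theta_{1_+} (\beta_{22} J_{1} \Lambda_{22}+\Lambda_{21}+\Lambda_{22})^2+4 \Lambda_{22}^2 \theta_2))\\ -&2 A_{1}^2 \beta_{12} \beta_{21} J_{1} J_{2} \Lambda_{22} \theta_{1_+} (\beta_{22} J_{1} \Lambda_{22}+\Lambda_{21}+\Lambda_{22})+\theta_{1_+} (\Lambda_{22}^2 (\beta_{21}^2 J_{1} (4 (A_{1}^2+1) \theta_{\varepsilon}+A_{1}^2 J_{1})+4 (A_{1}^2+1) \theta_2)-1)),\\ 0=&\frac{(A_{1}^2+1) (-2 (A_{1}^2+1) \Lambda_{22} +A_{1} +\frac{1}{2} \beta_{11} J_{1} (\beta_{22} (J_{1}-1) \Lambda_{22}+\Lambda_{21})+ (\beta_{12} J_{2} (\Lambda_{22} (\beta_{22} J_{1}-1)+\Lambda_{21})+\beta_{21} J_{1} \Lambda_{22}))}{4 A_{1} (A_{1}^2+1) \Lambda_{22} -\frac{1}{4} (2 A_{1}+\beta_{11} J_{1} (\beta_{22} (J_{1}-1)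 \Lambda_{22}+\Lambda_{21})+2 (\beta_{12} J_{2} (\beta_{22} J_{1} \Lambda_{22}+\Lambda_{21}-\Lambda_{22})+\beta_{21} J_{1} \Lambda_{22}))^2}+A_{1},\\ 0=&-4 A_{1}^2 \beta_{11} \beta_{22} (J_{1}-1) \Lambda_{22} (J_1-2)^+ (\beta_{11} \beta_{12} \theta_{\varepsilon} J_{2}+\beta_{12}^2 (-\theta_{\varepsilon}) J_{2}-\theta_{1_+})+A_{1}^2 (\beta_{11}^3 (-\theta_{\varepsilon}) (J_{1}-1) J_{1} (\beta_{22} (J_{1}-1) \Lambda_{22}+\Lambda_{21})\\ +&2 \beta_{11}^2 \theta_{\varepsilon} (J_{1}-1) \Lambda_{22} (\beta_{12} J_{2} (\beta_{22} (2 J_{1}-3)-1)+\beta_{21} (4 \theta_{\varepsilon}+3 J_{1}))-\beta_{11} (\beta_{12}^2 \theta_{\varepsilon} J_{2} ((J_{1}-1) \Lambda_{22} (7 \beta_{22} J_{1}-6 \beta_{22}-4)\\ +&(3 J_{1}-2) \Lambda_{21})-12 \beta_{12} \beta_{21} \theta_{\varepsilon} (J_{1}-1) J_{2} \Lambda_{22}+\theta_{1_+}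 (\beta_{22} (7 J_{1}^2-13 J_{1}+6) \Lambda_{22}+(3 J_{1}-2) \Lambda_{21}))\\ +&2 (\beta_{12}^3 (-\theta_{\varepsilon}) J_{2}^2 (\Lambda_{22} (\beta_{22} J_{1}-1)+\Lambda_{21})+\beta_{12}^2 \beta_{21} \theta_{\varepsilon} J_{2} \Lambda_{22} (4 \theta_{\varepsilon}+J_{1}+4 J_{2}+2)-\beta_{12} J_{2} \theta_{1_+} (\beta_{22} J_{1} \Lambda_{22}+\Lambda_{21}+\Lambda_{22})\\ +&\beta_{21} \Lambda_{22} \theta_{1_+} (4 \theta_{\varepsilon}+J_{1}+2)))-2 A_{1} (\beta_{11}^2 \theta_{\varepsilon} (J_{1}-1)+\beta_{12}^2 \theta_{\varepsilon} J_{2}+\theta_{1_+})+8 \beta_{21} \theta_{\varepsilon} \Lambda_{22} (\beta_{11}^2 \theta_{\varepsilon} (J_{1}-1)+\beta_{12}^2 \theta_{\varepsilon} J_{2}+\theta_{1_+}),\\ 0=&4 \beta_{11} \beta_{22} \theta_{\varepsilon} (J_{1}-1) \Lambda_{22} (J_1-2)^+ (\beta_{11} (A_{1}^2 \theta_{\varepsilon}+A_{1}^2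 J_{1}+\theta_{\varepsilon})+A_{1}^2 \beta_{12} J_{2})+A_{1}^2 (\beta_{11}^2 \theta_{\varepsilon} (J_{1}-1) (2 \theta_{\varepsilon} (\Lambda_{21}-\beta_{22} (J_{1}-5) \Lambda_{22})\\ +&J_{1} (\beta_{22} (11-3 J_{1}) \Lambda_{22}+\Lambda_{21}))+\beta_{11} \theta_{\varepsilon} (\beta_{12} J_{2} ((3 J_{1}-4) \Lambda_{21}-(J_{1}-1) \Lambda_{22} (\beta_{22} (J_{1}-14)+2))+2 \beta_{21} (J_{1}-1) \Lambda_{22} (2 \theta_{\varepsilon}+J_{1}))\\ +&2 (\beta_{12}^2 \theta_{\varepsilon} J_{2} (\Lambda_{22} (\beta_{22} (2 \theta_{\varepsilon} (J_{1}+1)+J_{1} J_{2}+2 J_{1}+2 J_{2}+2)-2 \theta_{\varepsilon}-J_{2}-2)+\Lambda_{21} (2 \theta_{\varepsilon}+J_{2}+2))+\beta_{12} \beta_{21} \theta_{\varepsilon} (J_{1}-2) J_{2} \Lambda_{22}\\ +&2 (\theta_{\varepsilon}+1) \theta_{1_+} (\beta_{22} (J_{1}+1) \Lambda_{22}+\Lambda_{21})))-2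 A_{1} \theta_{\varepsilon} (\beta_{11} (J_{1}-1)+\beta_{12} J_{2})+2 \theta_{\varepsilon} (\beta_{11}^2 \theta_{\varepsilon} (J_{1}-1) (\Lambda_{21}-\beta_{22} (J_{1}-5) \Lambda_{22})\\ +&2 \beta_{11} \beta_{21} \theta_{\varepsilon} (J_{1}-1) \Lambda_{22}+2 (\beta_{12}^2 \theta_{\varepsilon} J_{2} (\Lambda_{22} (\beta_{22} J_{1}+\beta_{22}-1)+\Lambda_{21})+\theta_{1_+} (\beta_{22} (J_{1}+1) \Lambda_{22}+\Lambda_{21}))), \end{aligned} $$ $$ \begin{aligned} 0=&\beta_{11}-(-(\beta_{22} (J_{1}-1) \Lambda_{22}+\Lambda_{21}) (A_{1}^2 (\beta_{11} \beta_{22} (J_{1}-1)+\beta_{12} \beta_{22} J_{2}+\beta_{21} (\theta_{\varepsilon}+1))+\beta_{21} \theta_{\varepsilon})\\ -&\frac{A_{1}^3 (\beta_{11} (J_{1}-1)+\beta_{12} J_{2}) (\beta_{11} J_{1}+\beta_{12} J_{2})}{\beta_{11}^2 J_{1} (A_{1}^2 \theta_{\varepsilon}+A_{1}^2 J_{1}+\theta_{\varepsilon})+2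 A_{1}^2 \beta_{11} \beta_{12} J_{1} J_{2}+\beta_{12}^2 J_{2} (A_{1}^2 \theta_{\varepsilon}+A_{1}^2 J_{2}+\theta_{\varepsilon})+(A_{1}^2+1) \theta_{1_+}}+A_{1})\\ /&(2 (A_{1}^2 (\theta_{\varepsilon}+1)+\theta_{\varepsilon}) (\frac{A_{1} (\beta_{11} J_{1}+\beta_{12} J_{2})}{\beta_{11}^2 J_{1} (A_{1}^2 \theta_{\varepsilon}+A_{1}^2 J_{1}+\theta_{\varepsilon})+2 A_{1}^2 \beta_{11} \beta_{12} J_{1} J_{2}+\beta_{12}^2 J_{2} (A_{1}^2 \theta_{\varepsilon}+A_{1}^2 J_{2}+\theta_{\varepsilon})+(A_{1}^2+1) \theta_{1_+}}\\ -&\frac{(\beta_{22} (J_{1}-1) \Lambda_{22}+\Lambda_{21})^2}{4 \Lambda_{22}})),\\ 0=&\beta_{12}-(A_{1} (A_{1} (4 (\beta_{11} J_{1}+\beta_{12} (J_{2}-1)) (\Lambda_{21}\\ -&\frac{A_{1} (\beta_{11} J_{1}+\beta_{12} J_{2})}{\beta_{11}^2 J_{1} (A_{1}^2 \theta_{\varepsilon}+A_{1}^2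 J_{1}+\theta_{\varepsilon})+2 A_{1}^2 \beta_{11} \beta_{12} J_{1} J_{2}+\beta_{12}^2 J_{2} (A_{1}^2 \theta_{\varepsilon}+A_{1}^2 J_{2}+\theta_{\varepsilon})+(A_{1}^2+1) \theta_{1_+}})+\beta_{11} J_{1} (\beta_{22} (J_{1}-1) \Lambda_{22}-3 \Lambda_{21})\\ -&2 \beta_{12} (J_{2} (-\beta_{22} J_{1} \Lambda_{22}+\Lambda_{21}+\Lambda_{22})+2 \Lambda_{22} (\beta_{22} J_{1}-1))+2 \beta_{21} J_{1} \Lambda_{22})+2))/(8 (A_{1}^2 (\theta_{\varepsilon}+1)+\theta_{\varepsilon})\\ &(\frac{A_{1} (\beta_{11} J_{1}+\beta_{12} J_{2})}{\beta_{11}^2 J_{1} (A_{1}^2 \theta_{\varepsilon}+A_{1}^2 J_{1}+\theta_{\varepsilon})+2 A_{1}^2 \beta_{11} \beta_{12} J_{1} J_{2}+\beta_{12}^2 J_{2} (A_{1}^2 \theta_{\varepsilon}+A_{1}^2 J_{2}+\theta_{\varepsilon})+(A_{1}^2+1) \theta_{1_+}}-\beta_{22} J_{1} \Lambda_{22}-\Lambda_{21}+\Lambda_{22})),\\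 0<&\frac{A_{1}}{A_{1}^2+1}-\frac{(2 A_{1}+\beta_{11} J_{1} (\beta_{22} (J_{1}-1) \Lambda_{22}+\Lambda_{21})+2 (\beta_{12} J_{2} (\beta_{22} J_{1} \Lambda_{22}+\Lambda_{21}-\Lambda_{22})+\beta_{21} J_{1} \Lambda_{22}))^2}{16 (A_{1}^2+1)^2 \Lambda_{22}},\\ 0<&\frac{A_{1} (\beta_{11} J_{1}+\beta_{12} J_{2})}{\beta_{11}^2 J_{1} (A_{1}^2 \theta_{\varepsilon}+A_{1}^2 J_{1}+\theta_{\varepsilon})+2 A_{1}^2 \beta_{11} \beta_{12} J_{1} J_{2}+\beta_{12}^2 J_{2} (A_{1}^2 \theta_{\varepsilon}+A_{1}^2 J_{2}+\theta_{\varepsilon})+(A_{1}^2+1) \theta_{1_+}}-\frac{(\beta_{22} (J_{1}-1) \Lambda_{22}+\Lambda_{21})^2}{4 \Lambda_{22}},\\ 0<&\frac{A_{1} (\beta_{11} J_{1}+\beta_{12} J_{2})}{\beta_{11}^2 J_{1} (A_{1}^2 \theta_{\varepsilon}+A_{1}^2 J_{1}+\theta_{\varepsilon})+2 A_{1}^2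 \beta_{11} \beta_{12} J_{1} J_{2}+\beta_{12}^2 J_{2} (A_{1}^2 \theta_{\varepsilon}+A_{1}^2 J_{2}+\theta_{\varepsilon})+(A_{1}^2+1) \theta_{1_+}}-\beta_{22} J_{1} \Lambda_{22}-\Lambda_{21}+\Lambda_{22},\\ 0<&\Lambda_{22}. \end{aligned} $$ and the other coefficients are given by $$ \begin{aligned} &\Lambda_1=\frac{A_1 }{A_1^2 +1},\\ &\Lambda_{1_+}=\frac{A_{1} (\beta_{11} J_{1}+\beta_{12} J_{2})}{\beta_{11}^2 J_{1} (A_{1}^2 \theta_{\varepsilon}+A_{1}^2 J_{1}+\theta_{\varepsilon})+2 A_{1}^2 \beta_{11} \beta_{12} J_{1} J_{2}+\beta_{12}^2 J_{2} (A_{1}^2 \theta_{\varepsilon}+A_{1}^2 J_{2}+\theta_{\varepsilon})+(A_{1}^2+1) \theta_{1_+}},\\ &A_{21}=\frac{1}{2\Lambda_{22}},\\ &\alpha_{22}=-\frac{\beta_{11} J_{1} [\beta_{22} (J_{1}-1) \Lambda_{22}+\Lambda_{21}]+2 [\beta_{12} J_{2} (\beta_{22} J_{1} \Lambda_{22}+\Lambda_{21}-\Lambda_{22})+\beta_{21}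 J_{1} \Lambda_{22}]}{4 \Lambda_{22}},\\ &\beta_{23}=-\frac{\beta_{22} (J_1-1) \Lambda_{22}+\Lambda_{21}}{2\Lambda_{22}}. \end{aligned} $$ -/

import Mathlib

open MeasureTheory ProbabilityTheory
open scoped ENNReal

namespace HFTModel

/-! ### Exogenous data and random shocks -/

/-- Exogenous parameters: the prior mean `p0` of the asset value and the standard deviations of the
value (`σv`), of the noise orders at times `1`, `1₊`, `2` (`σ1`, `σp`, `σ2`), and of the errors in
the HFTs' signals (`σε`). -/
structure Market where
  p0 : ℝ
  σv : ℝ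
  σ1 : ℝ
  σp : ℝ
  σ2 : ℝ
  σε : ℝ

/-- Standing sign assumptions; a signal without error (`σε = 0`) is allowed. -/
structure Market.Valid (M : Market) : Prop where
  σv_pos : 0 < M.σv
  σ1_pos : 0 < M.σ1
  σp_pos : 0 < M.σp
  σ2_pos : 0 < M.σ2
  σε_nonneg : 0 ≤ M.σε

/-- Labels of the primitive random variables: the value `v`, IT's own randomization `z`, the noise
orders `u1`, `up`, `u2` at times `1`, `1₊`, `2`, and the signal error `ε j` of HFT `j`. -/
inductive Shock (H : Type) where
  | v
  | z
  | u1
  | up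
  | u2
  | ε (j : H)

/-- Laws of the primitive random variables, `σz` being the standard deviation of `z`. -/
noncomputable def shockLaw {H : Type} (M : Market) (σz : ℝ) : Shock H → Measure ℝ
  | .v => gaussianReal M.p0 (M.σv ^ 2).toNNReal
  | .z => gaussianReal 0 (σz ^ 2).toNNReal
  | .u1 => gaussianReal 0 (M.σ1 ^ 2).toNNReal
  | .up => gaussianReal 0 (M.σp ^ 2).toNNReal
  | .u2 => gaussianReal 0 (M.σ2 ^ 2).toNNReal
  | .ε _ => gaussianReal 0 (M.σε ^ 2).toNNReal

/-- `ξ` is a family of independent random variables with the laws above. -/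
structure IsShockModel {Ω : Type*} {H : Type} [MeasurableSpace Ω] (M : Market) (σz : ℝ) (P : Measure Ω)
    (ξ : Shock H → Ω → ℝ) : Prop where
  measurable : ∀ s, Measurable (ξ s)
  law : ∀ s, P.map (ξ s) = shockLaw M σz s
  indep : iIndepFun ξ P

/-! ### The trading game -/

/-- Strategies of all participants; each component is a function of the information on which the
participant may condition.

* dealers: `p1 (y₁)`, `pp (y₁, y₁₊)`, `p2 (y₁, y₁₊, y₂)`;
* IT: `i1 (v, z)` where `z` has standard deviation `σz`, and `i2 (v, i₁, y₁)`;
* HFT `j`: `x1 j (ĩ₁ⱼ, y₁)` and `x2 j (ĩ₁ⱼ, y₁, y₁₊, x₁ⱼ)`, where the last argument is the order that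
  `j` herself has sent at time `1₊`. -/
structure Profile (H : Type) where
  p1 : ℝ → ℝ
  pp : ℝ × ℝ → ℝ
  p2 : ℝ × ℝ × ℝ → ℝ
  σz : ℝ
  i1 : ℝ × ℝ → ℝ
  i2 : ℝ × ℝ × ℝ → ℝ
  x1 : H → ℝ × ℝ → ℝ
  x2 : H → ℝ × ℝ × ℝ × ℝ → ℝ

section Outcome

variable {Ω : Type*} {H : Type} [Fintype H] (s : Profile H) (ξ : Shock H → Ω → ℝ)

/-- IT's order executed at time `1`. -/
def I1 (ω : Ω) : ℝ := s.i1 (ξ .v ω, ξ .z ω)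

/-- Order flow at time `1`. -/
def Y1 (ω : Ω) : ℝ := I1 s ξ ω + ξ .u1 ω

/-- Signal of HFT `j` about IT's first order. -/
def Sig (j : H) (ω : Ω) : ℝ := I1 s ξ ω + ξ (.ε j) ω

/-- Order of HFT `j` at time `1₊`. -/
def X1 (j : H) (ω : Ω) : ℝ := s.x1 j (Sig s ξ j ω, Y1 s ξ ω)

/-- Order flow at time `1₊`. -/
def Yp (ω : Ω) : ℝ := ∑ j, X1 s ξ j ω + ξ .up ω

/-- Order of HFT `j` at time `2`. -/
def X2 (j : H) (ω : Ω) : ℝ := s.x2 j (Sig s ξ j ω, Y1 s ξ ω, Yp s ξ ω, X1 s ξ j ω)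

/-- IT's order executed at time `2`. -/
def I2 (ω : Ω) : ℝ := s.i2 (ξ .v ω, I1 s ξ ω, Y1 s ξ ω)

/-- Order flow at time `2`. -/
def Y2 (ω : Ω) : ℝ := I2 s ξ ω + ∑ j, X2 s ξ j ω + ξ .u2 ω

/-- Price at time `1`. -/
def Price1 (ω : Ω) : ℝ := s.p1 (Y1 s ξ ω)

/-- Price at time `1₊`. -/
def Pricep (ω : Ω) : ℝ := s.pp (Y1 s ξ ω, Yp s ξ ω)

/-- Price at time `2`. -/
def Price2 (ω : Ω) : ℝ := s.p2 (Y1 s ξ ω, Yp s ξ ω, Y2 s ξ ω)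

/-- IT's profit from her first order. -/
def profitIT1 (ω : Ω) : ℝ := I1 s ξ ω * (ξ .v ω - Price1 s ξ ω)

/-- IT's profit from her second order. -/
def profitIT2 (ω : Ω) : ℝ := (ξ .v ω - Price2 s ξ ω) * I2 s ξ ω

/-- Profit of HFT `j` from her order at time `1₊`. -/
def profitHFT1 (j : H) (ω : Ω) : ℝ := (ξ .v ω - Pricep s ξ ω) * X1 s ξ j ω

/-- Profit of HFT `j` from her order at time `2`. -/
def profitHFT2 (j : H) (ω : Ω) : ℝ := (ξ .v ω - Price2 s ξ ω) * X2 s ξ j ω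

/-- Inventory penalty `γ (x₁ⱼ + x₂ⱼ)²` of HFT `j`, for an inventory aversion `γ ∈ [0, ∞]`. Since
`∞ * 0 = 0`, an HFT with `γ = ∞` pays nothing if she ends with zero inventory and `∞` otherwise. -/
noncomputable def penalty (γ : H → ℝ≥0∞) (j : H) (ω : Ω) : ℝ≥0∞ :=
  γ j * ENNReal.ofReal ((X1 s ξ j ω + X2 s ξ j ω) ^ 2)

end Outcome

section Equilibrium

variable {Ω : Type*} {H : Type} [MeasurableSpace Ω] [Fintype H] [DecidableEq H]

/-- The information generated by a random element. -/
abbrev info {α : Type} [MeasurableSpace α] (X : Ω → α) : MeasurableSpace Ω :=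
  MeasurableSpace.comap X inferInstance

/-- The strategy `d` is *the* maximizer (`d = arg max`), among admissible strategies, of the
conditional expectation of `payoff` given `m`: almost surely no admissible strategy does better, and
one can do equally well only where it prescribes the same order. -/
def IsArgMax (P : Measure Ω) (m : MeasurableSpace Ω) {D : Type} (adm : D → Prop)
    (payoff order : D → Ω → ℝ) (d : D) : Prop :=
  adm d ∧ ∀ d', adm d' → ∀ᵐ ω ∂P,
    (P[payoff d' | m]) ω ≤ (P[payoff d | m]) ω ∧
      ((P[payoff d' | m]) ω = (P[payoff d | m]) ω → order d' ω = order d ω)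

variable (P : Measure Ω) (ξ : Shock H → Ω → ℝ) (γ : H → ℝ≥0∞) (s : Profile H)

/-- `s` with IT's first-period strategy replaced by `f`. -/
def Profile.withI1 (f : ℝ × ℝ → ℝ) : Profile H := { s with i1 := f }

/-- `s` with IT's second-period strategy replaced by `f`. -/
def Profile.withI2 (f : ℝ × ℝ × ℝ → ℝ) : Profile H := { s with i2 := f }

/-- `s` with the time-`1₊` strategy of HFT `j` replaced by `f`. -/
def Profile.withX1 (j : H) (f : ℝ × ℝ → ℝ) : Profile H := { s with x1 := Function.update s.x1 j f }

/-- `s` with the time-`2` strategy of HFT `j` replaced by `f`. -/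
def Profile.withX2 (j : H) (f : ℝ × ℝ × ℝ × ℝ → ℝ) : Profile H :=
  { s with x2 := Function.update s.x2 j f }

/-- Weak-efficiency pricing rule. -/
structure DealersEfficient : Prop where
  p1 : P[ξ .v | info (Y1 s ξ)] =ᵐ[P] Price1 s ξ
  pp : P[ξ .v | info (fun ω => (Y1 s ξ ω, Yp s ξ ω))] =ᵐ[P] Pricep s ξ
  p2 : P[ξ .v | info (fun ω => (Y1 s ξ ω, Yp s ξ ω, Y2 s ξ ω))] =ᵐ[P] Price2 s ξ

/-- An admissible first-period strategy of IT: measurable, with a square-integrable order. -/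
def AdmI1 (f : ℝ × ℝ → ℝ) : Prop := Measurable f ∧ MemLp (I1 (s.withI1 f) ξ) 2 P

/-- An admissible second-period strategy of IT: measurable, with a square-integrable order. -/
def AdmI2 (f : ℝ × ℝ × ℝ → ℝ) : Prop := Measurable f ∧ MemLp (I2 (s.withI2 f) ξ) 2 P

/-- An admissible time-`1₊` strategy of HFT `j`: measurable, with a square-integrable order. -/
def AdmX1 (j : H) (f : ℝ × ℝ → ℝ) : Prop := Measurable f ∧ MemLp (X1 (s.withX1 j f) ξ j) 2 P

/-- An admissible time-`2` strategy of HFT `j`: measurable, with a square-integrable order and an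
almost surely finite inventory penalty. -/
def AdmX2 (j : H) (f : ℝ × ℝ × ℝ × ℝ → ℝ) : Prop :=
  Measurable f ∧ MemLp (X2 (s.withX2 j f) ξ j) 2 P ∧ ∀ᵐ ω ∂P, penalty (s.withX2 j f) ξ γ j ω ≠ ∞

/-- In period 2, whatever order she has sent in period 1, IT maximizes
`E(π₂ | v, i₁, y₁)` over `i₂ = i₂(v, i₁, y₁)`. -/
def ITSecondOptimal : Prop :=
  ∀ f, AdmI1 P ξ s f →
    IsArgMax P (info fun ω => (ξ .v ω, I1 (s.withI1 f) ξ ω, Y1 (s.withI1 f) ξ ω))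
      (AdmI2 P ξ (s.withI1 f))
      (fun g => profitIT2 ((s.withI1 f).withI2 g) ξ)
      (fun g => I2 ((s.withI1 f).withI2 g) ξ) s.i2

/-- IT is indifferent among all pure strategies `i₁ = i₁(v)`: the conditional expectation
`E(π₁ + π₂ | v)` is the same for all of them. -/
def ITIndifferent : Prop :=
  ∀ f g : ℝ → ℝ, AdmI1 P ξ s (fun a => f a.1) → AdmI1 P ξ s (fun a => g a.1) →
    P[fun ω => profitIT1 (s.withI1 fun a => f a.1) ξ ω + profitIT2 (s.withI1 fun a => f a.1) ξ ω |
        info (ξ .v)] =ᵐ[P]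
      P[fun ω => profitIT1 (s.withI1 fun a => g a.1) ξ ω + profitIT2 (s.withI1 fun a => g a.1) ξ ω |
        info (ξ .v)]

/-- In period 1, IT maximizes `E(π₁ + π₂ | v)` over `i₁`. (Used only when `z = 0` almost surely, where
a strategy is a function of `v` up to a null event.) -/
def ITFirstOptimal : Prop :=
  IsArgMax P (info (ξ .v)) (AdmI1 P ξ s)
    (fun f ω => profitIT1 (s.withI1 f) ξ ω + profitIT2 (s.withI1 f) ξ ω)
    (fun f => I1 (s.withI1 f) ξ) s.i1

/-- During `(1₊, 2)`, whatever order she has sent at `1₊`, HFT `j` maximizes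
`E(π₂ⱼ - γⱼ (x₁ⱼ + x₂ⱼ)² | ĩ₁ⱼ, y₁, y₁₊)`. -/
def HFTSecondOptimal (j : H) : Prop :=
  ∀ f, AdmX1 P ξ s j f →
    IsArgMax P
      (info fun ω => (Sig (s.withX1 j f) ξ j ω, Y1 (s.withX1 j f) ξ ω, Yp (s.withX1 j f) ξ ω))
      (AdmX2 P ξ γ (s.withX1 j f) j)
      (fun g ω => profitHFT2 ((s.withX1 j f).withX2 j g) ξ j ω -
        (penalty ((s.withX1 j f).withX2 j g) ξ γ j ω).toReal)
      (fun g => X2 ((s.withX1 j f).withX2 j g) ξ j) (s.x2 j)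

/-- During `(1, 1₊)`, HFT `j` maximizes
`E(π₁ⱼ + π₂ⱼ - γⱼ (x₁ⱼ + x₂ⱼ)² | ĩ₁ⱼ, y₁)`, anticipating her own later behaviour. -/
def HFTFirstOptimal (j : H) : Prop :=
  IsArgMax P (info fun ω => (Sig s ξ j ω, Y1 s ξ ω)) (AdmX1 P ξ s j)
    (fun f ω => profitHFT1 (s.withX1 j f) ξ j ω + profitHFT2 (s.withX1 j f) ξ j ω -
      (penalty (s.withX1 j f) ξ γ j ω).toReal)
    (fun f => X1 (s.withX1 j f) ξ j) (s.x1 j)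

/-- Mixed-strategy equilibrium. -/
structure IsMixedEquilibrium : Prop where
  randomizes : 0 < s.σz
  dealers : DealersEfficient P ξ s
  itSecond : ITSecondOptimal P ξ s
  itFirst : ITIndifferent P ξ s
  hftSecond : ∀ j, HFTSecondOptimal P ξ γ s j
  hftFirst : ∀ j, HFTFirstOptimal P ξ γ s j

/-- Pure-strategy equilibrium. -/
structure IsPureEquilibrium : Prop where
  noRandomization : s.σz = 0
  dealers : DealersEfficient P ξ s
  itSecond : ITSecondOptimal P ξ s
  itFirst : ITFirstOptimal P ξ s
  hftSecond : ∀ j, HFTSecondOptimal P ξ γ s j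
  hftFirst : ∀ j, HFTFirstOptimal P ξ γ s j

end Equilibrium

/-! ### Linear strategies with two types of HFTs -/

/-- Inventory aversions: the first `J₁` HFTs have `γ = 0` (Small-ITs), the other `J₂` have `γ = ∞`
(Round-Trippers). -/
def aversion {J₁ J₂ : ℕ} : Fin J₁ ⊕ Fin J₂ → ℝ≥0∞ := Sum.elim (fun _ => 0) (fun _ => ⊤)

/-- Coefficients of the linear strategies. -/
structure Coeffs where
  lam1 : ℝ
  lamp : ℝ
  lam21 : ℝ
  lam22 : ℝ
  α1 : ℝ
  σz : ℝ
  α21 : ℝ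
  α22 : ℝ
  β11 : ℝ
  β21 : ℝ
  β22 : ℝ
  β23 : ℝ
  β12 : ℝ

section Linear

variable (M : Market) (c : Coeffs)

/-- The conditional expectation of `v` given `y₁ = y`, when `i₁ = α₁ (v - p₀) + z`. -/
noncomputable def meanV (y : ℝ) : ℝ :=
  M.p0 + c.α1 * M.σv ^ 2 / (c.α1 ^ 2 * M.σv ^ 2 + c.σz ^ 2 + M.σ1 ^ 2) * y

/-- The conditional expectation of `i₁` (and of each signal `ĩ₁ⱼ`) given `y₁ = y`, when
`i₁ = α₁ (v - p₀) + z`. -/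
noncomputable def meanI (y : ℝ) : ℝ :=
  (c.α1 ^ 2 * M.σv ^ 2 + c.σz ^ 2) / (c.α1 ^ 2 * M.σv ^ 2 + c.σz ^ 2 + M.σ1 ^ 2) * y

/-- The linear profile: for a Small-IT, `x₂ⱼ = β₂₁ (ĩ₁ⱼ - E(ĩ₁ⱼ|y₁)) + β₂₂ (y₁₊ - x₁ⱼ) + β₂₃ x₁ⱼ`,
where `y₁₊ - x₁ⱼ = ∑_{k ≠ j} x₁ₖ + u₁₊`; a Round-Tripper has `x₂ⱼ = -x₁ⱼ`. -/
noncomputable def linearProfile (J₁ J₂ : ℕ) : Profile (Fin J₁ ⊕ Fin J₂) where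
  p1 y := M.p0 + c.lam1 * y
  pp := fun (y, y') => M.p0 + c.lam1 * y + c.lamp * y'
  p2 := fun (y, y', y'') => M.p0 + c.lam1 * y + c.lam21 * y' + c.lam22 * y''
  σz := c.σz
  i1 := fun (v, z) => c.α1 * (v - M.p0) + z
  i2 := fun (v, i, y) => c.α21 * (v - meanV M c y) + c.α22 * (i - meanI M c y)
  x1 := Sum.elim (fun _ (a, y) => c.β11 * (a - meanI M c y))
    (fun _ (a, y) => c.β12 * (a - meanI M c y))
  x2 := Sum.elim
    (fun _ (a, y, y', x) => c.β21 * (a - meanI M c y) + c.β22 * (y' - x) + c.β23 * x)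
    (fun _ (_, _, _, x) => -x)

end Linear

/-! ### The explicit systems

The variables are dimensionless: `Λ = λ / (σv / σ1)`, `A = α / (σ1 / σv)`, `θz = σz² / σ1²`,
`θp = σ₁₊² / σ1²`, `θ2 = σ2² / σ1²`, `θε = σε² / σ1²`. -/

/-- Part 1 of `mixedEq1_num`. -/
noncomputable def mixedEq1_num_1 (J1 J2 θp θ2 θε A1 θz β21 β11 β22 β23 β12 : ℝ) : ℝ :=
  -2 * (β23 + β22 * (J1 - 1)) * J1 * (J1 * θz * (A1 ^ 2 + θz + 1) + θε * (-A1 ^ 4 + 2 * β12 *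
  (β22 - β23 - 1) * J2 * A1 ^ 2 + (θz + 1) ^ 2)) * β11 ^ 2 + J1 * (θz * A1 ^ 4 + 2 * (2 * (β22 -
  β23 - 1) * θε * (β22 * J1 - 1) * J2 * β12 ^ 2 + (-2 * J1 * β22 + β22 - β23 + 1) * J2 * θz *
  β12 + θz ^ 2 + 2 * β22 ^ 2 * J1 * θp - 2 * β22 * β23 * J1 * θp + 2 * θ2 + θz) * A1 ^ 2 - (2 *
  β12 * (β23 + β22 * (2 * J1 - 1) - 1) * J2 - θz - 1) * θz * (θz + 1) + 2 * β21 * (θε * (A1 ^ 4 +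
  2 * β12 * (2 * β23 + β22 * (J1 - 2) + 1) * J2 * A1 ^ 2 - (θz + 1) ^ 2) - J1 * θz * (A1 ^ 2 +
  θz + 1))) * β11 - 2 * β22 * J1 * θp * (-A1 ^ 4 + 2 * β21 * J1 * A1 ^ 2 + (θz + 1) ^ 2)

/-- Part 2 of `mixedEq1_num`. -/
noncomputable def mixedEq1_num_2 (J1 J2 θp θ2 θε A1 θz β21 β22 β12 : ℝ) : ℝ :=
  β12 * J2 * (θz * A1 ^ 4 + 2 * (2 * θε * J1 * β21 ^ 2 - J1 * θz * β21 + θz ^ 2 + 2 * β22 * J1 *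
  θp + 2 * θ2 + θz) * A1 ^ 2 - (2 * β21 * J1 - θz - 1) * θz * (θz + 1)) - 2 * β12 ^ 2 * (β22 *
  J1 - 1) * J2 * (J2 * θz * (A1 ^ 2 + θz + 1) + θε * (-A1 ^ 4 + 2 * β21 * J1 * A1 ^ 2 + (θz +
  1) ^ 2))

/-- Numerator in the first mixed-strategy equation. -/
noncomputable def mixedEq1_num (J1 J2 θp θ2 θε A1 θz β21 β11 β22 β23 β12 : ℝ) : ℝ :=
  (mixedEq1_num_1 J1 J2 θp θ2 θε A1 θz β21 β11 β22 β23 β12) +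
  (mixedEq1_num_2 J1 J2 θp θ2 θε A1 θz β21 β22 β12)

/-- Part 1 of `mixedEq1_den`. -/
noncomputable def mixedEq1_den_1 (J1 J2 θp θ2 θε A1 θz β21 β12 : ℝ) : ℝ :=
  4 * β12 * J2 * θp * (A1 ^ 4 + (2 * θz - 2 * β21 * J1) * A1 ^ 2 + θz ^ 2 - 2 * β21 * J1 * θz -
  1) * A1 ^ 2 + θp * (A1 ^ 8 + (3 * θz - 4 * β21 * J1) * A1 ^ 6 + (4 * J1 * (θε + J1) * β21 ^ 2 -
  8 * J1 * θz * β21 + 3 * θz ^ 2 + 4 * θ2 + θz - 2) * A1 ^ 4 + (4 * J1 * (θz * θε + θε + J1 *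
  θz) * β21 ^ 2 - 4 * J1 * (θz ^ 2 - 1) * β21 + (θz + 1) * (θz ^ 2 + θz + 4 * θ2)) * A1 ^ 2 +
  (θz + 1) ^ 3)

/-- Part 2 of `mixedEq1_den`. -/
noncomputable def mixedEq1_den_2 (J1 J2 θp θ2 θε A1 θz β21 β12 : ℝ) : ℝ :=
  β12 ^ 2 * J2 * (4 * A1 ^ 2 * β21 ^ 2 * J1 * (A1 ^ 2 + θz + 1) * θε ^ 2 + (A1 ^ 8 + (3 * θz - 4 *
  β21 * J1) * A1 ^ 6 + (4 * J1 * (J1 + J2) * β21 ^ 2 - 8 * J1 * θz * β21 + 3 * θz ^ 2 + 4 * θp +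
  4 * θ2 + θz - 2) * A1 ^ 4 + (4 * J1 * (J1 + J2) * θz * β21 ^ 2 - 4 * J1 * (θz ^ 2 - 1) * β21 +
  (θz + 1) * (θz ^ 2 + θz + 4 * θp + 4 * θ2)) * A1 ^ 2 + (θz + 1) ^ 3) * θε + J2 * ((4 * θp + 4 *
  θ2 + θz) * A1 ^ 4 + 2 * θz * (2 * θp + 2 * θ2 + θz + 1) * A1 ^ 2 + θz * (θz + 1) ^ 2))

/-- Part 3 of `mixedEq1_den`. -/
noncomputable def mixedEq1_den_3 (J1 J2 θp θ2 θε A1 θz β11 β22 β23 β12 : ℝ) : ℝ :=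
  β11 ^ 2 * J1 * (4 * A1 ^ 2 * β12 ^ 2 * (-β22 + β23 + 1) ^ 2 * J2 * (A1 ^ 2 + θz + 1) * θε ^ 2 +
  (A1 ^ 8 + (4 * β12 * (-β22 + β23 + 1) * J2 + 3 * θz) * A1 ^ 6 + (4 * θp * β22 ^ 2 - 8 * β23 *
  θp * β22 + 3 * θz ^ 2 + 4 * β12 ^ 2 * (-β22 + β23 + 1) ^ 2 * J2 * (J1 + J2) + 4 * β23 ^ 2 * θp +
  4 * θ2 + 8 * β12 * (-β22 + β23 + 1) * J2 * θz + θz - 2) * A1 ^ 4 + (4 * β12 ^ 2 * J2 * (J1 +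
  J2) * θz * (-β22 + β23 + 1) ^ 2 - 4 * β12 * (β22 - β23 - 1) * J2 * (θz ^ 2 - 1) + (θz + 1) *
  (4 * θp * β22 ^ 2 - 8 * β23 * θp * β22 + θz ^ 2 + 4 * β23 ^ 2 * θp + 4 * θ2 + θz)) * A1 ^ 2 +
  (θz + 1) ^ 3) * θε + J1 * ((4 * θp * β22 ^ 2 - 8 * β23 * θp * β22 + 4 * β23 ^ 2 * θp + 4 * θ2 +
  θz) * A1 ^ 4 + 2 * θz * (2 * θp * β22 ^ 2 - 4 * β23 * θp * β22 + 2 * β23 ^ 2 * θp + 2 * θ2 +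
  θz + 1) * A1 ^ 2 + θz * (θz + 1) ^ 2))

/-- Part 4 of `mixedEq1_den`. -/
noncomputable def mixedEq1_den_4 (J1 J2 θp θ2 θε A1 θz β21 β11 β22 β23 β12 : ℝ) : ℝ :=
  2 * β11 * J1 * (2 * ((β22 - β23 - 1) * θε * J2 * β12 ^ 2 + β21 * θε * J2 * β12 + (β22 - β23) *
  θp) * A1 ^ 6 + (-4 * (β22 - β23 - 1) * θε * J2 * (β21 * (θε + J1 + J2) - θz) * β12 ^ 2 + J2 *
  (4 * β22 * θp - 4 * β23 * θp + 4 * θ2 + 4 * β21 * θε * θz + θz) * β12 - 4 * (β22 - β23) * θp *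
  (β21 * (θε + J1) - θz)) * A1 ^ 4 + 2 * (-(β22 - β23 - 1) * θε * J2 * (-θz ^ 2 + 2 * β21 * ((J1 +
  J2) * θz + θε * (θz + 1)) + 1) * β12 ^ 2 + J2 * (θz * (2 * β22 * θp - 2 * β23 * θp + 2 * θ2 +
  θz + 1) + β21 * θε * (θz ^ 2 - 1)) * β12 - (β22 - β23) * θp * (-θz ^ 2 + 2 * β21 * (θz * θε +
  θε + J1 * θz) + 1)) * A1 ^ 2 + β12 * J2 * θz * (θz + 1) ^ 2)

/-- Denominator in the first mixed-strategy equation. -/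
noncomputable def mixedEq1_den (J1 J2 θp θ2 θε A1 θz β21 β11 β22 β23 β12 : ℝ) : ℝ :=
  (mixedEq1_den_1 J1 J2 θp θ2 θε A1 θz β21 β12) + (mixedEq1_den_2 J1 J2 θp θ2 θε A1 θz β21 β12) +
  (mixedEq1_den_3 J1 J2 θp θ2 θε A1 θz β11 β22 β23 β12) +
  (mixedEq1_den_4 J1 J2 θp θ2 θε A1 θz β21 β11 β22 β23 β12)

/-- Right-hand side of the first mixed-strategy equation. -/
noncomputable def mixedEq1 (J1 J2 θp θ2 θε A1 θz β21 β11 β22 β23 β12 : ℝ) : ℝ :=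
  (A1 * (A1 ^ 2 - β11 * β22 * J1 ^ 2 - β21 * J1 + β11 * β22 * J1 - β11 * β23 * J1 + β12 * J2 -
  β12 * β22 * J1 * J2 + θz + 1)) / ((β11 * J1 + β12 * J2) * (A1 ^ 2 + θz + 1)) - A1 *
  (mixedEq1_num J1 J2 θp θ2 θε A1 θz β21 β11 β22 β23 β12) /
  (mixedEq1_den J1 J2 θp θ2 θε A1 θz β21 β11 β22 β23 β12)

/-- Part 1 of `mixedEq2`. -/
noncomputable def mixedEq2_1 (J1 J2 θp θ2 θε A1 θz β21 β12 : ℝ) : ℝ :=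
  4 * β12 * J2 * θp * (A1 ^ 2 + θz) * (A1 ^ 2 - 2 * β21 * J1 + θz + 1) * A1 ^ 2 + θp * (A1 ^ 8 +
  (-4 * β21 * J1 + 3 * θz + 2) * A1 ^ 6 + (4 * J1 * (θε + J1) * β21 ^ 2 - 4 * (2 * θz * J1 + J1) *
  β21 + 4 * θ2 + 3 * θz * (θz + 1)) * A1 ^ 4 + (4 * J1 * (θz * θε + θε + J1 * θz) * β21 ^ 2 - 4 *
  J1 * θz * (θz + 1) * β21 + (θz + 1) * (θz ^ 2 - θz + 4 * θ2 - 2)) * A1 ^ 2 - (θz + 1) ^ 3)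

/-- Part 2 of `mixedEq2`. -/
noncomputable def mixedEq2_2 (J1 J2 θp θ2 θε A1 θz β21 β12 : ℝ) : ℝ :=
  β12 ^ 2 * J2 * (4 * A1 ^ 2 * β21 ^ 2 * J1 * (A1 ^ 2 + θz + 1) * θε ^ 2 + (A1 ^ 8 + (-4 * β21 *
  J1 + 3 * θz + 2) * A1 ^ 6 + (4 * J1 * (J1 + J2) * β21 ^ 2 - 4 * (2 * θz * J1 + J1) * β21 + 3 *
  θz ^ 2 + 4 * θp + 4 * θ2 + 3 * θz) * A1 ^ 4 + (θz ^ 3 + 4 * β21 * J1 * θz * (β21 * J1 - 1 -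
  θz) + 4 * β21 ^ 2 * J1 * J2 * θz - 3 * θz + 4 * θp * (θz + 1) + 4 * θ2 * (θz + 1) - 2) *
  A1 ^ 2 - (θz + 1) ^ 3) * θε + J2 * ((4 * θp + 4 * θ2 - θz) * A1 ^ 4 - 2 * θz * (-2 * θp - 2 *
  θ2 + θz + 1) * A1 ^ 2 - θz * (θz + 1) ^ 2))

/-- Part 3 of `mixedEq2`. -/
noncomputable def mixedEq2_3 (J1 J2 θp θ2 θε A1 θz β21 β11 β22 β23 β12 : ℝ) : ℝ :=
  2 * β11 * J1 * (2 * ((β22 - β23 - 1) * θε * J2 * β12 ^ 2 + β21 * θε * J2 * β12 + (β22 - β23) *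
  θp) * A1 ^ 6 + (-2 * (β22 - β23 - 1) * θε * J2 * (2 * β21 * (θε + J1 + J2) - 2 * θz - 1) *
  β12 ^ 2 + J2 * (4 * β22 * θp - 4 * β23 * θp + 4 * θ2 - θz + 2 * β21 * (2 * θz * θε + θε)) *
  β12 - 2 * (β22 - β23) * θp * (2 * β21 * (θε + J1) - 2 * θz - 1)) * A1 ^ 4 - 2 * ((β22 - β23 -
  1) * θε * J2 * (2 * β21 * ((J1 + J2) * θz + θε * (θz + 1)) - θz * (θz + 1)) * β12 ^ 2 + J2 *
  θz * (-2 * β22 * θp + 2 * β23 * θp - 2 * θ2 + θz - β21 * θε * (θz + 1) + 1) * β12 + (β22 -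
  β23) * θp * (2 * β21 * ((θz + 1) * θε + J1 * θz) - θz * (θz + 1))) * A1 ^ 2 - β12 * J2 * θz *
  (θz + 1) ^ 2)

/-- Part 4 of `mixedEq2`. -/
noncomputable def mixedEq2_4 (J1 J2 θp θ2 θε A1 θz β11 β22 β23 β12 : ℝ) : ℝ :=
  β11 ^ 2 * J1 * (4 * A1 ^ 2 * β12 ^ 2 * (-β22 + β23 + 1) ^ 2 * J2 * (A1 ^ 2 + θz + 1) * θε ^ 2 +
  (A1 ^ 8 + (4 * β12 * (-β22 + β23 + 1) * J2 + 3 * θz + 2) * A1 ^ 6 + (4 * θp * β22 ^ 2 - 8 *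
  β23 * θp * β22 + 3 * θz ^ 2 + 4 * β12 ^ 2 * (-β22 + β23 + 1) ^ 2 * J2 * (J1 + J2) + 4 *
  β23 ^ 2 * θp + 4 * θ2 + 3 * θz - 4 * β12 * (β22 - β23 - 1) * J2 * (2 * θz + 1)) * A1 ^ 4 +
  (θz ^ 3 + 4 * β12 * J2 * θz ^ 2 + 4 * β12 ^ 2 * J2 ^ 2 * θz + 4 * β12 * J2 * θz + 4 * β12 ^ 2 *
  J1 * J2 * θz + 4 * θ2 * θz + 4 * β12 * β23 * J2 * (2 * β12 * (J1 + J2) + θz + 1) * θz - 3 * θz +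
  4 * θ2 + 4 * β22 ^ 2 * (J2 * (J1 + J2) * θz * β12 ^ 2 + θp * (θz + 1)) + 4 * β23 ^ 2 * (J2 *
  (J1 + J2) * θz * β12 ^ 2 + θp * (θz + 1)) - 4 * β22 * (β12 * J2 * θz * (2 * β12 * (J1 + J2) +
  θz + 1) + 2 * β23 * (J2 * (J1 + J2) * θz * β12 ^ 2 + θp * (θz + 1))) - 2) * A1 ^ 2 - (θz +
  1) ^ 3) * θε + J1 * ((4 * θp * β22 ^ 2 - 8 * β23 * θp * β22 + 4 * β23 ^ 2 * θp + 4 * θ2 - θz) *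
  A1 ^ 4 - 2 * θz * (-2 * θp * β22 ^ 2 + 4 * β23 * θp * β22 - 2 * β23 ^ 2 * θp - 2 * θ2 + θz +
  1) * A1 ^ 2 - θz * (θz + 1) ^ 2))

/-- Right-hand side of the second mixed-strategy equation. -/
noncomputable def mixedEq2 (J1 J2 θp θ2 θε A1 θz β21 β11 β22 β23 β12 : ℝ) : ℝ :=
  (mixedEq2_1 J1 J2 θp θ2 θε A1 θz β21 β12) + (mixedEq2_2 J1 J2 θp θ2 θε A1 θz β21 β12) +
  (mixedEq2_3 J1 J2 θp θ2 θε A1 θz β21 β11 β22 β23 β12) +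
  (mixedEq2_4 J1 J2 θp θ2 θε A1 θz β11 β22 β23 β12)

/-- Right-hand side of the third mixed-strategy equation. -/
noncomputable def mixedEq3 (J1 J2 θp _θ2 θε A1 θz β21 β11 β22 β23 β12 : ℝ) : ℝ :=
  β11 - (-((A1 ^ 2 + θz) * (β11 * (J1 - 1) + β12 * J2) * (β11 * J1 + β12 * J2)) / (β11 ^ 2 * J1 *
  (θε * (A1 ^ 2 + θz + 1) + J1 * (A1 ^ 2 + θz)) + 2 * β11 * β12 * J1 * J2 * (A1 ^ 2 + θz) +
  β12 ^ 2 * J2 * (θε * (A1 ^ 2 + θz + 1) + J2 * (A1 ^ 2 + θz)) + θp * (A1 ^ 2 + θz + 1)) + (2 *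
  β23 * (A1 ^ 2 * (β11 * β22 * (J1 - 1) + β12 * β22 * J2 + β21 * (θε + 1)) + β22 * θz * (β11 *
  (J1 - 1) + β12 * J2) + β21 * (θε * θz + θε + θz))) / (A1 ^ 2 + θz + 1) + 1) / (2 * (A1 ^ 2 *
  (θε + 1) + θε * θz + θε + θz) * ((β11 * J1 + β12 * J2) / (β11 ^ 2 * J1 * (θε * (A1 ^ 2 + θz +
  1) + J1 * (A1 ^ 2 + θz)) + 2 * β11 * β12 * J1 * J2 * (A1 ^ 2 + θz) + β12 ^ 2 * J2 * (θε *
  (A1 ^ 2 + θz + 1) + J2 * (A1 ^ 2 + θz)) + θp * (A1 ^ 2 + θz + 1)) - β23 ^ 2 / (A1 ^ 2 + θz +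
  1)))

/-- Part 1 of `mixedEq4`. -/
noncomputable def mixedEq4_1 (J1 J2 θp θε A1 θz β21 β11 β22 β23 β12 : ℝ) : ℝ :=
  2 * β11 * β22 * (J1 - 1) * (A1 ^ 2 + θz) * (max (J1 - 2) 0) * (β11 * β12 * θε * J2 + β12 ^ 2 *
  (-θε) * J2 - θp) + A1 ^ 4 * β12 ^ 2 * θε * J2 + A1 ^ 4 * θp + 2 * β11 * (J1 - 1) * (A1 ^ 2 +
  θz) * (-β12 ^ 2 * θε * J2 * (β22 * (-J1) + β22 + β23 + 1) - 3 * β12 * β21 * θε * J2 - θp *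
  (β22 * (-J1) + β22 + β23)) - 4 * A1 ^ 2 * β12 ^ 2 * β21 * θε ^ 2 * J2 - 2 * A1 ^ 2 * β12 ^ 2 *
  β21 * θε * J1 * J2 - 4 * A1 ^ 2 * β12 ^ 2 * β21 * θε * J2 ^ 2 - 2 * A1 ^ 2 * β12 ^ 2 * β21 *
  θε * J2 + 2 * A1 ^ 2 * β12 ^ 2 * θε * J2 * θz + 2 * A1 ^ 2 * β12 ^ 2 * θε * J2 + 2 * A1 ^ 2 *
  β12 * J2 * θp - 4 * A1 ^ 2 * β21 * θε * θp - 2 * A1 ^ 2 * β21 * J1 * θp - 2 * A1 ^ 2 * β21 *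
  θp + 2 * A1 ^ 2 * θp * θz + 2 * A1 ^ 2 * θp

/-- Part 2 of `mixedEq4`. -/
noncomputable def mixedEq4_2 (J1 J2 θp θε A1 θz β21 β11 β22 β23 β12 : ℝ) : ℝ :=
  β11 ^ 2 * θε * (J1 - 1) * (A1 ^ 4 + 2 * A1 ^ 2 * (β12 * J2 * (β22 * (-J1) + β22 + β23 + 1) - 2 *
  β21 * (θε + J1) + θz + 1) - 2 * β12 * β22 * J1 * J2 * θz + 2 * β12 * β22 * J2 * θz + 2 * β12 *
  β23 * J2 * θz + 2 * β12 * J2 * θz - 4 * β21 * θε * θz - 4 * β21 * θε - 4 * β21 * J1 * θz +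
  θz ^ 2 + 2 * θz + 1) - 4 * β12 ^ 2 * β21 * θε ^ 2 * J2 * θz - 4 * β12 ^ 2 * β21 * θε ^ 2 * J2 -
  2 * β12 ^ 2 * β21 * θε * J1 * J2 * θz - 4 * β12 ^ 2 * β21 * θε * J2 ^ 2 * θz - 2 * β12 ^ 2 *
  β21 * θε * J2 * θz + β12 ^ 2 * θε * J2 * θz ^ 2 + 2 * β12 ^ 2 * θε * J2 * θz + β12 ^ 2 * θε *
  J2 + 2 * β12 * J2 * θp * θz - 4 * β21 * θε * θp * θz - 4 * β21 * θε * θp - 2 * β21 * J1 * θp *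
  θz - 2 * β21 * θp * θz + θp * θz ^ 2 + 2 * θp * θz + θp

/-- Right-hand side of the fourth mixed-strategy equation. -/
noncomputable def mixedEq4 (J1 J2 θp _θ2 θε A1 θz β21 β11 β22 β23 β12 : ℝ) : ℝ :=
  (mixedEq4_1 J1 J2 θp θε A1 θz β21 β11 β22 β23 β12) +
  (mixedEq4_2 J1 J2 θp θε A1 θz β21 β11 β22 β23 β12)

/-- Part 1 of `mixedEq5`. -/
noncomputable def mixedEq5_1 (J1 J2 θp θε A1 β21 β22 β12 : ℝ) : ℝ :=
  β12 ^ 2 * θε * J2 ^ 2 * A1 ^ 4 + 2 * β12 ^ 2 * θε ^ 2 * J2 * A1 ^ 4 + 2 * β12 ^ 2 * θε * J2 *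
  A1 ^ 4 + 2 * θε * θp * A1 ^ 4 + 2 * θp * A1 ^ 4 + 2 * β12 ^ 3 * β22 * θε * J2 ^ 3 * A1 ^ 2 + 2 *
  β12 ^ 3 * β22 * θε ^ 2 * J2 ^ 2 * A1 ^ 2 - 2 * β12 ^ 2 * β21 * θε * J2 ^ 2 * A1 ^ 2 + 2 *
  β12 ^ 3 * β22 * θε * J2 ^ 2 * A1 ^ 2 + 4 * β12 ^ 2 * θε ^ 2 * J2 * A1 ^ 2 + 2 * β12 ^ 2 * θε *
  J2 * A1 ^ 2 - 2 * β12 ^ 2 * β21 * θε ^ 2 * J1 * J2 * A1 ^ 2 - 2 * β12 ^ 2 * β21 * θε * J1 * J2 *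
  A1 ^ 2 + 4 * θε * θp * A1 ^ 2 - 2 * β21 * J1 * θp * A1 ^ 2 - 2 * β21 * θε * J1 * θp * A1 ^ 2 +
  2 * β12 * J2 * θp * A1 ^ 2 + 2 * β12 * β22 * J2 * θp * A1 ^ 2 + 2 * β12 * θε * J2 * θp *
  A1 ^ 2 + 2 * β12 * β22 * θε * J2 * θp * A1 ^ 2 + 2 * θp * A1 ^ 2

/-- Part 2 of `mixedEq5`. -/
noncomputable def mixedEq5_2 (J1 J2 θp θε A1 θz β21 β22 β12 : ℝ) : ℝ :=
  2 * β12 ^ 2 * θε * J2 ^ 2 * θz * A1 ^ 2 + 4 * β12 ^ 2 * θε ^ 2 * J2 * θz * A1 ^ 2 + 4 *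
  β12 ^ 2 * θε * J2 * θz * A1 ^ 2 + 4 * θε * θp * θz * A1 ^ 2 + 4 * θp * θz * A1 ^ 2 + 2 *
  β12 ^ 3 * β22 * θε ^ 2 * J2 ^ 2 - β12 ^ 2 * θε * J2 ^ 2 + β12 ^ 2 * θε * J2 ^ 2 * θz ^ 2 + 2 *
  β12 ^ 2 * θε ^ 2 * J2 * θz ^ 2 + 2 * β12 ^ 2 * θε * J2 * θz ^ 2 + 2 * θε * θp * θz ^ 2 + 2 *
  θp * θz ^ 2 + 2 * β12 ^ 2 * θε ^ 2 * J2 - 2 * β12 ^ 2 * β21 * θε ^ 2 * J1 * J2 + 2 * θε * θp -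
  2 * β21 * θε * J1 * θp + 2 * β12 * θε * J2 * θp + 2 * β12 * β22 * θε * J2 * θp + 2 * β12 ^ 3 *
  β22 * θε * J2 ^ 3 * θz + 2 * β12 ^ 3 * β22 * θε ^ 2 * J2 ^ 2 * θz - 2 * β12 ^ 2 * β21 * θε *
  J2 ^ 2 * θz + 2 * β12 ^ 3 * β22 * θε * J2 ^ 2 * θz + 4 * β12 ^ 2 * θε ^ 2 * J2 * θz + 2 *
  β12 ^ 2 * θε * J2 * θz

/-- Part 3 of `mixedEq5`. -/
noncomputable def mixedEq5_3 (J1 J2 θp θε A1 θz β21 β11 β22 β12 : ℝ) : ℝ :=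
  -2 * β12 ^ 2 * β21 * θε ^ 2 * J1 * J2 * θz - 2 * β12 ^ 2 * β21 * θε * J1 * J2 * θz + 4 * θε *
  θp * θz - 2 * β21 * J1 * θp * θz - 2 * β21 * θε * J1 * θp * θz + 2 * β12 * J2 * θp * θz + 2 *
  β12 * β22 * J2 * θp * θz + 2 * β12 * θε * J2 * θp * θz + 2 * β12 * β22 * θε * J2 * θp * θz + 2 *
  θp * θz - 2 * β11 ^ 3 * β22 * θε * J1 * (J1 ^ 2 - 4 * J1 + 3) * (J1 * (A1 ^ 2 + θz) + θε *
  (A1 ^ 2 + θz + 1))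

/-- Part 4 of `mixedEq5`. -/
noncomputable def mixedEq5_4 (J1 J2 θp θε A1 θz β21 β11 β22 β23 β12 : ℝ) : ℝ :=
  β11 * (2 * θε * J2 * (-A1 ^ 2 * (β22 * J2 * J1 ^ 2 + (β23 + 1) * (θε + 1) * J1 - 2 * β22 * (θε +
  3 * J2 + 1) * J1 + (3 * β22 + β23 + 1) * J2) - (β22 * J2 * J1 ^ 2 + (-6 * J2 * β22 - 2 * β22 +
  β23 + 1) * J1 + (3 * β22 + β23 + 1) * J2) * θz + (2 * β22 - β23 - 1) * θε * J1 * (θz + 1)) *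
  β12 ^ 2 + θε * J2 * (A1 ^ 2 + θz + 1) * ((2 * J1 - 3) * A1 ^ 2 + 2 * β21 * θε * (J1 - 1) - 2 *
  J1 + 2 * J1 * θz - 3 * θz + 1) * β12 + 2 * (2 * β22 - β23) * J1 * θp * ((θε + 1) * A1 ^ 2 + θε +
  θε * θz + θz))

/-- Part 5 of `mixedEq5`. -/
noncomputable def mixedEq5_5 (J1 J2 θε A1 θz β11 β22 β23 β12 : ℝ) : ℝ :=
  β11 ^ 2 * θε * (J1 - 1) * (2 * θε * (A1 ^ 2 + θz + 1) * (A1 ^ 2 + β12 * (-J1 * β22 + 2 * β22 +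
  β23 + 1) * J2 + θz + 1) + J1 * (A1 ^ 4 + 2 * (β12 * β22 * (7 - 2 * J1) * J2 + θz) * A1 ^ 2 +
  θz ^ 2 + 2 * β12 * β22 * (7 - 2 * J1) * J2 * θz - 1)) + 2 * β11 * β22 * θε * (J1 - 1) * (β11 *
  J1 + β12 * J2) * (β11 * J1 * (A1 ^ 2 + θz) + β12 * J2 * (A1 ^ 2 + θz) + β11 * θε * (A1 ^ 2 +
  θz + 1)) * (max (J1 - 2) 0)

/-- Right-hand side of the fifth mixed-strategy equation. -/
noncomputable def mixedEq5 (J1 J2 θp _θ2 θε A1 θz β21 β11 β22 β23 β12 : ℝ) : ℝ :=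
  (mixedEq5_1 J1 J2 θp θε A1 β21 β22 β12) + (mixedEq5_2 J1 J2 θp θε A1 θz β21 β22 β12) +
  (mixedEq5_3 J1 J2 θp θε A1 θz β21 β11 β22 β12) +
  (mixedEq5_4 J1 J2 θp θε A1 θz β21 β11 β22 β23 β12) + (mixedEq5_5 J1 J2 θε A1 θz β11 β22 β23 β12)

/-- Right-hand side of the sixth mixed-strategy equation. -/
noncomputable def mixedEq6 (J1 J2 _θp _θ2 _θε A1 θz β21 β11 β22 β23 β12 : ℝ) : ℝ :=
  (A1 ^ 2 + β11 * β23 * J1 - β12 * β22 * J2 + 2 * β12 * β23 * J2 + β12 * J2 - β21 * J1 + θz + 1) /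
  (2 * β11 * J1 + 2 * β12 * J2)

/-- Right-hand side of the seventh mixed-strategy equation. -/
noncomputable def mixedEq7 (J1 J2 θp _θ2 θε A1 θz β21 β11 β22 β23 β12 : ℝ) : ℝ :=
  β12 - (A1 * (((A1 ^ 2 + θz) * (-(2 * (β11 * J1 + β12 * (J2 - 1)) * ((A1 ^ 2 + θz + 1) ^ 2 *
  (β11 * J1 + β12 * J2) ^ 2 - (θε * (A1 ^ 2 + θz + 1) ^ 2 * (β11 ^ 2 * J1 + β12 ^ 2 * J2) +
  (A1 ^ 2 + θz) ^ 2 * (β11 * J1 + β12 * J2) ^ 2 + (A1 ^ 2 + θz) * (β11 * J1 + β12 * J2) ^ 2 + θp *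
  (A1 ^ 2 + θz + 1) ^ 2) * (A1 ^ 2 - β11 * β22 * J1 ^ 2 + β11 * β22 * J1 - β11 * β23 * J1 - β12 *
  β22 * J1 * J2 + β12 * J2 - β21 * J1 + θz + 1))) / (θε * (A1 ^ 2 + θz + 1) ^ 2 * (β11 ^ 2 * J1 +
  β12 ^ 2 * J2) + (A1 ^ 2 + θz) ^ 2 * (β11 * J1 + β12 * J2) ^ 2 + (A1 ^ 2 + θz) * (β11 * J1 +
  β12 * J2) ^ 2 + θp * (A1 ^ 2 + θz + 1) ^ 2) - β12 * J2 * (A1 ^ 2 + β11 * J1 * (β22 - β23 - 1) -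
  β21 * J1 + θz + 1) - β11 * J1 * (A1 ^ 2 - β12 * β22 * J2 + β12 * β23 * J2 + β12 * J2 - β21 *
  J1 + θz + 1) + 2 * J1 * (β11 * J1 + β12 * J2) * (β11 * (β22 * (J1 - 1) + β23) + β12 * β22 *
  (J2 - 1) + β21) - β21 * J1 * (β11 * J1 + β12 * J2) - 2 * β12 * (J2 - 1) * (β11 * J1 + β12 *
  J2))) / ((A1 ^ 2 + θz + 1) * (β11 * J1 + β12 * J2)) + 1)) / (4 * (A1 ^ 2 * (θε + 1) + θε * θz +
  θε + θz) * ((A1 * (β11 * J1 + β12 * J2)) / (β11 ^ 2 * J1 * (θε * (A1 ^ 2 + θz + 1) + J1 *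
  (A1 ^ 2 + θz)) + 2 * β11 * β12 * J1 * J2 * (A1 ^ 2 + θz) + β12 ^ 2 * J2 * (θε * (A1 ^ 2 + θz +
  1) + J2 * (A1 ^ 2 + θz)) + θp * (A1 ^ 2 + θz + 1)) - (A1 * (A1 ^ 2 - β11 * β22 * J1 ^ 2 + β11 *
  β22 * J1 - β11 * β23 * J1 - β12 * β22 * J1 * J2 + β12 * J2 - β21 * J1 + θz + 1)) / ((A1 ^ 2 +
  θz + 1) * (β11 * J1 + β12 * J2)) + (A1 - A1 * β22 * J1) / (A1 ^ 2 + θz + 1)))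

/-- Equations and inequalities that determine a mixed-strategy equilibrium. -/
structure MixedSystem (J1 J2 θp θ2 θε A1 θz β21 β11 β22 β23 β12 : ℝ) : Prop where
  eq1 : 0 = mixedEq1 J1 J2 θp θ2 θε A1 θz β21 β11 β22 β23 β12
  eq2 : 0 = mixedEq2 J1 J2 θp θ2 θε A1 θz β21 β11 β22 β23 β12
  eq3 : 0 = mixedEq3 J1 J2 θp θ2 θε A1 θz β21 β11 β22 β23 β12
  eq4 : 0 = mixedEq4 J1 J2 θp θ2 θε A1 θz β21 β11 β22 β23 β12
  eq5 : 0 = mixedEq5 J1 J2 θp θ2 θε A1 θz β21 β11 β22 β23 β12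
  eq6 : 0 = mixedEq6 J1 J2 θp θ2 θε A1 θz β21 β11 β22 β23 β12
  eq7 : 0 = mixedEq7 J1 J2 θp θ2 θε A1 θz β21 β11 β22 β23 β12
  ineq1 :
    0 <
        (β11 * J1 + β12 * J2) / (β11 ^ 2 * J1 * (θε * (A1 ^ 2 + θz + 1) + J1 * (A1 ^ 2 + θz)) +
        2 * β11 * β12 * J1 * J2 * (A1 ^ 2 + θz) + β12 ^ 2 * J2 * (θε * (A1 ^ 2 + θz + 1) + J2 *
        (A1 ^ 2 + θz)) + θp * (A1 ^ 2 + θz + 1)) - β23 ^ 2 / (A1 ^ 2 + θz + 1)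
  ineq2 :
    0 <
        (A1 * (β11 * J1 + β12 * J2)) / (β11 ^ 2 * J1 * (θε * (A1 ^ 2 + θz + 1) + J1 * (A1 ^ 2 +
        θz)) + 2 * β11 * β12 * J1 * J2 * (A1 ^ 2 + θz) + β12 ^ 2 * J2 * (θε * (A1 ^ 2 + θz + 1) +
        J2 * (A1 ^ 2 + θz)) + θp * (A1 ^ 2 + θz + 1)) - (A1 * (A1 ^ 2 - β11 * β22 * J1 ^ 2 + β11 *
        β22 * J1 - β11 * β23 * J1 - β12 * β22 * J1 * J2 + β12 * J2 - β21 * J1 + θz + 1)) /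
        ((A1 ^ 2 + θz + 1) * (β11 * J1 + β12 * J2)) + (A1 - A1 * β22 * J1) / (A1 ^ 2 + θz + 1)
  A1_pos : 0 < A1
  θz_pos : 0 < θz

/-- The remaining coefficients of a mixed-strategy equilibrium. -/
structure MixedFormulas (J1 J2 θp θε A1 θz β21 β11 β22 β23 β12 Λ1 Λp Λ21 Λ22 A21 α22 : ℝ) :
    Prop where
  Λ1_eq : Λ1 = A1 / (A1 ^ 2 + θz + 1)
  Λp_eq : Λp =
    A1 * (β11 * J1 + β12 * J2) /
      (β11 ^ 2 * J1 * (θε * (A1 ^ 2 + θz + 1) + J1 * (A1 ^ 2 + θz)) +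
        2 * β11 * β12 * J1 * J2 * (A1 ^ 2 + θz) +
        β12 ^ 2 * J2 * (θε * (A1 ^ 2 + θz + 1) + J2 * (A1 ^ 2 + θz)) + θp * (A1 ^ 2 + θz + 1))
  Λ21_eq : Λ21 =
    A1 * (A1 ^ 2 - β11 * β22 * J1 ^ 2 + β11 * β22 * J1 - β11 * β23 * J1 - β12 * β22 * J1 * J2 +
        β12 * J2 - β21 * J1 + θz + 1) /
      ((A1 ^ 2 + θz + 1) * (β11 * J1 + β12 * J2))
  Λ22_eq : Λ22 = Λ1
  A21_eq : A21 = 1 / (2 * Λ22)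
  α22_eq : α22 = -((A1 ^ 2 + θz + 1) / 2)

/-- Part 1 of `pureEq1`. -/
noncomputable def pureEq1_1 (J1 J2 θε Λ21 Λ22 A1 β11 β21 β22 β12 : ℝ) : ℝ :=
  4 * A1 ^ 2 * θε * J2 ^ 3 * Λ21 * (Λ21 + (β22 * J1 - 1) * Λ22) ^ 2 * β12 ^ 4 + 4 * A1 * θε *
  J2 ^ 2 * (Λ21 + (β22 * J1 - 1) * Λ22) * (Λ21 * (3 * A1 * β11 * J1 * Λ21 - 2) + (-2 * β22 * J1 +
  A1 * (β11 * (3 * J1 * β22 + β22 - 4) - 2 * β21) * Λ21 * J1 + 2) * Λ22) * β12 ^ 3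

/-- Part 2 of `pureEq1`. -/
noncomputable def pureEq1_2 (J1 J2 θp θ2 θε Λ21 Λ22 A1 β11 β21 β22 β12 : ℝ) : ℝ :=
  J2 * (4 * J2 * Λ21 * (4 * θ2 * Λ22 ^ 2 + (Λ21 + β22 * J1 * Λ22 + Λ22) ^ 2 * θp) * A1 ^ 2 + 4 *
  (A1 ^ 2 + 1) * J1 * Λ21 * (β11 * θε * (Λ21 + (J1 * β22 + β22 - 2) * Λ22) - 2 * β21 * θε *
  Λ22) ^ 2 + θε * (9 * A1 ^ 2 * β11 ^ 2 * J1 ^ 2 * Λ21 ^ 3 + 6 * A1 * β11 * J1 * (A1 * J1 * (β11 *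
  (3 * J1 * β22 + β22 - 4) - 2 * β21) * Λ22 - 2) * Λ21 ^ 2 + (Λ22 * (Λ22 * (J1 * (4 * J2 * (β11 *
  (1 - β22) + 2 * β21) ^ 2 + J1 * (β11 * (3 * J1 * β22 + β22 - 4) - 2 * β21) ^ 2) + 16 * (θp +
  θ2)) * A1 ^ 2 - 4 * J1 * (β11 * (6 * J1 * β22 + β22 - 7) - 2 * β21) * A1 + 16 * Λ22 * (θp +
  θ2)) + 4) * Λ21 + 4 * (β22 * J1 - 1) * Λ22 * (A1 * J1 * (2 * β21 - β11 * (3 * J1 * β22 + β22 -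
  4)) * Λ22 + 2))) * β12 ^ 2

/-- Part 3 of `pureEq1`. -/
noncomputable def pureEq1_3 (J1 J2 θp θ2 θε Λ21 Λ22 A1 β11 β21 β22 β12 : ℝ) : ℝ :=
  -4 * A1 * J2 * (A1 * (β22 - 1) * θε * J1 ^ 2 * Λ21 * Λ22 * (Λ21 + β22 * (J1 - 1) * Λ22) *
  β11 ^ 3 + θε * J1 * Λ22 * (-Λ21 * (β22 + 2 * A1 * β21 * J1 * Λ21 - 1) - (β22 - 1) * β22 * (J1 -
  1) * Λ22 - 2 * A1 * β21 * (β22 * (J1 - 2) + 1) * J1 * Λ21 * Λ22) * β11 ^ 2 - J1 * (4 * A1 *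
  β21 ^ 2 * θε * J1 * Λ21 * Λ22 ^ 2 - 2 * β21 * θε * (Λ21 + β22 * (J1 - 2) * Λ22 + Λ22) * Λ22 +
  A1 * Λ21 * (8 * θ2 * Λ22 ^ 2 + (Λ21 + β22 * J1 * Λ22 + Λ22) * (3 * Λ21 + β22 * Λ22 + 3 * β22 *
  J1 * Λ22) * θp)) * β11 + 2 * (2 * β21 ^ 2 * θε * J1 * Λ22 ^ 2 + 2 * θ2 * Λ22 ^ 2 + A1 * β21 *
  J1 * Λ21 * (Λ21 + β22 * J1 * Λ22 + Λ22) * θp * Λ22 + (Λ21 + β22 * J1 * Λ22) * (Λ21 + β22 * J1 *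
  Λ22 + Λ22) * θp)) * β12

/-- Part 4 of `pureEq1`. -/
noncomputable def pureEq1_4 (J1 θp θ2 θε Λ21 Λ22 A1 β11 β21 β22 : ℝ) : ℝ :=
  -2 * A1 * J1 * (θε * J1 * (Λ21 + β22 * (J1 - 1) * Λ22) ^ 2 * β11 ^ 3 + 4 * β21 * θε * J1 * Λ22 *
  (Λ21 + β22 * (J1 - 1) * Λ22) * β11 ^ 2 + 2 * (2 * β21 ^ 2 * θε * J1 * Λ22 ^ 2 + 4 * θ2 *
  Λ22 ^ 2 + (Λ21 + β22 * J1 * Λ22) * (3 * Λ21 + β22 * Λ22 + 3 * β22 * J1 * Λ22) * θp) * β11 - 4 *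
  β21 * Λ22 * (Λ21 + β22 * J1 * Λ22) * θp)

/-- Part 5 of `pureEq1`. -/
noncomputable def pureEq1_5 (J1 θp θ2 θε Λ21 Λ22 A1 β11 β21 β22 : ℝ) : ℝ :=
  A1 ^ 2 * Λ21 * (θε * J1 ^ 3 * (Λ21 + β22 * (J1 - 1) * Λ22) ^ 2 * β11 ^ 4 + 4 * β21 * θε *
  J1 ^ 3 * Λ22 * (Λ21 + β22 * (J1 - 1) * Λ22) * β11 ^ 3 + J1 * (4 * β21 ^ 2 * θε * J1 ^ 2 *
  Λ22 ^ 2 + 16 * (θε + J1) * θ2 * Λ22 ^ 2 + (J1 * (3 * Λ21 + β22 * Λ22 + 3 * β22 * J1 * Λ22) ^ 2 +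
  4 * θε * (Λ21 + β22 * (J1 + 1) * Λ22) ^ 2) * θp) * β11 ^ 2 - 4 * β21 * J1 * Λ22 * (J1 * (3 *
  Λ21 + β22 * Λ22 + 3 * β22 * J1 * Λ22) + 4 * θε * (Λ21 + β22 * (J1 + 1) * Λ22)) * θp * β11 + 4 *
  Λ22 ^ 2 * θp * (J1 * (4 * θε + J1) * β21 ^ 2 + 4 * θ2))

/-- Part 6 of `pureEq1`. -/
noncomputable def pureEq1_6 (J1 θp θ2 θε Λ21 Λ22 β11 β21 β22 : ℝ) : ℝ :=
  4 * (θε * J1 * (θp * Λ21 ^ 3 + Λ22 * (β22 * (J1 + (J1 + 1) * Λ21 * (2 * Λ21 + β22 * (J1 + 1) *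
  Λ22) * θp - 1) + 4 * Λ21 * Λ22 * θ2)) * β11 ^ 2 + 2 * β21 * θε * J1 * Λ22 * (1 - 2 * Λ21 *
  (Λ21 + β22 * (J1 + 1) * Λ22) * θp) * β11 + θp * (4 * Λ21 * (θε * J1 * β21 ^ 2 + θ2) * Λ22 ^ 2 +
  2 * β22 * J1 * Λ22 + Λ21))

/-- Right-hand side of the first pure-strategy equation. -/
noncomputable def pureEq1 (J1 J2 θp θ2 θε Λ21 Λ22 A1 β11 β21 β22 β12 : ℝ) : ℝ :=
  (pureEq1_1 J1 J2 θε Λ21 Λ22 A1 β11 β21 β22 β12) +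
  (pureEq1_2 J1 J2 θp θ2 θε Λ21 Λ22 A1 β11 β21 β22 β12) +
  (pureEq1_3 J1 J2 θp θ2 θε Λ21 Λ22 A1 β11 β21 β22 β12) +
  (pureEq1_4 J1 θp θ2 θε Λ21 Λ22 A1 β11 β21 β22) +
  (pureEq1_5 J1 θp θ2 θε Λ21 Λ22 A1 β11 β21 β22) + (pureEq1_6 J1 θp θ2 θε Λ21 Λ22 β11 β21 β22)

/-- Part 1 of `pureEq2`. -/
noncomputable def pureEq2_1 (J1 J2 θε Λ21 Λ22 A1 β11 β21 β22 β12 : ℝ) : ℝ :=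
  A1 ^ 2 * β11 ^ 4 * θε * J1 ^ 3 * (β22 * (J1 - 1) * Λ22 + Λ21) ^ 2 + 4 * A1 ^ 2 * β11 ^ 3 * θε *
  J1 ^ 2 * Λ22 * (β22 * (J1 - 1) * Λ22 + Λ21) * (β21 * J1 - β12 * (β22 - 1) * J2)

/-- Part 2 of `pureEq2`. -/
noncomputable def pureEq2_2 (J1 J2 θp θ2 θε Λ21 Λ22 A1 β11 β21 β22 β12 : ℝ) : ℝ :=
  β11 ^ 2 * J1 * (θε * (A1 ^ 2 * (β12 ^ 2 * J2 * (Λ22 ^ 2 * (J1 * (3 * β22 * J1 + β22 - 4) ^ 2 +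
  4 * (β22 - 1) ^ 2 * J2) + 6 * J1 * Λ21 * Λ22 * (3 * β22 * J1 + β22 - 4) + 9 * J1 * Λ21 ^ 2) +
  8 * β12 * β21 * J1 * J2 * Λ22 * (β22 * (J1 - 2) * Λ22 + Λ21 + Λ22) + 4 * (β21 ^ 2 * J1 ^ 2 *
  Λ22 ^ 2 + θp * (β22 * (J1 + 1) * Λ22 + Λ21) ^ 2 + 4 * Λ22 ^ 2 * θ2)) + 4 * θp * (β22 * (J1 +
  1) * Λ22 + Λ21) ^ 2 + 16 * Λ22 ^ 2 * θ2 - 4) + 4 * (A1 ^ 2 + 1) * β12 ^ 2 * θε ^ 2 * J2 * (Λ22 *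
  (β22 * J1 + β22 - 2) + Λ21) ^ 2 + A1 ^ 2 * J1 * (θp * (β22 * (3 * J1 + 1) * Λ22 + 3 * Λ21) ^ 2 +
  16 * Λ22 ^ 2 * θ2))

/-- Part 3 of `pureEq2`. -/
noncomputable def pureEq2_3 (J1 J2 θp θ2 θε Λ21 Λ22 A1 β11 β21 β22 β12 : ℝ) : ℝ :=
  4 * β11 * J1 * (A1 ^ 2 * (β12 ^ 3 * θε * J2 ^ 2 * (Λ22 * (β22 * J1 - 1) + Λ21) * (Λ22 * (3 *
  β22 * J1 + β22 - 4) + 3 * Λ21) - β12 ^ 2 * β21 * θε * J2 * Λ22 * (4 * θε * (Λ22 * (β22 * J1 +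
  β22 - 2) + Λ21) + J1 * Λ22 * (3 * β22 * J1 + β22 - 4) + 4 * (β22 - 1) * J2 * Λ22 + 3 * J1 *
  Λ21) + β12 * J2 * (4 * β21 ^ 2 * θε * J1 * Λ22 ^ 2 + θp * (β22 * J1 * Λ22 + Λ21 + Λ22) * (3 *
  β22 * J1 * Λ22 + β22 * Λ22 + 3 * Λ21) + 8 * Λ22 ^ 2 * θ2) - β21 * Λ22 * θp * (4 * θε * (β22 *
  (J1 + 1) * Λ22 + Λ21) + J1 * (3 * β22 * J1 * Λ22 + β22 * Λ22 + 3 * Λ21))) + 4 * β21 * θε * Λ22 *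
  (-β12 ^ 2 * θε * J2 * (Λ22 * (β22 * J1 + β22 - 2) + Λ21) - θp * (β22 * (J1 + 1) * Λ22 + Λ21)))

/-- Part 4 of `pureEq2`. -/
noncomputable def pureEq2_4 (J1 J2 θp θ2 θε Λ21 Λ22 A1 β21 β22 β12 : ℝ) : ℝ :=
  4 * (A1 ^ 2 * β12 ^ 4 * θε * J2 ^ 3 * (Λ22 * (β22 * J1 - 1) + Λ21) ^ 2 - 2 * A1 ^ 2 * β12 ^ 3 *
  β21 * θε * J1 * J2 ^ 2 * Λ22 * (Λ22 * (β22 * J1 - 1) + Λ21) + β12 ^ 2 * J2 * (4 * (A1 ^ 2 + 1) *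
  β21 ^ 2 * θε ^ 2 * J1 * Λ22 ^ 2 + θε * (Λ22 ^ 2 * (A1 ^ 2 * (β21 ^ 2 * J1 * (J1 + 4 * J2) + 4 *
  (θp + θ2)) + 4 * (θp + θ2)) - 1) + A1 ^ 2 * J2 * (θp * (β22 * J1 * Λ22 + Λ21 + Λ22) ^ 2 + 4 *
  Λ22 ^ 2 * θ2)) - 2 * A1 ^ 2 * β12 * β21 * J1 * J2 * Λ22 * θp * (β22 * J1 * Λ22 + Λ21 + Λ22) +
  θp * (Λ22 ^ 2 * (β21 ^ 2 * J1 * (4 * (A1 ^ 2 + 1) * θε + A1 ^ 2 * J1) + 4 * (A1 ^ 2 + 1) * θ2) -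
  1))

/-- Right-hand side of the second pure-strategy equation. -/
noncomputable def pureEq2 (J1 J2 θp θ2 θε Λ21 Λ22 A1 β11 β21 β22 β12 : ℝ) : ℝ :=
  (pureEq2_1 J1 J2 θε Λ21 Λ22 A1 β11 β21 β22 β12) +
  (pureEq2_2 J1 J2 θp θ2 θε Λ21 Λ22 A1 β11 β21 β22 β12) +
  (pureEq2_3 J1 J2 θp θ2 θε Λ21 Λ22 A1 β11 β21 β22 β12) +
  (pureEq2_4 J1 J2 θp θ2 θε Λ21 Λ22 A1 β21 β22 β12)

/-- Right-hand side of the third pure-strategy equation. -/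
noncomputable def pureEq3 (J1 J2 _θp _θ2 _θε Λ21 Λ22 A1 β11 β21 β22 β12 : ℝ) : ℝ :=
  ((A1 ^ 2 + 1) * (-2 * (A1 ^ 2 + 1) * Λ22 + A1 + (1 / 2) * β11 * J1 * (β22 * (J1 - 1) * Λ22 +
  Λ21) + (β12 * J2 * (Λ22 * (β22 * J1 - 1) + Λ21) + β21 * J1 * Λ22))) / (4 * A1 * (A1 ^ 2 + 1) *
  Λ22 - (1 / 4) * (2 * A1 + β11 * J1 * (β22 * (J1 - 1) * Λ22 + Λ21) + 2 * (β12 * J2 * (β22 * J1 *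
  Λ22 + Λ21 - Λ22) + β21 * J1 * Λ22)) ^ 2) + A1

/-- Right-hand side of the fourth pure-strategy equation. -/
noncomputable def pureEq4 (J1 J2 θp _θ2 θε Λ21 Λ22 A1 β11 β21 β22 β12 : ℝ) : ℝ :=
  -4 * A1 ^ 2 * β11 * β22 * (J1 - 1) * Λ22 * (max (J1 - 2) 0) * (β11 * β12 * θε * J2 + β12 ^ 2 *
  (-θε) * J2 - θp) + A1 ^ 2 * (β11 ^ 3 * (-θε) * (J1 - 1) * J1 * (β22 * (J1 - 1) * Λ22 + Λ21) +
  2 * β11 ^ 2 * θε * (J1 - 1) * Λ22 * (β12 * J2 * (β22 * (2 * J1 - 3) - 1) + β21 * (4 * θε + 3 *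
  J1)) - β11 * (β12 ^ 2 * θε * J2 * ((J1 - 1) * Λ22 * (7 * β22 * J1 - 6 * β22 - 4) + (3 * J1 -
  2) * Λ21) - 12 * β12 * β21 * θε * (J1 - 1) * J2 * Λ22 + θp * (β22 * (7 * J1 ^ 2 - 13 * J1 + 6) *
  Λ22 + (3 * J1 - 2) * Λ21)) + 2 * (β12 ^ 3 * (-θε) * J2 ^ 2 * (Λ22 * (β22 * J1 - 1) + Λ21) +
  β12 ^ 2 * β21 * θε * J2 * Λ22 * (4 * θε + J1 + 4 * J2 + 2) - β12 * J2 * θp * (β22 * J1 * Λ22 +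
  Λ21 + Λ22) + β21 * Λ22 * θp * (4 * θε + J1 + 2))) - 2 * A1 * (β11 ^ 2 * θε * (J1 - 1) +
  β12 ^ 2 * θε * J2 + θp) + 8 * β21 * θε * Λ22 * (β11 ^ 2 * θε * (J1 - 1) + β12 ^ 2 * θε * J2 +
  θp)

/-- Right-hand side of the fifth pure-strategy equation. -/
noncomputable def pureEq5 (J1 J2 θp _θ2 θε Λ21 Λ22 A1 β11 β21 β22 β12 : ℝ) : ℝ :=
  4 * β11 * β22 * θε * (J1 - 1) * Λ22 * (max (J1 - 2) 0) * (β11 * (A1 ^ 2 * θε + A1 ^ 2 * J1 +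
  θε) + A1 ^ 2 * β12 * J2) + A1 ^ 2 * (β11 ^ 2 * θε * (J1 - 1) * (2 * θε * (Λ21 - β22 * (J1 - 5) *
  Λ22) + J1 * (β22 * (11 - 3 * J1) * Λ22 + Λ21)) + β11 * θε * (β12 * J2 * ((3 * J1 - 4) * Λ21 -
  (J1 - 1) * Λ22 * (β22 * (J1 - 14) + 2)) + 2 * β21 * (J1 - 1) * Λ22 * (2 * θε + J1)) + 2 *
  (β12 ^ 2 * θε * J2 * (Λ22 * (β22 * (2 * θε * (J1 + 1) + J1 * J2 + 2 * J1 + 2 * J2 + 2) - 2 *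
  θε - J2 - 2) + Λ21 * (2 * θε + J2 + 2)) + β12 * β21 * θε * (J1 - 2) * J2 * Λ22 + 2 * (θε + 1) *
  θp * (β22 * (J1 + 1) * Λ22 + Λ21))) - 2 * A1 * θε * (β11 * (J1 - 1) + β12 * J2) + 2 * θε *
  (β11 ^ 2 * θε * (J1 - 1) * (Λ21 - β22 * (J1 - 5) * Λ22) + 2 * β11 * β21 * θε * (J1 - 1) * Λ22 +
  2 * (β12 ^ 2 * θε * J2 * (Λ22 * (β22 * J1 + β22 - 1) + Λ21) + θp * (β22 * (J1 + 1) * Λ22 +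
  Λ21)))

/-- Right-hand side of the sixth pure-strategy equation. -/
noncomputable def pureEq6 (J1 J2 θp _θ2 θε Λ21 Λ22 A1 β11 β21 β22 β12 : ℝ) : ℝ :=
  β11 - (-(β22 * (J1 - 1) * Λ22 + Λ21) * (A1 ^ 2 * (β11 * β22 * (J1 - 1) + β12 * β22 * J2 + β21 *
  (θε + 1)) + β21 * θε) - (A1 ^ 3 * (β11 * (J1 - 1) + β12 * J2) * (β11 * J1 + β12 * J2)) /
  (β11 ^ 2 * J1 * (A1 ^ 2 * θε + A1 ^ 2 * J1 + θε) + 2 * A1 ^ 2 * β11 * β12 * J1 * J2 + β12 ^ 2 *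
  J2 * (A1 ^ 2 * θε + A1 ^ 2 * J2 + θε) + (A1 ^ 2 + 1) * θp) + A1) / (2 * (A1 ^ 2 * (θε + 1) +
  θε) * ((A1 * (β11 * J1 + β12 * J2)) / (β11 ^ 2 * J1 * (A1 ^ 2 * θε + A1 ^ 2 * J1 + θε) + 2 *
  A1 ^ 2 * β11 * β12 * J1 * J2 + β12 ^ 2 * J2 * (A1 ^ 2 * θε + A1 ^ 2 * J2 + θε) + (A1 ^ 2 + 1) *
  θp) - (β22 * (J1 - 1) * Λ22 + Λ21) ^ 2 / (4 * Λ22)))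

/-- Right-hand side of the seventh pure-strategy equation. -/
noncomputable def pureEq7 (J1 J2 θp _θ2 θε Λ21 Λ22 A1 β11 β21 β22 β12 : ℝ) : ℝ :=
  β12 - (A1 * (A1 * (4 * (β11 * J1 + β12 * (J2 - 1)) * (Λ21 - (A1 * (β11 * J1 + β12 * J2)) /
  (β11 ^ 2 * J1 * (A1 ^ 2 * θε + A1 ^ 2 * J1 + θε) + 2 * A1 ^ 2 * β11 * β12 * J1 * J2 + β12 ^ 2 *
  J2 * (A1 ^ 2 * θε + A1 ^ 2 * J2 + θε) + (A1 ^ 2 + 1) * θp)) + β11 * J1 * (β22 * (J1 - 1) * Λ22 -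
  3 * Λ21) - 2 * β12 * (J2 * (-β22 * J1 * Λ22 + Λ21 + Λ22) + 2 * Λ22 * (β22 * J1 - 1)) + 2 * β21 *
  J1 * Λ22) + 2)) / (8 * (A1 ^ 2 * (θε + 1) + θε) * ((A1 * (β11 * J1 + β12 * J2)) / (β11 ^ 2 *
  J1 * (A1 ^ 2 * θε + A1 ^ 2 * J1 + θε) + 2 * A1 ^ 2 * β11 * β12 * J1 * J2 + β12 ^ 2 * J2 *
  (A1 ^ 2 * θε + A1 ^ 2 * J2 + θε) + (A1 ^ 2 + 1) * θp) - β22 * J1 * Λ22 - Λ21 + Λ22))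

/-- Equations and inequalities that determine a pure-strategy equilibrium. -/
structure PureSystem (J1 J2 θp θ2 θε Λ21 Λ22 A1 β11 β21 β22 β12 : ℝ) : Prop where
  eq1 : 0 = pureEq1 J1 J2 θp θ2 θε Λ21 Λ22 A1 β11 β21 β22 β12
  eq2 : 0 = pureEq2 J1 J2 θp θ2 θε Λ21 Λ22 A1 β11 β21 β22 β12
  eq3 : 0 = pureEq3 J1 J2 θp θ2 θε Λ21 Λ22 A1 β11 β21 β22 β12
  eq4 : 0 = pureEq4 J1 J2 θp θ2 θε Λ21 Λ22 A1 β11 β21 β22 β12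
  eq5 : 0 = pureEq5 J1 J2 θp θ2 θε Λ21 Λ22 A1 β11 β21 β22 β12
  eq6 : 0 = pureEq6 J1 J2 θp θ2 θε Λ21 Λ22 A1 β11 β21 β22 β12
  eq7 : 0 = pureEq7 J1 J2 θp θ2 θε Λ21 Λ22 A1 β11 β21 β22 β12
  ineq1 :
    0 <
        A1 / (A1 ^ 2 + 1) - (2 * A1 + β11 * J1 * (β22 * (J1 - 1) * Λ22 + Λ21) + 2 * (β12 * J2 *
        (β22 * J1 * Λ22 + Λ21 - Λ22) + β21 * J1 * Λ22)) ^ 2 / (16 * (A1 ^ 2 + 1) ^ 2 * Λ22)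
  ineq2 :
    0 <
        (A1 * (β11 * J1 + β12 * J2)) / (β11 ^ 2 * J1 * (A1 ^ 2 * θε + A1 ^ 2 * J1 + θε) + 2 *
        A1 ^ 2 * β11 * β12 * J1 * J2 + β12 ^ 2 * J2 * (A1 ^ 2 * θε + A1 ^ 2 * J2 + θε) + (A1 ^ 2 +
        1) * θp) - (β22 * (J1 - 1) * Λ22 + Λ21) ^ 2 / (4 * Λ22)
  ineq3 :
    0 <
        (A1 * (β11 * J1 + β12 * J2)) / (β11 ^ 2 * J1 * (A1 ^ 2 * θε + A1 ^ 2 * J1 + θε) + 2 *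
        A1 ^ 2 * β11 * β12 * J1 * J2 + β12 ^ 2 * J2 * (A1 ^ 2 * θε + A1 ^ 2 * J2 + θε) + (A1 ^ 2 +
        1) * θp) - β22 * J1 * Λ22 - Λ21 + Λ22
  Λ22_pos : 0 < Λ22

/-- The remaining coefficients of a pure-strategy equilibrium. -/
structure PureFormulas (J1 J2 θp θε Λ21 Λ22 A1 β11 β21 β22 β12 Λ1 Λp A21 α22 β23 : ℝ) : Prop where
  Λ1_eq : Λ1 = A1 / (A1 ^ 2 + 1)
  Λp_eq : Λp =
    A1 * (β11 * J1 + β12 * J2) /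
      (β11 ^ 2 * J1 * (A1 ^ 2 * θε + A1 ^ 2 * J1 + θε) + 2 * A1 ^ 2 * β11 * β12 * J1 * J2 +
        β12 ^ 2 * J2 * (A1 ^ 2 * θε + A1 ^ 2 * J2 + θε) + (A1 ^ 2 + 1) * θp)
  A21_eq : A21 = 1 / (2 * Λ22)
  α22_eq : α22 =
    -((β11 * J1 * (β22 * (J1 - 1) * Λ22 + Λ21) +
        2 * (β12 * J2 * (β22 * J1 * Λ22 + Λ21 - Λ22) + β21 * J1 * Λ22)) / (4 * Λ22))
  β23_eq : β23 = -((β22 * (J1 - 1) * Λ22 + Λ21) / (2 * Λ22))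

end HFTModel

set_option linter.unusedSectionVars false

/-! The proof rests on two reductions. First, all participants but the deviator trade along affine
rules, so replacing one of her orders by an arbitrary measurable one, with difference `δ`, moves
prices linearly and changes her payoff by exactly `δ (W - κ δ)` with a deterministic `κ`. Her
information determines `δ`, so the conditional gain is `δ E(W) - κ δ²`, where `E(W)` is the
conditional mean of `W`. The prescribed order is therefore the almost surely unique maximizer among
all measurable ones iff `κ > 0` and the marginal profit `W` has conditional mean zero
(`isArgMax_iff`). Efficient pricing says, in the same way, that the pricing errors have conditional
mean zero.

Second, in normalized units these errors and marginal profits are linear forms in independent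
centred Gaussian variables. For such forms uncorrelated means independent, so a conditional mean
given other forms vanishes iff finitely many covariances do (`condExp_lin_eq_zero_iff`). As the
first order flow is public, the forms are written in the residuals of the value and of IT's first
order given that flow; `ip_res` holds their covariances.

Second-stage optimality is demanded after every own first-stage strategy. The marginal profit then
contains the deviation with a fixed coefficient, which has to vanish: this is `link` for a Small-IT
and determines `β23`; for IT the coefficients of the two residuals have to vanish separately, which
determines `α21` and `α22`. A Round-Tripper has no choice left at the second stage. With the second
order of IT optimal, her total profit is a quadratic in her first order (`profit_withI1`). A pure
strategy needs positive curvature and a first-order condition; indifference needs the curvature and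
the conditional slope at zero to vanish, which forces `Λ22 = Λ1` and `C = A1`, hence the formulas
for `α22` and `Λ21`.

`Dimless.Core` collects the conditions other than those on the first order of IT. The explicit
systems are the same conditions in solved form (`mixed_iff`, `pure_iff`): the prices at time `2` by
Cramer's rule, the two second-stage orthogonality conditions of a Small-IT multiplied by the
adjugate of a Gram matrix, and the first-stage conditions divided by the curvatures. The equivalence
holds because every divisor is nonzero: `det_pos`, `oth_gram_pos` and `sigVar_pos` come from the
noise variances and `A1 ≠ 0`, while `A1 > 0` and, in the mixed case, `B > 0` come from the
inequalities. -/

namespace HFTModel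

/-! ### Conditional expectations of linear forms in independent Gaussian variables -/

section GaussianForms

variable {Ω : Type*} {S : Type}

/-- Independent centred Gaussian variables `η s` with variances `w s`. -/
structure IsGaussianFamily [MeasurableSpace Ω] (P : Measure Ω) (η : S → Ω → ℝ) (w : S → ℝ) : Prop where
  measurable : ∀ s, Measurable (η s)
  gaussian : ∀ s, HasGaussianLaw (η s) P
  mean : ∀ s, ∫ ω, η s ω ∂P = 0
  var : ∀ s, ∫ ω, η s ω * η s ω ∂P = w s
  indep : iIndepFun η P

variable [Fintype S]

/-- The linear form with coefficients `a`. -/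
def lin (η : S → Ω → ℝ) (a : S → ℝ) (ω : Ω) : ℝ := ∑ s, a s * η s ω

/-- The covariance of two linear forms. -/
def ip (w a b : S → ℝ) : ℝ := ∑ s, w s * (a s * b s)

variable {η : S → Ω → ℝ} {w : S → ℝ}

lemma lin_add (a b : S → ℝ) (ω : Ω) : lin η (a + b) ω = lin η a ω + lin η b ω := by
  simp [lin, add_mul, Finset.sum_add_distrib]

lemma lin_sub (a b : S → ℝ) (ω : Ω) : lin η (a - b) ω = lin η a ω - lin η b ω := by
  simp [lin, sub_mul, Finset.sum_sub_distrib]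

lemma lin_smul (t : ℝ) (a : S → ℝ) (ω : Ω) : lin η (t • a) ω = t * lin η a ω := by
  simp [lin, Finset.mul_sum, mul_assoc]

lemma ip_comm (a b : S → ℝ) : ip w a b = ip w b a := by
  simp [ip, mul_comm]

lemma ip_add_left (a b c : S → ℝ) : ip w (a + b) c = ip w a c + ip w b c := by
  simp [ip, add_mul, mul_add, Finset.sum_add_distrib]

lemma ip_sub_left (a b c : S → ℝ) : ip w (a - b) c = ip w a c - ip w b c := by
  simp [ip, sub_mul, mul_sub, Finset.sum_sub_distrib]

lemma ip_smul_left (t : ℝ) (a c : S → ℝ) : ip w (t • a) c = t * ip w a c := by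
  simp only [ip, Finset.mul_sum, Pi.smul_apply, smul_eq_mul]
  exact Finset.sum_congr rfl fun s _ => by ring

lemma info_le_info {α β : Type} [MeasurableSpace α] [MeasurableSpace β] {X : Ω → α} {Y : Ω → β}
    {φ : β → α} (hφ : Measurable φ) (h : ∀ ω, X ω = φ (Y ω)) : info X ≤ info Y := by
  have : X = φ ∘ Y := funext h
  rw [this]
  exact (hφ.comp (comap_measurable Y)).comap_le

variable {m : MeasurableSpace Ω} [m0 : MeasurableSpace Ω] {P : Measure Ω} [IsProbabilityMeasure P]

namespace IsGaussianFamily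

variable (hη : IsGaussianFamily P η w)
include hη

lemma measurable_lin (a : S → ℝ) : Measurable (lin η a) :=
  Finset.measurable_sum _ fun s _ => (hη.measurable s).const_mul _

lemma memLp (s : S) : MemLp (η s) 2 P := (hη.gaussian s).memLp_two

lemma memLp_lin (a : S → ℝ) : MemLp (lin η a) 2 P :=
  memLp_finsetSum _ fun s _ => (hη.memLp s).const_mul _

lemma integrable_lin (a : S → ℝ) : Integrable (lin η a) P :=
  (hη.memLp_lin a).integrable one_le_two

lemma integral_lin (a : S → ℝ) : ∫ ω, lin η a ω ∂P = 0 := by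
  unfold lin
  rw [integral_finsetSum _ fun s _ => ((hη.memLp s).integrable one_le_two).const_mul _]
  simp [integral_const_mul, hη.mean]

lemma integral_mul_eq_zero {s t : S} (h : s ≠ t) : ∫ ω, η s ω * η t ω ∂P = 0 := by
  rw [(hη.indep.indepFun h).integral_fun_mul_eq_mul_integral
    (hη.measurable s).aestronglyMeasurable (hη.measurable t).aestronglyMeasurable, hη.mean,
    zero_mul]

lemma integral_lin_mul_lin (a b : S → ℝ) : ∫ ω, lin η a ω * lin η b ω ∂P = ip w a b := by
  classical
  have hi : ∀ s t, Integrable (fun ω => a s * b t * (η s ω * η t ω)) P := fun s t =>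
    ((hη.memLp s).integrable_mul (hη.memLp t)).const_mul _
  have : ∀ ω, lin η a ω * lin η b ω = ∑ s, ∑ t, a s * b t * (η s ω * η t ω) := fun ω => by
    simp only [lin, Finset.sum_mul_sum]
    exact Finset.sum_congr rfl fun s _ => Finset.sum_congr rfl fun t _ => by ring
  simp_rw [this]
  rw [integral_finsetSum _ fun s _ => integrable_finsetSum _ fun t _ => hi s t]
  refine Finset.sum_congr rfl fun s _ => ?_
  rw [integral_finsetSum _ fun t _ => hi s t, Finset.sum_eq_single s]
  · rw [integral_const_mul, hη.var]; ring
  · intro t _ hts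
    rw [integral_const_mul, hη.integral_mul_eq_zero hts.symm, mul_zero]
  · simp

/-- Linear forms in independent Gaussian variables are jointly Gaussian, and for jointly Gaussian
families zero covariance is independence. Degenerate laws are allowed, which is what admits `σz = 0`
and `σε = 0`. -/
lemma indepFun_lin {ι : Type} [Finite ι] (a : S → ℝ) (b : ι → S → ℝ) (h : ∀ i, ip w a (b i) = 0) :
    IndepFun (lin η a) (fun ω i => lin η (b i) ω) P := by
  have hG : HasGaussianLaw (fun ω => (fun s => η s ω)) P := hη.indep.hasGaussianLaw hη.gaussian
  have hcl : ∀ c : S → ℝ, ∃ L : (S → ℝ) →L[ℝ] ℝ, ∀ x, L x = ∑ s, c s * x s := fun c =>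
    ⟨∑ s, c s • ContinuousLinearMap.proj s, fun x => by simp⟩
  choose L hL using hcl
  have := Fintype.ofFinite ι
  have hG2 := hG.map_fun ((ContinuousLinearMap.pi fun _ : Unit => L a).prod
    (ContinuousLinearMap.pi fun i => L (b i)))
  -- The single form is viewed as a family over `Unit`, so that the covariance criterion for two
  -- families applies.
  have hG3 : HasGaussianLaw (fun ω => (fun _ : Unit => lin η a ω, fun i => lin η (b i) ω)) P := by
    have e : (fun ω => (fun _ : Unit => lin η a ω, fun i => lin η (b i) ω)) = fun ω =>
        ((ContinuousLinearMap.pi fun _ : Unit => L a).prod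
          (ContinuousLinearMap.pi fun i => L (b i))) (fun s => η s ω) := by
      funext ω
      exact Prod.ext (funext fun _ => (hL a _).symm) (funext fun i => (hL (b i) _).symm)
    rw [e]
    exact hG2
  have key := hG3.indepFun_of_covariance_eval (X := fun _ : Unit => lin η a)
    (Y := fun i => lin η (b i)) fun _ i => by
      rw [covariance_eq_sub (hη.memLp_lin _) (hη.memLp_lin _)]
      simp [hη.integral_lin, hη.integral_lin_mul_lin, h]
  exact key.comp (φ := fun x : Unit → ℝ => x ()) (ψ := id) (measurable_pi_apply _) measurable_id

lemma measurable_lin_pi {ι : Type} (b : ι → S → ℝ) : Measurable fun ω i => lin η (b i) ω :=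
  measurable_pi_lambda _ fun i => hη.measurable_lin (b i)

/-- A form independent of all `b i` is independent of the smaller `m`, so its conditional mean is
its mean, which is zero. Only an inclusion is asked of `m`, so the forms may carry more information
than `m`; `condExp_noise` uses this freedom. -/
lemma condExp_lin_eq_zero {ι : Type} [Finite ι] (a : S → ℝ) (b : ι → S → ℝ) 
    (hm : m ≤ MeasurableSpace.comap (fun ω i => lin η (b i) ω) inferInstance)
    (h : ∀ i, ip w a (b i) = 0) : P[lin η a | m] =ᵐ[P] 0 := by
  have h2 := hm.trans (hη.measurable_lin_pi b).comap_le
  have hind : Indep (MeasurableSpace.comap (lin η a) inferInstance) m P :=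
    indep_of_indep_of_le_right ((hη.indepFun_lin a b h)) hm
  refine (condExp_indep_eq (hη.measurable_lin a).comap_le h2
    (comap_measurable (lin η a)).stronglyMeasurable hind).trans ?_
  simp only [hη.integral_lin]
  rfl

/-- The known factor `lin η b` is pulled out of the conditional expectation of the product, and the
result is integrated. -/
lemma ip_eq_zero_of_condExp {a b : S → ℝ} 
    (hm : m ≤ m0) (hb : Measurable[m] (lin η b))
    (h : P[lin η a | m] =ᵐ[P] 0) : ip w a b = 0 := by
  rw [← hη.integral_lin_mul_lin]
  have h1 := condExp_mul_of_stronglyMeasurable_right (μ := P) (f := lin η a) (g := lin η b)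
    hb.stronglyMeasurable ((hη.memLp_lin a).integrable_mul (hη.memLp_lin b)) (hη.integrable_lin a)
  rw [show ∫ ω, lin η a ω * lin η b ω ∂P = ∫ ω, (lin η a * lin η b) ω ∂P from rfl,
    ← integral_condExp hm]
  refine integral_eq_zero_of_ae (h1.trans ?_)
  filter_upwards [h] with ω hω
  simp [hω]

/-- The two hypotheses on `m` together say that it is generated by the forms `b i`. This turns every
pricing and first-order condition into covariance equations. -/
lemma condExp_lin_eq_zero_iff {ι : Type} [Finite ι] (a : S → ℝ) (b : ι → S → ℝ)
    (hm : m ≤ MeasurableSpace.comap (fun ω i => lin η (b i) ω) inferInstance)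
    (hb : ∀ i, Measurable[m] (lin η (b i))) :
    P[lin η a | m] =ᵐ[P] 0 ↔ ∀ i, ip w a (b i) = 0 :=
  ⟨fun h i => hη.ip_eq_zero_of_condExp (hm.trans (hη.measurable_lin_pi b).comap_le) (hb i) h,
    hη.condExp_lin_eq_zero a b hm⟩

/-- An affine form that vanishes almost surely has zero constant term and is orthogonal to every
linear form. -/
lemma eq_zero_of_const_add_lin {t : ℝ} {a : S → ℝ} (h : ∀ᵐ ω ∂P, t + lin η a ω = 0) :
    t = 0 ∧ ∀ b, ip w a b = 0 := by
  have h1 : ∫ ω, (t + lin η a ω) ∂P = 0 := integral_eq_zero_of_ae h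
  rw [integral_add (integrable_const _) (hη.integrable_lin a), hη.integral_lin] at h1
  have ht : t = 0 := by simpa using h1
  subst ht
  refine ⟨rfl, fun b => ?_⟩
  rw [← hη.integral_lin_mul_lin]
  refine integral_eq_zero_of_ae ?_
  filter_upwards [h] with ω hω
  have : lin η a ω = 0 := by simpa using hω
  simp [this]

end IsGaussianFamily

end GaussianForms

/-! ### Maximization of quadratic payoffs -/

section ArgMax

variable {Ω : Type*} {m : MeasurableSpace Ω} [m0 : MeasurableSpace Ω] {P : Measure Ω} [IsProbabilityMeasure P]

/-- The deviation `δ` is known given `m` and comes out of the conditional expectation. Almost sure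
measurability is enough; this matters for IT without randomization, whose order is a function of `v`
only up to a null event. -/
lemma condExp_quadratic (hm : m ≤ m0) {W δ R : Ω → ℝ} (κ : ℝ)
    (hW : MemLp W 2 P) (hR : Integrable R P) (hδ : MemLp δ 2 P) (hδm : AEStronglyMeasurable[m] δ P)
    {π : Ω → ℝ} (hπ : π =ᵐ[P] fun ω => R ω + δ ω * (W ω - κ * δ ω)) :
    P[π | m] =ᵐ[P] fun ω => (P[R | m]) ω + (δ ω * (P[W | m]) ω - κ * δ ω ^ 2) := by
  have hδW : Integrable (δ * W) P := hδ.integrable_mul hW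
  have hδδ : Integrable (δ * δ) P := hδ.integrable_mul hδ
  have e1 : π =ᵐ[P] R + (δ * W - κ • (δ * δ)) := by
    filter_upwards [hπ] with ω h
    simp only [h, Pi.add_apply, Pi.sub_apply, Pi.mul_apply, Pi.smul_apply, smul_eq_mul]
    ring
  have e2 := condExp_add hR (hδW.sub (hδδ.smul κ)) m
  have e3 := condExp_sub hδW (hδδ.smul κ) m
  have e4 := condExp_smul (μ := P) κ (δ * δ) m
  have e5 := condExp_mul_of_aestronglyMeasurable_left hδm hδW (hW.integrable one_le_two)
  have e6 := condExp_of_aestronglyMeasurable' hm (hδm.mul hδm) hδδ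
  filter_upwards [condExp_congr_ae (m := m) e1, e2, e3, e4, e5, e6] with ω h1 h2 h3 h4 h5 h6
  simp only [h1, h2, h3, h4, h5, h6, Pi.add_apply, Pi.sub_apply, Pi.mul_apply, Pi.smul_apply,
    smul_eq_mul]
  ring

/-- A strategy maximizes a payoff that is quadratic in the order if and only if the payoff is
strictly concave and the first-order condition holds. -/
theorem isArgMax_iff (hm : m ≤ m0) {D : Type} {adm : D → Prop}
    {payoff order : D → Ω → ℝ} {d : D} {κ : ℝ} {W : Ω → ℝ}
    (hd : adm d) (hW : MemLp W 2 P) (hR : Integrable (payoff d) P)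
    (hδ : ∀ d', adm d' → MemLp (fun ω => order d' ω - order d ω) 2 P)
    (hδm : ∀ d', adm d' → AEStronglyMeasurable[m] (fun ω => order d' ω - order d ω) P)
    (hpay : ∀ d', adm d' → payoff d' =ᵐ[P] fun ω =>
      payoff d ω + (order d' ω - order d ω) * (W ω - κ * (order d' ω - order d ω)))
    (hshift : ∀ t : ℝ, ∃ d', adm d' ∧ ∀ ω, order d' ω = order d ω + t) :
    IsArgMax P m adm payoff order d ↔ 0 < κ ∧ P[W | m] =ᵐ[P] 0 := by
  have key : ∀ d', adm d' → P[payoff d' | m] =ᵐ[P] fun ω => (P[payoff d | m]) ω +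
      ((order d' ω - order d ω) * (P[W | m]) ω - κ * (order d' ω - order d ω) ^ 2) :=
    fun d' hd' => condExp_quadratic hm κ hW hR (hδ d' hd') (hδm d' hd') (hpay d' hd')
  constructor
  · rintro ⟨-, h⟩
    -- A constant shift never prescribes the same order, so the uniqueness of the maximizer makes
    -- the loss strict.
    have hall : ∀ t : ℝ, t ≠ 0 → ∀ᵐ ω ∂P, t * (P[W | m]) ω - κ * t ^ 2 < 0 := by
      intro t ht
      obtain ⟨d', hd', ho⟩ := hshift t
      filter_upwards [h d' hd', key d' hd'] with ω h1 h2
      simp only [ho, add_sub_cancel_left] at h1 h2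
      rcases lt_or_eq_of_le h1.1 with h3 | h3
      · linarith
      · exact absurd (h1.2 h3) (by simpa using ht)
    -- Adding the inequalities for the shifts `1` and `-1` cancels the linear term.
    have hκ : 0 < κ := by
      obtain ⟨ω, h1, h2⟩ := ((hall 1 one_ne_zero).and (hall (-1) (by norm_num))).exists
      nlinarith
    refine ⟨hκ, ?_⟩
    -- Countably many shifts `±1/(n+1)` give, outside one null set, `|E(W)| < κ/(n+1)` for every
    -- `n`, hence `E(W) = 0`.
    have h3 : ∀ᵐ ω ∂P, ∀ n : ℕ, (1 / ((n : ℝ) + 1)) * (P[W | m]) ω - κ * (1 / ((n : ℝ) + 1)) ^ 2 < 0 ∧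
        (-(1 / ((n : ℝ) + 1))) * (P[W | m]) ω - κ * (-(1 / ((n : ℝ) + 1))) ^ 2 < 0 := by
      rw [ae_all_iff]
      intro n
      have : (1 / ((n : ℝ) + 1)) ≠ 0 := by positivity
      exact (hall _ this).and (hall _ (neg_ne_zero.mpr this))
    filter_upwards [h3] with ω hω
    by_contra hne
    have hpos : 0 < |(P[W | m]) ω| := abs_pos.mpr hne
    obtain ⟨n, hn⟩ := exists_nat_one_div_lt (div_pos hpos hκ)
    rw [lt_div_iff₀ hκ] at hn
    have hn0 : 0 < 1 / ((n : ℝ) + 1) := by positivity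
    obtain ⟨h4, h5⟩ := hω n
    rcases abs_cases ((P[W | m]) ω) with ⟨h6, -⟩ | ⟨h6, -⟩
    · rw [h6] at hn; nlinarith
    · rw [h6] at hn; nlinarith
  · rintro ⟨hκ, hW0⟩
    refine ⟨hd, fun d' hd' => ?_⟩
    filter_upwards [key d' hd', hW0] with ω h1 h2
    simp only [h2, Pi.zero_apply, mul_zero, zero_sub] at h1
    refine ⟨by rw [h1]; nlinarith [mul_nonneg hκ.le (sq_nonneg (order d' ω - order d ω))],
      fun h3 => ?_⟩
    have h4 : κ * (order d' ω - order d ω) ^ 2 = 0 := by linarith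
    have h5 := (mul_eq_zero.mp h4).resolve_left hκ.ne'
    linarith [pow_eq_zero_iff (two_ne_zero) |>.mp h5]

end ArgMax


/-! ### Dimensionless form of the linear model -/

/-- The shocks that are not signal errors are listed by `Fin 5`. -/
def shockEquiv (H : Type) : Fin 5 ⊕ H ≃ Shock H where
  toFun := Sum.elim ![.v, .z, .u1, .up, .u2] .ε
  invFun := fun s => match s with
    | .v => .inl 0
    | .z => .inl 1
    | .u1 => .inl 2
    | .up => .inl 3
    | .u2 => .inl 4
    | .ε j => .inr j
  left_inv := by
    rintro (i | j)
    · fin_cases i <;> rfl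
    · rfl
  right_inv := by rintro (_ | _) <;> rfl

instance {H : Type} [Fintype H] : Fintype (Shock H) := Fintype.ofEquiv _ (shockEquiv H)

lemma sum_shock {H : Type} [Fintype H] (f : Shock H → ℝ) :
    ∑ s, f s = f .v + f .z + f .u1 + f .up + f .u2 + ∑ j, f (.ε j) := by
  rw [← Equiv.sum_comp (shockEquiv H) f, Fintype.sum_sum_type]
  simp [Fin.sum_univ_five, shockEquiv]

/-- The family of coefficients with the given values. -/
def coef {H : Type} (v z u1 up u2 : ℝ) (e : H → ℝ) : Shock H → ℝ
  | .v => v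
  | .z => z
  | .u1 => u1
  | .up => up
  | .u2 => u2
  | .ε j => e j

/-- Shocks in units of `σv` (the asset value) and `σ1` (all others), with mean zero. -/
noncomputable def nrm {Ω : Type*} {H : Type} (M : Market) (ξ : Shock H → Ω → ℝ) :
    Shock H → Ω → ℝ
  | .v, ω => (ξ .v ω - M.p0) / M.σv
  | .z, ω => ξ .z ω / M.σ1
  | .u1, ω => ξ .u1 ω / M.σ1
  | .up, ω => ξ .up ω / M.σ1
  | .u2, ω => ξ .u2 ω / M.σ1
  | .ε j, ω => ξ (.ε j) ω / M.σ1

/-- Dimensionless parameters and coefficients. -/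
structure Dimless where
  θp : ℝ
  θ2 : ℝ
  θε : ℝ
  θz : ℝ
  Λ1 : ℝ
  Λp : ℝ
  Λ21 : ℝ
  Λ22 : ℝ
  A1 : ℝ
  A21 : ℝ
  α22 : ℝ
  β11 : ℝ
  β21 : ℝ
  β22 : ℝ
  β23 : ℝ
  β12 : ℝ

/-- The dimensionless parameters of the linear strategies `c` in the market `M`. -/
noncomputable def dimless (M : Market) (c : Coeffs) : Dimless where
  θp := M.σp ^ 2 / M.σ1 ^ 2
  θ2 := M.σ2 ^ 2 / M.σ1 ^ 2
  θε := M.σε ^ 2 / M.σ1 ^ 2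
  θz := c.σz ^ 2 / M.σ1 ^ 2
  Λ1 := c.lam1 / (M.σv / M.σ1)
  Λp := c.lamp / (M.σv / M.σ1)
  Λ21 := c.lam21 / (M.σv / M.σ1)
  Λ22 := c.lam22 / (M.σv / M.σ1)
  A1 := c.α1 / (M.σ1 / M.σv)
  A21 := c.α21 / (M.σ1 / M.σv)
  α22 := c.α22
  β11 := c.β11
  β21 := c.β21
  β22 := c.β22
  β23 := c.β23
  β12 := c.β12

namespace Dimless

variable (q : Dimless) {J₁ J₂ : ℕ}

/-- Variances of the normalized shocks. -/
def var : Shock (Fin J₁ ⊕ Fin J₂) → ℝ := coef 1 q.θz 1 q.θp q.θ2 fun _ => q.θε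

/-- Variance of the normalized first order flow. -/
def S : ℝ := q.A1 ^ 2 + q.θz + 1

/-- The normalized first order flow. -/
def flow1 : Shock (Fin J₁ ⊕ Fin J₂) → ℝ := coef q.A1 1 1 0 0 0

/-- `a v̂ + b î + c u₁₊ + d u₂ + ∑ eⱼ εⱼ`, where `v̂`, `î` are the residuals of the asset value and of
IT's first order after observation of the first order flow. -/
noncomputable def res (a b c d : ℝ) (e : Fin J₁ ⊕ Fin J₂ → ℝ) : Shock (Fin J₁ ⊕ Fin J₂) → ℝ :=
  coef (a + b * q.A1 - (a * q.A1 + b * (q.S - 1)) / q.S * q.A1)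
    (b - (a * q.A1 + b * (q.S - 1)) / q.S) (-((a * q.A1 + b * (q.S - 1)) / q.S)) c d e

lemma ip_var (a b : Shock (Fin J₁ ⊕ Fin J₂) → ℝ) :
    ip q.var a b = a .v * b .v + q.θz * (a .z * b .z) + a .u1 * b .u1 + q.θp * (a .up * b .up) +
      q.θ2 * (a .u2 * b .u2) + q.θε * ∑ j, a (.ε j) * b (.ε j) := by
  simp only [ip, sum_shock, var, coef, Finset.mul_sum, one_mul]

/-- The coefficient subtracted in `res` is the regression coefficient on the first order flow, whose
variance is `S`. -/
lemma ip_res_flow1 (hS : q.S ≠ 0) (a b c d : ℝ) (e : Fin J₁ ⊕ Fin J₂ → ℝ) :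
    ip q.var (q.res a b c d e) q.flow1 = 0 := by
  simp only [ip_var, res, flow1, coef, Pi.zero_apply, mul_zero, Finset.sum_const_zero]
  field_simp
  simp only [S]
  ring

/-- Covariance table of the residuals given the first order flow: `1 - A1²/S` for the value,
`(S-1)/S` for IT's first order, `A1/S` between them. The remaining shocks are independent of that
flow and keep their variances. -/
lemma ip_res (hS : q.S ≠ 0) (a b c d a' b' c' d' : ℝ) (e e' : Fin J₁ ⊕ Fin J₂ → ℝ) :
    ip q.var (q.res a b c d e) (q.res a' b' c' d' e') =
      a * a' * (1 - q.A1 ^ 2 / q.S) + (a * b' + a' * b) * (q.A1 / q.S) +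
        b * b' * ((q.S - 1) / q.S) + q.θp * (c * c') + q.θ2 * (d * d') +
        q.θε * ∑ j, e j * e' j := by
  have hz : q.θz = q.S - 1 - q.A1 ^ 2 := by simp only [S]; ring
  simp only [ip_var, res, coef]
  rw [hz]
  field_simp
  ring

/-- Slope of the first orders of the HFTs in their signals. -/
def b1 : Fin J₁ ⊕ Fin J₂ → ℝ := Sum.elim (fun _ => q.β11) fun _ => q.β12

/-- Slope of the second orders of the HFTs in the order flow at time `1₊`. -/
def slope : Fin J₁ ⊕ Fin J₂ → ℝ := Sum.elim (fun _ => q.β22) fun _ => 0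

/-- Slope of the second orders of the HFTs in their signals, given the order flow. -/
def b2 : Fin J₁ ⊕ Fin J₂ → ℝ :=
  Sum.elim (fun _ => q.β21 + (q.β23 - q.β22) * q.β11) fun _ => -q.β12

/-- Residual of the asset value. -/
noncomputable def value : Shock (Fin J₁ ⊕ Fin J₂) → ℝ := q.res 1 0 0 0 0

/-- Residual of IT's first order. -/
noncomputable def order1 : Shock (Fin J₁ ⊕ Fin J₂) → ℝ := q.res 0 1 0 0 0

/-- Residual of the signal of HFT `j`. -/
noncomputable def sig (j : Fin J₁ ⊕ Fin J₂) : Shock (Fin J₁ ⊕ Fin J₂) → ℝ :=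
  q.res 0 1 0 0 (Pi.single j 1)

/-- Sum of the slopes of the first orders of the HFTs. -/
def B (J₁ J₂ : ℕ) : ℝ := q.β11 * J₁ + q.β12 * J₂

/-- The order flow at time `1₊`. -/
noncomputable def flowp : Shock (Fin J₁ ⊕ Fin J₂) → ℝ := q.res 0 (q.B J₁ J₂) 1 0 q.b1

/-- The second order of HFT `j`. -/
noncomputable def ord2 (j : Fin J₁ ⊕ Fin J₂) : Shock (Fin J₁ ⊕ Fin J₂) → ℝ :=
  q.b2 j • q.sig j + q.slope j • q.flowp

/-- The order flow at time `2`. -/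
noncomputable def flow2 : Shock (Fin J₁ ⊕ Fin J₂) → ℝ :=
  q.res q.A21 (q.α22 + J₁ * q.β22 * q.B J₁ J₂ + J₁ * (q.β21 + (q.β23 - q.β22) * q.β11) -
    J₂ * q.β12) (J₁ * q.β22) 1 fun j => J₁ * q.β22 * q.b1 j + q.b2 j

/-- The profit per share at time `2`. -/
noncomputable def gain2 : Shock (Fin J₁ ⊕ Fin J₂) → ℝ :=
  q.value - q.Λ21 • q.flowp - q.Λ22 • q.flow2

/-- The profit per share at time `1₊`. -/
noncomputable def gainp : Shock (Fin J₁ ⊕ Fin J₂) → ℝ := q.value - q.Λp • q.flowp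

variable {Ω : Type*} (η : Shock (Fin J₁ ⊕ Fin J₂) → Ω → ℝ) (ω : Ω)

lemma lin_shock (a : Shock (Fin J₁ ⊕ Fin J₂) → ℝ) :
    lin η a ω = a .v * η .v ω + a .z * η .z ω + a .u1 * η .u1 ω + a .up * η .up ω +
      a .u2 * η .u2 ω + ∑ j, a (.ε j) * η (.ε j) ω := by
  simp [lin, sum_shock]

lemma lin_flow1 : lin η q.flow1 ω = q.A1 * η .v ω + η .z ω + η .u1 ω := by
  simp [lin_shock, flow1, coef]

lemma lin_res (a b c d : ℝ) (e : Fin J₁ ⊕ Fin J₂ → ℝ) :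
    lin η (q.res a b c d e) ω = a * (η .v ω - q.A1 / q.S * lin η q.flow1 ω) +
      b * (q.A1 * η .v ω + η .z ω - (q.S - 1) / q.S * lin η q.flow1 ω) + c * η .up ω +
      d * η .u2 ω + ∑ j, e j * η (.ε j) ω := by
  rw [lin_flow1, lin_shock]
  simp only [res, coef]
  ring

lemma lin_value : lin η q.value ω = η .v ω - q.A1 / q.S * lin η q.flow1 ω := by
  simp [value, lin_res]

lemma lin_order1 :
    lin η q.order1 ω = q.A1 * η .v ω + η .z ω - (q.S - 1) / q.S * lin η q.flow1 ω := by
  simp [order1, lin_res]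

lemma lin_sig (j : Fin J₁ ⊕ Fin J₂) : lin η (q.sig j) ω = lin η q.order1 ω + η (.ε j) ω := by
  rw [lin_order1]
  simp [sig, lin_res, Pi.single_apply]

lemma sum_b1 : ∑ j : Fin J₁ ⊕ Fin J₂, q.b1 j = q.B J₁ J₂ := by
  simp [b1, B, mul_comm]

lemma sum_slope : ∑ j : Fin J₁ ⊕ Fin J₂, q.slope j = J₁ * q.β22 := by
  simp [slope]

lemma lin_flowp :
    lin η q.flowp ω = ∑ j : Fin J₁ ⊕ Fin J₂, q.b1 j * lin η (q.sig j) ω + η .up ω := by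
  simp only [lin_sig, mul_add, Finset.sum_add_distrib, ← Finset.sum_mul, sum_b1]
  simp only [flowp, lin_res, lin_order1]
  ring

lemma lin_ord2 (j : Fin J₁ ⊕ Fin J₂) :
    lin η (q.ord2 j) ω = q.b2 j * lin η (q.sig j) ω + q.slope j * lin η q.flowp ω := by
  simp [ord2, lin_add, lin_smul]

/-- Justifies the closed form chosen for `flow2`: each second order is a slope in the signal plus a
slope in `flowp`, and summing over the HFTs gives the total slope `J₁ * β22` in `flowp`. -/
lemma lin_flow2 :
    lin η q.flow2 ω = q.A21 * lin η q.value ω + q.α22 * lin η q.order1 ω +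
      ∑ j : Fin J₁ ⊕ Fin J₂, lin η (q.ord2 j) ω + η .u2 ω := by
  have hb2 : ∑ j : Fin J₁ ⊕ Fin J₂, q.b2 j =
      J₁ * (q.β21 + (q.β23 - q.β22) * q.β11) - J₂ * q.β12 := by
    simp [b2]
    ring
  simp only [lin_ord2, Finset.sum_add_distrib, ← Finset.sum_mul, sum_slope]
  simp only [lin_sig, mul_add, Finset.sum_add_distrib, ← Finset.sum_mul, hb2]
  simp only [flow2, flowp, lin_res, lin_order1, lin_value, add_mul, Finset.sum_add_distrib, mul_assoc,
    ← Finset.mul_sum]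
  ring

end Dimless

/-! ### Equilibrium quantities as linear forms -/

section Outcome

variable {Ω : Type*} {J₁ J₂ : ℕ} (M : Market) (c : Coeffs)
  (ξ : Shock (Fin J₁ ⊕ Fin J₂) → Ω → ℝ) (ω : Ω)

/-- The linear forms in the normalized shocks. -/
noncomputable abbrev nl (a : Shock (Fin J₁ ⊕ Fin J₂) → ℝ) (ω : Ω) : ℝ := lin (nrm M ξ) a ω

variable {M}

lemma S_pos (q : Dimless) (hz : 0 ≤ q.θz) : 0 < q.S := by
  unfold Dimless.S; positivity

lemma θz_nonneg : 0 ≤ (dimless M c).θz := by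
  simp only [dimless]; positivity

variable (hM : M.Valid)
include hM

lemma α1_eq : c.α1 = (dimless M c).A1 * M.σ1 / M.σv := by
  have := hM.σv_pos.ne'; have := hM.σ1_pos.ne'
  simp only [dimless]; field_simp

lemma α21_eq : c.α21 = (dimless M c).A21 * M.σ1 / M.σv := by
  have := hM.σv_pos.ne'; have := hM.σ1_pos.ne'
  simp only [dimless]; field_simp

lemma σz_sq_eq : c.σz ^ 2 = (dimless M c).θz * M.σ1 ^ 2 := by
  have := hM.σ1_pos.ne'
  simp only [dimless]; field_simp

lemma lam1_eq : c.lam1 = (dimless M c).Λ1 * M.σv / M.σ1 := by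
  have := hM.σv_pos.ne'; have := hM.σ1_pos.ne'
  simp only [dimless]; field_simp

lemma lamp_eq : c.lamp = (dimless M c).Λp * M.σv / M.σ1 := by
  have := hM.σv_pos.ne'; have := hM.σ1_pos.ne'
  simp only [dimless]; field_simp

lemma lam21_eq : c.lam21 = (dimless M c).Λ21 * M.σv / M.σ1 := by
  have := hM.σv_pos.ne'; have := hM.σ1_pos.ne'
  simp only [dimless]; field_simp

lemma lam22_eq : c.lam22 = (dimless M c).Λ22 * M.σv / M.σ1 := by
  have := hM.σv_pos.ne'; have := hM.σ1_pos.ne'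
  simp only [dimless]; field_simp

lemma meanI_eq (y : ℝ) : meanI M c y = ((dimless M c).S - 1) / (dimless M c).S * y := by
  have h1 := hM.σv_pos.ne'; have h2 := hM.σ1_pos.ne'
  have hS := (S_pos (dimless M c) (θz_nonneg c)).ne'
  have e : c.α1 ^ 2 * M.σv ^ 2 + c.σz ^ 2 = ((dimless M c).S - 1) * M.σ1 ^ 2 := by
    rw [α1_eq c hM, σz_sq_eq c hM, Dimless.S]; field_simp; ring
  have e' : c.α1 ^ 2 * M.σv ^ 2 + c.σz ^ 2 + M.σ1 ^ 2 = (dimless M c).S * M.σ1 ^ 2 := by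
    rw [e]; ring
  rw [meanI, e', e]
  field_simp

lemma meanV_eq (y : ℝ) :
    meanV M c y = M.p0 + M.σv * ((dimless M c).A1 / (dimless M c).S * (y / M.σ1)) := by
  have h1 := hM.σv_pos.ne'; have h2 := hM.σ1_pos.ne'
  have hS := (S_pos (dimless M c) (θz_nonneg c)).ne'
  have e' : c.α1 ^ 2 * M.σv ^ 2 + c.σz ^ 2 + M.σ1 ^ 2 = (dimless M c).S * M.σ1 ^ 2 := by
    rw [α1_eq c hM, σz_sq_eq c hM, Dimless.S]; field_simp
  rw [meanV, e', α1_eq c hM]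
  field_simp

lemma v_eq : ξ .v ω = M.p0 + M.σv * nrm M ξ .v ω := by
  have := hM.σv_pos.ne'
  simp only [nrm]; field_simp; ring

lemma shock_eq : ξ .z ω = M.σ1 * nrm M ξ .z ω ∧ ξ .u1 ω = M.σ1 * nrm M ξ .u1 ω ∧
    ξ .up ω = M.σ1 * nrm M ξ .up ω ∧ ξ .u2 ω = M.σ1 * nrm M ξ .u2 ω ∧
    ∀ j, ξ (.ε j) ω = M.σ1 * nrm M ξ (.ε j) ω := by
  have := hM.σ1_pos.ne'
  refine ⟨?_, ?_, ?_, ?_, fun j => ?_⟩ <;> simp only [nrm] <;> field_simp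

local notation "𝓛" => linearProfile M c J₁ J₂
local notation "𝓺" => dimless M c

lemma I1_eq : I1 𝓛 ξ ω = M.σ1 * ((𝓺).A1 * nrm M ξ .v ω + nrm M ξ .z ω) := by
  have h1 := hM.σv_pos.ne'; have h2 := hM.σ1_pos.ne'
  simp only [I1, linearProfile]
  rw [v_eq ξ ω hM, (shock_eq ξ ω hM).1, α1_eq c hM]
  field_simp
  ring

lemma Y1_eq : Y1 𝓛 ξ ω = M.σ1 * nl M ξ (𝓺).flow1 ω := by
  rw [Y1, I1_eq c ξ ω hM, (shock_eq ξ ω hM).2.1, nl, Dimless.lin_flow1]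
  ring

lemma I1_sub_eq : I1 𝓛 ξ ω - meanI M c (Y1 𝓛 ξ ω) = M.σ1 * nl M ξ (𝓺).order1 ω := by
  rw [meanI_eq c hM, Y1_eq c ξ ω hM, I1_eq c ξ ω hM, nl, nl, Dimless.lin_order1]
  ring

lemma v_sub_eq : ξ .v ω - meanV M c (Y1 𝓛 ξ ω) = M.σv * nl M ξ (𝓺).value ω := by
  have h2 := hM.σ1_pos.ne'
  rw [meanV_eq c hM, Y1_eq c ξ ω hM, v_eq ξ ω hM, nl, nl, Dimless.lin_value]
  field_simp
  ring

lemma Sig_sub_eq (j) : Sig 𝓛 ξ j ω - meanI M c (Y1 𝓛 ξ ω) = M.σ1 * nl M ξ ((𝓺).sig j) ω := by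
  rw [Sig, nl, Dimless.lin_sig, mul_add, ← I1_sub_eq c ξ ω hM, (shock_eq ξ ω hM).2.2.2.2]
  ring

lemma X1_eq (j) : X1 𝓛 ξ j ω = M.σ1 * ((𝓺).b1 j * nl M ξ ((𝓺).sig j) ω) := by
  have : X1 𝓛 ξ j ω = (𝓺).b1 j * (Sig 𝓛 ξ j ω - meanI M c (Y1 𝓛 ξ ω)) := by
    rcases j with j | j <;> rfl
  rw [this, Sig_sub_eq c ξ ω hM]
  ring

lemma Yp_eq : Yp 𝓛 ξ ω = M.σ1 * nl M ξ (𝓺).flowp ω := by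
  simp only [Yp, X1_eq c ξ ω hM, nl, Dimless.lin_flowp, (shock_eq ξ ω hM).2.2.1, ← Finset.mul_sum]
  ring

lemma X2_eq (j) : X2 𝓛 ξ j ω = M.σ1 * nl M ξ ((𝓺).ord2 j) ω := by
  rcases j with j | j
  · have : X2 𝓛 ξ (.inl j) ω = c.β21 * (Sig 𝓛 ξ (.inl j) ω - meanI M c (Y1 𝓛 ξ ω)) +
      c.β22 * (Yp 𝓛 ξ ω - X1 𝓛 ξ (.inl j) ω) + c.β23 * X1 𝓛 ξ (.inl j) ω := rfl
    rw [this, Sig_sub_eq c ξ ω hM, Yp_eq c ξ ω hM, X1_eq c ξ ω hM]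
    simp only [nl, Dimless.lin_ord2, Dimless.b1, Dimless.b2, Dimless.slope, Sum.elim_inl, dimless]
    ring
  · have : X2 𝓛 ξ (.inr j) ω = - X1 𝓛 ξ (.inr j) ω := rfl
    rw [this, X1_eq c ξ ω hM]
    simp only [nl, Dimless.lin_ord2, Dimless.b1, Dimless.b2, Dimless.slope, Sum.elim_inr, dimless]
    ring

lemma I2_eq : I2 𝓛 ξ ω =
    M.σ1 * ((𝓺).A21 * nl M ξ (𝓺).value ω + (𝓺).α22 * nl M ξ (𝓺).order1 ω) := by
  have h1 := hM.σv_pos.ne'; have h2 := hM.σ1_pos.ne'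
  have : I2 𝓛 ξ ω = c.α21 * (ξ .v ω - meanV M c (Y1 𝓛 ξ ω)) +
    c.α22 * (I1 𝓛 ξ ω - meanI M c (Y1 𝓛 ξ ω)) := rfl
  rw [this, v_sub_eq c ξ ω hM, I1_sub_eq c ξ ω hM, α21_eq c hM, mul_add]
  congr 1
  · field_simp
  · simp only [dimless]; ring

lemma Y2_eq : Y2 𝓛 ξ ω = M.σ1 * nl M ξ (𝓺).flow2 ω := by
  simp only [Y2, I2_eq c ξ ω hM, X2_eq c ξ ω hM, nl, Dimless.lin_flow2, (shock_eq ξ ω hM).2.2.2.1,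
    ← Finset.mul_sum]
  ring

lemma Price1_eq : Price1 𝓛 ξ ω = M.p0 + M.σv * ((𝓺).Λ1 * nl M ξ (𝓺).flow1 ω) := by
  have h2 := hM.σ1_pos.ne'
  have : Price1 𝓛 ξ ω = M.p0 + c.lam1 * Y1 𝓛 ξ ω := rfl
  rw [this, Y1_eq c ξ ω hM, lam1_eq c hM]
  field_simp

lemma Pricep_eq : Pricep 𝓛 ξ ω =
    M.p0 + M.σv * ((𝓺).Λ1 * nl M ξ (𝓺).flow1 ω + (𝓺).Λp * nl M ξ (𝓺).flowp ω) := by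
  have h2 := hM.σ1_pos.ne'
  have : Pricep 𝓛 ξ ω = M.p0 + c.lam1 * Y1 𝓛 ξ ω + c.lamp * Yp 𝓛 ξ ω := rfl
  rw [this, Y1_eq c ξ ω hM, Yp_eq c ξ ω hM, lam1_eq c hM, lamp_eq c hM]
  field_simp
  ring

lemma Price2_eq : Price2 𝓛 ξ ω = M.p0 + M.σv * ((𝓺).Λ1 * nl M ξ (𝓺).flow1 ω +
    (𝓺).Λ21 * nl M ξ (𝓺).flowp ω + (𝓺).Λ22 * nl M ξ (𝓺).flow2 ω) := by
  have h2 := hM.σ1_pos.ne'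
  have : Price2 𝓛 ξ ω = M.p0 + c.lam1 * Y1 𝓛 ξ ω + c.lam21 * Yp 𝓛 ξ ω + c.lam22 * Y2 𝓛 ξ ω := rfl
  rw [this, Y1_eq c ξ ω hM, Yp_eq c ξ ω hM, Y2_eq c ξ ω hM, lam1_eq c hM, lam21_eq c hM,
    lam22_eq c hM]
  field_simp
  ring

end Outcome

/-- The normalized shocks are independent centred Gaussian variables. -/
lemma IsShockModel.isGaussianFamily {Ω : Type*} [MeasurableSpace Ω] {P : Measure Ω}
    [IsProbabilityMeasure P] {J₁ J₂ : ℕ} {M : Market} (hM : M.Valid) {c : Coeffs}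
    {ξ : Shock (Fin J₁ ⊕ Fin J₂) → Ω → ℝ} (hξ : IsShockModel M c.σz P ξ) :
    IsGaussianFamily P (nrm M ξ) (dimless M c).var := by
  have h1 := hM.σv_pos.ne'; have h2 := hM.σ1_pos.ne'
  -- Each normalized shock is an affine function of a single primitive shock, so independence is
  -- inherited.
  obtain ⟨φ, hφ, hφm⟩ : ∃ φ : Shock (Fin J₁ ⊕ Fin J₂) → ℝ → ℝ,
      (∀ s, nrm M ξ s = φ s ∘ ξ s) ∧ ∀ s, Measurable (φ s) := by
    refine ⟨fun s x => (x - coef M.p0 0 0 0 0 0 s) /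
      coef M.σv M.σ1 M.σ1 M.σ1 M.σ1 (fun _ => M.σ1) s, fun s => ?_, fun s => by fun_prop⟩
    funext ω
    rcases s with _ | _ | _ | _ | _ | _ <;> simp [nrm, coef]
  have hlaw : ∀ s, P.map (nrm M ξ s) = gaussianReal 0 ((dimless M c).var s).toNNReal := by
    intro s
    have key : ∀ (μ σ τ : ℝ), 0 < τ →
        (gaussianReal μ (σ ^ 2).toNNReal).map (fun x => (x - μ) / τ) =
          gaussianReal 0 (σ ^ 2 / τ ^ 2).toNNReal := by
      intro μ σ τ hτ
      rw [show (fun x : ℝ => (x - μ) / τ) = (fun x => x / τ) ∘ fun x => x - μ from rfl,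
        ← Measure.map_map (by fun_prop) (by fun_prop), gaussianReal_map_sub_const,
        gaussianReal_map_div_const, sub_self, zero_div]
      congr 1
      ext
      simp [Real.coe_toNNReal _ (sq_nonneg _),
        Real.coe_toNNReal _ (div_nonneg (sq_nonneg σ) (sq_nonneg τ))]
    have key0 : ∀ (σ τ : ℝ), 0 < τ →
        (gaussianReal 0 (σ ^ 2).toNNReal).map (fun x => x / τ) =
          gaussianReal 0 (σ ^ 2 / τ ^ 2).toNNReal := by
      intro σ τ hτ
      simpa using key 0 σ τ hτ
    have hm := hξ.measurable s
    have hl := hξ.law s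
    rcases s with _ | _ | _ | _ | _ | j
    · have := key M.p0 M.σv M.σv hM.σv_pos
      rw [div_self (pow_ne_zero 2 h1)] at this
      rw [show nrm M ξ .v = (fun x => (x - M.p0) / M.σv) ∘ ξ .v from rfl,
        ← Measure.map_map (by fun_prop) hm, hl]
      exact this
    · rw [show nrm M ξ .z = (fun x => x / M.σ1) ∘ ξ .z from rfl,
        ← Measure.map_map (by fun_prop) hm, hl]
      exact key0 c.σz M.σ1 hM.σ1_pos
    · have := key0 M.σ1 M.σ1 hM.σ1_pos
      rw [div_self (pow_ne_zero 2 h2)] at this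
      rw [show nrm M ξ .u1 = (fun x => x / M.σ1) ∘ ξ .u1 from rfl,
        ← Measure.map_map (by fun_prop) hm, hl]
      exact this
    · rw [show nrm M ξ .up = (fun x => x / M.σ1) ∘ ξ .up from rfl,
        ← Measure.map_map (by fun_prop) hm, hl]
      exact key0 M.σp M.σ1 hM.σ1_pos
    · rw [show nrm M ξ .u2 = (fun x => x / M.σ1) ∘ ξ .u2 from rfl,
        ← Measure.map_map (by fun_prop) hm, hl]
      exact key0 M.σ2 M.σ1 hM.σ1_pos
    · rw [show nrm M ξ (.ε j) = (fun x => x / M.σ1) ∘ ξ (.ε j) from rfl,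
        ← Measure.map_map (by fun_prop) hm, hl]
      exact key0 M.σε M.σ1 hM.σ1_pos
  have hmeas : ∀ s, Measurable (nrm M ξ s) := fun s => by
    rw [hφ]; exact (hφm s).comp (hξ.measurable s)
  have hgauss : ∀ s, HasGaussianLaw (nrm M ξ s) P := fun s => ⟨by rw [hlaw]; infer_instance⟩
  have hmean : ∀ s, ∫ ω, nrm M ξ s ω ∂P = 0 := fun s => by
    have := integral_map (μ := P) (hmeas s).aemeasurable (f := fun x : ℝ => x) (by fun_prop)
    rw [← this, hlaw, integral_id_gaussianReal]
  refine ⟨hmeas, hgauss, hmean, fun s => ?_, ?_⟩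
  · have hv : Var[nrm M ξ s; P] = ((dimless M c).var s).toNNReal := by
      have := variance_map (μ := P) (X := fun x : ℝ => x) (Y := nrm M ξ s) (by fun_prop) (hmeas s).aemeasurable
      rw [hlaw, variance_fun_id_gaussianReal] at this
      exact this.symm
    rw [variance_eq_sub (hgauss s).memLp_two, hmean] at hv
    have hnn : 0 ≤ (dimless M c).var s := by
      rcases s with _ | _ | _ | _ | _ | _ <;> simp only [Dimless.var, coef, dimless] <;> positivity
    rw [Real.coe_toNNReal _ hnn] at hv
    rw [← hv]
    simp [pow_two]
  · have : nrm M ξ = fun s => φ s ∘ ξ s := funext hφ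
    rw [this]
    exact hξ.indep.comp φ hφm


/-! ### Conditional expectations up to a known summand. -/

section CondExp

variable {Ω : Type*} {m : MeasurableSpace Ω} [m0 : MeasurableSpace Ω] {P : Measure Ω}
  [IsProbabilityMeasure P]

lemma condExp_add_const_mul (hm : m ≤ m0) {X g Z : Ω → ℝ} (τ : ℝ) (hg : AEStronglyMeasurable[m] g P)
    (hgi : Integrable g P) (hZ : Integrable Z P) (h : ∀ ω, X ω = g ω + τ * Z ω) :
    P[X | m] =ᵐ[P] fun ω => g ω + τ * (P[Z | m]) ω := by
  have e : X = g + τ • Z := funext h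
  rw [e]
  filter_upwards [condExp_add hgi (hZ.smul τ) m, condExp_smul τ Z m (μ := P),
    condExp_of_aestronglyMeasurable' hm hg hgi] with ω h1 h2 h3
  rw [h1, Pi.add_apply, h2, h3]
  simp

/-- With `X` the asset value and `g` a price known to the dealers, efficiency becomes a vanishing
conditional mean of the normalized pricing error `Z`. -/
lemma condExp_eq_iff (hm : m ≤ m0) {X g Z : Ω → ℝ} {τ : ℝ} (hτ : τ ≠ 0)
    (hg : Measurable[m] g) (hgi : Integrable g P) (hZ : Integrable Z P)
    (h : ∀ ω, X ω - g ω = τ * Z ω) : P[X | m] =ᵐ[P] g ↔ P[Z | m] =ᵐ[P] 0 := by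
  have key := condExp_add_const_mul (P := P) (X := X) hm τ hg.stronglyMeasurable.aestronglyMeasurable
    hgi hZ fun ω => by linarith [h ω]
  constructor
  · intro h1
    filter_upwards [h1, key] with ω h2 h3
    have : τ * (P[Z | m]) ω = 0 := by linarith
    simpa [hτ] using this
  · intro h1
    filter_upwards [h1, key] with ω h2 h3
    rw [h3, h2]
    simp

lemma condExp_const_mul_eq_zero_iff {X Z : Ω → ℝ} {τ : ℝ} (hτ : τ ≠ 0)
    (h : ∀ ω, X ω = τ * Z ω) : P[X | m] =ᵐ[P] 0 ↔ P[Z | m] =ᵐ[P] 0 := by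
  have e : X = τ • Z := funext h
  rw [e]
  constructor <;> intro h1 <;> filter_upwards [h1, condExp_smul τ Z m (μ := P)] with ω h2 h3
  · rw [h3] at h2
    simpa [hτ] using h2
  · rw [h3, Pi.smul_apply, h2]
    simp

end CondExp

lemma measurable_info {Ω : Type*} {α : Type} [MeasurableSpace α] (X : Ω → α) :
    Measurable[info X] X := comap_measurable X

/-! ### Normalized forms as functions of the observed order flows and signals. -/

section Info

variable {Ω : Type*} {m : MeasurableSpace Ω} {J₁ J₂ : ℕ} {M : Market} (hM : M.Valid) (c : Coeffs)
  (ξ : Shock (Fin J₁ ⊕ Fin J₂) → Ω → ℝ)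
include hM

local notation "𝓛" => linearProfile M c J₁ J₂
local notation "𝓺" => dimless M c

/-- The σ-algebra `m` is arbitrary, since the same fact serves the dealers and the HFTs, also after
a deviation. -/
lemma measurable_flow1 (h : Measurable[m] (Y1 𝓛 ξ)) : Measurable[m] (nl M ξ (𝓺).flow1) := by
  have h2 := hM.σ1_pos.ne'
  have e : nl M ξ (𝓺).flow1 = fun ω => Y1 𝓛 ξ ω / M.σ1 := funext fun ω => by
    rw [Y1_eq c ξ ω hM]; field_simp
  rw [e]
  exact h.div_const _

lemma measurable_flowp (h : Measurable[m] (Yp 𝓛 ξ)) : Measurable[m] (nl M ξ (𝓺).flowp) := by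
  have h2 := hM.σ1_pos.ne'
  have e : nl M ξ (𝓺).flowp = fun ω => Yp 𝓛 ξ ω / M.σ1 := funext fun ω => by
    rw [Yp_eq c ξ ω hM]; field_simp
  rw [e]
  exact h.div_const _

lemma measurable_flow2 (h : Measurable[m] (Y2 𝓛 ξ)) : Measurable[m] (nl M ξ (𝓺).flow2) := by
  have h2 := hM.σ1_pos.ne'
  have e : nl M ξ (𝓺).flow2 = fun ω => Y2 𝓛 ξ ω / M.σ1 := funext fun ω => by
    rw [Y2_eq c ξ ω hM]; field_simp
  rw [e]
  exact h.div_const _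

lemma measurable_sig (j) (h : Measurable[m] (Y1 𝓛 ξ)) (h' : Measurable[m] (Sig 𝓛 ξ j)) :
    Measurable[m] (nl M ξ ((𝓺).sig j)) := by
  have h2 := hM.σ1_pos.ne'
  have e : nl M ξ ((𝓺).sig j) =
      fun ω => (Sig 𝓛 ξ j ω - ((𝓺).S - 1) / (𝓺).S * Y1 𝓛 ξ ω) / M.σ1 := funext fun ω => by
    rw [← meanI_eq c hM, Sig_sub_eq c ξ ω hM]; field_simp
  rw [e]
  exact (h'.sub (h.const_mul _)).div_const _

lemma Sig_eq (j) (ω : Ω) : Sig 𝓛 ξ j ω =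
    M.σ1 * (nl M ξ ((𝓺).sig j) ω + ((𝓺).S - 1) / (𝓺).S * nl M ξ (𝓺).flow1 ω) := by
  have := Sig_sub_eq c ξ ω hM j
  rw [meanI_eq c hM, Y1_eq c ξ ω hM] at this
  linarith

end Info

/-! ### Integrability of the equilibrium quantities, and efficient pricing. -/

section Dealers

variable {Ω : Type*} [MeasurableSpace Ω] {P : Measure Ω} [IsProbabilityMeasure P] {J₁ J₂ : ℕ}
  {M : Market} (hM : M.Valid) (c : Coeffs)
  {ξ : Shock (Fin J₁ ⊕ Fin J₂) → Ω → ℝ} (hξ : IsShockModel M c.σz P ξ)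

local notation "𝓛" => linearProfile M c J₁ J₂
local notation "𝓺" => dimless M c

include hM

/-- With `Λ1 = A1 / S` the price at time `1` is the conditional mean of `v`, so what remains of `v`
is the residual `value`. This is why the condition on `Λ1` is settled before all others. -/
lemma v_sub_Pricep (hΛ1 : (𝓺).Λ1 = (𝓺).A1 / (𝓺).S) (ω : Ω) :
    ξ .v ω - Pricep 𝓛 ξ ω = M.σv * nl M ξ (𝓺).gainp ω := by
  have e1 := v_eq ξ ω hM
  have e2 := Pricep_eq c ξ ω hM
  have e3 := (𝓺).lin_value (nrm M ξ) ω
  simp only [nl, Dimless.gainp, lin_sub, lin_smul] at *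
  rw [e1, e2, e3, hΛ1]
  ring

lemma v_sub_Price2 (hΛ1 : (𝓺).Λ1 = (𝓺).A1 / (𝓺).S) (ω : Ω) :
    ξ .v ω - Price2 𝓛 ξ ω = M.σv * nl M ξ (𝓺).gain2 ω := by
  have e1 := v_eq ξ ω hM
  have e2 := Price2_eq c ξ ω hM
  have e3 := (𝓺).lin_value (nrm M ξ) ω
  simp only [nl, Dimless.gain2, lin_sub, lin_smul] at *
  rw [e1, e2, e3, hΛ1]
  ring

include hξ

omit hM in
lemma IsShockModel.measurable_I1 : Measurable (I1 𝓛 ξ) := by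
  have h1 := hξ.measurable .v; have h2 := hξ.measurable .z
  exact ((h1.sub_const _).const_mul _).add h2

omit hM in
lemma IsShockModel.measurable_Y1 : Measurable (Y1 𝓛 ξ) :=
  (hξ.measurable_I1 c).add (hξ.measurable _)

omit hM in
lemma IsShockModel.measurable_Sig (j) : Measurable (Sig 𝓛 ξ j) :=
  (hξ.measurable_I1 c).add (hξ.measurable _)

lemma IsShockModel.measurable_Yp : Measurable (Yp 𝓛 ξ) := by
  rw [show Yp 𝓛 ξ = fun ω => M.σ1 * nl M ξ (𝓺).flowp ω from funext fun ω => Yp_eq c ξ ω hM]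
  exact ((hξ.isGaussianFamily hM).measurable_lin _).const_mul _

lemma IsShockModel.measurable_Y2 : Measurable (Y2 𝓛 ξ) := by
  rw [show Y2 𝓛 ξ = fun ω => M.σ1 * nl M ξ (𝓺).flow2 ω from funext fun ω => Y2_eq c ξ ω hM]
  exact ((hξ.isGaussianFamily hM).measurable_lin _).const_mul _

lemma IsShockModel.memLp_nl (a) : MemLp (nl M ξ a) 2 P := (hξ.isGaussianFamily hM).memLp_lin a

lemma IsShockModel.memLp_v : MemLp (ξ .v) 2 P := by
  have := ((hξ.isGaussianFamily hM).memLp .v).const_mul M.σv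
  rw [show ξ .v = fun ω => M.p0 + M.σv * nrm M ξ .v ω from funext fun ω => v_eq ξ ω hM]
  exact (memLp_const M.p0).add this

lemma IsShockModel.memLp_Y1 : MemLp (Y1 𝓛 ξ) 2 P := by
  rw [show Y1 𝓛 ξ = fun ω => M.σ1 * nl M ξ (𝓺).flow1 ω from funext fun ω => Y1_eq c ξ ω hM]
  exact (hξ.memLp_nl hM c _).const_mul _

lemma IsShockModel.memLp_Yp : MemLp (Yp 𝓛 ξ) 2 P := by
  rw [show Yp 𝓛 ξ = fun ω => M.σ1 * nl M ξ (𝓺).flowp ω from funext fun ω => Yp_eq c ξ ω hM]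
  exact (hξ.memLp_nl hM c _).const_mul _

lemma IsShockModel.memLp_Y2 : MemLp (Y2 𝓛 ξ) 2 P := by
  rw [show Y2 𝓛 ξ = fun ω => M.σ1 * nl M ξ (𝓺).flow2 ω from funext fun ω => Y2_eq c ξ ω hM]
  exact (hξ.memLp_nl hM c _).const_mul _

lemma IsShockModel.memLp_X1 (j) : MemLp (X1 𝓛 ξ j) 2 P := by
  rw [show X1 𝓛 ξ j = fun ω => M.σ1 * ((𝓺).b1 j * nl M ξ ((𝓺).sig j) ω) from
    funext fun ω => X1_eq c ξ ω hM j]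
  exact ((hξ.memLp_nl hM c _).const_mul _).const_mul _

lemma IsShockModel.memLp_X2 (j) : MemLp (X2 𝓛 ξ j) 2 P := by
  rw [show X2 𝓛 ξ j = fun ω => M.σ1 * nl M ξ ((𝓺).ord2 j) ω from funext fun ω => X2_eq c ξ ω hM j]
  exact (hξ.memLp_nl hM c _).const_mul _

lemma IsShockModel.memLp_Price1 : MemLp (Price1 𝓛 ξ) 2 P :=
  (memLp_const M.p0).add ((hξ.memLp_Y1 hM c).const_mul c.lam1)

lemma IsShockModel.memLp_Pricep : MemLp (Pricep 𝓛 ξ) 2 P :=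
  (hξ.memLp_Price1 hM c).add ((hξ.memLp_Yp hM c).const_mul c.lamp)

lemma IsShockModel.memLp_Price2 : MemLp (Price2 𝓛 ξ) 2 P :=
  ((hξ.memLp_Price1 hM c).add ((hξ.memLp_Yp hM c).const_mul c.lam21)).add
    ((hξ.memLp_Y2 hM c).const_mul c.lam22)

/-- A residual uncorrelated with the first order flow has conditional mean zero given this flow. -/
lemma condExp_info_Y1 (a : Shock (Fin J₁ ⊕ Fin J₂) → ℝ) :
    P[nl M ξ a | info (Y1 𝓛 ξ)] =ᵐ[P] 0 ↔ ip (𝓺).var a (𝓺).flow1 = 0 := by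
  rw [(hξ.isGaussianFamily hM).condExp_lin_eq_zero_iff a ![(𝓺).flow1]]
  · simp
  · exact info_le_info (φ := fun x => M.σ1 * x 0) (by fun_prop) fun ω => by
      simp [Y1_eq c ξ ω hM]
  · intro i
    fin_cases i
    exact measurable_flow1 hM c ξ (measurable_info _)

lemma condExp_info_Y1_Yp (a : Shock (Fin J₁ ⊕ Fin J₂) → ℝ) :
    P[nl M ξ a | info (fun ω => (Y1 𝓛 ξ ω, Yp 𝓛 ξ ω))] =ᵐ[P] 0 ↔
      ip (𝓺).var a (𝓺).flow1 = 0 ∧ ip (𝓺).var a (𝓺).flowp = 0 := by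
  rw [(hξ.isGaussianFamily hM).condExp_lin_eq_zero_iff a ![(𝓺).flow1, (𝓺).flowp]]
  · simp [Fin.forall_fin_succ]
  · exact info_le_info (φ := fun x => (M.σ1 * x 0, M.σ1 * x 1)) (by fun_prop) fun ω => by
      simp [Y1_eq c ξ ω hM, Yp_eq c ξ ω hM]
  · intro i
    have h := measurable_info (fun ω => (Y1 𝓛 ξ ω, Yp 𝓛 ξ ω))
    fin_cases i
    · exact measurable_flow1 hM c ξ (measurable_fst.comp h)
    · exact measurable_flowp hM c ξ (measurable_snd.comp h)

lemma condExp_info_Y1_Yp_Y2 (a : Shock (Fin J₁ ⊕ Fin J₂) → ℝ) :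
    P[nl M ξ a | info (fun ω => (Y1 𝓛 ξ ω, Yp 𝓛 ξ ω, Y2 𝓛 ξ ω))] =ᵐ[P] 0 ↔
      ip (𝓺).var a (𝓺).flow1 = 0 ∧ ip (𝓺).var a (𝓺).flowp = 0 ∧ ip (𝓺).var a (𝓺).flow2 = 0 := by
  rw [(hξ.isGaussianFamily hM).condExp_lin_eq_zero_iff a ![(𝓺).flow1, (𝓺).flowp, (𝓺).flow2]]
  · simp [Fin.forall_fin_succ]
  · exact info_le_info (φ := fun x => (M.σ1 * x 0, M.σ1 * x 1, M.σ1 * x 2)) (by fun_prop) fun ω => by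
      simp [Y1_eq c ξ ω hM, Yp_eq c ξ ω hM, Y2_eq c ξ ω hM]
  · intro i
    have h := measurable_info (fun ω => (Y1 𝓛 ξ ω, Yp 𝓛 ξ ω, Y2 𝓛 ξ ω))
    fin_cases i
    · exact measurable_flow1 hM c ξ (measurable_fst.comp h)
    · exact measurable_flowp hM c ξ (measurable_fst.comp (measurable_snd.comp h))
    · exact measurable_flow2 hM c ξ (measurable_snd.comp (measurable_snd.comp h))

/-- The functions in the linear strategies are the conditional expectations given `y₁`. -/
theorem condExp_means :
    (P[ξ .v | info (Y1 𝓛 ξ)] =ᵐ[P] fun ω => meanV M c (Y1 𝓛 ξ ω)) ∧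
      (P[I1 𝓛 ξ | info (Y1 𝓛 ξ)] =ᵐ[P] fun ω => meanI M c (Y1 𝓛 ξ ω)) ∧
      ∀ j, P[Sig 𝓛 ξ j | info (Y1 𝓛 ξ)] =ᵐ[P] fun ω => meanI M c (Y1 𝓛 ξ ω) := by
  have hS := (S_pos 𝓺 (θz_nonneg c)).ne'
  have hm : info (Y1 𝓛 ξ) ≤ _ := (hξ.measurable_Y1 c).comap_le
  have hY : Measurable[info (Y1 𝓛 ξ)] (Y1 𝓛 ξ) := measurable_info _
  have hYi := (hξ.memLp_Y1 hM c).integrable one_le_two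
  have hgI : Measurable[info (Y1 𝓛 ξ)] fun ω => meanI M c (Y1 𝓛 ξ ω) := hY.const_mul _
  have hgIi : Integrable (fun ω => meanI M c (Y1 𝓛 ξ ω)) P := hYi.const_mul _
  have hi := fun a => (hξ.memLp_nl hM c a).integrable one_le_two
  refine ⟨?_, ?_, fun j => ?_⟩
  · rw [condExp_eq_iff (g := fun ω => meanV M c (Y1 𝓛 ξ ω)) hm hM.σv_pos.ne' ((hY.const_mul _).const_add _)
      ((integrable_const _).add (hYi.const_mul _)) (hi _) fun ω => v_sub_eq c ξ ω hM,
      condExp_info_Y1 hM c hξ]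
    exact (𝓺).ip_res_flow1 hS ..
  · rw [condExp_eq_iff hm hM.σ1_pos.ne' hgI hgIi (hi _) fun ω => I1_sub_eq c ξ ω hM,
      condExp_info_Y1 hM c hξ]
    exact (𝓺).ip_res_flow1 hS ..
  · rw [condExp_eq_iff hm hM.σ1_pos.ne' hgI hgIi (hi _) fun ω => Sig_sub_eq c ξ ω hM j,
      condExp_info_Y1 hM c hξ]
    exact (𝓺).ip_res_flow1 hS ..

omit hM hξ in
lemma ip_flow1 : ip (𝓺).var (𝓺).flow1 ((𝓺).flow1 (J₁ := J₁) (J₂ := J₂)) = (𝓺).S := by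
  simp [Dimless.ip_var, Dimless.flow1, coef, Dimless.S]
  ring

omit hM hξ in
lemma ip_gainp_flow1 : ip (𝓺).var (𝓺).gainp ((𝓺).flow1 (J₁ := J₁) (J₂ := J₂)) = 0 := by
  have hS := (S_pos 𝓺 (θz_nonneg c)).ne'
  simp [Dimless.gainp, ip_sub_left, ip_smul_left, Dimless.flowp, Dimless.value,
    (𝓺).ip_res_flow1 hS]

omit hM hξ in
lemma ip_gain2_flow1 : ip (𝓺).var (𝓺).gain2 ((𝓺).flow1 (J₁ := J₁) (J₂ := J₂)) = 0 := by
  have hS := (S_pos 𝓺 (θz_nonneg c)).ne'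
  simp [Dimless.gain2, ip_sub_left, ip_smul_left, Dimless.flowp, Dimless.flow2, Dimless.value,
    (𝓺).ip_res_flow1 hS]

/-- Prices are efficient if and only if they satisfy the normal equations. -/
theorem dealersEfficient_iff : DealersEfficient P ξ 𝓛 ↔
    (𝓺).Λ1 = (𝓺).A1 / (𝓺).S ∧ ip (𝓺).var (𝓺).gainp ((𝓺).flowp (J₁ := J₁) (J₂ := J₂)) = 0 ∧
      ip (𝓺).var (𝓺).gain2 ((𝓺).flowp (J₁ := J₁) (J₂ := J₂)) = 0 ∧
      ip (𝓺).var (𝓺).gain2 ((𝓺).flow2 (J₁ := J₁) (J₂ := J₂)) = 0 := by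
  have hS := (S_pos 𝓺 (θz_nonneg c)).ne'
  have hi := fun a => (hξ.memLp_nl hM c a).integrable one_le_two
  have hm1 : info (Y1 𝓛 ξ) ≤ _ := (hξ.measurable_Y1 c).comap_le
  have hY : Measurable[info (Y1 𝓛 ξ)] (Y1 𝓛 ξ) := measurable_info _
  -- The pricing error is `value + (A1/S - Λ1) • flow1` in units of `σv`. Since `value` is
  -- orthogonal to `flow1`, its covariance with `flow1` is `(A1/S - Λ1) S`.
  have h1 : P[ξ .v | info (Y1 𝓛 ξ)] =ᵐ[P] Price1 𝓛 ξ ↔ (𝓺).Λ1 = (𝓺).A1 / (𝓺).S := by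
    rw [condExp_eq_iff (g := Price1 𝓛 ξ) hm1 hM.σv_pos.ne' ((hY.const_mul _).const_add _)
      ((hξ.memLp_Price1 hM c).integrable one_le_two)
      (hi ((𝓺).value + ((𝓺).A1 / (𝓺).S - (𝓺).Λ1) • (𝓺).flow1)) fun ω => ?_,
      condExp_info_Y1 hM c hξ, ip_add_left, ip_smul_left, ip_flow1, Dimless.value,
      (𝓺).ip_res_flow1 hS, zero_add, mul_eq_zero, or_iff_left hS, sub_eq_zero, eq_comm]
    rw [v_eq ξ ω hM, Price1_eq c ξ ω hM, nl, nl, lin_add, lin_smul, Dimless.lin_value]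
    ring
  have hmp : info (fun ω => (Y1 𝓛 ξ ω, Yp 𝓛 ξ ω)) ≤ _ :=
    ((hξ.measurable_Y1 c).prodMk (hξ.measurable_Yp hM c)).comap_le
  have hYp := measurable_info (fun ω => (Y1 𝓛 ξ ω, Yp 𝓛 ξ ω))
  have hm2 : info (fun ω => (Y1 𝓛 ξ ω, Yp 𝓛 ξ ω, Y2 𝓛 ξ ω)) ≤ _ :=
    ((hξ.measurable_Y1 c).prodMk ((hξ.measurable_Yp hM c).prodMk (hξ.measurable_Y2 hM c))).comap_le
  have hY2 := measurable_info (fun ω => (Y1 𝓛 ξ ω, Yp 𝓛 ξ ω, Y2 𝓛 ξ ω))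
  have hpm : Measurable (𝓛).pp := by simp only [linearProfile]; fun_prop
  have hp2m : Measurable (𝓛).p2 := by simp only [linearProfile]; fun_prop
  have hp : (𝓺).Λ1 = (𝓺).A1 / (𝓺).S →
      (P[ξ .v | info (fun ω => (Y1 𝓛 ξ ω, Yp 𝓛 ξ ω))] =ᵐ[P] Pricep 𝓛 ξ ↔
        ip (𝓺).var (𝓺).gainp ((𝓺).flowp (J₁ := J₁) (J₂ := J₂)) = 0) := fun h => by
    rw [condExp_eq_iff (g := Pricep 𝓛 ξ) hmp hM.σv_pos.ne' (hpm.comp hYp)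
      ((hξ.memLp_Pricep hM c).integrable one_le_two) (hi _) fun ω => v_sub_Pricep hM c h ω,
      condExp_info_Y1_Yp hM c hξ, ip_gainp_flow1]
    simp
  have h2 : (𝓺).Λ1 = (𝓺).A1 / (𝓺).S →
      (P[ξ .v | info (fun ω => (Y1 𝓛 ξ ω, Yp 𝓛 ξ ω, Y2 𝓛 ξ ω))] =ᵐ[P] Price2 𝓛 ξ ↔
        ip (𝓺).var (𝓺).gain2 ((𝓺).flowp (J₁ := J₁) (J₂ := J₂)) = 0 ∧
        ip (𝓺).var (𝓺).gain2 ((𝓺).flow2 (J₁ := J₁) (J₂ := J₂)) = 0) := fun h => by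
    rw [condExp_eq_iff (g := Price2 𝓛 ξ) hm2 hM.σv_pos.ne' (hp2m.comp hY2)
      ((hξ.memLp_Price2 hM c).integrable one_le_two) (hi _) fun ω => v_sub_Price2 hM c h ω,
      condExp_info_Y1_Yp_Y2 hM c hξ, ip_gain2_flow1]
    simp
  constructor
  · rintro ⟨e1, ep, e2⟩
    exact ⟨h1.mp e1, (hp (h1.mp e1)).mp ep, (h2 (h1.mp e1)).mp e2⟩
  · rintro ⟨e1, ep, e2⟩
    exact ⟨h1.mpr e1, (hp e1).mpr ep, (h2 e1).mpr e2⟩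

end Dealers


/-! ### Optimality of the high-frequency traders -/

namespace Dimless

variable (q : Dimless) {J₁ J₂ : ℕ}

/-- Response of an HFT's second order to her own first order. -/
def own : Fin J₁ ⊕ Fin J₂ → ℝ := Sum.elim (fun _ => q.β23) fun _ => -1

/-- Effect of a deviation of HFT `j` at time `1₊` on the price at time `2`, her own second order
being fixed. -/
def impact (j : Fin J₁ ⊕ Fin J₂) : ℝ := q.Λ21 + q.Λ22 * (J₁ * q.β22 - q.slope j)

end Dimless

/-! ### Effect of a deviation of one HFT on orders, flows and prices. -/

section Deviation

variable {Ω : Type*} {J₁ J₂ : ℕ} (M : Market) (c : Coeffs)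
  (ξ : Shock (Fin J₁ ⊕ Fin J₂) → Ω → ℝ) (j : Fin J₁ ⊕ Fin J₂) (f : ℝ × ℝ → ℝ)
  (g : ℝ × ℝ × ℝ × ℝ → ℝ) (ω : Ω)

local notation "𝓛" => linearProfile M c J₁ J₂
local notation "𝓺" => dimless M c

lemma withX2_self (s : Profile (Fin J₁ ⊕ Fin J₂)) : s.withX2 j (s.x2 j) = s := by
  simp [Profile.withX2]

lemma withX1_self (s : Profile (Fin J₁ ⊕ Fin J₂)) : s.withX1 j (s.x1 j) = s := by
  simp [Profile.withX1]

lemma X1_withX1_self : X1 (((𝓛).withX1 j f).withX2 j g) ξ j ω = f (Sig 𝓛 ξ j ω, Y1 𝓛 ξ ω) := by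
  simp only [X1, Profile.withX1, Profile.withX2, Function.update_self]
  rfl

lemma X1_withX1_of_ne {k} (h : k ≠ j) : X1 (((𝓛).withX1 j f).withX2 j g) ξ k ω = X1 𝓛 ξ k ω := by
  simp only [X1, Profile.withX1, Profile.withX2, Function.update_of_ne h]
  rfl

/-- The other HFTs trade at time `1₊` without seeing this order, so the flow moves one for one. -/
lemma Yp_dev : Yp (((𝓛).withX1 j f).withX2 j g) ξ ω = Yp 𝓛 ξ ω + (X1 (((𝓛).withX1 j f).withX2 j g) ξ j ω - X1 𝓛 ξ j ω) := by
  have : ∀ k, X1 (((𝓛).withX1 j f).withX2 j g) ξ k ω = X1 𝓛 ξ k ω + if k = j then X1 (((𝓛).withX1 j f).withX2 j g) ξ j ω - X1 𝓛 ξ j ω else 0 := by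
    intro k
    by_cases h : k = j
    · subst h; simp
    · rw [X1_withX1_of_ne M c ξ j f g ω h]; simp [h]
  rw [Yp, Finset.sum_congr rfl fun k _ => this k, Finset.sum_add_distrib, Finset.sum_ite_eq' Finset.univ j,
    Yp]
  simp
  ring

lemma X2_withX2_self :
    X2 (((𝓛).withX1 j f).withX2 j g) ξ j ω = g (Sig 𝓛 ξ j ω, Y1 𝓛 ξ ω, Yp (((𝓛).withX1 j f).withX2 j g) ξ ω, X1 (((𝓛).withX1 j f).withX2 j g) ξ j ω) := by
  simp only [X2, Profile.withX2, Function.update_self]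
  rfl

/-- Another HFT notices the deviation only through the order flow at time `1₊`: a Small-IT reacts
with slope `β22`, a Round-Tripper not at all. -/
lemma X2_withX2_of_ne {k} (h : k ≠ j) :
    X2 (((𝓛).withX1 j f).withX2 j g) ξ k ω = X2 𝓛 ξ k ω + (𝓺).slope k * (X1 (((𝓛).withX1 j f).withX2 j g) ξ j ω - X1 𝓛 ξ j ω) := by
  have : X2 (((𝓛).withX1 j f).withX2 j g) ξ k ω =
      (𝓛).x2 k (Sig 𝓛 ξ k ω, Y1 𝓛 ξ ω, Yp (((𝓛).withX1 j f).withX2 j g) ξ ω, X1 𝓛 ξ k ω) := by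
    rw [← X1_withX1_of_ne M c ξ j f g ω h]
    simp only [X2, Profile.withX2, Function.update_of_ne h]
    rfl
  rw [this, Yp_dev]
  rcases k with k | k <;> simp [X2, linearProfile, Dimless.slope, dimless]
  ring

/-- The reactions of the others add up to `J₁ * β22` minus the slope of the deviator herself. IT
does not react, because her second order is independent of the flow at time `1₊`. -/
lemma Y2_dev : Y2 (((𝓛).withX1 j f).withX2 j g) ξ ω = Y2 𝓛 ξ ω + (X2 (((𝓛).withX1 j f).withX2 j g) ξ j ω - X2 𝓛 ξ j ω) +
    (J₁ * (𝓺).β22 - (𝓺).slope j) * (X1 (((𝓛).withX1 j f).withX2 j g) ξ j ω - X1 𝓛 ξ j ω) := by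
  have : ∀ k, X2 (((𝓛).withX1 j f).withX2 j g) ξ k ω = X2 𝓛 ξ k ω + (𝓺).slope k * (X1 (((𝓛).withX1 j f).withX2 j g) ξ j ω - X1 𝓛 ξ j ω) +
      if k = j then X2 (((𝓛).withX1 j f).withX2 j g) ξ j ω - X2 𝓛 ξ j ω - (𝓺).slope j * (X1 (((𝓛).withX1 j f).withX2 j g) ξ j ω - X1 𝓛 ξ j ω) else 0 := by
    intro k
    by_cases h : k = j
    · subst h; simp
    · rw [X2_withX2_of_ne M c ξ j f g ω h]; simp [h]
  have hI : I2 (((𝓛).withX1 j f).withX2 j g) ξ ω = I2 𝓛 ξ ω := rfl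
  rw [Y2, Finset.sum_congr rfl fun k _ => this k, Finset.sum_add_distrib, Finset.sum_add_distrib,
    Finset.sum_ite_eq' Finset.univ j, ← Finset.sum_mul, Dimless.sum_slope, Y2, hI]
  simp
  ring

lemma Pricep_dev : Pricep (((𝓛).withX1 j f).withX2 j g) ξ ω = Pricep 𝓛 ξ ω + c.lamp * (X1 (((𝓛).withX1 j f).withX2 j g) ξ j ω - X1 𝓛 ξ j ω) := by
  have h1 : Pricep (((𝓛).withX1 j f).withX2 j g) ξ ω = M.p0 + c.lam1 * Y1 𝓛 ξ ω + c.lamp * Yp (((𝓛).withX1 j f).withX2 j g) ξ ω := rfl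
  have h2 : Pricep 𝓛 ξ ω = M.p0 + c.lam1 * Y1 𝓛 ξ ω + c.lamp * Yp 𝓛 ξ ω := rfl
  rw [h1, h2, Yp_dev]
  ring

variable {M} (hM : M.Valid)
include hM

lemma Price2_dev : Price2 (((𝓛).withX1 j f).withX2 j g) ξ ω = Price2 𝓛 ξ ω +
    (𝓺).impact j * M.σv / M.σ1 * (X1 (((𝓛).withX1 j f).withX2 j g) ξ j ω - X1 𝓛 ξ j ω) +
      c.lam22 * (X2 (((𝓛).withX1 j f).withX2 j g) ξ j ω - X2 𝓛 ξ j ω) := by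
  have h1 : Price2 (((𝓛).withX1 j f).withX2 j g) ξ ω =
    M.p0 + c.lam1 * Y1 𝓛 ξ ω + c.lam21 * Yp (((𝓛).withX1 j f).withX2 j g) ξ ω + c.lam22 * Y2 (((𝓛).withX1 j f).withX2 j g) ξ ω := rfl
  have h2 : Price2 𝓛 ξ ω =
    M.p0 + c.lam1 * Y1 𝓛 ξ ω + c.lam21 * Yp 𝓛 ξ ω + c.lam22 * Y2 𝓛 ξ ω := rfl
  rw [h1, h2, Yp_dev, Y2_dev, lam21_eq c hM, lam22_eq c hM, Dimless.impact]
  ring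

omit hM in
-- The second order of a Small-IT uses the flow net of her own order, which her deviation leaves
-- unchanged; only the term in `β23` moves. A Round-Tripper reverses her deviation.
lemma X2_own : X2 ((𝓛).withX1 j f) ξ j ω = X2 𝓛 ξ j ω +
    (𝓺).own j * (X1 ((𝓛).withX1 j f) ξ j ω - X1 𝓛 ξ j ω) := by
  have h1 := Yp_dev M c ξ j f ((𝓛).x2 j) ω
  rw [show ((𝓛).withX1 j f).withX2 j ((𝓛).x2 j) = (𝓛).withX1 j f from
    withX2_self j ((𝓛).withX1 j f)] at h1
  have h2 : X2 ((𝓛).withX1 j f) ξ j ω = (𝓛).x2 j (Sig 𝓛 ξ j ω, Y1 𝓛 ξ ω,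
    Yp ((𝓛).withX1 j f) ξ ω, X1 ((𝓛).withX1 j f) ξ j ω) := rfl
  rw [h2, h1]
  rcases j with k | k <;> simp [X2, linearProfile, Dimless.own, dimless] <;> ring

omit hM in
-- The prescribed second order of a Round-Tripper closes her position after any first order, so the
-- penalty is `∞ * 0 = 0`.
lemma penalty_toReal_withX1 :
    penalty ((𝓛).withX1 j f) ξ aversion j ω = 0 := by
  rcases j with k | k
  · simp [penalty, aversion]
  · have : X2 ((𝓛).withX1 (.inr k) f) ξ (.inr k) ω = - X1 ((𝓛).withX1 (.inr k) f) ξ (.inr k) ω := rfl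
    simp [penalty, this]

end Deviation

section HFT

variable {Ω : Type*} [MeasurableSpace Ω] {P : Measure Ω} [IsProbabilityMeasure P] {J₁ J₂ : ℕ}
  {M : Market} (hM : M.Valid) (c : Coeffs)
  {ξ : Shock (Fin J₁ ⊕ Fin J₂) → Ω → ℝ} (hξ : IsShockModel M c.σz P ξ)

local notation "𝓛" => linearProfile M c J₁ J₂
local notation "𝓺" => dimless M c

include hM hξ

lemma condExp_info_Sig_Y1 (j) (a : Shock (Fin J₁ ⊕ Fin J₂) → ℝ) :
    P[nl M ξ a | info (fun ω => (Sig 𝓛 ξ j ω, Y1 𝓛 ξ ω))] =ᵐ[P] 0 ↔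
      ip (𝓺).var a (𝓺).flow1 = 0 ∧ ip (𝓺).var a ((𝓺).sig j) = 0 := by
  rw [(hξ.isGaussianFamily hM).condExp_lin_eq_zero_iff a ![(𝓺).flow1, (𝓺).sig j]]
  · simp [Fin.forall_fin_succ]
  · exact info_le_info (φ := fun x => (M.σ1 * (x 1 + ((𝓺).S - 1) / (𝓺).S * x 0), M.σ1 * x 0))
      (by fun_prop) fun ω => by simp [Y1_eq c ξ ω hM, Sig_eq hM c ξ]
  · intro i
    have h := measurable_info (fun ω => (Sig 𝓛 ξ j ω, Y1 𝓛 ξ ω))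
    fin_cases i
    · exact measurable_flow1 hM c ξ (measurable_snd.comp h)
    · exact measurable_sig hM c ξ j (measurable_snd.comp h) (measurable_fst.comp h)

/-- The forms orthogonal to an HFT's information. -/
lemma condExp_info_Sig_Y1_Yp (j) (a : Shock (Fin J₁ ⊕ Fin J₂) → ℝ) {f : ℝ × ℝ → ℝ} (hf : Measurable f) :
    P[nl M ξ a | info (fun ω => (Sig ((𝓛).withX1 j f) ξ j ω, Y1 ((𝓛).withX1 j f) ξ ω,
      Yp ((𝓛).withX1 j f) ξ ω))] =ᵐ[P] 0 ↔
      ip (𝓺).var a (𝓺).flow1 = 0 ∧ ip (𝓺).var a ((𝓺).sig j) = 0 ∧ ip (𝓺).var a (𝓺).flowp = 0 := by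
  -- After the deviation the observed flow differs from the linear one by a function of her signal
  -- and the first order flow. She knows this function, so her information is still generated by
  -- `flow1`, `sig j` and `flowp`.
  have hYp : ∀ ω, Yp ((𝓛).withX1 j f) ξ ω = M.σ1 * nl M ξ (𝓺).flowp ω +
      (f (Sig 𝓛 ξ j ω, Y1 𝓛 ξ ω) - M.σ1 * ((𝓺).b1 j * nl M ξ ((𝓺).sig j) ω)) := fun ω => by
    have h1 := Yp_dev M c ξ j f ((𝓛).x2 j) ω
    rw [X1_withX1_self, Yp_eq c ξ ω hM, X1_eq c ξ ω hM] at h1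
    rw [← h1, show ((𝓛).withX1 j f).withX2 j ((𝓛).x2 j) = (𝓛).withX1 j f from
      withX2_self j ((𝓛).withX1 j f)]
  rw [(hξ.isGaussianFamily hM).condExp_lin_eq_zero_iff a ![(𝓺).flow1, (𝓺).sig j, (𝓺).flowp]]
  · simp [Fin.forall_fin_succ]
  · refine info_le_info (φ := fun x => (M.σ1 * (x 1 + ((𝓺).S - 1) / (𝓺).S * x 0), M.σ1 * x 0,
      M.σ1 * x 2 + (f (M.σ1 * (x 1 + ((𝓺).S - 1) / (𝓺).S * x 0), M.σ1 * x 0) -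
        M.σ1 * ((𝓺).b1 j * x 1)))) (by fun_prop) fun ω => ?_
    rw [hYp]
    refine Prod.ext ?_ (Prod.ext ?_ ?_)
    · exact Sig_eq hM c ξ j ω
    · exact Y1_eq c ξ ω hM
    · simp [Y1_eq c ξ ω hM, Sig_eq hM c ξ]
  · intro i
    have h := measurable_info (fun ω => (Sig ((𝓛).withX1 j f) ξ j ω, Y1 ((𝓛).withX1 j f) ξ ω,
      Yp ((𝓛).withX1 j f) ξ ω))
    have h1 := measurable_fst.comp h
    have h2 := measurable_fst.comp (measurable_snd.comp h)
    have h3 := measurable_snd.comp (measurable_snd.comp h)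
    have hs := measurable_sig hM c ξ j h2 h1
    fin_cases i
    · exact measurable_flow1 hM c ξ h2
    · exact hs
    · have h2' := hM.σ1_pos.ne'
      have h4 := (h3.sub ((hf.comp (h1.prodMk h2)).sub ((hs.const_mul ((𝓺).b1 j)).const_mul M.σ1))).div_const M.σ1
      have e : nl M ξ (𝓺).flowp = fun ω => (Yp ((𝓛).withX1 j f) ξ ω -
          (f (Sig 𝓛 ξ j ω, Y1 𝓛 ξ ω) - M.σ1 * ((𝓺).b1 j * nl M ξ ((𝓺).sig j) ω))) / M.σ1 :=
        funext fun ω => by rw [hYp]; field_simp; ring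
      exact (congrArg (fun g => Measurable[info (fun ω => (Sig ((𝓛).withX1 j f) ξ j ω,
        Y1 ((𝓛).withX1 j f) ξ ω, Yp ((𝓛).withX1 j f) ξ ω))] g) e).mpr h4

lemma memLp_withX1 {j} {f : ℝ × ℝ → ℝ} (hf : AdmX1 P ξ 𝓛 j f) :
    MemLp (fun ω => X1 ((𝓛).withX1 j f) ξ j ω - X1 𝓛 ξ j ω) 2 P :=
  hf.2.sub (hξ.memLp_X1 hM c j)

lemma memLp_X2_withX1 {j} {f : ℝ × ℝ → ℝ} (hf : AdmX1 P ξ 𝓛 j f) :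
    MemLp (X2 ((𝓛).withX1 j f) ξ j) 2 P := by
  rw [show X2 ((𝓛).withX1 j f) ξ j = fun ω => X2 𝓛 ξ j ω +
    (𝓺).own j * (X1 ((𝓛).withX1 j f) ξ j ω - X1 𝓛 ξ j ω) from funext fun ω => X2_own c ξ j f ω]
  exact (hξ.memLp_X2 hM c j).add ((memLp_withX1 hM c hξ hf).const_mul _)

lemma Price2_withX1 (j) (f : ℝ × ℝ → ℝ) (ω : Ω) : Price2 ((𝓛).withX1 j f) ξ ω = Price2 𝓛 ξ ω +
    ((𝓺).impact j * M.σv / M.σ1 + c.lam22 * (𝓺).own j) *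
      (X1 ((𝓛).withX1 j f) ξ j ω - X1 𝓛 ξ j ω) := by
  have h1 := Price2_dev c ξ j f ((𝓛).x2 j) ω hM
  rw [show ((𝓛).withX1 j f).withX2 j ((𝓛).x2 j) = (𝓛).withX1 j f from
    withX2_self j ((𝓛).withX1 j f), X2_own] at h1
  rw [h1]
  ring

lemma memLp_Price2_withX1 {j} {f : ℝ × ℝ → ℝ} (hf : AdmX1 P ξ 𝓛 j f) :
    MemLp (Price2 ((𝓛).withX1 j f) ξ) 2 P := by
  rw [show Price2 ((𝓛).withX1 j f) ξ = fun ω => _ from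
    funext fun ω => Price2_withX1 hM c hξ j f ω]
  exact (hξ.memLp_Price2 hM c).add ((memLp_withX1 hM c hξ hf).const_mul _)

lemma Price2_withX2 (j) (f : ℝ × ℝ → ℝ) (g : ℝ × ℝ × ℝ × ℝ → ℝ) (ω : Ω) :
    Price2 (((𝓛).withX1 j f).withX2 j g) ξ ω = Price2 ((𝓛).withX1 j f) ξ ω +
      c.lam22 * (X2 (((𝓛).withX1 j f).withX2 j g) ξ j ω - X2 ((𝓛).withX1 j f) ξ j ω) := by
  have h1 := Price2_dev c ξ j f ((𝓛).x2 j) ω hM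
  rw [show ((𝓛).withX1 j f).withX2 j ((𝓛).x2 j) = (𝓛).withX1 j f from
    withX2_self j ((𝓛).withX1 j f)] at h1
  have h2 := Price2_dev c ξ j f g ω hM
  rw [show X1 (((𝓛).withX1 j f).withX2 j g) ξ j ω = X1 ((𝓛).withX1 j f) ξ j ω from rfl] at h2
  rw [h1, h2]
  ring

lemma admX1_self (j) : AdmX1 P ξ 𝓛 j ((𝓛).x1 j) := by
  refine ⟨?_, ?_⟩
  · rcases j with j | j <;> exact (measurable_fst.sub (measurable_snd.const_mul _)).const_mul _
  · rw [withX1_self]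
    exact hξ.memLp_X1 hM c j

/-- Constant shifts are the test deviations that `isArgMax_iff` asks for; the shift by `1` also
probes second-stage optimality off the path. -/
lemma admX1_add_const {j} {f : ℝ × ℝ → ℝ} (hf : AdmX1 P ξ 𝓛 j f) (t : ℝ) :
    AdmX1 P ξ 𝓛 j (fun a => f a + t) ∧
      ∀ ω, X1 ((𝓛).withX1 j fun a => f a + t) ξ j ω = X1 ((𝓛).withX1 j f) ξ j ω + t := by
  have h : ∀ ω, X1 ((𝓛).withX1 j fun a => f a + t) ξ j ω = X1 ((𝓛).withX1 j f) ξ j ω + t := by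
    intro ω
    simp only [X1, Profile.withX1, Function.update_self]
    rfl
  refine ⟨⟨hf.1.add_const t, ?_⟩, h⟩
  rw [show X1 ((𝓛).withX1 j fun a => f a + t) ξ j = fun ω => X1 ((𝓛).withX1 j f) ξ j ω + t from
    funext h]
  exact hf.2.add (memLp_const t)

/-- The first-order optimality of an HFT before time `1₊`. -/
theorem hftFirstOptimal_iff (hΛ1 : (𝓺).Λ1 = (𝓺).A1 / (𝓺).S) (j : Fin J₁ ⊕ Fin J₂) :
    HFTFirstOptimal P ξ aversion 𝓛 j ↔
      0 < (𝓺).Λp + (𝓺).own j * ((𝓺).impact j + (𝓺).Λ22 * (𝓺).own j) ∧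
        ip (𝓺).var ((𝓺).gainp - ((𝓺).Λp * (𝓺).b1 j) • (𝓺).sig j + (𝓺).own j • (𝓺).gain2 -
          ((𝓺).impact j + (𝓺).Λ22 * (𝓺).own j) • (𝓺).ord2 j) ((𝓺).sig j) = 0 := by
  have hS := (S_pos 𝓺 (θz_nonneg c)).ne'
  have h1 := hM.σv_pos; have h2 := hM.σ1_pos
  set κ := (𝓺).Λp + (𝓺).own j * ((𝓺).impact j + (𝓺).Λ22 * (𝓺).own j) with hκ
  set a := (𝓺).gainp - ((𝓺).Λp * (𝓺).b1 j) • (𝓺).sig j + (𝓺).own j • (𝓺).gain2 -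
          ((𝓺).impact j + (𝓺).Λ22 * (𝓺).own j) • (𝓺).ord2 j with ha
  have hmeas := (hξ.measurable_Sig c j).prodMk (hξ.measurable_Y1 c)
  have hm : info (fun ω => (Sig 𝓛 ξ j ω, Y1 𝓛 ξ ω)) ≤ _ := hmeas.comap_le
  have hinfo := measurable_info (fun ω => (Sig 𝓛 ξ j ω, Y1 𝓛 ξ ω))
  have hX1 := hξ.memLp_X1 hM c j
  have hX2 := hξ.memLp_X2 hM c j
  have hadm := admX1_self hM c hξ j
  -- All forms involved are residuals given the first order flow, so of the two orthogonality
  -- conditions only the one with the signal is a restriction.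
  have hflow : ip (𝓺).var a (𝓺).flow1 = 0 := by
    simp [ha, ip_sub_left, ip_add_left, ip_smul_left, ip_gainp_flow1, ip_gain2_flow1, Dimless.ord2,
      Dimless.sig, Dimless.flowp, (𝓺).ip_res_flow1 hS]
  have hpen : ∀ f ω, profitHFT1 ((𝓛).withX1 j f) ξ j ω + profitHFT2 ((𝓛).withX1 j f) ξ j ω -
      (penalty ((𝓛).withX1 j f) ξ aversion j ω).toReal =
      (ξ .v ω - Pricep ((𝓛).withX1 j f) ξ ω) * X1 ((𝓛).withX1 j f) ξ j ω +
        (ξ .v ω - Price2 ((𝓛).withX1 j f) ξ ω) * X2 ((𝓛).withX1 j f) ξ j ω := fun f ω => by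
    rw [penalty_toReal_withX1]
    simp [profitHFT1, profitHFT2]
  have key := isArgMax_iff (P := P) hm (adm := AdmX1 P ξ 𝓛 j)
    (payoff := fun f ω => profitHFT1 ((𝓛).withX1 j f) ξ j ω + profitHFT2 ((𝓛).withX1 j f) ξ j ω -
      (penalty ((𝓛).withX1 j f) ξ aversion j ω).toReal)
    (order := fun f => X1 ((𝓛).withX1 j f) ξ j) (d := (𝓛).x1 j)
    (κ := κ * M.σv / M.σ1) (W := fun ω => M.σv * nl M ξ a ω) hadm
    ((hξ.memLp_nl hM c _).const_mul _) ?_ ?_ ?_ ?_ ?_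
  · rw [HFTFirstOptimal, key, condExp_const_mul_eq_zero_iff h1.ne' fun ω => rfl,
      condExp_info_Sig_Y1 hM c hξ, hflow]
    have : 0 < κ * M.σv / M.σ1 ↔ 0 < κ := by
      rw [mul_div_assoc]
      exact mul_pos_iff_of_pos_right (div_pos h1 h2)
    simp [this]
  · simp only [hpen]
    simp only [withX1_self]
    exact (((hξ.memLp_v hM c).sub (hξ.memLp_Pricep hM c)).integrable_mul hX1).add
      (((hξ.memLp_v hM c).sub (hξ.memLp_Price2 hM c)).integrable_mul hX2)
  · intro f hf
    simp only [withX1_self]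
    exact memLp_withX1 hM c hξ hf
  · intro f hf
    have : Measurable[info (fun ω => (Sig 𝓛 ξ j ω, Y1 𝓛 ξ ω))]
        (fun ω => X1 ((𝓛).withX1 j f) ξ j ω - X1 ((𝓛).withX1 j ((𝓛).x1 j)) ξ j ω) := by
      have e : ∀ g, X1 ((𝓛).withX1 j g) ξ j = fun ω => g (Sig 𝓛 ξ j ω, Y1 𝓛 ξ ω) := fun g =>
        funext fun ω => by simp only [X1, Profile.withX1, Function.update_self]; rfl
      rw [e, e]
      exact (hf.1.comp hinfo).sub (hadm.1.comp hinfo)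
    exact this.stronglyMeasurable.aestronglyMeasurable
  · intro f hf
    -- If her order moves by `δ`, then the price at `1₊` moves by `Λp δ`, her second order by `own
    -- δ`, and the price at time `2` by `(impact + Λ22 own) δ`, in normalized units. Expanding the
    -- two profits gives the form `a` and the curvature `κ`.
    refine Filter.Eventually.of_forall fun ω => ?_
    have e1 := Pricep_dev M c ξ j f ((𝓛).x2 j) ω
    rw [show ((𝓛).withX1 j f).withX2 j ((𝓛).x2 j) = (𝓛).withX1 j f from
      withX2_self j ((𝓛).withX1 j f)] at e1
    have e2 := Price2_withX1 hM c hξ j f ω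
    have e3 := X2_own c ξ j f ω (M := M)
    have e4 := v_sub_Pricep hM c (ξ := ξ) hΛ1 ω
    have e5 := v_sub_Price2 hM c (ξ := ξ) hΛ1 ω
    have e6 := X1_eq c ξ ω hM j
    have e7 := X2_eq c ξ ω hM j
    simp only [hpen]
    simp only [withX1_self]
    rw [e1, e2, e3, lamp_eq c hM, lam22_eq c hM]
    have e8 : nl M ξ a ω = nl M ξ (𝓺).gainp ω - (𝓺).Λp * (𝓺).b1 j * nl M ξ ((𝓺).sig j) ω +
        (𝓺).own j * nl M ξ (𝓺).gain2 ω -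
          ((𝓺).impact j + (𝓺).Λ22 * (𝓺).own j) * nl M ξ ((𝓺).ord2 j) ω := by
      simp only [ha, nl, lin_sub, lin_add, lin_smul]
    rw [e8, hκ]
    have e4' : Pricep 𝓛 ξ ω = ξ .v ω - M.σv * nl M ξ (𝓺).gainp ω := by linarith
    have e5' : Price2 𝓛 ξ ω = ξ .v ω - M.σv * nl M ξ (𝓺).gain2 ω := by linarith
    rw [e4', e5', e7]
    have e6' : nl M ξ ((𝓺).sig j) ω * (𝓺).b1 j = X1 𝓛 ξ j ω / M.σ1 := by
      rw [e6]; field_simp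
    rw [show (𝓺).Λp * (𝓺).b1 j * nl M ξ ((𝓺).sig j) ω =
      (𝓺).Λp * (nl M ξ ((𝓺).sig j) ω * (𝓺).b1 j) by ring, e6']
    field_simp
    ring
  · intro t
    obtain ⟨h3, h4⟩ := admX1_add_const hM c hξ hadm t
    exact ⟨_, h3, h4⟩

/-- The second-order optimality of a Small-IT after time `1₊`. -/
theorem hftSecondOptimal_inl_iff (hΛ1 : (𝓺).Λ1 = (𝓺).A1 / (𝓺).S) (i : Fin J₁) :
    HFTSecondOptimal P ξ aversion 𝓛 (.inl i) ↔
      0 < (𝓺).Λ22 ∧ (𝓺).Λ21 + (𝓺).Λ22 * (J₁ * (𝓺).β22 - (𝓺).β22) + 2 * (𝓺).Λ22 * (𝓺).β23 = 0 ∧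
        ip (𝓺).var ((𝓺).gain2 - (𝓺).Λ22 • (𝓺).ord2 (.inl i))
          ((𝓺).sig (J₁ := J₁) (J₂ := J₂) (.inl i)) = 0 ∧
        ip (𝓺).var ((𝓺).gain2 - (𝓺).Λ22 • (𝓺).ord2 (.inl i))
          ((𝓺).flowp (J₁ := J₁) (J₂ := J₂)) = 0 := by
  have hS := (S_pos 𝓺 (θz_nonneg c)).ne'
  have h1 := hM.σv_pos; have h2 := hM.σ1_pos
  set j : Fin J₁ ⊕ Fin J₂ := .inl i with hj
  set a := (𝓺).gain2 - (𝓺).Λ22 • (𝓺).ord2 j with ha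
  set b := (𝓺).Λ21 + (𝓺).Λ22 * (J₁ * (𝓺).β22 - (𝓺).β22) + 2 * (𝓺).Λ22 * (𝓺).β23 with hb
  -- After a first-stage deviation `δ` the price at time `2` has moved by `(impact + Λ22 own) δ` and
  -- the prescribed second order by `own δ`. The marginal profit `v - p₂ - λ₂₂ x₂` thus falls by
  -- `(impact + 2 Λ22 own) δ`.
  have hbi : (𝓺).impact j + 2 * (𝓺).Λ22 * (𝓺).own j = b := by
    simp [hb, hj, Dimless.impact, Dimless.own, Dimless.slope]
  have hflow : ip (𝓺).var a (𝓺).flow1 = 0 := by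
    simp [ha, ip_sub_left, ip_add_left, ip_smul_left, ip_gain2_flow1, Dimless.ord2,
      Dimless.sig, Dimless.flowp, (𝓺).ip_res_flow1 hS]
  have hX1 := hξ.memLp_X1 hM c j
  have hX2 := hξ.memLp_X2 hM c j
  have hlam : 0 < c.lam22 ↔ 0 < (𝓺).Λ22 := by
    rw [lam22_eq c hM, mul_div_assoc]
    exact mul_pos_iff_of_pos_right (div_pos h1 h2)
  have hx2 : Measurable ((𝓛).x2 j) := by
    simp only [hj, linearProfile, Sum.elim_inl, meanI]
    fun_prop
  have hmeas : ∀ f, Measurable f → Measurable (fun ω =>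
      (Sig ((𝓛).withX1 j f) ξ j ω, Y1 ((𝓛).withX1 j f) ξ ω, Yp ((𝓛).withX1 j f) ξ ω)) := by
    intro f hf
    refine (hξ.measurable_Sig c j).prodMk ((hξ.measurable_Y1 c).prodMk ?_)
    have e : Yp ((𝓛).withX1 j f) ξ = fun ω => Yp 𝓛 ξ ω + (f (Sig 𝓛 ξ j ω, Y1 𝓛 ξ ω) -
        (𝓛).x1 j (Sig 𝓛 ξ j ω, Y1 𝓛 ξ ω)) := funext fun ω => by
      have h1 := Yp_dev M c ξ j f ((𝓛).x2 j) ω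
      rw [X1_withX1_self] at h1
      rw [show ((𝓛).withX1 j f).withX2 j ((𝓛).x2 j) = (𝓛).withX1 j f from
        withX2_self j ((𝓛).withX1 j f)] at h1
      exact h1
    rw [e]
    have hp := (hξ.measurable_Sig c j).prodMk (hξ.measurable_Y1 c)
    exact (hξ.measurable_Yp hM c).add ((hf.comp hp).sub ((admX1_self hM c hξ j).1.comp hp))
  have key : ∀ f, AdmX1 P ξ 𝓛 j f →
      (IsArgMax P (info fun ω => (Sig ((𝓛).withX1 j f) ξ j ω, Y1 ((𝓛).withX1 j f) ξ ω,
          Yp ((𝓛).withX1 j f) ξ ω))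
        (AdmX2 P ξ aversion ((𝓛).withX1 j f) j)
        (fun g ω => profitHFT2 (((𝓛).withX1 j f).withX2 j g) ξ j ω -
          (penalty (((𝓛).withX1 j f).withX2 j g) ξ aversion j ω).toReal)
        (fun g => X2 (((𝓛).withX1 j f).withX2 j g) ξ j) ((𝓛).x2 j) ↔
      0 < c.lam22 ∧ P[fun ω => -(b * M.σv / M.σ1 * (X1 ((𝓛).withX1 j f) ξ j ω - X1 𝓛 ξ j ω)) +
        M.σv * nl M ξ a ω | info fun ω => (Sig ((𝓛).withX1 j f) ξ j ω, Y1 ((𝓛).withX1 j f) ξ ω,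
          Yp ((𝓛).withX1 j f) ξ ω)] =ᵐ[P] 0) := by
    intro f hf
    have hself : ((𝓛).withX1 j f).withX2 j ((𝓛).x2 j) = (𝓛).withX1 j f :=
      withX2_self j ((𝓛).withX1 j f)
    have hpen : ∀ g ω, profitHFT2 (((𝓛).withX1 j f).withX2 j g) ξ j ω -
        (penalty (((𝓛).withX1 j f).withX2 j g) ξ aversion j ω).toReal =
        (ξ .v ω - Price2 (((𝓛).withX1 j f).withX2 j g) ξ ω) *
          X2 (((𝓛).withX1 j f).withX2 j g) ξ j ω := fun g ω => by
      simp [penalty, profitHFT2, aversion, hj]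
    have hX2f := memLp_X2_withX1 hM c hξ hf
    have hinfo := measurable_info (fun ω => (Sig ((𝓛).withX1 j f) ξ j ω, Y1 ((𝓛).withX1 j f) ξ ω,
          Yp ((𝓛).withX1 j f) ξ ω))
    have hadm : ∀ g, Measurable g → MemLp (X2 (((𝓛).withX1 j f).withX2 j g) ξ j) 2 P →
        AdmX2 P ξ aversion ((𝓛).withX1 j f) j g := fun g hg hg2 =>
      ⟨hg, hg2, Filter.Eventually.of_forall fun ω => by simp [penalty, aversion, hj]⟩
    refine isArgMax_iff (hmeas f hf.1).comap_le (hadm _ hx2 (by rw [hself]; exact hX2f)) ?_ ?_ ?_ ?_ ?_ ?_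
    · exact (((memLp_withX1 hM c hξ hf).const_mul _).neg).add ((hξ.memLp_nl hM c a).const_mul _)
    · refine (integrable_congr (.of_forall (hpen _))).mpr ?_
      rw [hself]
      exact ((hξ.memLp_v hM c).sub (memLp_Price2_withX1 hM c hξ hf)).integrable_mul hX2f
    · intro g hg
      rw [hself]
      exact hg.2.1.sub hX2f
    · intro g hg
      have e : ∀ g, X2 (((𝓛).withX1 j f).withX2 j g) ξ j = fun ω =>
          g (Sig ((𝓛).withX1 j f) ξ j ω, Y1 ((𝓛).withX1 j f) ξ ω, Yp ((𝓛).withX1 j f) ξ ω,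
            f (Sig ((𝓛).withX1 j f) ξ j ω, Y1 ((𝓛).withX1 j f) ξ ω)) := fun g => funext fun ω => by
        rw [X2_withX2_self, X1_withX1_self]; rfl
      have hi1 := measurable_fst.comp hinfo
      have hi2 := measurable_fst.comp (measurable_snd.comp hinfo)
      have hi3 := measurable_snd.comp (measurable_snd.comp hinfo)
      have hi : Measurable[info fun ω => (Sig ((𝓛).withX1 j f) ξ j ω, Y1 ((𝓛).withX1 j f) ξ ω,
          Yp ((𝓛).withX1 j f) ξ ω)] fun ω =>
          (Sig ((𝓛).withX1 j f) ξ j ω, Y1 ((𝓛).withX1 j f) ξ ω, Yp ((𝓛).withX1 j f) ξ ω,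
            f (Sig ((𝓛).withX1 j f) ξ j ω, Y1 ((𝓛).withX1 j f) ξ ω)) :=
        hi1.prodMk (hi2.prodMk (hi3.prodMk (hf.1.comp (hi1.prodMk hi2))))
      rw [e, e]
      exact ((hg.1.comp hi).sub (hx2.comp hi)).stronglyMeasurable.aestronglyMeasurable
    · intro g hg
      refine Filter.Eventually.of_forall fun ω => ?_
      have e2 := Price2_withX2 hM c hξ j f g ω
      have e3 := Price2_withX1 hM c hξ j f ω
      have e4 := X2_own c ξ j f ω (M := M)
      have e5 := v_sub_Price2 hM c (ξ := ξ) hΛ1 ω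
      have e7 := X2_eq c ξ ω hM j
      have e8 : nl M ξ a ω = nl M ξ (𝓺).gain2 ω - (𝓺).Λ22 * nl M ξ ((𝓺).ord2 j) ω := by
        simp only [ha, nl, lin_sub, lin_smul]
      have e5' : Price2 𝓛 ξ ω = ξ .v ω - M.σv * nl M ξ (𝓺).gain2 ω := by linarith
      simp only [hpen]
      simp only [hself]
      rw [e2, e3, e4, e5', e7, e8, lam22_eq c hM, ← hbi]
      field_simp
      ring
    · intro t
      have e : ∀ ω, X2 (((𝓛).withX1 j f).withX2 j fun x => (𝓛).x2 j x + t) ξ j ω =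
          X2 (((𝓛).withX1 j f).withX2 j ((𝓛).x2 j)) ξ j ω + t := fun ω => by
        rw [X2_withX2_self, X2_withX2_self]; rfl
      refine ⟨_, hadm (fun x => (𝓛).x2 j x + t) (hx2.add_const t) ?_, e⟩
      rw [show X2 (((𝓛).withX1 j f).withX2 j fun x => (𝓛).x2 j x + t) ξ j = fun ω => _ from funext e,
        hself]
      exact hX2f.add (memLp_const t)
  have hown := admX1_self hM c hξ j
  constructor
  · intro h
    have k0 := (key _ hown).mp (h _ hown)
    rw [condExp_const_mul_eq_zero_iff (Z := nl M ξ a) h1.ne' fun ω => by simp [withX1_self],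
      condExp_info_Sig_Y1_Yp hM c hξ j a hown.1] at k0
    -- The strategy itself gives the orthogonality conditions. Shifting the first order by `1` adds
    -- the constant `-b σv / σ1` to the marginal profit; taking expectations then forces `b = 0`.
    obtain ⟨hf1, hf2⟩ := admX1_add_const hM c hξ hown 1
    have k1 := ((key _ hf1).mp (h _ hf1)).2
    refine ⟨hlam.mp k0.1, ?_, k0.2.2⟩
    have hint := integral_condExp (μ := P) (f := fun ω => -(b * M.σv / M.σ1 *
      (X1 ((𝓛).withX1 j fun x => (𝓛).x1 j x + 1) ξ j ω - X1 𝓛 ξ j ω)) + M.σv * nl M ξ a ω)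
      (hmeas _ hf1.1).comap_le
    rw [integral_congr_ae k1] at hint
    simp only [hf2, withX1_self, add_sub_cancel_left] at hint
    rw [integral_add (integrable_const _) (((hξ.memLp_nl hM c a).integrable one_le_two).const_mul _),
      integral_const_mul, (hξ.isGaussianFamily hM).integral_lin] at hint
    have : b * M.σv / M.σ1 = 0 := by simpa using hint
    have h3 := h1.ne'; have h4 := h2.ne'
    simpa [h3, h4] using this
  · rintro ⟨h3, h4, h5⟩ f hf
    rw [key f hf, h4]
    refine ⟨hlam.mpr h3, ?_⟩
    rw [condExp_const_mul_eq_zero_iff (Z := nl M ξ a) h1.ne' fun ω => by simp,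
      condExp_info_Sig_Y1_Yp hM c hξ j a hf.1]
    exact ⟨hflow, h5⟩

/-- After time `1₊` a Round-Tripper has only one admissible order. -/
theorem hftSecondOptimal_inr (i : Fin J₂) : HFTSecondOptimal P ξ aversion 𝓛 (.inr i) := by
  set j : Fin J₁ ⊕ Fin J₂ := .inr i with hj
  intro f hf
  have hself : ((𝓛).withX1 j f).withX2 j ((𝓛).x2 j) = (𝓛).withX1 j f :=
    withX2_self j ((𝓛).withX1 j f)
  refine ⟨⟨?_, ?_, ?_⟩, fun g hg => ?_⟩
  · simp only [hj, linearProfile, Sum.elim_inr]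
    fun_prop
  · rw [hself]
    exact memLp_X2_withX1 hM c hξ hf
  · rw [hself]
    exact Filter.Eventually.of_forall fun ω => by simp [penalty_toReal_withX1]
  -- A finite penalty with infinite aversion forces zero final inventory almost surely, so every
  -- admissible order agrees with the prescribed one and yields the same payoff.
  · have hX : ∀ᵐ ω ∂P, X2 (((𝓛).withX1 j f).withX2 j g) ξ j ω = X2 ((𝓛).withX1 j f) ξ j ω := by
      filter_upwards [hg.2.2] with ω hω
      have e : X2 ((𝓛).withX1 j f) ξ j ω = - X1 ((𝓛).withX1 j f) ξ j ω := rfl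
      have e' : X1 (((𝓛).withX1 j f).withX2 j g) ξ j ω = X1 ((𝓛).withX1 j f) ξ j ω := rfl
      by_contra hne
      refine hω ?_
      have : 0 < (X1 (((𝓛).withX1 j f).withX2 j g) ξ j ω +
          X2 (((𝓛).withX1 j f).withX2 j g) ξ j ω) ^ 2 := by
        rw [e] at hne
        rw [e']
        refine sq_pos_of_ne_zero fun h0 => hne (by linarith)
      have h2 := (ENNReal.ofReal_pos.mpr this).ne'
      simp only [penalty, hj, aversion, Sum.elim_inr]
      exact ENNReal.top_mul h2
    have hpay : (fun ω => profitHFT2 (((𝓛).withX1 j f).withX2 j g) ξ j ω -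
        (penalty (((𝓛).withX1 j f).withX2 j g) ξ aversion j ω).toReal) =ᵐ[P]
        fun ω => profitHFT2 (((𝓛).withX1 j f).withX2 j ((𝓛).x2 j)) ξ j ω -
          (penalty (((𝓛).withX1 j f).withX2 j ((𝓛).x2 j)) ξ aversion j ω).toReal := by
      filter_upwards [hX] with ω hω
      rw [hself]
      simp only [profitHFT2, penalty]
      rw [Price2_withX2 hM c hξ, hω, sub_self, mul_zero, add_zero]
      rfl
    filter_upwards [hX, condExp_congr_ae (m := info fun ω => (Sig ((𝓛).withX1 j f) ξ j ω,
      Y1 ((𝓛).withX1 j f) ξ ω, Yp ((𝓛).withX1 j f) ξ ω)) hpay] with ω h3 h4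
    refine ⟨h4.le, fun _ => ?_⟩
    rw [hself]
    exact h3

end HFT


/-! ### Optimality of the informed trader -/

namespace Dimless

variable (q : Dimless) (J₁ J₂ : ℕ)

/-- Effect of IT's first order on the price at time `2`, through the orders of the HFTs. -/
def C : ℝ := q.Λ21 * q.B J₁ J₂ + q.Λ22 * (J₁ * q.β22 * q.B J₁ J₂ +
  J₁ * (q.β21 + (q.β23 - q.β22) * q.β11) - J₂ * q.β12)

/-- The part of the price at time `2` which is independent of IT's information. -/
def noise : Shock (Fin J₁ ⊕ Fin J₂) → ℝ :=
  coef 0 0 0 (q.Λ21 + q.Λ22 * (J₁ * q.β22)) q.Λ22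
    fun j => (q.Λ21 + q.Λ22 * (J₁ * q.β22)) * q.b1 j + q.Λ22 * q.b2 j

/-- Sensitivity of IT's second-period margin to her first order. -/
noncomputable def D : ℝ := q.A1 / q.S + q.C J₁ J₂ / q.S

/-- Curvature of IT's first-period problem. -/
noncomputable def curv : ℝ := q.A1 / q.S - q.D J₁ J₂ ^ 2 / (4 * q.Λ22)

/-- Marginal profit of IT's first order, at order `0`. -/
noncomputable def marginal : Shock (Fin J₁ ⊕ Fin J₂) → ℝ :=
  coef (1 - q.D J₁ J₂ / (2 * q.Λ22)) 0
    (-(q.A1 / q.S) - q.D J₁ J₂ / (2 * q.Λ22) * (q.C J₁ J₂ * ((q.S - 1) / q.S) - q.A1 / q.S)) 0 0 0 +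
  (q.D J₁ J₂ / (2 * q.Λ22)) • q.noise J₁ J₂

end Dimless

section Deviation

variable {Ω : Type*} {J₁ J₂ : ℕ} {M : Market} (hM : M.Valid) (c : Coeffs)
  (ξ : Shock (Fin J₁ ⊕ Fin J₂) → Ω → ℝ) (f : ℝ × ℝ → ℝ) (g : ℝ × ℝ × ℝ → ℝ) (ω : Ω)

local notation "𝓛" => linearProfile M c J₁ J₂
local notation "𝓺" => dimless M c

include hM

/-- The HFTs see IT's first order only through `i₁` plus noise, so after an arbitrary deviation the
price is still affine in `i₁ - E(i₁|y₁)` and `i₂`. The rest consists of shocks that IT does not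
observe. -/
lemma Price2_withI : Price2 (((𝓛).withI1 f).withI2 g) ξ ω =
    M.p0 + c.lam1 * Y1 ((𝓛).withI1 f) ξ ω + (𝓺).C J₁ J₂ * M.σv / M.σ1 *
      (I1 ((𝓛).withI1 f) ξ ω - meanI M c (Y1 ((𝓛).withI1 f) ξ ω)) +
        c.lam22 * I2 (((𝓛).withI1 f).withI2 g) ξ ω + M.σv * nl M ξ ((𝓺).noise J₁ J₂) ω := by
  have h2 := hM.σ1_pos.ne'
  set s := ((𝓛).withI1 f).withI2 g
  set r := I1 ((𝓛).withI1 f) ξ ω - meanI M c (Y1 ((𝓛).withI1 f) ξ ω) with hr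
  obtain ⟨-, -, hup, hu2, hε⟩ := shock_eq ξ ω hM
  have hX1 : ∀ j, X1 s ξ j ω = (𝓺).b1 j * (r + ξ (.ε j) ω) := fun j => by
    rcases j with j | j
    · have : X1 s ξ (.inl j) ω = c.β11 * (I1 ((𝓛).withI1 f) ξ ω + ξ (.ε (.inl j)) ω -
        meanI M c (Y1 ((𝓛).withI1 f) ξ ω)) := rfl
      rw [this, hr]
      simp only [Dimless.b1, Sum.elim_inl, dimless]
      ring
    · have : X1 s ξ (.inr j) ω = c.β12 * (I1 ((𝓛).withI1 f) ξ ω + ξ (.ε (.inr j)) ω -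
        meanI M c (Y1 ((𝓛).withI1 f) ξ ω)) := rfl
      rw [this, hr]
      simp only [Dimless.b1, Sum.elim_inr, dimless]
      ring
  have hX2 : ∀ j, X2 s ξ j ω = (𝓺).b2 j * (r + ξ (.ε j) ω) + (𝓺).slope j * Yp s ξ ω := fun j => by
    have hj := hX1 j
    rcases j with j | j
    · have : X2 s ξ (.inl j) ω = c.β21 * (I1 ((𝓛).withI1 f) ξ ω + ξ (.ε (.inl j)) ω -
        meanI M c (Y1 ((𝓛).withI1 f) ξ ω)) + c.β22 * (Yp s ξ ω - X1 s ξ (.inl j) ω) +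
          c.β23 * X1 s ξ (.inl j) ω := rfl
      rw [this, hj, hr]
      simp only [Dimless.b1, Dimless.b2, Dimless.slope, Sum.elim_inl, dimless]
      ring
    · have : X2 s ξ (.inr j) ω = - X1 s ξ (.inr j) ω := rfl
      rw [this, hj]
      simp only [Dimless.b1, Dimless.b2, Dimless.slope, Sum.elim_inr, dimless]
      ring
  have hb2 : ∑ j : Fin J₁ ⊕ Fin J₂, (𝓺).b2 j =
      J₁ * ((𝓺).β21 + ((𝓺).β23 - (𝓺).β22) * (𝓺).β11) - J₂ * (𝓺).β12 := by
    simp [Dimless.b2]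
    ring
  have hYp : Yp s ξ ω = (𝓺).B J₁ J₂ * r + ∑ j, (𝓺).b1 j * ξ (.ε j) ω + ξ .up ω := by
    rw [Yp]
    simp only [hX1, mul_add, Finset.sum_add_distrib, ← Finset.sum_mul, Dimless.sum_b1]
  have hY2 : Y2 s ξ ω = I2 s ξ ω + ((J₁ * ((𝓺).β21 + ((𝓺).β23 - (𝓺).β22) * (𝓺).β11) -
      J₂ * (𝓺).β12) * r + ∑ j, (𝓺).b2 j * ξ (.ε j) ω + J₁ * (𝓺).β22 * Yp s ξ ω) + ξ .u2 ω := by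
    rw [Y2]
    simp only [hX2, mul_add, Finset.sum_add_distrib, ← Finset.sum_mul, Dimless.sum_slope, hb2]
  have hp : Price2 s ξ ω = M.p0 + c.lam1 * Y1 ((𝓛).withI1 f) ξ ω + c.lam21 * Yp s ξ ω +
    c.lam22 * Y2 s ξ ω := rfl
  rw [hp, hY2, hYp]
  simp only [hε, hup, hu2]
  rw [nl, Dimless.lin_shock]
  simp only [Dimless.noise, coef, add_mul, Finset.sum_add_distrib, mul_assoc, ← Finset.mul_sum]
  simp only [mul_left_comm _ M.σ1, ← Finset.mul_sum]
  rw [lam21_eq c hM, lam22_eq c hM, Dimless.C]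
  field_simp
  ring

/-- IT's margin at time `2`. -/
lemma v_sub_Price2_withI (hΛ1 : (𝓺).Λ1 = (𝓺).A1 / (𝓺).S) :
    ξ .v ω - Price2 (((𝓛).withI1 f).withI2 g) ξ ω =
    (ξ .v ω - meanV M c (Y1 ((𝓛).withI1 f) ξ ω)) - (𝓺).C J₁ J₂ * M.σv / M.σ1 *
      (I1 ((𝓛).withI1 f) ξ ω - meanI M c (Y1 ((𝓛).withI1 f) ξ ω)) -
        c.lam22 * I2 (((𝓛).withI1 f).withI2 g) ξ ω - M.σv * nl M ξ ((𝓺).noise J₁ J₂) ω := by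
  have h2 := hM.σ1_pos.ne'
  rw [Price2_withI hM, meanV_eq c hM, lam1_eq c hM, hΛ1]
  field_simp
  ring

/-- IT's total profit, as a quadratic function of her first order. -/
lemma profit_withI1 (hΛ1 : (𝓺).Λ1 = (𝓺).A1 / (𝓺).S) (hΛ22 : (𝓺).Λ22 ≠ 0)
    (h1 : 2 * (𝓺).Λ22 * (𝓺).A21 = 1) (h2 : (𝓺).C J₁ J₂ + 2 * (𝓺).Λ22 * (𝓺).α22 = 0) :
    profitIT1 ((𝓛).withI1 f) ξ ω + profitIT2 ((𝓛).withI1 f) ξ ω =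
      profitIT1 ((𝓛).withI1 0) ξ ω + profitIT2 ((𝓛).withI1 0) ξ ω +
        I1 ((𝓛).withI1 f) ξ ω * (M.σv * nl M ξ ((𝓺).marginal J₁ J₂) ω -
          (𝓺).curv J₁ J₂ * M.σv / M.σ1 * I1 ((𝓛).withI1 f) ξ ω) := by
  have hv := hM.σv_pos.ne'; have h0 := hM.σ1_pos.ne'
  have hS := (S_pos 𝓺 (θz_nonneg c)).ne'
  have hA21 : (𝓺).A21 = 1 / (2 * (𝓺).Λ22) := by field_simp; linarith
  have hα22 : c.α22 = -((𝓺).C J₁ J₂) / (2 * (𝓺).Λ22) := by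
    rw [show c.α22 = (𝓺).α22 from rfl]; field_simp; linarith
  -- The expected second-period profit is a squared margin divided by `4 λ₂₂`. The margin falls in
  -- `i₁` at the normalized rate `D`, through the inferred value (`A1/S`) and through the HFTs
  -- (`C/S`). Hence the curvature is `Λ1 - D²/(4 Λ22)`, and `1 - D/(2 Λ22)` is the weight of `v` in
  -- the marginal profit.
  have key : ∀ f : ℝ × ℝ → ℝ, profitIT1 ((𝓛).withI1 f) ξ ω + profitIT2 ((𝓛).withI1 f) ξ ω =
      I1 ((𝓛).withI1 f) ξ ω * (ξ .v ω - (M.p0 + c.lam1 * (I1 ((𝓛).withI1 f) ξ ω + ξ .u1 ω))) +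
        (ξ .v ω - Price2 ((𝓛).withI1 f) ξ ω) * (c.α21 * (ξ .v ω - meanV M c
          (I1 ((𝓛).withI1 f) ξ ω + ξ .u1 ω)) + c.α22 * (I1 ((𝓛).withI1 f) ξ ω - meanI M c
            (I1 ((𝓛).withI1 f) ξ ω + ξ .u1 ω))) := fun f => rfl
  have hp : ∀ f : ℝ × ℝ → ℝ, ξ .v ω - Price2 ((𝓛).withI1 f) ξ ω =
    (ξ .v ω - meanV M c (I1 ((𝓛).withI1 f) ξ ω + ξ .u1 ω)) - (𝓺).C J₁ J₂ * M.σv / M.σ1 *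
      (I1 ((𝓛).withI1 f) ξ ω - meanI M c (I1 ((𝓛).withI1 f) ξ ω + ξ .u1 ω)) -
        c.lam22 * (c.α21 * (ξ .v ω - meanV M c
          (I1 ((𝓛).withI1 f) ξ ω + ξ .u1 ω)) + c.α22 * (I1 ((𝓛).withI1 f) ξ ω - meanI M c
            (I1 ((𝓛).withI1 f) ξ ω + ξ .u1 ω))) - M.σv * nl M ξ ((𝓺).noise J₁ J₂) ω := fun f =>
    v_sub_Price2_withI hM c ξ f (𝓛).i2 ω hΛ1
  have hI0 : I1 ((𝓛).withI1 0) ξ ω = 0 := rfl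
  have hm : nl M ξ ((𝓺).marginal J₁ J₂) ω = (1 - (𝓺).D J₁ J₂ / (2 * (𝓺).Λ22)) * nrm M ξ .v ω +
      (-((𝓺).A1 / (𝓺).S) - (𝓺).D J₁ J₂ / (2 * (𝓺).Λ22) *
        ((𝓺).C J₁ J₂ * (((𝓺).S - 1) / (𝓺).S) - (𝓺).A1 / (𝓺).S)) * nrm M ξ .u1 ω +
      (𝓺).D J₁ J₂ / (2 * (𝓺).Λ22) * nl M ξ ((𝓺).noise J₁ J₂) ω := by
    rw [nl, Dimless.marginal, lin_add, lin_smul, Dimless.lin_shock]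
    simp [coef]
  rw [key f, key 0, hp f, hp 0, hI0, hm]
  simp only [meanV_eq c hM, meanI_eq c hM, hα22]
  rw [α21_eq c hM, hA21, lam1_eq c hM, hΛ1, lam22_eq c hM, v_eq ξ ω hM, (shock_eq ξ ω hM).2.1]
  generalize I1 ((𝓛).withI1 f) ξ ω = i
  generalize nl M ξ ((𝓺).noise J₁ J₂) ω = n
  simp only [Dimless.curv, Dimless.D]
  field_simp
  ring

end Deviation

section IT

variable {Ω : Type*} [MeasurableSpace Ω] {P : Measure Ω} [IsProbabilityMeasure P] {J₁ J₂ : ℕ}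
  {M : Market} (hM : M.Valid) (c : Coeffs)
  {ξ : Shock (Fin J₁ ⊕ Fin J₂) → Ω → ℝ} (hξ : IsShockModel M c.σz P ξ)

local notation "𝓛" => linearProfile M c J₁ J₂
local notation "𝓺" => dimless M c

lemma lin_coef_v (η : Shock (Fin J₁ ⊕ Fin J₂) → Ω → ℝ) : lin η (coef 1 0 0 0 0 0) = η .v := by
  funext ω
  simp [Dimless.lin_shock, coef]

lemma lin_coef_z (η : Shock (Fin J₁ ⊕ Fin J₂) → Ω → ℝ) : lin η (coef 0 1 0 0 0 0) = η .z := by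
  funext ω
  simp [Dimless.lin_shock, coef]

lemma lin_coef_u1 (η : Shock (Fin J₁ ⊕ Fin J₂) → Ω → ℝ) : lin η (coef 0 0 1 0 0 0) = η .u1 := by
  funext ω
  simp [Dimless.lin_shock, coef]

include hM hξ

/-- Only the loading on `v` counts, since the other shocks are independent of `v`. -/
lemma condExp_info_v (a : Shock (Fin J₁ ⊕ Fin J₂) → ℝ) :
    P[nl M ξ a | info (ξ .v)] =ᵐ[P] 0 ↔ a .v = 0 := by
  rw [(hξ.isGaussianFamily hM).condExp_lin_eq_zero_iff a ![coef 1 0 0 0 0 0]]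
  · simp [Dimless.ip_var, coef]
  · exact info_le_info (φ := fun x => M.p0 + M.σv * x 0) (by fun_prop) fun ω => by
      simp [lin_coef_v, v_eq ξ ω hM]
  · intro i
    fin_cases i
    have := measurable_info (ξ .v)
    show Measurable[info (ξ .v)] (lin (nrm M ξ) (coef 1 0 0 0 0 0))
    rw [lin_coef_v]
    exact (this.sub_const M.p0).div_const M.σv

/-- For an arbitrary `f` the information of IT is not generated by linear forms, but it is contained
in that of `v`, `z` and `u₁`, of which the noise is independent. The one-sided criterion is enough.
-/
lemma condExp_noise {f : ℝ × ℝ → ℝ} (hf : Measurable f) :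
    P[nl M ξ ((𝓺).noise J₁ J₂) | info fun ω => (ξ .v ω, I1 ((𝓛).withI1 f) ξ ω,
      Y1 ((𝓛).withI1 f) ξ ω)] =ᵐ[P] 0 := by
  refine (hξ.isGaussianFamily hM).condExp_lin_eq_zero _
    ![coef 1 0 0 0 0 0, coef 0 1 0 0 0 0, coef 0 0 1 0 0 0] ?_ ?_
  · refine info_le_info (φ := fun x => (M.p0 + M.σv * x 0, f (M.p0 + M.σv * x 0, M.σ1 * x 1),
      f (M.p0 + M.σv * x 0, M.σ1 * x 1) + M.σ1 * x 2)) (by fun_prop) fun ω => ?_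
    have e : I1 ((𝓛).withI1 f) ξ ω = f (ξ .v ω, ξ .z ω) := rfl
    simp [lin_coef_v, lin_coef_z, lin_coef_u1, Y1, e, ← (shock_eq ξ ω hM).1,
      ← (shock_eq ξ ω hM).2.1, ← v_eq ξ ω hM]
  · intro i
    fin_cases i <;> simp [Dimless.ip_var, Dimless.noise, coef]

omit hM in
lemma measurable_info_withI1 {f : ℝ × ℝ → ℝ} (hf : Measurable f) : Measurable fun ω =>
    (ξ .v ω, I1 ((𝓛).withI1 f) ξ ω, Y1 ((𝓛).withI1 f) ξ ω) := by
  have h1 : Measurable (I1 ((𝓛).withI1 f) ξ) :=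
    hf.comp ((hξ.measurable .v).prodMk (hξ.measurable .z))
  exact (hξ.measurable .v).prodMk (h1.prodMk (h1.add (hξ.measurable .u1)))

lemma memLp_u1 : MemLp (ξ .u1) 2 P := by
  rw [show ξ .u1 = fun ω => M.σ1 * nrm M ξ .u1 ω from funext fun ω => (shock_eq ξ ω hM).2.1]
  exact ((hξ.isGaussianFamily hM).memLp .u1).const_mul _

lemma memLp_withI1 {f : ℝ × ℝ → ℝ} (hf : AdmI1 P ξ 𝓛 f) :
    MemLp (Y1 ((𝓛).withI1 f) ξ) 2 P ∧
    MemLp (fun ω => ξ .v ω - meanV M c (Y1 ((𝓛).withI1 f) ξ ω)) 2 P ∧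
    MemLp (fun ω => I1 ((𝓛).withI1 f) ξ ω - meanI M c (Y1 ((𝓛).withI1 f) ξ ω)) 2 P ∧
    MemLp (I2 ((𝓛).withI1 f) ξ) 2 P := by
  have h1 : MemLp (Y1 ((𝓛).withI1 f) ξ) 2 P := hf.2.add (memLp_u1 hM c hξ)
  have h2 : MemLp (fun ω => ξ .v ω - meanV M c (Y1 ((𝓛).withI1 f) ξ ω)) 2 P :=
    (hξ.memLp_v hM).sub ((memLp_const M.p0).add (h1.const_mul _))
  have h3 : MemLp (fun ω => I1 ((𝓛).withI1 f) ξ ω - meanI M c (Y1 ((𝓛).withI1 f) ξ ω)) 2 P :=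
    hf.2.sub (h1.const_mul _)
  exact ⟨h1, h2, h3, (h2.const_mul c.α21).add (h3.const_mul c.α22)⟩

lemma memLp_gain_withI1 (hΛ1 : (𝓺).Λ1 = (𝓺).A1 / (𝓺).S) {f : ℝ × ℝ → ℝ} (hf : AdmI1 P ξ 𝓛 f) :
    MemLp (fun ω => ξ .v ω - Price2 ((𝓛).withI1 f) ξ ω) 2 P := by
  obtain ⟨-, h2, h3, h4⟩ := memLp_withI1 hM c hξ hf
  rw [show (fun ω => ξ .v ω - Price2 ((𝓛).withI1 f) ξ ω) = fun ω => _ from funext fun ω =>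
    v_sub_Price2_withI hM c ξ f (𝓛).i2 ω hΛ1]
  exact ((h2.sub (h3.const_mul _)).sub (h4.const_mul _)).sub ((hξ.memLp_nl hM c _).const_mul _)

lemma integrable_profit_withI1 (hΛ1 : (𝓺).Λ1 = (𝓺).A1 / (𝓺).S) {f : ℝ × ℝ → ℝ}
    (hf : AdmI1 P ξ 𝓛 f) :
    Integrable (fun ω => profitIT1 ((𝓛).withI1 f) ξ ω + profitIT2 ((𝓛).withI1 f) ξ ω) P := by
  obtain ⟨h1, -, -, h4⟩ := memLp_withI1 hM c hξ hf
  have hp : MemLp (fun ω => ξ .v ω - Price1 ((𝓛).withI1 f) ξ ω) 2 P :=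
    (hξ.memLp_v hM).sub ((memLp_const M.p0).add (h1.const_mul c.lam1))
  exact (hf.2.integrable_mul hp).add ((memLp_gain_withI1 hM c hξ hΛ1 hf).integrable_mul h4)

omit hM hξ in
lemma admI1_const (t : ℝ) : AdmI1 P ξ 𝓛 (fun _ => t) := ⟨measurable_const, memLp_const t⟩

/-- The second-period optimality of IT. -/
theorem itSecondOptimal_iff (hΛ1 : (𝓺).Λ1 = (𝓺).A1 / (𝓺).S) : ITSecondOptimal P ξ 𝓛 ↔
    0 < (𝓺).Λ22 ∧ 2 * (𝓺).Λ22 * (𝓺).A21 = 1 ∧ (𝓺).C J₁ J₂ + 2 * (𝓺).Λ22 * (𝓺).α22 = 0 := by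
  have hv := hM.σv_pos; have h0 := hM.σ1_pos
  have hv' := hv.ne'; have h0' := h0.ne'
  have hS := (S_pos 𝓺 (θz_nonneg c)).ne'
  have hlam : 0 < c.lam22 ↔ 0 < (𝓺).Λ22 := by
    rw [lam22_eq c hM, mul_div_assoc]
    exact mul_pos_iff_of_pos_right (div_pos hv h0)
  set a := 1 - 2 * (𝓺).Λ22 * (𝓺).A21 with ha
  set b := ((𝓺).C J₁ J₂ + 2 * (𝓺).Λ22 * (𝓺).α22) * M.σv / M.σ1 with hb
  have hi2 : Measurable (𝓛).i2 := by simp only [linearProfile, meanV, meanI]; fun_prop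
  -- The marginal profit splits into a combination of the two residuals, known to IT, and noise of
  -- conditional mean zero. Optimality is therefore the almost sure vanishing of the known part.
  have hW : ∀ (f : ℝ × ℝ → ℝ) ω, ξ .v ω - Price2 ((𝓛).withI1 f) ξ ω -
      c.lam22 * I2 ((𝓛).withI1 f) ξ ω =
      (a * (ξ .v ω - meanV M c (Y1 ((𝓛).withI1 f) ξ ω)) -
        b * (I1 ((𝓛).withI1 f) ξ ω - meanI M c (Y1 ((𝓛).withI1 f) ξ ω))) +
          (-M.σv) * nl M ξ ((𝓺).noise J₁ J₂) ω := fun f ω => by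
    have e1 : ξ .v ω - Price2 ((𝓛).withI1 f) ξ ω = _ :=
      v_sub_Price2_withI hM c ξ f (𝓛).i2 ω hΛ1
    have e2 : I2 ((𝓛).withI1 f) ξ ω = c.α21 * (ξ .v ω - meanV M c (Y1 ((𝓛).withI1 f) ξ ω)) +
      c.α22 * (I1 ((𝓛).withI1 f) ξ ω - meanI M c (Y1 ((𝓛).withI1 f) ξ ω)) := rfl
    rw [e1, show I2 (((𝓛).withI1 f).withI2 (𝓛).i2) ξ ω = I2 ((𝓛).withI1 f) ξ ω from rfl, e2,
      α21_eq c hM, lam22_eq c hM, show c.α22 = (𝓺).α22 from rfl, ha, hb]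
    field_simp
    ring
  have key : ∀ f, AdmI1 P ξ 𝓛 f →
      (IsArgMax P (info fun ω => (ξ .v ω, I1 ((𝓛).withI1 f) ξ ω, Y1 ((𝓛).withI1 f) ξ ω))
        (AdmI2 P ξ ((𝓛).withI1 f))
        (fun g => profitIT2 (((𝓛).withI1 f).withI2 g) ξ)
        (fun g => I2 (((𝓛).withI1 f).withI2 g) ξ) (𝓛).i2 ↔
      0 < c.lam22 ∧ ∀ᵐ ω ∂P, a * (ξ .v ω - meanV M c (Y1 ((𝓛).withI1 f) ξ ω)) -
        b * (I1 ((𝓛).withI1 f) ξ ω - meanI M c (Y1 ((𝓛).withI1 f) ξ ω)) = 0) := by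
    intro f hf
    obtain ⟨m1, m2, m3, m4⟩ := memLp_withI1 hM c hξ hf
    have hm := (measurable_info_withI1 c hξ hf.1).comap_le
    have hinfo := measurable_info (fun ω => (ξ .v ω, I1 ((𝓛).withI1 f) ξ ω, Y1 ((𝓛).withI1 f) ξ ω))
    have hgain := memLp_gain_withI1 hM c hξ hΛ1 hf
    have hcond : P[fun ω => ξ .v ω - Price2 ((𝓛).withI1 f) ξ ω - c.lam22 * I2 ((𝓛).withI1 f) ξ ω |
        info fun ω => (ξ .v ω, I1 ((𝓛).withI1 f) ξ ω, Y1 ((𝓛).withI1 f) ξ ω)] =ᵐ[P] 0 ↔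
        ∀ᵐ ω ∂P, a * (ξ .v ω - meanV M c (Y1 ((𝓛).withI1 f) ξ ω)) -
          b * (I1 ((𝓛).withI1 f) ξ ω - meanI M c (Y1 ((𝓛).withI1 f) ξ ω)) = 0 := by
      have hg : Measurable fun x : ℝ × ℝ × ℝ => a * (x.1 - meanV M c x.2.2) -
        b * (x.2.1 - meanI M c x.2.2) := by simp only [meanV, meanI]; fun_prop
      have h1 := condExp_add_const_mul (P := P) hm (-M.σv)
        (hg.comp hinfo).stronglyMeasurable.aestronglyMeasurable
        (((m2.const_mul a).sub (m3.const_mul b)).integrable one_le_two)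
        ((hξ.memLp_nl hM c _).integrable one_le_two) (hW f)
      have h2 := condExp_noise hM c hξ hf.1
      constructor
      · intro h
        filter_upwards [h, h1, h2] with ω e1 e2 e3
        rw [e1, e3] at e2
        simpa using e2.symm
      · intro h
        filter_upwards [h, h1, h2] with ω e1 e2 e3
        rw [e2, e3]
        simpa using e1
    rw [← hcond]
    refine isArgMax_iff hm ⟨hi2, m4⟩ (hgain.sub (m4.const_mul _)) (hgain.integrable_mul m4)
      ?_ ?_ ?_ ?_
    · exact fun g hg => hg.2.sub m4
    · exact fun g hg => ((hg.1.comp hinfo).sub (hi2.comp hinfo)).stronglyMeasurable.aestronglyMeasurable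
    · intro g hg
      refine Filter.Eventually.of_forall fun ω => ?_
      have e1 := Price2_withI hM c ξ f g ω
      have e2 := Price2_withI hM c ξ f (𝓛).i2 ω
      simp only [profitIT2]
      rw [e1, show Price2 ((𝓛).withI1 f) ξ ω = Price2 (((𝓛).withI1 f).withI2 (𝓛).i2) ξ ω from rfl,
        e2, show I2 ((𝓛).withI1 f) ξ ω = I2 (((𝓛).withI1 f).withI2 (𝓛).i2) ξ ω from rfl]
      ring
    · exact fun t => ⟨fun x => (𝓛).i2 x + t, ⟨hi2.add_const t, m4.add (memLp_const t)⟩,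
        fun ω => rfl⟩
  constructor
  · intro h
    -- A deviation is needed to separate `a` from `b`: without randomization the two residuals are
    -- proportional on the path. With `i₁ = 1` the known part is affine in the independent shocks
    -- `v` and `u₁`; its loading on `v` gives `a = 0`, and its constant term is then `-b / S`.
    have hf := admI1_const (P := P) (M := M) (ξ := ξ) c 1
    obtain ⟨h1, h2⟩ := (key _ hf).mp (h _ hf)
    have h3 := (hξ.isGaussianFamily hM).eq_zero_of_const_add_lin (t := -(a * M.σv * (𝓺).A1 /
      ((𝓺).S * M.σ1)) - b / (𝓺).S) (a := coef (a * M.σv) 0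
        (-(a * M.σv * (𝓺).A1 / (𝓺).S) + b * M.σ1 * (((𝓺).S - 1) / (𝓺).S)) 0 0 0) ?_
    · obtain ⟨h4, h5⟩ := h3
      have h6 := h5 (coef 1 0 0 0 0 0)
      have ha0 : a = 0 := by simpa [Dimless.ip_var, coef, hv'] using h6
      rw [ha0] at h4
      have hb0 : b = 0 := by simpa [hS] using h4
      refine ⟨hlam.mp h1, by linarith, ?_⟩
      simpa [hb, hv', h0'] using hb0
    · filter_upwards [h2] with ω e1
      have e2 : I1 ((𝓛).withI1 fun _ => 1) ξ ω = 1 := rfl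
      have e3 : Y1 ((𝓛).withI1 fun _ => 1) ξ ω = 1 + ξ .u1 ω := rfl
      rw [e2, e3, meanV_eq c hM, meanI_eq c hM, v_eq ξ ω hM, (shock_eq ξ ω hM).2.1] at e1
      refine Eq.trans ?_ e1
      rw [Dimless.lin_shock]
      simp [coef]
      field_simp
      ring
  · rintro ⟨h1, h2, h3⟩ f hf
    refine (key f hf).mpr ⟨hlam.mpr h1, Filter.Eventually.of_forall fun ω => ?_⟩
    have ha0 : a = 0 := by rw [ha, h2, sub_self]
    have hb0 : b = 0 := by rw [hb, h3]; simp
    rw [ha0, hb0]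
    ring

/-- The indifference of IT among her first-period orders. -/
theorem itIndifferent_iff (hΛ1 : (𝓺).Λ1 = (𝓺).A1 / (𝓺).S) (hΛ22 : (𝓺).Λ22 ≠ 0)
    (h1 : 2 * (𝓺).Λ22 * (𝓺).A21 = 1) (h2 : (𝓺).C J₁ J₂ + 2 * (𝓺).Λ22 * (𝓺).α22 = 0) :
    ITIndifferent P ξ 𝓛 ↔ (𝓺).curv J₁ J₂ = 0 ∧ (𝓺).D J₁ J₂ = 2 * (𝓺).Λ22 := by
  have hv := hM.σv_pos; have h0 := hM.σ1_pos
  have hv' := hv.ne'; have h0' := h0.ne'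
  set w := (𝓺).marginal J₁ J₂
  have hwv : w .v = 1 - (𝓺).D J₁ J₂ / (2 * (𝓺).Λ22) := by
    simp [w, Dimless.marginal, Dimless.noise, coef]
  have hwv0 : w .v = 0 ↔ (𝓺).D J₁ J₂ = 2 * (𝓺).Λ22 := by
    rw [hwv, sub_eq_zero, eq_comm, div_eq_one_iff_eq (by simpa using hΛ22)]
  set κ := (𝓺).curv J₁ J₂ * M.σv / M.σ1 with hκ
  have hκ0 : κ = 0 ↔ (𝓺).curv J₁ J₂ = 0 := by simp [hκ, hv', h0']
  have hm : info (ξ .v) ≤ _ := (hξ.measurable .v).comap_le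
  -- Given `v`, the marginal profit keeps only its loading on `v`.
  have hcw : P[fun ω => M.σv * nl M ξ w ω | info (ξ .v)] =ᵐ[P]
      fun ω => M.σv * w .v * nrm M ξ .v ω := by
    have h3 := (condExp_info_v hM c hξ (w - w .v • coef 1 0 0 0 0 0)).mpr (by simp [coef])
    have h4 := condExp_add_const_mul (P := P) (X := fun ω => M.σv * nl M ξ w ω)
      (g := fun ω => M.σv * w .v * nrm M ξ .v ω)
      (Z := nl M ξ (w - w .v • coef 1 0 0 0 0 0)) hm M.σv
      ((((measurable_info (ξ .v)).sub_const M.p0).div_const M.σv).const_mul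
        (M.σv * w .v)).stronglyMeasurable.aestronglyMeasurable
      ((((hξ.isGaussianFamily hM).memLp .v).integrable one_le_two).const_mul _)
      ((hξ.memLp_nl hM c _).integrable one_le_two) fun ω => by
        simp only [nl, lin_sub, lin_smul, lin_coef_v]; ring
    filter_upwards [h3, h4] with ω e3 e4
    rw [e4, e3]
    simp
  have key : ∀ f : ℝ → ℝ, AdmI1 P ξ 𝓛 (fun a => f a.1) →
      P[fun ω => profitIT1 ((𝓛).withI1 fun a => f a.1) ξ ω +
        profitIT2 ((𝓛).withI1 fun a => f a.1) ξ ω | info (ξ .v)] =ᵐ[P] fun ω =>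
      (P[fun ω => profitIT1 ((𝓛).withI1 0) ξ ω + profitIT2 ((𝓛).withI1 0) ξ ω | info (ξ .v)]) ω +
        (f (ξ .v ω) * (M.σv * w .v * nrm M ξ .v ω) - κ * f (ξ .v ω) ^ 2) := by
    intro f hf
    have hfm : Measurable f := by
      have := hf.1.comp (measurable_id.prodMk (measurable_const (a := (0 : ℝ))))
      exact this
    have h3 := condExp_quadratic (P := P) hm κ ((hξ.memLp_nl hM c w).const_mul M.σv)
      (integrable_profit_withI1 hM c hξ hΛ1 (admI1_const c 0)) hf.2
      (hfm.comp (measurable_info (ξ .v))).stronglyMeasurable.aestronglyMeasurable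
      (Filter.Eventually.of_forall fun ω =>
        profit_withI1 hM c ξ (fun a => f a.1) ω hΛ1 hΛ22 h1 h2)
    filter_upwards [h3, hcw] with ω e3 e4
    rw [e3, e4]
    rfl
  constructor
  · intro h
    -- Comparing the orders `0` and `1` already makes an affine function of the Gaussian `v` vanish,
    -- so both its constant term and its slope are zero.
    have k0 := key (fun _ => 0) (admI1_const c 0)
    have k1 := key (fun _ => 1) (admI1_const c 1)
    have h3 := (hξ.isGaussianFamily hM).eq_zero_of_const_add_lin (t := -κ)
      (a := (M.σv * w .v) • coef 1 0 0 0 0 0) ?_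
    · obtain ⟨h4, h5⟩ := h3
      have h6 := h5 (coef 1 0 0 0 0 0)
      have : w .v = 0 := by simpa [Dimless.ip_var, coef, hv'] using h6
      exact ⟨hκ0.mp (by linarith), hwv0.mp this⟩
    · filter_upwards [k0, k1, h (fun _ => 0) (fun _ => 1) (admI1_const c 0) (admI1_const c 1)]
        with ω e0 e1 e2
      rw [e0, e1] at e2
      rw [lin_smul, lin_coef_v]
      linarith
  · rintro ⟨h3, h4⟩ f g hf hg
    filter_upwards [key f hf, key g hg] with ω e1 e2
    rw [e1, e2, hwv0.mpr h4, hκ0.mpr h3]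
    ring

/-- The first-period optimality of IT, when she does not randomize. -/
theorem itFirstOptimal_iff (hΛ1 : (𝓺).Λ1 = (𝓺).A1 / (𝓺).S) (hΛ22 : (𝓺).Λ22 ≠ 0)
    (h1 : 2 * (𝓺).Λ22 * (𝓺).A21 = 1) (h2 : (𝓺).C J₁ J₂ + 2 * (𝓺).Λ22 * (𝓺).α22 = 0)
    (hz : (𝓺).θz = 0) : ITFirstOptimal P ξ 𝓛 ↔
    0 < (𝓺).curv J₁ J₂ ∧
      1 - (𝓺).D J₁ J₂ / (2 * (𝓺).Λ22) = 2 * (𝓺).curv J₁ J₂ * (𝓺).A1 := by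
  have hv := hM.σv_pos; have h0 := hM.σ1_pos
  have hv' := hv.ne'; have h0' := h0.ne'
  set w := (𝓺).marginal J₁ J₂
  have hwv : w .v = 1 - (𝓺).D J₁ J₂ / (2 * (𝓺).Λ22) := by
    simp [w, Dimless.marginal, Dimless.noise, coef]
  set κ := (𝓺).curv J₁ J₂ * M.σv / M.σ1 with hκ
  have hκ0 : 0 < κ ↔ 0 < (𝓺).curv J₁ J₂ := by
    rw [hκ, mul_div_assoc]
    exact mul_pos_iff_of_pos_right (div_pos hv h0)
  have hm : info (ξ .v) ≤ _ := (hξ.measurable .v).comap_le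
  -- Marginal profit at the prescribed order: the quadratic of `profit_withI1`, expanded around that
  -- order instead of around zero.
  set b := w - (2 * (𝓺).curv J₁ J₂) • coef (𝓺).A1 1 0 0 0 0
  have hbv : b .v = 0 ↔ 1 - (𝓺).D J₁ J₂ / (2 * (𝓺).Λ22) = 2 * (𝓺).curv J₁ J₂ * (𝓺).A1 := by
    rw [← hwv]
    simp [b, coef, sub_eq_zero]
  have hi1 : Measurable (𝓛).i1 := by simp only [linearProfile]; fun_prop
  have hadm : AdmI1 P ξ 𝓛 (𝓛).i1 := by
    refine ⟨hi1, ?_⟩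
    have : MemLp (I1 𝓛 ξ) 2 P := by
      have := (hξ.memLp_Y1 hM c).sub (memLp_u1 hM c hξ)
      simpa [Y1, Pi.sub_def] using this
    exact this
  -- Admissible strategies may formally use `z`. As `z = 0` almost surely, the deviation coincides
  -- almost surely with a function of `v`, as the conditional criterion requires.
  have hz0 : ∀ᵐ ω ∂P, ξ .z ω = 0 := by
    have h3 := (hξ.isGaussianFamily hM).var .z
    have h4 : (𝓺).var (J₁ := J₁) (J₂ := J₂) .z = 0 := hz
    rw [h4, integral_eq_zero_iff_of_nonneg (fun ω => mul_self_nonneg _)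
      (((hξ.isGaussianFamily hM).memLp .z).integrable_mul ((hξ.isGaussianFamily hM).memLp .z))] at h3
    filter_upwards [h3] with ω e
    have e' : nrm M ξ .z ω = 0 := by simpa using e
    rw [(shock_eq ξ ω hM).1, e', mul_zero]
  have key := isArgMax_iff (P := P) hm (adm := AdmI1 P ξ 𝓛)
    (payoff := fun f ω => profitIT1 ((𝓛).withI1 f) ξ ω + profitIT2 ((𝓛).withI1 f) ξ ω)
    (order := fun f => I1 ((𝓛).withI1 f) ξ) (d := (𝓛).i1) (κ := κ)
    (W := fun ω => M.σv * nl M ξ b ω) hadm ((hξ.memLp_nl hM c _).const_mul _)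
    (integrable_profit_withI1 hM c hξ hΛ1 hadm) (fun f hf => hf.2.sub hadm.2) ?_ ?_ ?_
  · rw [ITFirstOptimal, key, condExp_const_mul_eq_zero_iff hv' fun ω => rfl,
      condExp_info_v hM c hξ, hbv, hκ0]
  · intro f hf
    have hg : Measurable fun x : ℝ => f (x, 0) - (𝓛).i1 (x, 0) :=
      (hf.1.comp (measurable_id.prodMk measurable_const)).sub
        (hi1.comp (measurable_id.prodMk measurable_const))
    refine ⟨_, (hg.comp (measurable_info (ξ .v))).stronglyMeasurable, ?_⟩
    filter_upwards [hz0] with ω e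
    simp only [I1, Profile.withI1, Function.comp, e]
  · intro f hf
    refine Filter.Eventually.of_forall fun ω => ?_
    simp only []
    rw [profit_withI1 hM c ξ f ω hΛ1 hΛ22 h1 h2, profit_withI1 hM c ξ (𝓛).i1 ω hΛ1 hΛ22 h1 h2]
    have e1 : I1 ((𝓛).withI1 (𝓛).i1) ξ ω = M.σ1 * ((𝓺).A1 * nrm M ξ .v ω + nrm M ξ .z ω) :=
      I1_eq c ξ ω hM
    have e2 : nl M ξ b ω = nl M ξ w ω - 2 * (𝓺).curv J₁ J₂ *
        ((𝓺).A1 * nrm M ξ .v ω + nrm M ξ .z ω) := by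
      have e3 : lin (nrm M ξ) (coef (𝓺).A1 1 0 0 0 0) ω = (𝓺).A1 * nrm M ξ .v ω + nrm M ξ .z ω := by
        rw [Dimless.lin_shock]
        simp [coef]
      simp only [b, nl, lin_sub, lin_smul, e3]
    rw [e2, e1, hκ]
    field_simp
    ring
  · intro t
    exact ⟨fun x => (𝓛).i1 x + t, ⟨hi1.add_const t, hadm.2.add (memLp_const t)⟩, fun ω => rfl⟩

end IT


/-! ### Covariances of the equilibrium quantities -/

namespace Dimless

variable (q : Dimless) (J₁ J₂ : ℕ)

/-- Slope of the second order of a Small-IT in her signal, given the order flow. -/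
def b2s : ℝ := q.β21 + (q.β23 - q.β22) * q.β11

/-- Coefficient of IT's first order in the order flow at time `2`. -/
def G : ℝ := q.α22 + J₁ * q.β22 * q.B J₁ J₂ + J₁ * q.b2s - J₂ * q.β12

/-- Conditional variance of the order flow at time `1₊`. -/
noncomputable def varp : ℝ :=
  q.B J₁ J₂ ^ 2 * ((q.S - 1) / q.S) + q.θp + q.θε * (J₁ * q.β11 ^ 2 + J₂ * q.β12 ^ 2)

/-- Conditional covariance of the value and the order flow at time `2`. -/
noncomputable def covv2 : ℝ := q.A21 * (1 - q.A1 ^ 2 / q.S) + q.G J₁ J₂ * (q.A1 / q.S)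

/-- Conditional covariance of the order flows at times `1₊` and `2`. -/
noncomputable def covp2 : ℝ :=
  q.A21 * q.B J₁ J₂ * (q.A1 / q.S) + q.B J₁ J₂ * q.G J₁ J₂ * ((q.S - 1) / q.S) +
    q.θp * (J₁ * q.β22) + q.θε * (J₁ * (q.β11 * (J₁ * q.β22 * q.β11 + q.b2s)) +
      J₂ * (q.β12 * (J₁ * q.β22 * q.β12 - q.β12)))

/-- Conditional variance of the order flow at time `2`, without the noise orders at this time. -/
noncomputable def var2 : ℝ :=
  q.A21 ^ 2 * (1 - q.A1 ^ 2 / q.S) + 2 * q.A21 * q.G J₁ J₂ * (q.A1 / q.S) +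
    q.G J₁ J₂ ^ 2 * ((q.S - 1) / q.S) + q.θp * (J₁ * q.β22) ^ 2 +
      q.θε * (J₁ * (J₁ * q.β22 * q.β11 + q.b2s) ^ 2 + J₂ * (J₁ * q.β22 * q.β12 - q.β12) ^ 2)

/-- Determinant of the normal equations for the price at time `2`. -/
noncomputable def det : ℝ := q.varp J₁ J₂ * (q.var2 J₁ J₂ + q.θ2) - q.covp2 J₁ J₂ ^ 2

/-- Cramer numerator for `Λ₂₁`. -/
noncomputable def num1 : ℝ :=
  q.B J₁ J₂ * (q.A1 / q.S) * (q.var2 J₁ J₂ + q.θ2) - q.covv2 J₁ J₂ * q.covp2 J₁ J₂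

/-- Cramer numerator for `Λ₂₂`. -/
noncomputable def num2 : ℝ :=
  q.covv2 J₁ J₂ * q.varp J₁ J₂ - q.B J₁ J₂ * (q.A1 / q.S) * q.covp2 J₁ J₂

variable {q J₁ J₂}

lemma θz_eq : q.θz = q.S - 1 - q.A1 ^ 2 := by simp only [S]; ring

section Mixed

variable (hS : q.S ≠ 0) (hA : q.A1 ≠ 0) (hA21 : q.A21 = q.S / (2 * q.A1)) (hα22 : q.α22 = -(q.S / 2))
include hS hA hA21 hα22

set_option maxHeartbeats 4000000 in
-- Up to a positive factor the long polynomial is the determinant of the normal equations, once the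
-- values of `A21` and `α22` are inserted and `θz` is expressed through `S`. It therefore never
-- vanishes, by `det_pos`.
lemma mixedEq1_den_eq : mixedEq1_den J₁ J₂ q.θp q.θ2 q.θε q.A1 q.θz q.β21 q.β11 q.β22 q.β23 q.β12 =
    4 * q.A1 ^ 2 * q.S * q.det J₁ J₂ := by
  rw [θz_eq, det]
  simp only [mixedEq1_den, mixedEq1_den_1, mixedEq1_den_2, mixedEq1_den_3, mixedEq1_den_4, varp, var2,
    covp2, G, b2s, B, hA21, hα22]
  field_simp
  ring

set_option maxHeartbeats 4000000 in
-- Together with `mixedEq1_den_eq`, the fraction in the first equation is the Cramer quotient for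
-- `Λ21`.
lemma mixedEq1_num_eq : mixedEq1_num J₁ J₂ q.θp q.θ2 q.θε q.A1 q.θz q.β21 q.β11 q.β22 q.β23 q.β12 =
    4 * q.A1 * q.S * q.num1 J₁ J₂ := by
  rw [θz_eq, num1]
  simp only [mixedEq1_num, mixedEq1_num_1, mixedEq1_num_2, covv2, var2,
    covp2, G, b2s, B, hA21, hα22]
  field_simp
  ring

set_option maxHeartbeats 4000000 in
-- With `Λ22 = A1 / S`, its vanishing is Cramer's rule for `Λ22`.
lemma mixedEq2_eq : mixedEq2 J₁ J₂ q.θp q.θ2 q.θε q.A1 q.θz q.β21 q.β11 q.β22 q.β23 q.β12 =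
    4 * q.A1 ^ 2 * q.S * q.det J₁ J₂ - 4 * q.A1 * q.S ^ 2 * q.num2 J₁ J₂ := by
  rw [θz_eq, num2, det]
  simp only [mixedEq2, mixedEq2_1, mixedEq2_2, mixedEq2_3, mixedEq2_4, covv2, var2, varp,
    covp2, G, b2s, B, hA21, hα22]
  field_simp
  ring

end Mixed

section Pure

variable (hS : q.S = q.A1 ^ 2 + 1) (hΛ : q.Λ22 ≠ 0) (hA21 : q.A21 = 1 / (2 * q.Λ22))
  (hα22 : q.α22 = -((q.β11 * J₁ * (q.β22 * (J₁ - 1) * q.Λ22 + q.Λ21) +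
        2 * (q.β12 * J₂ * (q.β22 * J₁ * q.Λ22 + q.Λ21 - q.Λ22) + q.β21 * J₁ * q.Λ22)) / (4 * q.Λ22)))
  (hβ23 : q.β23 = -((q.β22 * (J₁ - 1) * q.Λ22 + q.Λ21) / (2 * q.Λ22)))
include hS hΛ hA21 hα22 hβ23

set_option maxHeartbeats 4000000 in
-- Here `Λ21` and `Λ22` are unknowns of the system, so Cramer's rule appears with denominators
-- cleared, after elimination of `A21`, `α22` and `β23`.
lemma pureEq1_eq : pureEq1 J₁ J₂ q.θp q.θ2 q.θε q.Λ21 q.Λ22 q.A1 q.β11 q.β21 q.β22 q.β12 =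
    16 * q.Λ22 ^ 2 * q.S * (q.Λ21 * q.det J₁ J₂ - q.num1 J₁ J₂) := by
  have h1 : q.A1 ^ 2 + 1 ≠ 0 := by positivity
  rw [num1, det]
  simp only [pureEq1, pureEq1_1, pureEq1_2, pureEq1_3, pureEq1_4, pureEq1_5, pureEq1_6, varp, var2,
    covv2, covp2, G, b2s, B, hA21, hα22, hβ23, hS]
  field_simp
  ring

set_option maxHeartbeats 4000000 in
lemma pureEq2_eq : pureEq2 J₁ J₂ q.θp q.θ2 q.θε q.Λ21 q.Λ22 q.A1 q.β11 q.β21 q.β22 q.β12 =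
    16 * q.Λ22 * q.S * (q.Λ22 * q.det J₁ J₂ - q.num2 J₁ J₂) := by
  have h1 : q.A1 ^ 2 + 1 ≠ 0 := by positivity
  rw [num2, det]
  simp only [pureEq2, pureEq2_1, pureEq2_2, pureEq2_3, pureEq2_4, varp, var2,
    covv2, covp2, G, b2s, B, hA21, hα22, hβ23, hS]
  field_simp
  ring
end Pure

end Dimless


/-! ### First-order conditions of the high-frequency traders -/

namespace Dimless

variable (q : Dimless) (J₁ J₂ : ℕ)

/-- Conditional variance of a signal. -/
noncomputable def sigVar : ℝ := (q.S - 1) / q.S + q.θε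

/-- Conditional variance of the order flow at time `1₊` without the order of one Small-IT. -/
noncomputable def othVar : ℝ := (q.B J₁ J₂ - q.β11) ^ 2 * ((q.S - 1) / q.S) + q.θp +
  q.θε * ((J₁ - 1) * q.β11 ^ 2 + J₂ * q.β12 ^ 2)

/-- Conditional covariance of this order flow with the signal of that Small-IT. -/
noncomputable def othSig : ℝ := (q.B J₁ J₂ - q.β11) * ((q.S - 1) / q.S)

/-- Weight of the first orders of the others in the marginal profit of a Small-IT at time `2`. -/
def othWeight : ℝ := q.Λ21 + q.Λ22 * ((J₁ + 1) * q.β22)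

/-- Weight of IT's first order in the marginal profit of a Small-IT at time `2`. -/
def ordWeight : ℝ := -(q.Λ22 * (q.α22 + (J₁ - 1) * q.b2s - J₂ * q.β12 + 2 * q.β21)) -
  q.othWeight J₁ * (q.B J₁ J₂ - q.β11)

/-- Covariance with her signal of the marginal profit of a Small-IT at time `2`. -/
noncomputable def margSig : ℝ := (1 - q.Λ22 * q.A21) * (q.A1 / q.S) +
  q.ordWeight J₁ J₂ * ((q.S - 1) / q.S) - 2 * q.θε * q.Λ22 * q.β21

/-- Covariance with the orders of the others of the marginal profit of a Small-IT at time `2`. -/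
noncomputable def margOth : ℝ :=
  (1 - q.Λ22 * q.A21) * ((q.B J₁ J₂ - q.β11) * (q.A1 / q.S)) +
    q.ordWeight J₁ J₂ * ((q.B J₁ J₂ - q.β11) * ((q.S - 1) / q.S)) - q.θp * q.othWeight J₁ +
      q.θε * ((J₁ - 1) * (q.β11 * (-(q.othWeight J₁ * q.β11) - q.Λ22 * q.b2s)) +
        J₂ * (q.β12 * (-(q.othWeight J₁ * q.β12) + q.Λ22 * q.β12)))

/-- Marginal effect of her own first order on the marginal profit of a Small-IT at time `2`. -/
def link : ℝ := q.Λ21 + q.Λ22 * (J₁ * q.β22 - q.β22) + 2 * q.Λ22 * q.β23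

/-- Curvature of the first problem of a Small-IT. -/
def curvS : ℝ := q.Λp - q.Λ22 * q.β23 ^ 2

/-- Curvature of the first problem of a Round-Tripper. -/
def curvR : ℝ := q.Λp - q.Λ21 - q.Λ22 * (J₁ * q.β22) + q.Λ22

/-- Covariance with her signal of the marginal profit of a Small-IT at time `1₊`. -/
noncomputable def focS : ℝ := q.A1 / q.S - q.Λp * q.othSig J₁ J₂ +
  2 * q.β23 * q.Λ22 * (q.β21 * q.sigVar + q.β22 * q.othSig J₁ J₂) - 2 * q.curvS * q.β11 * q.sigVar

/-- Covariance with her signal of the marginal profit of a Round-Tripper at time `1₊`. -/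
noncomputable def focR : ℝ :=
  (q.Λ21 - q.Λp) * (q.B J₁ J₂ * ((q.S - 1) / q.S) + q.θε * q.β12) +
    q.Λ22 * (q.A21 * (q.A1 / q.S) + q.G J₁ J₂ * ((q.S - 1) / q.S) +
      q.θε * (J₁ * q.β22 * q.β12 - q.β12)) - q.curvR J₁ * q.β12 * q.sigVar

variable {q J₁ J₂}

lemma ip_gainp_flowp (hS : q.S ≠ 0) : ip q.var q.gainp (q.flowp (J₁ := J₁) (J₂ := J₂)) =
    q.B J₁ J₂ * (q.A1 / q.S) - q.Λp * q.varp J₁ J₂ := by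
  simp only [gainp, ip_sub_left, ip_smul_left, value, flowp, q.ip_res hS, b1, varp,
    Fintype.sum_sum_type, Sum.elim_inl, Sum.elim_inr, Finset.sum_const, Finset.card_univ,
    Fintype.card_fin, nsmul_eq_mul, Pi.zero_apply]
  ring

lemma ip_gain2_flowp (hS : q.S ≠ 0) : ip q.var q.gain2 (q.flowp (J₁ := J₁) (J₂ := J₂)) =
    q.B J₁ J₂ * (q.A1 / q.S) - q.Λ21 * q.varp J₁ J₂ - q.Λ22 * q.covp2 J₁ J₂ := by
  simp [gain2, ip_sub_left, ip_smul_left, value, flowp, flow2, q.ip_res hS, b1, b2, varp, covp2, G, b2s]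
  ring

lemma ip_gain2_flow2 (hS : q.S ≠ 0) : ip q.var q.gain2 (q.flow2 (J₁ := J₁) (J₂ := J₂)) =
    q.covv2 J₁ J₂ - q.Λ21 * q.covp2 J₁ J₂ - q.Λ22 * (q.var2 J₁ J₂ + q.θ2) := by
  simp [gain2, ip_sub_left, ip_smul_left, value, flowp, flow2, q.ip_res hS, b1, b2, covv2, var2, covp2,
    G, b2s]
  ring

lemma ip_sig (hS : q.S ≠ 0) (j : Fin J₁ ⊕ Fin J₂) (a b c d : ℝ) (e : Fin J₁ ⊕ Fin J₂ → ℝ) :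
    ip q.var (q.res a b c d e) (q.sig j) =
      a * (q.A1 / q.S) + b * ((q.S - 1) / q.S) + q.θε * e j := by
  simp [sig, q.ip_res hS, Pi.single_apply]

lemma ip_sig_right (hS : q.S ≠ 0) (j : Fin J₁ ⊕ Fin J₂) (a b c d : ℝ) (e : Fin J₁ ⊕ Fin J₂ → ℝ) :
    ip q.var (q.sig j) (q.res a b c d e) =
      a * (q.A1 / q.S) + b * ((q.S - 1) / q.S) + q.θε * e j := by
  rw [ip_comm, ip_sig hS]

lemma ip_sig_sig (hS : q.S ≠ 0) (j : Fin J₁ ⊕ Fin J₂) :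
    ip q.var (q.sig j) (q.sig j) = q.sigVar := by
  have := ip_sig hS j 0 1 0 0 (Pi.single j 1)
  simpa [sigVar, sig] using this

/-- The marginal profit at time `2` depends on her own first order with coefficient `-link`.
Splitting this term off leaves quantities that involve only her signal and the orders of the others.
-/
lemma ip_marg_sig (hS : q.S ≠ 0) (i : Fin J₁) :
    ip q.var (q.gain2 - q.Λ22 • q.ord2 (.inl i)) (q.sig (J₁ := J₁) (J₂ := J₂) (.inl i)) =
      q.margSig J₁ J₂ - q.link J₁ * q.β11 * q.sigVar := by
  simp only [gain2, ord2, ip_sub_left, ip_add_left, ip_smul_left, value, flowp, flow2, ip_sig hS,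
    ip_sig_sig hS]
  simp [b1, b2, slope, margSig, link, sigVar, ordWeight, othWeight, b2s]
  ring

/-- The flow at time `1₊` is the flow of the others plus `β11` times her signal. Given the condition
on the signal, orthogonality to the whole flow is thus orthogonality to the flow of the others. -/
lemma ip_marg_flowp (hS : q.S ≠ 0) (i : Fin J₁) :
    ip q.var (q.gain2 - q.Λ22 • q.ord2 (.inl i)) (q.flowp (J₁ := J₁) (J₂ := J₂)) =
      q.margOth J₁ J₂ - q.link J₁ * q.β11 * q.othSig J₁ J₂ +
        q.β11 * (q.margSig J₁ J₂ - q.link J₁ * q.β11 * q.sigVar) := by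
  simp only [gain2, ord2, ip_sub_left, ip_add_left, ip_smul_left, value, flowp, flow2, ip_sig_right hS,
    q.ip_res hS]
  simp [b1, b2, slope, margSig, margOth, link, sigVar, othSig, ordWeight, othWeight, b2s]
  ring

/-- When `link` vanishes, the effect of her first order on time `2` is `β23` times the second-stage
marginal profit plus `2 Λ22 β23` times her second order. The first part drops out once the
second-stage condition holds, and `focS` remains. -/
lemma ip_first_inl (hS : q.S ≠ 0) (i : Fin J₁) (hlink : q.link J₁ = 0) :
    ip q.var (q.gainp - (q.Λp * q.b1 (.inl i : Fin J₁ ⊕ Fin J₂)) • q.sig (.inl i : Fin J₁ ⊕ Fin J₂) +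
      q.own (.inl i : Fin J₁ ⊕ Fin J₂) • q.gain2 - (q.impact (.inl i : Fin J₁ ⊕ Fin J₂) +
        q.Λ22 * q.own (.inl i : Fin J₁ ⊕ Fin J₂)) • q.ord2 (.inl i)) (q.sig (.inl i)) = q.focS J₁ J₂ + q.β23 * q.margSig J₁ J₂ := by
  have h := ip_marg_sig (J₂ := J₂) hS i
  rw [hlink, ip_sub_left, ip_smul_left] at h
  have hi : q.impact (J₂ := J₂) (.inl i) = -(2 * q.Λ22 * q.β23) := by
    have : q.impact (J₂ := J₂) (.inl i) = q.link J₁ - 2 * q.Λ22 * q.β23 := by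
      simp [impact, slope, link]
    rw [this, hlink]
    ring
  have ho : ip q.var (q.ord2 (.inl i)) (q.sig (J₁ := J₁) (J₂ := J₂) (.inl i)) =
      (q.β21 + q.β23 * q.β11) * q.sigVar + q.β22 * q.othSig J₁ J₂ := by
    simp only [ord2, ip_add_left, ip_smul_left, flowp, ip_sig hS, ip_sig_sig hS]
    simp [b1, b2, slope, sigVar, othSig]
    ring
  have hp : ip q.var q.gainp (q.sig (J₁ := J₁) (J₂ := J₂) (.inl i)) =
      q.A1 / q.S - q.Λp * (q.othSig J₁ J₂ + q.β11 * q.sigVar) := by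
    simp only [gainp, ip_sub_left, ip_smul_left, value, flowp, ip_sig hS, b1, sigVar, othSig,
      Sum.elim_inl, Pi.zero_apply]
    ring
  rw [ip_sub_left, ip_add_left, ip_sub_left, ip_smul_left, ip_smul_left, ip_smul_left, hp,
    ip_sig_sig hS, hi]
  rw [ho] at h ⊢
  simp only [own, b1, Sum.elim_inl, focS, curvS]
  linear_combination q.β23 * h

lemma ip_first_inr (hS : q.S ≠ 0) (i : Fin J₂) :
    ip q.var (q.gainp - (q.Λp * q.b1 (.inr i : Fin J₁ ⊕ Fin J₂)) • q.sig (.inr i : Fin J₁ ⊕ Fin J₂) +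
      q.own (.inr i : Fin J₁ ⊕ Fin J₂) • q.gain2 - (q.impact (.inr i : Fin J₁ ⊕ Fin J₂) +
        q.Λ22 * q.own (.inr i : Fin J₁ ⊕ Fin J₂)) • q.ord2 (.inr i)) (q.sig (.inr i)) = q.focR J₁ J₂ := by
  simp only [gainp, gain2, ord2, ip_sub_left, ip_add_left, ip_smul_left, value, flowp, flow2,
    ip_sig hS, ip_sig_sig hS]
  simp [b1, b2, slope, own, impact, focR, curvR, G, b2s]
  ring

/-- The expression is the variance of a combination of the residuals of the value and of IT's first
order; it is rewritten as a sum of squares over `S`. -/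
lemma sum_nonneg_of_gram {a b : ℝ} (hz : 0 ≤ q.θz) :
    0 ≤ a ^ 2 * (1 - q.A1 ^ 2 / q.S) + 2 * a * b * (q.A1 / q.S) + b ^ 2 * ((q.S - 1) / q.S) := by
  have hS := S_pos q hz
  have : a ^ 2 * (1 - q.A1 ^ 2 / q.S) + 2 * a * b * (q.A1 / q.S) + b ^ 2 * ((q.S - 1) / q.S) =
      ((a + q.A1 * b) ^ 2 + q.θz * (a ^ 2 + b ^ 2)) / q.S := by
    rw [θz_eq]
    field_simp
    ring
  rw [this]
  positivity

lemma S_sub_one_nonneg (hz : 0 ≤ q.θz) : 0 ≤ (q.S - 1) / q.S := by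
  have := sum_nonneg_of_gram (q := q) (a := 0) (b := 1) hz
  simpa using this

lemma varp_pos (hz : 0 ≤ q.θz) (hp : 0 < q.θp) (hε : 0 ≤ q.θε) : 0 < q.varp J₁ J₂ := by
  have := S_sub_one_nonneg hz
  rw [varp]
  positivity

/-- By the Cauchy-Schwarz inequality for the two flows without `u₂`, the determinant is at least
`varp * θ2`, and the noise orders at times `1₊` and `2` make this positive. -/
lemma det_pos (hz : 0 ≤ q.θz) (hp : 0 < q.θp) (hε : 0 ≤ q.θε) (h2 : 0 < q.θ2) :
    0 < q.det J₁ J₂ := by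
  have hV := varp_pos (J₁ := J₁) (J₂ := J₂) hz hp hε
  have key : 0 ≤ q.varp J₁ J₂ * (q.varp J₁ J₂ * q.var2 J₁ J₂ - q.covp2 J₁ J₂ ^ 2) := by
    -- The right side is the variance of `varp` times the flow at time `2`, without `u₂`, minus
    -- `covp2` times the flow at time `1₊`.
    have e : q.varp J₁ J₂ * (q.varp J₁ J₂ * q.var2 J₁ J₂ - q.covp2 J₁ J₂ ^ 2) =
        ((q.varp J₁ J₂ * q.A21) ^ 2 * (1 - q.A1 ^ 2 / q.S) + 2 * (q.varp J₁ J₂ * q.A21) *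
          (q.varp J₁ J₂ * q.G J₁ J₂ - q.covp2 J₁ J₂ * q.B J₁ J₂) * (q.A1 / q.S) +
          (q.varp J₁ J₂ * q.G J₁ J₂ - q.covp2 J₁ J₂ * q.B J₁ J₂) ^ 2 * ((q.S - 1) / q.S)) +
        (q.θp * (q.varp J₁ J₂ * (J₁ * q.β22) - q.covp2 J₁ J₂) ^ 2 + q.θε *
          (J₁ * (q.varp J₁ J₂ * (J₁ * q.β22 * q.β11 + q.b2s) - q.covp2 J₁ J₂ * q.β11) ^ 2 +
            J₂ * (q.varp J₁ J₂ * (J₁ * q.β22 * q.β12 - q.β12) - q.covp2 J₁ J₂ * q.β12) ^ 2)) := by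
      -- Opaque names let the definitions of the three moments enter as linear relations, instead of
      -- being expanded inside their own products.
      obtain ⟨V, hV'⟩ : ∃ V, V = q.varp J₁ J₂ := ⟨_, rfl⟩
      obtain ⟨C, hC'⟩ : ∃ C, C = q.covp2 J₁ J₂ := ⟨_, rfl⟩
      obtain ⟨W, hW'⟩ : ∃ W, W = q.var2 J₁ J₂ := ⟨_, rfl⟩
      rw [← hV', ← hC', ← hW']
      rw [varp] at hV'
      rw [covp2] at hC'
      rw [var2] at hW'
      linear_combination (V ^ 2) * hW' - 2 * V * C * hC' + C ^ 2 * hV'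
    rw [e]
    have := sum_nonneg_of_gram (q := q) (a := q.varp J₁ J₂ * q.A21)
      (b := q.varp J₁ J₂ * q.G J₁ J₂ - q.covp2 J₁ J₂ * q.B J₁ J₂) hz
    positivity
  have h := nonneg_of_mul_nonneg_right key hV
  have : 0 < q.varp J₁ J₂ * q.θ2 := mul_pos hV h2
  rw [det]
  linarith

lemma sigVar_pos (hz : 0 ≤ q.θz) (hA : q.A1 ≠ 0) (hε : 0 ≤ q.θε) : 0 < q.sigVar := by
  have hS := S_pos q hz
  have h : q.S - 1 = q.A1 ^ 2 + q.θz := by rw [S]; ring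
  rw [sigVar, h]
  positivity

/-- The flow of the others contains the independent noise `u₁₊`, so it is not proportional to the
signal. The assumption `1 ≤ J₁` keeps the number `J₁ - 1` of other Small-ITs nonnegative. -/
lemma oth_gram_pos (hJ₁ : 1 ≤ J₁) (hz : 0 ≤ q.θz) (hA : q.A1 ≠ 0) (hp : 0 < q.θp) (hε : 0 ≤ q.θε) :
    0 < q.othVar J₁ J₂ * q.sigVar - q.othSig J₁ J₂ ^ 2 := by
  have h0 := S_sub_one_nonneg hz
  have h1 := sigVar_pos hz hA hε
  have h2 : (0 : ℝ) ≤ J₁ - 1 := by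
    have : (1 : ℝ) ≤ J₁ := by exact_mod_cast hJ₁
    linarith
  have e : q.othVar J₁ J₂ * q.sigVar - q.othSig J₁ J₂ ^ 2 =
      (q.B J₁ J₂ - q.β11) ^ 2 * ((q.S - 1) / q.S) * q.θε + q.θp * q.sigVar +
        q.θε * ((J₁ - 1) * q.β11 ^ 2 + J₂ * q.β12 ^ 2) * q.sigVar := by
    simp only [othVar, sigVar, othSig]
    ring
  rw [e]
  positivity

end Dimless


/-! ### The explicit mixed-strategy system -/

namespace Dimless

variable (q : Dimless) (J₁ J₂ : ℕ)

/-- Cramer numerator for the regression coefficient on the signal of a Small-IT. -/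
noncomputable def resSig : ℝ := q.margSig J₁ J₂ * q.othVar J₁ J₂ - q.margOth J₁ J₂ * q.othSig J₁ J₂

/-- Cramer numerator for the regression coefficient on the orders of the others. -/
noncomputable def resOth : ℝ := q.margOth J₁ J₂ * q.sigVar - q.margSig J₁ J₂ * q.othSig J₁ J₂

variable {q J₁ J₂}

/-- Multiplication by the adjugate of the invertible Gram matrix of the signal and the flow of the
others. -/
lemma resSig_resOth_eq_zero_iff (h : q.othVar J₁ J₂ * q.sigVar - q.othSig J₁ J₂ ^ 2 ≠ 0) :
    q.resSig J₁ J₂ = 0 ∧ q.resOth J₁ J₂ = 0 ↔ q.margSig J₁ J₂ = 0 ∧ q.margOth J₁ J₂ = 0 := by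
  constructor
  · rintro ⟨h1, h2⟩
    rw [resSig] at h1
    rw [resOth] at h2
    constructor
    · refine (mul_eq_zero.mp ?_).resolve_right h
      linear_combination q.sigVar * h1 + q.othSig J₁ J₂ * h2
    · refine (mul_eq_zero.mp ?_).resolve_right h
      linear_combination q.othVar J₁ J₂ * h2 + q.othSig J₁ J₂ * h1
  · rintro ⟨h1, h2⟩
    simp [resSig, resOth, h1, h2]

/-- The positive part always comes with the factor `n - 1`. It differs from `n - 2` only at `n = 1`,
where this factor is zero. -/
lemma sub_one_mul_max {n : ℕ} (hn : 1 ≤ n) : ((n : ℝ) - 1) * max ((n : ℝ) - 2) 0 = (n - 1) * (n - 2) := by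
  obtain _ | _ | n := n
  · simp at hn
  · simp
  · rw [max_eq_left]
    push_cast
    linarith [n.cast_nonneg (α := ℝ)]

lemma varp_eq (hS : q.S ≠ 0) : (q.β11 ^ 2 * J₁ * (q.θε * (q.A1 ^ 2 + q.θz + 1) + J₁ * (q.A1 ^ 2 + q.θz)) + 2 * q.β11 * q.β12 * J₁ * J₂ * (q.A1 ^ 2 + q.θz) + q.β12 ^ 2 * J₂ * (q.θε * (q.A1 ^ 2 + q.θz + 1) + J₂ * (q.A1 ^ 2 + q.θz)) + q.θp * (q.A1 ^ 2 + q.θz + 1)) =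
    q.S * q.varp J₁ J₂ := by
  rw [θz_eq, varp, B]
  field_simp
  ring

lemma sigVar_eq (hS : q.S ≠ 0) : q.A1 ^ 2 * (q.θε + 1) + q.θε * q.θz + q.θε + q.θz =
    q.S * q.sigVar := by
  rw [θz_eq, sigVar]
  field_simp
  ring

lemma sum_eq : q.A1 ^ 2 + q.θz + 1 = q.S := rfl

section Mixed

variable (hJ₁ : 1 ≤ J₁) (hS : q.S ≠ 0) (hA : q.A1 ≠ 0) (hB : q.B J₁ J₂ ≠ 0) (hΛ22 : q.Λ22 = q.A1 / q.S)
  (hA21 : q.A21 = q.S / (2 * q.A1)) (hα22 : q.α22 = -(q.S / 2))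
  (hΛ21 : q.Λ21 = q.A1 * (q.A1 ^ 2 - q.β11 * q.β22 * J₁ ^ 2 + q.β11 * q.β22 * J₁ - q.β11 * q.β23 * J₁ - q.β12 * q.β22 * J₁ * J₂ + q.β12 * J₂ - q.β21 * J₁ + q.θz + 1) / ((q.A1 ^ 2 + q.θz + 1) * (q.β11 * J₁ + q.β12 * J₂)))
  (hV : q.varp J₁ J₂ ≠ 0) (hΛp : q.Λp = q.A1 * q.B J₁ J₂ / (q.S * q.varp J₁ J₂))
include hS hA hB hΛ22 hA21 hα22 hΛ21

include hJ₁ in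
set_option maxHeartbeats 4000000 in
lemma mixedEq4_eq : q.A1 * mixedEq4 J₁ J₂ q.θp q.θ2 q.θε q.A1 q.θz q.β21 q.β11 q.β22 q.β23 q.β12 =
    2 * q.S ^ 2 * q.resSig J₁ J₂ := by
  have hm := sub_one_mul_max hJ₁
  rw [B] at hB
  simp only [mixedEq4, mixedEq4_1, mixedEq4_2]
  generalize max ((J₁ : ℝ) - 2) 0 = m at hm
  rw [sum_eq] at hΛ21
  simp only [resSig, margSig, margOth, othVar, othSig, ordWeight, othWeight, b2s, B, hΛ21, hΛ22, hA21, hα22, θz_eq]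
  field_simp
  -- Both cases are polynomial identities; `sub_one_mul_max` says that there is no third one.
  obtain h | rfl : (J₁ : ℝ) = 1 ∨ m = (J₁ : ℝ) - 2 := by
    rcases mul_eq_zero.mp (show ((J₁ : ℝ) - 1) * (m - (J₁ - 2)) = 0 by linear_combination hm) with h | h
    · exact .inl (sub_eq_zero.mp h)
    · exact .inr (sub_eq_zero.mp h)
  · rw [h]
    ring
  · ring

include hJ₁ in
set_option maxHeartbeats 4000000 in
-- `Λ21` enters `resOth` only as `-Λ21` times the Gram determinant. After multiplication by `B` it
-- can be replaced through the value of `B * Λ21`, so no division by `B` is left.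
lemma mixedEq5_eq : q.A1 * mixedEq5 J₁ J₂ q.θp q.θ2 q.θε q.A1 q.θz q.β21 q.β11 q.β22 q.β23 q.β12 =
    -(2 * q.S ^ 2 * q.B J₁ J₂ * q.resOth J₁ J₂) := by
  have hm := sub_one_mul_max hJ₁
  have hL : q.B J₁ J₂ * q.Λ21 = q.A1 * (q.A1 ^ 2 - q.β11 * q.β22 * J₁ ^ 2 + q.β11 * q.β22 * J₁ - q.β11 * q.β23 * J₁ - q.β12 * q.β22 * J₁ * J₂ + q.β12 * J₂ - q.β21 * J₁ + q.θz + 1) / q.S := by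
    rw [hΛ21, sum_eq, ← B, ← div_div, mul_div_cancel₀ _ hB]
  have e : q.B J₁ J₂ * q.resOth J₁ J₂ = q.B J₁ J₂ * (q.resOth J₁ J₂ + q.Λ21 *
      (q.othVar J₁ J₂ * q.sigVar - q.othSig J₁ J₂ ^ 2)) - q.B J₁ J₂ * q.Λ21 *
      (q.othVar J₁ J₂ * q.sigVar - q.othSig J₁ J₂ ^ 2) := by ring
  rw [mul_assoc _ (q.B J₁ J₂), e, hL]
  simp only [mixedEq5, mixedEq5_1, mixedEq5_2, mixedEq5_3, mixedEq5_4, mixedEq5_5]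
  generalize max ((J₁ : ℝ) - 2) 0 = m at hm
  simp only [resOth, margSig, margOth, sigVar, othVar, othSig, ordWeight, othWeight, b2s, B]
  rw [hΛ22, hA21, hα22, θz_eq]
  field_simp
  obtain h | rfl : (J₁ : ℝ) = 1 ∨ m = (J₁ : ℝ) - 2 := by
    rcases mul_eq_zero.mp (show ((J₁ : ℝ) - 1) * (m - (J₁ - 2)) = 0 by linear_combination hm) with h | h
    · exact .inl (sub_eq_zero.mp h)
    · exact .inr (sub_eq_zero.mp h)
  · rw [h]
    ring
  · ring

/-- The sixth equation expresses optimality of the second order of a Small-IT after her own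
deviations. -/
lemma mixedEq6_eq : q.A1 * mixedEq6 J₁ J₂ q.θp q.θ2 q.θε q.A1 q.θz q.β21 q.β11 q.β22 q.β23 q.β12 * 2 =
    q.S * q.link J₁ := by
  rw [B] at hB
  rw [sum_eq] at hΛ21
  have h2 : 2 * q.β11 * J₁ + 2 * q.β12 * J₂ = 2 * (q.β11 * J₁ + q.β12 * J₂) := by ring
  rw [mixedEq6, h2, link, hΛ21, hΛ22, θz_eq]
  field_simp
  ring

end Mixed

end Dimless


namespace Dimless

variable {q : Dimless} {J₁ J₂ : ℕ}

section Mixed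

variable (hS : q.S ≠ 0) (hA : q.A1 ≠ 0) (hB : q.B J₁ J₂ ≠ 0) (hΛ22 : q.Λ22 = q.A1 / q.S)
  (hA21 : q.A21 = q.S / (2 * q.A1)) (hα22 : q.α22 = -(q.S / 2))
  (hΛ21 : q.Λ21 = q.A1 * (q.A1 ^ 2 - q.β11 * q.β22 * J₁ ^ 2 + q.β11 * q.β22 * J₁ - q.β11 * q.β23 *
      J₁ - q.β12 * q.β22 * J₁ * J₂ + q.β12 * J₂ - q.β21 * J₁ + q.θz + 1) / ((q.A1 ^ 2 + q.θz + 1) *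
      (q.β11 * J₁ + q.β12 * J₂)))

include hS hA hA21 hα22 hΛ21 in
lemma mixedEq1_eq (hdet : q.det J₁ J₂ ≠ 0) : mixedEq1 J₁ J₂ q.θp q.θ2 q.θε q.A1 q.θz q.β21 q.β11
    q.β22 q.β23 q.β12 =
    (q.Λ21 * q.det J₁ J₂ - q.num1 J₁ J₂) / q.det J₁ J₂ := by
  rw [mixedEq1, mixedEq1_den_eq hS hA hA21 hα22, mixedEq1_num_eq hS hA hA21 hα22, sub_div,
    mul_div_cancel_right₀ _ hdet]
  congr 1
  · rw [hΛ21, mul_comm (q.β11 * J₁ + q.β12 * J₂)]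
    ring
  · field_simp

include hS hA hA21 hα22 hΛ22 in
lemma mixedEq2_eq' : mixedEq2 J₁ J₂ q.θp q.θ2 q.θε q.A1 q.θz q.β21 q.β11 q.β22 q.β23 q.β12 =
    4 * q.A1 * q.S ^ 2 * (q.Λ22 * q.det J₁ J₂ - q.num2 J₁ J₂) := by
  rw [mixedEq2_eq hS hA hA21 hα22, hΛ22]
  field_simp

variable (hV : q.varp J₁ J₂ ≠ 0) (hΛp : q.Λp = q.A1 * q.B J₁ J₂ / (q.S * q.varp J₁ J₂))

include hS hA hΛ22 hV hΛp in
lemma curvS_eq : ((q.β11 * J₁ + q.β12 * J₂) / (q.β11 ^ 2 * J₁ * (q.θε * (q.A1 ^ 2 + q.θz + 1) + J₁ *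
    (q.A1 ^ 2 + q.θz)) + 2 * q.β11 * q.β12 * J₁ * J₂ * (q.A1 ^ 2 + q.θz) + q.β12 ^ 2 * J₂ * (q.θε *
    (q.A1 ^ 2 + q.θz + 1) + J₂ * (q.A1 ^ 2 + q.θz)) + q.θp * (q.A1 ^ 2 + q.θz + 1)) - q.β23 ^ 2 /
    (q.A1 ^ 2 + q.θz + 1)) =
    q.curvS / q.A1 := by
  rw [varp_eq hS, sum_eq, curvS, hΛp, hΛ22, ← B]
  field_simp

include hS hΛ22 hΛ21 hΛp in
lemma curvR_eq : ((q.A1 * (q.β11 * J₁ + q.β12 * J₂)) / (q.β11 ^ 2 * J₁ * (q.θε * (q.A1 ^ 2 + q.θz +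
    1) + J₁ * (q.A1 ^ 2 + q.θz)) + 2 * q.β11 * q.β12 * J₁ * J₂ * (q.A1 ^ 2 + q.θz) + q.β12 ^ 2 * J₂
    * (q.θε * (q.A1 ^ 2 + q.θz + 1) + J₂ * (q.A1 ^ 2 + q.θz)) + q.θp * (q.A1 ^ 2 + q.θz + 1)) -
    (q.A1 * (q.A1 ^ 2 - q.β11 * q.β22 * J₁ ^ 2 + q.β11 * q.β22 * J₁ - q.β11 * q.β23 * J₁ - q.β12 *
    q.β22 * J₁ * J₂ + q.β12 * J₂ - q.β21 * J₁ + q.θz + 1)) / ((q.A1 ^ 2 + q.θz + 1) * (q.β11 * J₁ +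
    q.β12 * J₂)) + (q.A1 - q.A1 * q.β22 * J₁) / (q.A1 ^ 2 + q.θz + 1)) =
    q.curvR J₁ := by
  rw [varp_eq hS, ← hΛ21, sum_eq, ← B, ← hΛp, curvR, hΛ22]
  field_simp
  ring

include hS hA hΛ22 hV hΛp in
-- The equation is the first-order condition at time `1₊` solved for `β11`: the denominator is twice
-- the curvature times the signal variance, up to a common factor. `mixedEq7_eq` does the same for
-- `β12`.
lemma mixedEq3_eq (hσ : q.sigVar ≠ 0) (hc : q.curvS ≠ 0) : mixedEq3 J₁ J₂ q.θp q.θ2 q.θε q.A1 q.θz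
    q.β21 q.β11 q.β22 q.β23 q.β12 =
    -(q.focS J₁ J₂ / (2 * q.curvS * q.sigVar)) := by
  have e : (-((q.A1 ^ 2 + q.θz) * (q.β11 * (J₁ - 1) + q.β12 * J₂) * (q.β11 * J₁ + q.β12 * J₂)) /
      (q.β11 ^ 2 * J₁ * (q.θε * (q.A1 ^ 2 + q.θz + 1) + J₁ * (q.A1 ^ 2 + q.θz)) + 2 * q.β11 * q.β12
      * J₁ * J₂ * (q.A1 ^ 2 + q.θz) + q.β12 ^ 2 * J₂ * (q.θε * (q.A1 ^ 2 + q.θz + 1) + J₂ * (q.A1 ^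
      2 + q.θz)) + q.θp * (q.A1 ^ 2 + q.θz + 1)) + (2 * q.β23 * (q.A1 ^ 2 * (q.β11 * q.β22 * (J₁ -
      1) + q.β12 * q.β22 * J₂ + q.β21 * (q.θε + 1)) + q.β22 * q.θz * (q.β11 * (J₁ - 1) + q.β12 * J₂)
      + q.β21 * (q.θε * q.θz + q.θε + q.θz))) / (q.A1 ^ 2 + q.θz + 1) + 1) =
      q.S / q.A1 * (q.focS J₁ J₂ + 2 * q.curvS * q.β11 * q.sigVar) := by
    rw [varp_eq hS, sum_eq, focS, hΛp, hΛ22]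
    generalize q.varp J₁ J₂ = V at hV
    simp only [curvS, othSig, sigVar, B, θz_eq]
    field_simp
    ring
  rw [mixedEq3, curvS_eq hS hA hΛ22 hV hΛp, sigVar_eq hS, e]
  field_simp
  ring

include hS hA hB hΛ22 hA21 hα22 hΛ21 hV hΛp in
lemma mixedEq7_eq (hσ : q.sigVar ≠ 0) (hc : q.curvR J₁ ≠ 0) : mixedEq7 J₁ J₂ q.θp q.θ2 q.θε q.A1
    q.θz q.β21 q.β11 q.β22 q.β23 q.β12 =
    -(q.focR J₁ J₂ / (2 * q.curvR J₁ * q.sigVar)) := by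
  have hW : q.θε * (q.A1 ^ 2 + q.θz + 1) ^ 2 * (q.β11 ^ 2 * J₁ + q.β12 ^ 2 * J₂) + (q.A1 ^ 2 + q.θz)
      ^ 2 * (q.β11 * J₁ + q.β12 * J₂) ^ 2 + (q.A1 ^ 2 + q.θz) * (q.β11 * J₁ + q.β12 * J₂) ^ 2 + q.θp
      * (q.A1 ^ 2 + q.θz + 1) ^ 2 =
      q.S ^ 2 * q.varp J₁ J₂ := by
    rw [sum_eq, θz_eq, varp, B]
    field_simp
    ring
  have e : (q.A1 * (((q.A1 ^ 2 + q.θz) * (-(2 * (q.β11 * J₁ + q.β12 * (J₂ - 1)) * ((q.A1 ^ 2 + q.θz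
      + 1) ^ 2 * (q.β11 * J₁ + q.β12 * J₂) ^ 2 - (q.θε * (q.A1 ^ 2 + q.θz + 1) ^ 2 * (q.β11 ^ 2 * J₁
      + q.β12 ^ 2 * J₂) + (q.A1 ^ 2 + q.θz) ^ 2 * (q.β11 * J₁ + q.β12 * J₂) ^ 2 + (q.A1 ^ 2 + q.θz)
      * (q.β11 * J₁ + q.β12 * J₂) ^ 2 + q.θp * (q.A1 ^ 2 + q.θz + 1) ^ 2) * (q.A1 ^ 2 - q.β11 *
      q.β22 * J₁ ^ 2 + q.β11 * q.β22 * J₁ - q.β11 * q.β23 * J₁ - q.β12 * q.β22 * J₁ * J₂ + q.β12 *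
      J₂ - q.β21 * J₁ + q.θz + 1))) / (q.θε * (q.A1 ^ 2 + q.θz + 1) ^ 2 * (q.β11 ^ 2 * J₁ + q.β12 ^
      2 * J₂) + (q.A1 ^ 2 + q.θz) ^ 2 * (q.β11 * J₁ + q.β12 * J₂) ^ 2 + (q.A1 ^ 2 + q.θz) * (q.β11 *
      J₁ + q.β12 * J₂) ^ 2 + q.θp * (q.A1 ^ 2 + q.θz + 1) ^ 2) - q.β12 * J₂ * (q.A1 ^ 2 + q.β11 * J₁
      * (q.β22 - q.β23 - 1) - q.β21 * J₁ + q.θz + 1) - q.β11 * J₁ * (q.A1 ^ 2 - q.β12 * q.β22 * J₂ +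
      q.β12 * q.β23 * J₂ + q.β12 * J₂ - q.β21 * J₁ + q.θz + 1) + 2 * J₁ * (q.β11 * J₁ + q.β12 * J₂)
      * (q.β11 * (q.β22 * (J₁ - 1) + q.β23) + q.β12 * q.β22 * (J₂ - 1) + q.β21) - q.β21 * J₁ *
      (q.β11 * J₁ + q.β12 * J₂) - 2 * q.β12 * (J₂ - 1) * (q.β11 * J₁ + q.β12 * J₂))) / ((q.A1 ^ 2 +
      q.θz + 1) * (q.β11 * J₁ + q.β12 * J₂)) + 1)) =
      2 * q.S * (q.focR J₁ J₂ + 2 * q.curvR J₁ * q.β12 * q.sigVar) := by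
    rw [hW, sum_eq, focR, curvR, hΛp]
    rw [sum_eq] at hΛ21
    generalize q.varp J₁ J₂ = V at hV
    rw [B] at hB
    simp only [hΛ21, hΛ22, hA21, hα22, sigVar, G, b2s, B, θz_eq]
    field_simp
    ring
  rw [mixedEq7, curvR_eq hS hΛ22 hΛ21 hΛp, sigVar_eq hS, e]
  field_simp
  ring

end Mixed

end Dimless


/-! ### The explicit pure-strategy system -/

namespace Dimless

variable {q : Dimless} {J₁ J₂ : ℕ}

lemma link_eq_zero_iff (hΛ : q.Λ22 ≠ 0) : q.link J₁ = 0 ↔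
    q.β23 = -((q.β22 * (J₁ - 1) * q.Λ22 + q.Λ21) / (2 * q.Λ22)) := by
  rw [link, ← neg_div, eq_div_iff (by simpa using hΛ)]
  constructor <;> intro h <;> linear_combination h

section Pure

variable (hS : q.S = q.A1 ^ 2 + 1) (hΛ : q.Λ22 ≠ 0) (hA21 : q.A21 = 1 / (2 * q.Λ22))
  (hα22 : q.α22 = -((q.β11 * J₁ * (q.β22 * (J₁ - 1) * q.Λ22 + q.Λ21) +
        2 * (q.β12 * J₂ * (q.β22 * J₁ * q.Λ22 + q.Λ21 - q.Λ22) + q.β21 * J₁ * q.Λ22)) / (4 *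
            q.Λ22)))
  (hβ23 : q.β23 = -((q.β22 * (J₁ - 1) * q.Λ22 + q.Λ21) / (2 * q.Λ22)))
  (hV : q.varp J₁ J₂ ≠ 0) (hΛp : q.Λp = q.A1 * q.B J₁ J₂ / (q.S * q.varp J₁ J₂))

include hS in
lemma varp_eq_pure : (q.β11 ^ 2 * J₁ * (q.A1 ^ 2 * q.θε + q.A1 ^ 2 * J₁ + q.θε) + 2 * q.A1 ^ 2 *
    q.β11 * q.β12 * J₁ * J₂ + q.β12 ^ 2 * J₂ * (q.A1 ^ 2 * q.θε + q.A1 ^ 2 * J₂ + q.θε) + (q.A1 ^ 2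
    + 1) * q.θp) = q.S * q.varp J₁ J₂ := by
  have h1 : q.A1 ^ 2 + 1 ≠ 0 := by positivity
  rw [varp, B, hS]
  field_simp
  ring

include hS in
lemma sigVar_eq_pure : q.A1 ^ 2 * (q.θε + 1) + q.θε = q.S * q.sigVar := by
  have h1 : q.A1 ^ 2 + 1 ≠ 0 := by positivity
  rw [sigVar, hS]
  field_simp
  ring

include hΛ hβ23 in
-- The bracket that recurs in the pure-strategy system is twice the effect `C` of IT's first order
-- through the HFTs, with `β23` eliminated.
lemma two_mul_C_eq : q.β11 * J₁ * (q.β22 * (J₁ - 1) * q.Λ22 + q.Λ21) +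
    2 * (q.β12 * J₂ * (q.β22 * J₁ * q.Λ22 + q.Λ21 - q.Λ22) + q.β21 * J₁ * q.Λ22) =
      2 * q.C J₁ J₂ := by
  rw [C, B, hβ23]
  field_simp
  ring

include hS hΛ hβ23 in
lemma curv_eq : q.A1 / (q.A1 ^ 2 + 1) - (2 * q.A1 + q.β11 * J₁ * (q.β22 * (J₁ - 1) * q.Λ22 + q.Λ21)
    +
    2 * (q.β12 * J₂ * (q.β22 * J₁ * q.Λ22 + q.Λ21 - q.Λ22) + q.β21 * J₁ * q.Λ22)) ^ 2 /
      (16 * (q.A1 ^ 2 + 1) ^ 2 * q.Λ22) = q.curv J₁ J₂ := by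
  have h1 : q.A1 ^ 2 + 1 ≠ 0 := by positivity
  rw [add_assoc, two_mul_C_eq hΛ hβ23, curv, D, hS]
  field_simp
  ring

include hS hΛ hβ23 in
-- IT's first-order condition solved for `A1`: numerator and denominator share a multiple of `S²`,
-- through `D S = A1 + C`.
lemma pureEq3_eq (hc : q.curv J₁ J₂ ≠ 0) : pureEq3 J₁ J₂ q.θp q.θ2 q.θε q.Λ21 q.Λ22 q.A1 q.β11 q.β21
    q.β22 q.β12 =
    -((1 - q.D J₁ J₂ / (2 * q.Λ22) - 2 * q.curv J₁ J₂ * q.A1) / (2 * q.curv J₁ J₂)) := by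
  have h1 : q.A1 ^ 2 + 1 ≠ 0 := by positivity
  have hC := two_mul_C_eq (J₂ := J₂) hΛ hβ23
  have hD : q.D J₁ J₂ * q.S = q.A1 + q.C J₁ J₂ := by
    rw [D, hS]
    field_simp
  have hcurv : 4 * q.A1 * (q.A1 ^ 2 + 1) * q.Λ22 - 1 / 4 * (2 * q.A1 + q.β11 * J₁ *
      (q.β22 * (J₁ - 1) * q.Λ22 + q.Λ21) + 2 * (q.β12 * J₂ * (q.β22 * J₁ * q.Λ22 + q.Λ21 - q.Λ22) +
        q.β21 * J₁ * q.Λ22)) ^ 2 = 4 * q.S ^ 2 * q.Λ22 * q.curv J₁ J₂ := by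
    rw [add_assoc, hC, curv, ← hS, show 2 * q.A1 + 2 * q.C J₁ J₂ = 2 * (q.D J₁ J₂ * q.S) by
      rw [hD]; ring]
    have : q.S ≠ 0 := hS ▸ h1
    field_simp
    ring
  rw [pureEq3, hcurv, ← hS]
  have hN : -2 * q.S * q.Λ22 + q.A1 + 1 / 2 * q.β11 * J₁ * (q.β22 * (J₁ - 1) * q.Λ22 + q.Λ21) +
      (q.β12 * J₂ * (q.Λ22 * (q.β22 * J₁ - 1) + q.Λ21) + q.β21 * J₁ * q.Λ22) =
        q.S * (q.D J₁ J₂ - 2 * q.Λ22) := by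
    linear_combination hC / 2 - hD
  rw [hN]
  have : q.S ≠ 0 := hS ▸ h1
  field_simp
  ring

section SmallIT

variable (hJ₁ : 1 ≤ J₁)
include hJ₁ hS hΛ hA21 hα22 hβ23

set_option maxHeartbeats 4000000 in
lemma pureEq4_eq : pureEq4 J₁ J₂ q.θp q.θ2 q.θε q.Λ21 q.Λ22 q.A1 q.β11 q.β21 q.β22 q.β12 = -(4 * q.S
    * q.resSig J₁ J₂) := by
  have h1 : q.A1 ^ 2 + 1 ≠ 0 := by positivity
  have hm := sub_one_mul_max hJ₁
  rw [pureEq4]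
  generalize max ((J₁ : ℝ) - 2) 0 = m at hm
  simp only [resSig, margSig, margOth, othVar, othSig, ordWeight, othWeight, b2s, B, hA21, hα22,
    hβ23, hS]
  field_simp
  obtain h | rfl : (J₁ : ℝ) = 1 ∨ m = (J₁ : ℝ) - 2 := by
    rcases mul_eq_zero.mp (show ((J₁ : ℝ) - 1) * (m - (J₁ - 2)) = 0 by linear_combination hm) with h
        | h
    · exact .inl (sub_eq_zero.mp h)
    · exact .inr (sub_eq_zero.mp h)
  · rw [h]
    ring
  · ring

set_option maxHeartbeats 4000000 in
lemma pureEq5_eq : pureEq5 J₁ J₂ q.θp q.θ2 q.θε q.Λ21 q.Λ22 q.A1 q.β11 q.β21 q.β22 q.β12 = -(4 * q.S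
    * q.resOth J₁ J₂) := by
  have h1 : q.A1 ^ 2 + 1 ≠ 0 := by positivity
  have hm := sub_one_mul_max hJ₁
  rw [pureEq5]
  generalize max ((J₁ : ℝ) - 2) 0 = m at hm
  simp only [resOth, margSig, margOth, sigVar, othSig, ordWeight, othWeight, b2s, B, hA21, hα22,
    hβ23, hS]
  field_simp
  obtain h | rfl : (J₁ : ℝ) = 1 ∨ m = (J₁ : ℝ) - 2 := by
    rcases mul_eq_zero.mp (show ((J₁ : ℝ) - 1) * (m - (J₁ - 2)) = 0 by linear_combination hm) with h
        | h
    · exact .inl (sub_eq_zero.mp h)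
    · exact .inr (sub_eq_zero.mp h)
  · rw [h]
    ring
  · ring

end SmallIT

include hS hΛ hβ23 hΛp in
lemma curvS_eq_pure : ((q.A1 * (q.β11 * J₁ + q.β12 * J₂)) / (q.β11 ^ 2 * J₁ * (q.A1 ^ 2 * q.θε +
    q.A1 ^ 2 * J₁ + q.θε) + 2 * q.A1 ^ 2 * q.β11 * q.β12 * J₁ * J₂ + q.β12 ^ 2 * J₂ * (q.A1 ^ 2 *
    q.θε + q.A1 ^ 2 * J₂ + q.θε) + (q.A1 ^ 2 + 1) * q.θp) - (q.β22 * (J₁ - 1) * q.Λ22 + q.Λ21) ^ 2 /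
    (4 * q.Λ22)) = q.curvS := by
  rw [varp_eq_pure hS, ← B, ← hΛp, curvS, hβ23]
  field_simp
  ring

include hS hΛp in
lemma curvR_eq_pure : ((q.A1 * (q.β11 * J₁ + q.β12 * J₂)) / (q.β11 ^ 2 * J₁ * (q.A1 ^ 2 * q.θε +
    q.A1 ^ 2 * J₁ + q.θε) + 2 * q.A1 ^ 2 * q.β11 * q.β12 * J₁ * J₂ + q.β12 ^ 2 * J₂ * (q.A1 ^ 2 *
    q.θε + q.A1 ^ 2 * J₂ + q.θε) + (q.A1 ^ 2 + 1) * q.θp) - q.β22 * J₁ * q.Λ22 - q.Λ21 + q.Λ22) =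
    q.curvR J₁ := by
  rw [varp_eq_pure hS, ← B, ← hΛp, curvR]
  ring

include hS hΛ hβ23 hV hΛp in
lemma pureEq6_eq (hσ : q.sigVar ≠ 0) (hc : q.curvS ≠ 0) : pureEq6 J₁ J₂ q.θp q.θ2 q.θε q.Λ21 q.Λ22
    q.A1 q.β11 q.β21 q.β22 q.β12 =
    -(q.focS J₁ J₂ / (2 * q.curvS * q.sigVar)) := by
  have h1 : q.A1 ^ 2 + 1 ≠ 0 := by positivity
  have h2 : q.S ≠ 0 := hS ▸ h1
  have e : (-(q.β22 * (J₁ - 1) * q.Λ22 + q.Λ21) * (q.A1 ^ 2 * (q.β11 * q.β22 * (J₁ - 1) + q.β12 *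
      q.β22 * J₂ + q.β21 * (q.θε + 1)) + q.β21 * q.θε) - (q.A1 ^ 3 * (q.β11 * (J₁ - 1) + q.β12 * J₂)
      * (q.β11 * J₁ + q.β12 * J₂)) / (q.β11 ^ 2 * J₁ * (q.A1 ^ 2 * q.θε + q.A1 ^ 2 * J₁ + q.θε) + 2
      * q.A1 ^ 2 * q.β11 * q.β12 * J₁ * J₂ + q.β12 ^ 2 * J₂ * (q.A1 ^ 2 * q.θε + q.A1 ^ 2 * J₂ +
      q.θε) + (q.A1 ^ 2 + 1) * q.θp) + q.A1) =
      q.S * (q.focS J₁ J₂ + 2 * q.curvS * q.β11 * q.sigVar) := by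
    rw [varp_eq_pure hS, focS, hΛp]
    generalize q.varp J₁ J₂ = V at hV
    simp only [othSig, sigVar, B, hβ23, hS]
    field_simp
    ring
  rw [pureEq6, curvS_eq_pure hS hΛ hβ23 hΛp, sigVar_eq_pure hS, e]
  field_simp
  ring

include hS hΛ hA21 hα22 hβ23 hV hΛp in
lemma pureEq7_eq (hσ : q.sigVar ≠ 0) (hc : q.curvR J₁ ≠ 0) : pureEq7 J₁ J₂ q.θp q.θ2 q.θε q.Λ21
    q.Λ22 q.A1 q.β11 q.β21 q.β22 q.β12 =
    -(q.focR J₁ J₂ / (2 * q.curvR J₁ * q.sigVar)) := by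
  have h1 : q.A1 ^ 2 + 1 ≠ 0 := by positivity
  have h2 : q.S ≠ 0 := hS ▸ h1
  have e : (q.A1 * (q.A1 * (4 * (q.β11 * J₁ + q.β12 * (J₂ - 1)) * (q.Λ21 - (q.A1 * (q.β11 * J₁ +
      q.β12 * J₂)) / (q.β11 ^ 2 * J₁ * (q.A1 ^ 2 * q.θε + q.A1 ^ 2 * J₁ + q.θε) + 2 * q.A1 ^ 2 *
      q.β11 * q.β12 * J₁ * J₂ + q.β12 ^ 2 * J₂ * (q.A1 ^ 2 * q.θε + q.A1 ^ 2 * J₂ + q.θε) + (q.A1 ^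
      2 + 1) * q.θp)) + q.β11 * J₁ * (q.β22 * (J₁ - 1) * q.Λ22 - 3 * q.Λ21) - 2 * q.β12 * (J₂ *
      (-q.β22 * J₁ * q.Λ22 + q.Λ21 + q.Λ22) + 2 * q.Λ22 * (q.β22 * J₁ - 1)) + 2 * q.β21 * J₁ *
      q.Λ22) + 2)) =
      4 * q.S * (q.focR J₁ J₂ + 2 * q.curvR J₁ * q.β12 * q.sigVar) := by
    rw [varp_eq_pure hS, focR, curvR, hΛp]
    generalize q.varp J₁ J₂ = V at hV
    simp only [hA21, hα22, hβ23, sigVar, G, b2s, B, hS]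
    field_simp
    ring
  rw [pureEq7, curvR_eq_pure hS hΛp, sigVar_eq_pure hS, e]
  field_simp
  ring

end Pure

end Dimless


/-! ### Equilibrium conditions in terms of the coefficients -/

namespace Dimless

/-- The equilibrium conditions on the coefficients, apart from those for IT's first order. -/
structure Core (q : Dimless) (J₁ J₂ : ℕ) : Prop where
  Λ1_eq : q.Λ1 = q.A1 / q.S
  pricep : q.B J₁ J₂ * (q.A1 / q.S) - q.Λp * q.varp J₁ J₂ = 0
  price21 : q.Λ21 * q.det J₁ J₂ - q.num1 J₁ J₂ = 0
  price22 : q.Λ22 * q.det J₁ J₂ - q.num2 J₁ J₂ = 0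
  Λ22_pos : 0 < q.Λ22
  A21_eq : 2 * q.Λ22 * q.A21 = 1
  α22_eq : q.C J₁ J₂ + 2 * q.Λ22 * q.α22 = 0
  link : q.link J₁ = 0
  margSig : q.margSig J₁ J₂ = 0
  margOth : q.margOth J₁ J₂ = 0
  curvS_pos : 0 < q.curvS
  focS : q.focS J₁ J₂ = 0
  curvR_pos : 0 < q.curvR J₁
  focR : q.focR J₁ J₂ = 0

variable {q : Dimless} {J₁ J₂ : ℕ}

lemma normal_equations_iff (hS : q.S ≠ 0) (hdet : q.det J₁ J₂ ≠ 0) :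
    ip q.var q.gain2 (q.flowp (J₁ := J₁) (J₂ := J₂)) = 0 ∧
      ip q.var q.gain2 (q.flow2 (J₁ := J₁) (J₂ := J₂)) = 0 ↔
    q.Λ21 * q.det J₁ J₂ - q.num1 J₁ J₂ = 0 ∧ q.Λ22 * q.det J₁ J₂ - q.num2 J₁ J₂ = 0 := by
  rw [ip_gain2_flowp hS, ip_gain2_flow2 hS, num1, num2]
  rw [det] at hdet
  constructor
  · rintro ⟨h1, h2⟩
    rw [det]
    constructor
    · linear_combination q.covp2 J₁ J₂ * h2 - (q.var2 J₁ J₂ + q.θ2) * h1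
    · linear_combination q.covp2 J₁ J₂ * h1 - q.varp J₁ J₂ * h2
  · rintro ⟨h1, h2⟩
    rw [det] at h1 h2
    constructor
    · refine (mul_eq_zero.mp ?_).resolve_right hdet
      linear_combination -q.varp J₁ J₂ * h1 - q.covp2 J₁ J₂ * h2
    · refine (mul_eq_zero.mp ?_).resolve_right hdet
      linear_combination -q.covp2 J₁ J₂ * h1 - (q.var2 J₁ J₂ + q.θ2) * h2

lemma curvature_inl (i : Fin J₁) (h : q.link J₁ = 0) :
    q.Λp + q.own (.inl i : Fin J₁ ⊕ Fin J₂) * (q.impact (.inl i : Fin J₁ ⊕ Fin J₂) +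
      q.Λ22 * q.own (.inl i : Fin J₁ ⊕ Fin J₂)) = q.curvS := by
  simp only [Dimless.link] at h
  simp only [own, impact, slope, Sum.elim_inl, curvS]
  linear_combination q.β23 * h

lemma curvature_inr (i : Fin J₂) :
    q.Λp + q.own (.inr i : Fin J₁ ⊕ Fin J₂) * (q.impact (.inr i : Fin J₁ ⊕ Fin J₂) +
      q.Λ22 * q.own (.inr i : Fin J₁ ⊕ Fin J₂)) = q.curvR J₁ := by
  simp only [own, impact, slope, Sum.elim_inr, curvR]
  ring

end Dimless

lemma θp_pos {M : Market} (hM : M.Valid) (c : Coeffs) : 0 < (dimless M c).θp :=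
  div_pos (pow_pos hM.σp_pos 2) (pow_pos hM.σ1_pos 2)

lemma θ2_pos {M : Market} (hM : M.Valid) (c : Coeffs) : 0 < (dimless M c).θ2 :=
  div_pos (pow_pos hM.σ2_pos 2) (pow_pos hM.σ1_pos 2)

lemma θε_nonneg (M : Market) (c : Coeffs) : 0 ≤ (dimless M c).θε :=
  div_nonneg (sq_nonneg _) (sq_nonneg _)

section Equilibrium

variable {Ω : Type*} [MeasurableSpace Ω] {P : Measure Ω} [IsProbabilityMeasure P] {J₁ J₂ : ℕ}
  {M : Market} (hM : M.Valid) (c : Coeffs) {ξ : Shock (Fin J₁ ⊕ Fin J₂) → Ω → ℝ}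
  (hξ : IsShockModel M c.σz P ξ)

local notation "𝓛" => linearProfile M c J₁ J₂
local notation "𝓺" => dimless M c

include hM hξ

theorem dealersEfficient_iff_cramer : DealersEfficient P ξ 𝓛 ↔
    (𝓺).Λ1 = (𝓺).A1 / (𝓺).S ∧
      (𝓺).B J₁ J₂ * ((𝓺).A1 / (𝓺).S) - (𝓺).Λp * (𝓺).varp J₁ J₂ = 0 ∧
      (𝓺).Λ21 * (𝓺).det J₁ J₂ - (𝓺).num1 J₁ J₂ = 0 ∧
      (𝓺).Λ22 * (𝓺).det J₁ J₂ - (𝓺).num2 J₁ J₂ = 0 := by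
  have hz : 0 ≤ (𝓺).θz := θz_nonneg c
  have hS := (S_pos 𝓺 hz).ne'
  have hp := θp_pos hM c
  have hε := θε_nonneg M c
  rw [dealersEfficient_iff hM c hξ, Dimless.ip_gainp_flowp hS,
    Dimless.normal_equations_iff hS
      (Dimless.det_pos hz hp hε (θ2_pos hM c)).ne']

theorem hftOptimal_inl_iff (hΛ1 : (𝓺).Λ1 = (𝓺).A1 / (𝓺).S) (i : Fin J₁) :
    HFTSecondOptimal P ξ aversion 𝓛 (.inl i) ∧ HFTFirstOptimal P ξ aversion 𝓛 (.inl i) ↔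
      0 < (𝓺).Λ22 ∧ (𝓺).link J₁ = 0 ∧ (𝓺).margSig J₁ J₂ = 0 ∧ (𝓺).margOth J₁ J₂ = 0 ∧
        0 < (𝓺).curvS ∧ (𝓺).focS J₁ J₂ = 0 := by
  have hS := (S_pos 𝓺 (θz_nonneg c)).ne'
  rw [hftSecondOptimal_inl_iff hM c hξ hΛ1, hftFirstOptimal_iff hM c hξ hΛ1, Dimless.ip_marg_sig hS,
    Dimless.ip_marg_flowp hS, ← Dimless.link]
  constructor
  · rintro ⟨⟨h1, h2, h3, h4⟩, h5, h6⟩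
    rw [Dimless.ip_first_inl hS _ h2] at h6
    rw [Dimless.curvature_inl _ h2] at h5
    rw [h2] at h3 h4
    simp only [zero_mul, sub_zero] at h3 h4
    rw [h3] at h4 h6
    simp only [mul_zero, add_zero] at h4 h6
    exact ⟨h1, h2, h3, h4, h5, h6⟩
  · rintro ⟨h1, h2, h3, h4, h5, h6⟩
    rw [Dimless.ip_first_inl hS _ h2, Dimless.curvature_inl _ h2, h2, h3, h4, h6]
    simp [h1, h5]

theorem hftOptimal_inr_iff (hΛ1 : (𝓺).Λ1 = (𝓺).A1 / (𝓺).S) (i : Fin J₂) :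
    HFTSecondOptimal P ξ aversion 𝓛 (.inr i) ∧ HFTFirstOptimal P ξ aversion 𝓛 (.inr i) ↔
      0 < (𝓺).curvR J₁ ∧ (𝓺).focR J₁ J₂ = 0 := by
  have hS := (S_pos 𝓺 (θz_nonneg c)).ne'
  rw [and_iff_right (hftSecondOptimal_inr hM c hξ i), hftFirstOptimal_iff hM c hξ hΛ1,
    Dimless.ip_first_inr hS, Dimless.curvature_inr]

theorem core_iff (hJ₁ : 1 ≤ J₁) (hJ₂ : 1 ≤ J₂) :
    DealersEfficient P ξ 𝓛 ∧ ITSecondOptimal P ξ 𝓛 ∧ (∀ j, HFTSecondOptimal P ξ aversion 𝓛 j) ∧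
      (∀ j, HFTFirstOptimal P ξ aversion 𝓛 j) ↔ (𝓺).Core J₁ J₂ := by
  constructor
  · rintro ⟨hd, hi, h2, h1⟩
    obtain ⟨d1, d2, d3, d4⟩ := (dealersEfficient_iff_cramer hM c hξ).mp hd
    obtain ⟨i1, i2, i3⟩ := (itSecondOptimal_iff hM c hξ d1).mp hi
    -- Traders of one type satisfy the same conditions, so one of each type suffices; this is where
    -- both groups have to be nonempty.
    obtain ⟨-, s2, s3, s4, s5, s6⟩ := (hftOptimal_inl_iff hM c hξ d1 ⟨0, hJ₁⟩).mp ⟨h2 _, h1 _⟩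
    obtain ⟨r1, r2⟩ := (hftOptimal_inr_iff hM c hξ d1 ⟨0, hJ₂⟩).mp ⟨h2 _, h1 _⟩
    exact ⟨d1, d2, d3, d4, i1, i2, i3, s2, s3, s4, s5, s6, r1, r2⟩
  · rintro ⟨d1, d2, d3, d4, i1, i2, i3, s2, s3, s4, s5, s6, r1, r2⟩
    have h : ∀ j, HFTSecondOptimal P ξ aversion 𝓛 j ∧ HFTFirstOptimal P ξ aversion 𝓛 j := by
      rintro (i | i)
      · exact (hftOptimal_inl_iff hM c hξ d1 i).mpr ⟨i1, s2, s3, s4, s5, s6⟩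
      · exact (hftOptimal_inr_iff hM c hξ d1 i).mpr ⟨r1, r2⟩
    exact ⟨(dealersEfficient_iff_cramer hM c hξ).mpr ⟨d1, d2, d3, d4⟩,
      (itSecondOptimal_iff hM c hξ d1).mpr ⟨i1, i2, i3⟩, fun j => (h j).1, fun j => (h j).2⟩

theorem isMixedEquilibrium_iff (hJ₁ : 1 ≤ J₁) (hJ₂ : 1 ≤ J₂) :
    IsMixedEquilibrium P ξ aversion 𝓛 ↔ 0 < c.σz ∧ (𝓺).Core J₁ J₂ ∧ (𝓺).curv J₁ J₂ = 0 ∧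
      (𝓺).D J₁ J₂ = 2 * (𝓺).Λ22 := by
  constructor
  · rintro ⟨h1, h2, h3, h4, h5, h6⟩
    have hc := (core_iff hM c hξ hJ₁ hJ₂).mp ⟨h2, h3, h5, h6⟩
    exact ⟨h1, hc, (itIndifferent_iff hM c hξ hc.Λ1_eq hc.Λ22_pos.ne' hc.A21_eq hc.α22_eq).mp h4⟩
  · rintro ⟨h1, hc, h2⟩
    obtain ⟨h3, h4, h5, h6⟩ := (core_iff hM c hξ hJ₁ hJ₂).mpr hc
    exact ⟨h1, h3, h4,
      (itIndifferent_iff hM c hξ hc.Λ1_eq hc.Λ22_pos.ne' hc.A21_eq hc.α22_eq).mpr h2, h5, h6⟩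

theorem isPureEquilibrium_iff (hJ₁ : 1 ≤ J₁) (hJ₂ : 1 ≤ J₂) :
    IsPureEquilibrium P ξ aversion 𝓛 ↔ c.σz = 0 ∧ (𝓺).Core J₁ J₂ ∧ 0 < (𝓺).curv J₁ J₂ ∧
      1 - (𝓺).D J₁ J₂ / (2 * (𝓺).Λ22) = 2 * (𝓺).curv J₁ J₂ * (𝓺).A1 := by
  have hz : c.σz = 0 → (𝓺).θz = 0 := fun h => by simp [dimless, h]
  constructor
  · rintro ⟨h1, h2, h3, h4, h5, h6⟩
    have hc := (core_iff hM c hξ hJ₁ hJ₂).mp ⟨h2, h3, h5, h6⟩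
    exact ⟨h1, hc,
      (itFirstOptimal_iff hM c hξ hc.Λ1_eq hc.Λ22_pos.ne' hc.A21_eq hc.α22_eq (hz h1)).mp h4⟩
  · rintro ⟨h1, hc, h2⟩
    obtain ⟨h3, h4, h5, h6⟩ := (core_iff hM c hξ hJ₁ hJ₂).mpr hc
    exact ⟨h1, h3, h4,
      (itFirstOptimal_iff hM c hξ hc.Λ1_eq hc.Λ22_pos.ne' hc.A21_eq hc.α22_eq (hz h1)).mpr h2, h5, h6⟩

end Equilibrium


/-! ### Equivalence with the explicit systems -/

namespace Dimless

variable {q : Dimless} {J₁ J₂ : ℕ}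

/-- `C` is affine in `Λ21` with slope `B`, so the equation can be solved for `Λ21` as soon as `B ≠
0`. -/
lemma C_eq_A1_iff (hS : q.S ≠ 0) (hB : q.B J₁ J₂ ≠ 0) (hΛ22 : q.Λ22 = q.A1 / q.S) :
    q.C J₁ J₂ = q.A1 ↔ q.Λ21 = q.A1 * (q.A1 ^ 2 - q.β11 * q.β22 * J₁ ^ 2 + q.β11 * q.β22 * J₁ -
        q.β11 * q.β23 * J₁ - q.β12 * q.β22 * J₁ * J₂ + q.β12 * J₂ - q.β21 * J₁ + q.θz + 1) / ((q.A1
        ^ 2 + q.θz + 1) * (q.β11 * J₁ + q.β12 * J₂)) := by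
  rw [sum_eq, C, hΛ22, B] at *
  rw [eq_div_iff (mul_ne_zero hS hB), θz_eq]
  field_simp
  constructor <;> intro h <;> linear_combination h

lemma neg_div_eq_zero_iff {a b c : ℝ} (hb : 0 < b) (hc : 0 < c) : -(a / (2 * b * c)) = 0 ↔ a = 0 :=
    by
  rw [neg_eq_zero, div_eq_zero_iff, or_iff_left (by positivity)]

lemma pricep_iff (hS : q.S ≠ 0) (hV : q.varp J₁ J₂ ≠ 0) :
    q.B J₁ J₂ * (q.A1 / q.S) - q.Λp * q.varp J₁ J₂ = 0 ↔
      q.Λp = q.A1 * q.B J₁ J₂ / (q.S * q.varp J₁ J₂) := by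
  rw [eq_div_iff (mul_ne_zero hS hV), sub_eq_zero]
  field_simp
  constructor <;> intro h <;> linear_combination -h

theorem mixed_iff (hJ₁ : 1 ≤ J₁) (hz : 0 < q.θz) (hp : 0 < q.θp) (h2 : 0 < q.θ2) (hε : 0 ≤ q.θε) :
    q.Core J₁ J₂ ∧ q.curv J₁ J₂ = 0 ∧ q.D J₁ J₂ = 2 * q.Λ22 ↔
      MixedSystem J₁ J₂ q.θp q.θ2 q.θε q.A1 q.θz q.β21 q.β11 q.β22 q.β23 q.β12 ∧ MixedFormulas J₁ J₂
          q.θp q.θε q.A1 q.θz q.β21 q.β11 q.β22 q.β23 q.β12 q.Λ1 q.Λp q.Λ21 q.Λ22 q.A21 q.α22 := by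
  have hS := S_pos q hz.le
  have hV := varp_pos (J₁ := J₁) (J₂ := J₂) hz.le hp hε
  have hdet := det_pos (J₁ := J₁) (J₂ := J₂) hz.le hp hε h2
  constructor
  · rintro ⟨h, hcurv, hD⟩
    have hΛ := h.Λ22_pos
    -- Zero curvature with `D = 2 Λ22` reads `A1 / S = (2 Λ22)² / (4 Λ22)`. Then `D = (A1 + C)/S`
    -- gives `C = A1`, and IT's second-stage condition gives `α22 = -S/2`.
    have hΛ22 : q.Λ22 = q.A1 / q.S := by
      rw [curv, hD] at hcurv
      field_simp at hcurv ⊢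
      linarith
    have hA : 0 < q.A1 := by
      rw [hΛ22] at hΛ
      exact (div_pos_iff_of_pos_right hS).mp hΛ
    have hC : q.C J₁ J₂ = q.A1 := by
      rw [D, hΛ22] at hD
      field_simp at hD
      linarith
    have hα22 : q.α22 = -(q.S / 2) := by
      have := h.α22_eq
      rw [hC, (eq_div_iff hS.ne').mp hΛ22 |>.symm, show q.Λ22 * q.S + 2 * q.Λ22 * q.α22 =
        q.Λ22 * (q.S + 2 * q.α22) by ring] at this
      linarith [(mul_eq_zero.mp this).resolve_left hΛ.ne']
    have hA21 : q.A21 = q.S / (2 * q.A1) := by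
      have := h.A21_eq
      rw [hΛ22] at this
      field_simp at this ⊢
      linarith
    -- Concavity for a Small-IT gives `Λp > Λ22 β23² ≥ 0`, and by efficient pricing `Λp` has the
    -- sign of `B`. Only now may the formula for `Λ21` divide by `B`.
    have hB : 0 < q.B J₁ J₂ := by
      have h3 : 0 < q.Λp := by
        have h4 := h.curvS_pos
        rw [curvS] at h4
        have : 0 ≤ q.Λ22 * q.β23 ^ 2 := by positivity
        linarith
      have h5 : 0 < q.B J₁ J₂ * (q.A1 / q.S) := by
        have := mul_pos h3 hV
        linarith [h.pricep]
      exact (mul_pos_iff_of_pos_right (by positivity)).mp h5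
    have hΛ21 := (C_eq_A1_iff hS.ne' hB.ne' hΛ22).mp hC
    have hΛp := (pricep_iff hS.ne' hV.ne').mp h.pricep
    have hσ := sigVar_pos hz.le hA.ne' hε
    obtain ⟨h5, h6⟩ := (resSig_resOth_eq_zero_iff (oth_gram_pos (J₂ := J₂) hJ₁ hz.le hA.ne' hp
        hε).ne').mpr
      ⟨h.margSig, h.margOth⟩
    refine ⟨⟨?_, ?_, ?_, ?_, ?_, ?_, ?_, ?_, ?_, hA, hz⟩, ⟨h.Λ1_eq, ?_, hΛ21, ?_, ?_, hα22⟩⟩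
    · rw [mixedEq1_eq hS.ne' hA.ne' hA21 hα22 hΛ21 hdet.ne', h.price21, zero_div]
    · rw [mixedEq2_eq' hS.ne' hA.ne' hΛ22 hA21 hα22, h.price22, mul_zero]
    · rw [mixedEq3_eq hS.ne' hA.ne' hΛ22 hV.ne' hΛp hσ.ne' h.curvS_pos.ne', h.focS, zero_div,
        neg_zero]
    · have := mixedEq4_eq hJ₁ hS.ne' hA.ne' hB.ne' hΛ22 hA21 hα22 hΛ21
      rw [h5, mul_zero] at this
      exact ((mul_eq_zero.mp this).resolve_left hA.ne').symm
    · have := mixedEq5_eq hJ₁ hS.ne' hA.ne' hB.ne' hΛ22 hA21 hα22 hΛ21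
      rw [h6, mul_zero, neg_zero] at this
      exact ((mul_eq_zero.mp this).resolve_left hA.ne').symm
    · have := mixedEq6_eq hS.ne' hA.ne' hB.ne' hΛ22 hA21 hα22 hΛ21
      rw [h.link, mul_zero] at this
      exact ((mul_eq_zero.mp ((mul_eq_zero.mp this).resolve_right two_ne_zero)).resolve_left
          hA.ne').symm
    · rw [mixedEq7_eq hS.ne' hA.ne' hB.ne' hΛ22 hA21 hα22 hΛ21 hV.ne' hΛp hσ.ne' h.curvR_pos.ne',
        h.focR, zero_div, neg_zero]
    · rw [curvS_eq hS.ne' hA.ne' hΛ22 hV.ne' hΛp]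
      exact div_pos h.curvS_pos hA
    · rw [curvR_eq hS.ne' hΛ22 hΛ21 hΛp]
      exact h.curvR_pos
    · rw [varp_eq hS.ne', ← B, hΛp]
    · rw [h.Λ1_eq, hΛ22]
    · rw [hA21, hΛ22]
      field_simp
  · rintro ⟨h, f⟩
    have hA := h.A1_pos
    have hΛ1 : q.Λ1 = q.A1 / q.S := f.Λ1_eq
    have hΛ22 : q.Λ22 = q.A1 / q.S := f.Λ22_eq.trans hΛ1
    have hΛ : 0 < q.Λ22 := hΛ22 ▸ div_pos hA hS
    have hα22 : q.α22 = -(q.S / 2) := f.α22_eq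
    have hA21 : q.A21 = q.S / (2 * q.A1) := by
      rw [f.A21_eq, hΛ22]
      field_simp
    -- The system does not state `B > 0`; it follows from the first inequality, where `B` over a
    -- positive variance exceeds a square over `S`.
    have hB : 0 < q.B J₁ J₂ := by
      have := h.ineq1
      rw [varp_eq hS.ne', sum_eq, ← B] at this
      have h3 : 0 ≤ q.β23 ^ 2 / q.S := by positivity
      exact (div_pos_iff_of_pos_right (mul_pos hS hV)).mp (by linarith)
    have hΛ21 := f.Λ21_eq
    have hΛp := f.Λp_eq
    rw [varp_eq hS.ne', ← B] at hΛp
    have hC := (C_eq_A1_iff hS.ne' hB.ne' hΛ22).mpr hΛ21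
    have hD : q.D J₁ J₂ = 2 * q.Λ22 := by
      rw [D, hC, hΛ22]
      ring
    have hσ := sigVar_pos hz.le hA.ne' hε
    have hcS : 0 < q.curvS := by
      have := h.ineq1
      rw [curvS_eq hS.ne' hA.ne' hΛ22 hV.ne' hΛp] at this
      exact (div_pos_iff_of_pos_right hA).mp this
    have hcR : 0 < q.curvR J₁ := by
      have := h.ineq2
      rwa [curvR_eq hS.ne' hΛ22 hΛ21 hΛp] at this
    have h5 : q.resSig J₁ J₂ = 0 := by
      have := mixedEq4_eq hJ₁ hS.ne' hA.ne' hB.ne' hΛ22 hA21 hα22 hΛ21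
      rw [← h.eq4, mul_zero] at this
      exact (mul_eq_zero.mp this.symm).resolve_left (by positivity)
    have h6 : q.resOth J₁ J₂ = 0 := by
      have := mixedEq5_eq hJ₁ hS.ne' hA.ne' hB.ne' hΛ22 hA21 hα22 hΛ21
      rw [← h.eq5, mul_zero] at this
      exact (mul_eq_zero.mp (neg_eq_zero.mp this.symm)).resolve_left (by positivity)
    obtain ⟨h7, h8⟩ := (resSig_resOth_eq_zero_iff
      (oth_gram_pos (J₂ := J₂) hJ₁ hz.le hA.ne' hp hε).ne').mp ⟨h5, h6⟩
    refine ⟨⟨hΛ1, (pricep_iff hS.ne' hV.ne').mpr hΛp, ?_, ?_, hΛ, ?_, ?_, ?_, h7, h8, hcS, ?_, hcR,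
        ?_⟩,
      ?_, hD⟩
    · have := h.eq1
      rw [mixedEq1_eq hS.ne' hA.ne' hA21 hα22 hΛ21 hdet.ne'] at this
      exact (div_eq_zero_iff.mp this.symm).resolve_right hdet.ne'
    · have := h.eq2
      rw [mixedEq2_eq' hS.ne' hA.ne' hΛ22 hA21 hα22] at this
      exact (mul_eq_zero.mp this.symm).resolve_left (by positivity)
    · rw [hA21, hΛ22]
      field_simp
    · rw [hC, hα22, hΛ22]
      field_simp
      ring
    · have := mixedEq6_eq hS.ne' hA.ne' hB.ne' hΛ22 hA21 hα22 hΛ21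
      rw [← h.eq6, mul_zero, zero_mul] at this
      exact (mul_eq_zero.mp this.symm).resolve_left hS.ne'
    · have := h.eq3
      rw [mixedEq3_eq hS.ne' hA.ne' hΛ22 hV.ne' hΛp hσ.ne' hcS.ne'] at this
      exact (neg_div_eq_zero_iff hcS hσ).mp this.symm
    · have := h.eq7
      rw [mixedEq7_eq hS.ne' hA.ne' hB.ne' hΛ22 hA21 hα22 hΛ21 hV.ne' hΛp hσ.ne' hcR.ne'] at this
      exact (neg_div_eq_zero_iff hcR hσ).mp this.symm
    · rw [curv, hD, hΛ22]
      field_simp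
      ring

theorem pure_iff (hJ₁ : 1 ≤ J₁) (hz : q.θz = 0) (hp : 0 < q.θp) (h2 : 0 < q.θ2) (hε : 0 ≤ q.θε) :
    q.Core J₁ J₂ ∧ 0 < q.curv J₁ J₂ ∧ 1 - q.D J₁ J₂ / (2 * q.Λ22) = 2 * q.curv J₁ J₂ * q.A1 ↔
      PureSystem J₁ J₂ q.θp q.θ2 q.θε q.Λ21 q.Λ22 q.A1 q.β11 q.β21 q.β22 q.β12 ∧ PureFormulas J₁ J₂
          q.θp q.θε q.Λ21 q.Λ22 q.A1 q.β11 q.β21 q.β22 q.β12 q.Λ1 q.Λp q.A21 q.α22 q.β23 := by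
  have hS1 : q.S = q.A1 ^ 2 + 1 := by rw [S, hz, add_zero]
  have hS : 0 < q.S := by rw [hS1]; positivity
  have hV := varp_pos (J₁ := J₁) (J₂ := J₂) hz.ge hp hε
  have hdet := det_pos (J₁ := J₁) (J₂ := J₂) hz.ge hp hε h2
  -- The pure-strategy system does not list `A1 > 0`; it follows because the positive curvature is
  -- `A1 / S` minus a nonnegative term.
  have hA : 0 < q.Λ22 → 0 < q.curv J₁ J₂ → 0 < q.A1 := by
    intro hΛ hc
    rw [curv] at hc
    have : 0 ≤ q.D J₁ J₂ ^ 2 / (4 * q.Λ22) := by positivity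
    exact (div_pos_iff_of_pos_right hS).mp (by linarith)
  constructor
  · rintro ⟨h, hcurv, hfoc⟩
    have hΛ := h.Λ22_pos
    have hA := hA hΛ hcurv
    have hβ23 := (link_eq_zero_iff hΛ.ne').mp h.link
    have hA21 : q.A21 = 1 / (2 * q.Λ22) := by
      rw [eq_div_iff (by positivity), mul_comm]
      exact h.A21_eq
    have hα22 : q.α22 = -((q.β11 * J₁ * (q.β22 * (J₁ - 1) * q.Λ22 + q.Λ21) + 2 * (q.β12 * J₂ *
        (q.β22 * J₁ * q.Λ22 + q.Λ21 - q.Λ22) + q.β21 * J₁ * q.Λ22)) / (4 * q.Λ22)) := by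
      rw [two_mul_C_eq hΛ.ne' hβ23, ← neg_div, eq_div_iff (by positivity)]
      linear_combination 2 * h.α22_eq
    have hΛp := (pricep_iff hS.ne' hV.ne').mp h.pricep
    have hσ := sigVar_pos hz.ge hA.ne' hε
    obtain ⟨h5, h6⟩ := (resSig_resOth_eq_zero_iff
      (oth_gram_pos (J₂ := J₂) hJ₁ hz.ge hA.ne' hp hε).ne').mpr ⟨h.margSig, h.margOth⟩
    refine ⟨⟨?_, ?_, ?_, ?_, ?_, ?_, ?_, ?_, ?_, ?_, hΛ⟩, ⟨?_, ?_, hA21, hα22, hβ23⟩⟩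
    · rw [pureEq1_eq hS1 hΛ.ne' hA21 hα22 hβ23, h.price21, mul_zero]
    · rw [pureEq2_eq hS1 hΛ.ne' hA21 hα22 hβ23, h.price22, mul_zero]
    · rw [pureEq3_eq hS1 hΛ.ne' hβ23 hcurv.ne', sub_eq_zero.mpr hfoc, zero_div, neg_zero]
    · rw [pureEq4_eq hS1 hΛ.ne' hA21 hα22 hβ23 hJ₁, h5, mul_zero, neg_zero]
    · rw [pureEq5_eq hS1 hΛ.ne' hA21 hα22 hβ23 hJ₁, h6, mul_zero, neg_zero]
    · rw [pureEq6_eq hS1 hΛ.ne' hβ23 hV.ne' hΛp hσ.ne' h.curvS_pos.ne', h.focS, zero_div, neg_zero]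
    · rw [pureEq7_eq hS1 hΛ.ne' hA21 hα22 hβ23 hV.ne' hΛp hσ.ne' h.curvR_pos.ne', h.focR, zero_div,
        neg_zero]
    · rw [curv_eq hS1 hΛ.ne' hβ23]
      exact hcurv
    · rw [curvS_eq_pure hS1 hΛ.ne' hβ23 hΛp]
      exact h.curvS_pos
    · rw [curvR_eq_pure hS1 hΛp]
      exact h.curvR_pos
    · rw [h.Λ1_eq, hS1]
    · rw [varp_eq_pure hS1, ← B, hΛp]
  · rintro ⟨h, f⟩
    have hΛ := h.Λ22_pos
    have hβ23 := f.β23_eq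
    have hA21 := f.A21_eq
    have hα22 := f.α22_eq
    have hcurv : 0 < q.curv J₁ J₂ := by
      rw [← curv_eq hS1 hΛ.ne' hβ23]
      exact h.ineq1
    have hA := hA hΛ hcurv
    have hΛp := f.Λp_eq
    rw [varp_eq_pure hS1, ← B] at hΛp
    have hσ := sigVar_pos hz.ge hA.ne' hε
    have hcS : 0 < q.curvS := by
      rw [← curvS_eq_pure hS1 hΛ.ne' hβ23 hΛp]
      exact h.ineq2
    have hcR : 0 < q.curvR J₁ := by
      rw [← curvR_eq_pure hS1 hΛp]
      exact h.ineq3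
    have h5 : q.resSig J₁ J₂ = 0 := by
      have := h.eq4
      rw [pureEq4_eq hS1 hΛ.ne' hA21 hα22 hβ23 hJ₁] at this
      exact (mul_eq_zero.mp (neg_eq_zero.mp this.symm)).resolve_left (by positivity)
    have h6 : q.resOth J₁ J₂ = 0 := by
      have := h.eq5
      rw [pureEq5_eq hS1 hΛ.ne' hA21 hα22 hβ23 hJ₁] at this
      exact (mul_eq_zero.mp (neg_eq_zero.mp this.symm)).resolve_left (by positivity)
    obtain ⟨h7, h8⟩ := (resSig_resOth_eq_zero_iff
      (oth_gram_pos (J₂ := J₂) hJ₁ hz.ge hA.ne' hp hε).ne').mp ⟨h5, h6⟩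
    refine ⟨⟨?_, (pricep_iff hS.ne' hV.ne').mpr hΛp, ?_, ?_, hΛ, ?_, ?_, (link_eq_zero_iff
        hΛ.ne').mpr hβ23,
      h7, h8, hcS, ?_, hcR, ?_⟩, hcurv, ?_⟩
    · rw [f.Λ1_eq, hS1]
    · have := h.eq1
      rw [pureEq1_eq hS1 hΛ.ne' hA21 hα22 hβ23] at this
      exact (mul_eq_zero.mp this.symm).resolve_left (by positivity)
    · have := h.eq2
      rw [pureEq2_eq hS1 hΛ.ne' hA21 hα22 hβ23] at this
      exact (mul_eq_zero.mp this.symm).resolve_left (by positivity)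
    · rw [hA21]
      field_simp
    · rw [hα22, two_mul_C_eq hΛ.ne' hβ23]
      field_simp
      ring
    · have := h.eq6
      rw [pureEq6_eq hS1 hΛ.ne' hβ23 hV.ne' hΛp hσ.ne' hcS.ne'] at this
      exact (neg_div_eq_zero_iff hcS hσ).mp this.symm
    · have := h.eq7
      rw [pureEq7_eq hS1 hΛ.ne' hA21 hα22 hβ23 hV.ne' hΛp hσ.ne' hcR.ne'] at this
      exact (neg_div_eq_zero_iff hcR hσ).mp this.symm
    · have := h.eq3
      rw [pureEq3_eq hS1 hΛ.ne' hβ23 hcurv.ne'] at this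
      have h9 := (div_eq_zero_iff.mp (neg_eq_zero.mp this.symm)).resolve_right (by positivity)
      linarith

end Dimless

end HFTModel

theorem mainTheorem4 {Ω : Type*} [MeasurableSpace Ω] (P : Measure Ω) [IsProbabilityMeasure P]
    (J₁ J₂ : ℕ) (hJ₁ : 1 ≤ J₁) (hJ₂ : 1 ≤ J₂)
    (M : HFTModel.Market) (hM : M.Valid) (c : HFTModel.Coeffs) (hσz : 0 ≤ c.σz)
    (ξ : HFTModel.Shock (Fin J₁ ⊕ Fin J₂) → Ω → ℝ) (hξ : HFTModel.IsShockModel M c.σz P ξ)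
    (s : HFTModel.Profile (Fin J₁ ⊕ Fin J₂)) (hs : s = HFTModel.linearProfile M c J₁ J₂)
    (θp θ2 θε Λ1 Λp Λ21 Λ22 A1 θz A21 : ℝ)
    (hθp : θp = M.σp ^ 2 / M.σ1 ^ 2) (hθ2 : θ2 = M.σ2 ^ 2 / M.σ1 ^ 2)
    (hθε : θε = M.σε ^ 2 / M.σ1 ^ 2)
    (hΛ1 : Λ1 = c.lam1 / (M.σv / M.σ1)) (hΛp : Λp = c.lamp / (M.σv / M.σ1))
    (hΛ21 : Λ21 = c.lam21 / (M.σv / M.σ1)) (hΛ22 : Λ22 = c.lam22 / (M.σv / M.σ1))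
    (hA1 : A1 = c.α1 / (M.σ1 / M.σv)) (hθz : θz = c.σz ^ 2 / M.σ1 ^ 2)
    (hA21 : A21 = c.α21 / (M.σ1 / M.σv)) :
    -- the functions used in the linear strategies are the conditional expectations given `y₁`
    ((P[ξ .v | HFTModel.info (HFTModel.Y1 s ξ)] =ᵐ[P]
        fun ω => HFTModel.meanV M c (HFTModel.Y1 s ξ ω)) ∧
      (P[HFTModel.I1 s ξ | HFTModel.info (HFTModel.Y1 s ξ)] =ᵐ[P]
        fun ω => HFTModel.meanI M c (HFTModel.Y1 s ξ ω)) ∧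
      ∀ j, P[HFTModel.Sig s ξ j | HFTModel.info (HFTModel.Y1 s ξ)] =ᵐ[P]
        fun ω => HFTModel.meanI M c (HFTModel.Y1 s ξ ω)) ∧
    -- mixed-strategy equilibrium
    (HFTModel.IsMixedEquilibrium P ξ HFTModel.aversion s ↔
      HFTModel.MixedSystem J₁ J₂ θp θ2 θε A1 θz c.β21 c.β11 c.β22 c.β23 c.β12 ∧
        HFTModel.MixedFormulas J₁ J₂ θp θε A1 θz c.β21 c.β11 c.β22 c.β23 c.β12
          Λ1 Λp Λ21 Λ22 A21 c.α22) ∧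
    -- pure-strategy equilibrium
    (HFTModel.IsPureEquilibrium P ξ HFTModel.aversion s ↔
      c.σz = 0 ∧ HFTModel.PureSystem J₁ J₂ θp θ2 θε Λ21 Λ22 A1 c.β11 c.β21 c.β22 c.β12 ∧
        HFTModel.PureFormulas J₁ J₂ θp θε Λ21 Λ22 A1 c.β11 c.β21 c.β22 c.β12
          Λ1 Λp A21 c.α22 c.β23) := by
  subst hs hθp hθ2 hθε hΛ1 hΛp hΛ21 hΛ22 hA1 hθz hA21
  have hp := HFTModel.θp_pos hM c
  have h2 := HFTModel.θ2_pos hM c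
  have hε := HFTModel.θε_nonneg M c
  refine ⟨HFTModel.condExp_means hM c hξ, ?_, ?_⟩
  · rw [HFTModel.isMixedEquilibrium_iff hM c hξ hJ₁ hJ₂]
    -- The system sees only the variance `θz`; the assumption `0 ≤ σz` recovers the sign of the
    -- standard deviation.
    have hz : 0 < c.σz ↔ 0 < (HFTModel.dimless M c).θz :=
      ⟨fun h => div_pos (pow_pos h 2) (pow_pos hM.σ1_pos 2),
        fun h => hσz.lt_of_ne fun h0 => h.ne' (by simp [HFTModel.dimless, ← h0])⟩
    constructor
    · rintro ⟨h1, h3⟩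
      exact (HFTModel.Dimless.mixed_iff hJ₁ (hz.mp h1) hp h2 hε).mp h3
    · intro h
      exact ⟨hz.mpr h.1.θz_pos, (HFTModel.Dimless.mixed_iff hJ₁ h.1.θz_pos hp h2 hε).mpr h⟩
  · rw [HFTModel.isPureEquilibrium_iff hM c hξ hJ₁ hJ₂]
    refine and_congr_right fun h0 => HFTModel.Dimless.pure_iff hJ₁ ?_ hp h2 hε
    simp [HFTModel.dimless, h0]
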